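/- Let $Q=(I,H,s,t)$ be a finite quiver without loops, $k$ a finite field with $q$ elements, $v=\sqrt q$, and $\psi$ a nontrivial additive character $k\to\mathbb C^\times$. Let $\langle\nu,\nu'\rangle=\sum_i\nu_i\nu'_i-\sum_{h}\nu_{s(h)}\nu'_{t(h)}$ be the Euler form and $(\nu,\nu')=\langle\nu,\nu'\rangle+\langle\nu',\nu\rangle$. Let $\mathcal P$ be the set of isomorphism classes of finite-dimensional representations of $Q$ over $k$; for $\alpha\in\mathcal P$ fix $V_\alpha$ in $\alpha$, write $\alpha$ also for its dimension vector, $\dim V_\alpha$ for its total dimension, and $a_\alpha=|\mathrm{Aut}(V_\alpha)|$. Write $V_i$ for the representation with $k$ at $i$, $0$ elsewhere and zero arrows, and $i$ for its class, so $|V_i|=q$. Let $g^{\gamma}_{\alpha\beta}$ be the number of subrepresentations $W\subset V_\gamma$ with $W\simeq V_\beta$ and $V_\gamma/W\simeq V_\alpha$. Let $\hat Q$ be an enlarged quiver: the vertices are $\hat I=I\sqcup\{\hat i: i\in I\}$, the arrows are $\hat H=H\sqcup\{h_i:i\in I\}$, where $h_i$ joins $i$ and $\hat i$ in either direction. For $\nu\in\mathbb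 N\hat I$ and an orientation $\Gamma$ of the underlying graph of $\hat Q$ put $V_j=k^{\nu_j}$, $E_{\nu,\Gamma}=\bigoplus_h\mathrm{Hom}(V_{s(h)},V_{t(h)})$, $G_\nu=\prod_{i\in I}GL(V_i)$ (acting by conjugation), and let $\mathcal F_G(E_{\nu,\Gamma})$ be the space of $G_\nu$-invariant complex functions. For each $i\in I$ choose an orientation ${}^i\hat Q$ of the same graph in which $i$ is a source, let $\Phi_i$ be the Fourier transform with kernel $v^{-d}\psi(\sum\mathrm{tr}(x_hx'_h))$ over the reversed arrows ($d$ is the sum of the dimensions of their $\mathrm{Hom}$-spaces; other components unchanged) from functions for $\hat Q$ to functions for ${}^i\hat Q$, and let $\Phi_i^{-1}$ be its inverse. Let ${}^iE_\nu\subset E_{\nu,{}^i\hat Q}$ be the set of $x$ for which $\bigoplus_{s(h)=i}x_h:V_i\to\bigoplus_{s(h)=i}V_{t(h)}$ is injective, $\mathcal N_{\nu,i}=\{f\in\mathcal F_G(E_{\nu,\hat Q}): \Phi_i(f)|_{{}^iE_\nu}=0\}$, $\mathcal N_\nu=\sum_{i\in I}\mathcal N_{\nu,i}$, and $$\mathcal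 F_{\hat Q}=\bigoplus_{\nu\in\mathbb N\hat I}\mathcal F_G(E_{\nu,\hat Q})/\mathcal N_\nu .$$ For $\nu'-\nu\in\mathbb NI$ let $Z_\Gamma$ be the set of $(x,x',y)$ with $x\in E_{\nu,\Gamma}$, $x'\in E_{\nu',\Gamma}$, $y=(y_j:V_j\to V'_j)_{j\in\hat I}$, all $y_i$ $(i\in I)$ injective, $y_{\hat i}=\mathrm{id}$, and $x'_hy_{s(h)}=y_{t(h)}x_h$ for all $h$. Define: * $\mathcal K_i^{\pm1}=v^{\pm(\bar\nu_i-\nu_i)}$ on the summand of $\nu$, where $\bar\nu_i=\sum_{s(h)=i}\nu_{t(h)}+\sum_{t(h)=i}\nu_{s(h)}-\nu_i$ (sums over $\hat H$); * $\mathcal E^+_i=\Phi_i^{-1}\circ{}^i\mathcal E\circ\Phi_i$ from $\mathcal F_G(E_{\nu+i,\hat Q})$ to $\mathcal F_G(E_{\nu,\hat Q})$, where $({}^i\mathcal Ef)(x)=v^{-\nu_i}|G_{\nu+i}|^{-1}\sum f(x')$, the sum being over all $(x',y)$ with $(x,x',y)\in Z_{{}^i\hat Q}$ and $x'\in{}^iE_{\nu+i}$;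 and $\mathcal E^+_i=0$ on the summands with $\nu_i=0$; * $(\mathcal E^-_\alpha f)(x')=(-v)^{\dim V_\alpha}v^{\langle\alpha,\nu\rangle+\dim V_\alpha}|G_\nu|^{-1}\sum f(x)$ from $\mathcal F_G(E_{\nu,\hat Q})$ to $\mathcal F_G(E_{\nu+\alpha,\hat Q})$, where $\langle\,,\rangle$ is the Euler form of $\hat Q$ and the sum is over all $(x,y)$ with $(x,x',y)\in Z_{\hat Q}$ and $(V',x')/\mathrm{Im}\,y$ in the class $\alpha$. **Theorem.** For all such choices these maps induce well-defined operators $\mathcal K_i^{\pm1}$, $\mathcal E^+_i$ $(i\in I)$, $\mathcal E^-_\alpha$ $(\alpha\in\mathcal P)$ on $\mathcal F_{\hat Q}$, the operators $\mathcal K_i$ and $\mathcal K_i^{-1}$ are mutually inverse, and: 1. $\mathcal K_i\mathcal K_j=\mathcal K_j\mathcal K_i$ for $i,j\in I$; 2. $\mathcal K_j\mathcal E^+_i=v^{(j,i)}\mathcal E^+_i\mathcal K_j$ for $i,j\in I$; 3. $\mathcal K_j\mathcal E^-_\alpha=v^{-(\alpha,j)}\mathcal E^-_\alpha\mathcal K_j$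 for $j\in I$, $\alpha\in\mathcal P$; 4. $\sum_{m=0}^{1-(i,j)}(-1)^m(\mathcal E^+_i)^{(m)}\mathcal E^+_j(\mathcal E^+_i)^{(1-(i,j)-m)}=0$ for $i\ne j$ in $I$, where $T^{(m)}=T^m/[m]_v!$ and $[m]_v!=\prod_{h=1}^m\frac{v^h-v^{-h}}{v-v^{-1}}$; 5. $\mathcal E^-_\alpha\mathcal E^-_\beta=v^{\langle\alpha,\beta\rangle}\sum_{\lambda\in\mathcal P}g^\lambda_{\alpha\beta}\mathcal E^-_\lambda$ for $\alpha,\beta\in\mathcal P$; 6. $\mathcal E^-_\alpha\mathcal E^+_i-\mathcal E^+_i\mathcal E^-_\alpha=\frac{|V_i|}{a_\alpha}\sum_{\beta\in\mathcal P}a_\beta\,\mathcal E^-_\beta\left(v^{-\langle\beta,i\rangle}g^\alpha_{i\beta}\mathcal K_i-v^{\langle\beta,i\rangle}g^\alpha_{\beta i}\mathcal K_i^{-1}\right)$ for $\alpha\in\mathcal P$, $i\in I$. The sums in 5 and 6 have only finitely many nonzero coefficients. -/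

import Mathlib

open scoped DirectSum Matrix

set_option linter.unusedSectionVars false

noncomputable section

namespace FramedHall

/-- A quiver with vertex set `J` and arrow set `A`, given by its start and terminal maps. -/
structure Qv (J A : Type*) where
  src : A → J
  tgt : A → J

namespace Qv

variable {J A : Type*}

/-- The vertex `j` is a source: no arrow ends at `j`. -/
def IsSource (Γ : Qv J A) (j : J) : Prop := ∀ a, Γ.tgt a ≠ j

/-- The quiver with the same underlying graph in which exactly the arrows `a` with `r a = true`
are reversed. -/
def reorient (Γ : Qv J A) (r : A → Bool) : Qv J A where
  src a := cond (r a) (Γ.tgt a) (Γ.src a)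
  tgt a := cond (r a) (Γ.src a) (Γ.tgt a)

/-- The Euler form `⟨μ, μ'⟩` on `ℤJ`. -/
def euler [Fintype J] [Fintype A] (Γ : Qv J A) (μ μ' : J → ℤ) : ℤ :=
  ∑ j, μ j * μ' j - ∑ a, μ (Γ.src a) * μ' (Γ.tgt a)

/-- The symmetric Euler form `(μ, μ')` on `ℤJ`. -/
def symEuler [Fintype J] [Fintype A] (Γ : Qv J A) (μ μ' : J → ℤ) : ℤ :=
  Γ.euler μ μ' + Γ.euler μ' μ

/-- An enlarged quiver of `Q`: the vertex `î` is `Sum.inr i`, and the extra arrow `h_i`, which is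
`Sum.inr i`, goes `i → î` if `ε i = false` and `î → i` if `ε i = true`. -/
def hat {I H : Type*} (Q : Qv I H) (ε : I → Bool) : Qv (I ⊕ I) (H ⊕ I) where
  src := Sum.elim (fun h => Sum.inl (Q.src h)) (fun i => cond (ε i) (Sum.inr i) (Sum.inl i))
  tgt := Sum.elim (fun h => Sum.inl (Q.tgt h)) (fun i => cond (ε i) (Sum.inl i) (Sum.inr i))

end Qv

/-- The representation space `⊕_a Hom(k^{d (s a)}, k^{d (t a)})`, as matrices. -/
abbrev E {J A : Type*} (Γ : Qv J A) (k : Type*) (d : J → ℕ) : Type _ :=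
  ∀ a : A, Matrix (Fin (d (Γ.tgt a))) (Fin (d (Γ.src a))) k

/-! ### Isomorphism classes of representations and Hall numbers -/

section Hall

variable {I H : Type*} {k : Type*} [Field k]

/-- `φ` is an isomorphism from the representation `(k^n, x)` to the representation `(k^n, x')`. -/
def IsIso (Q : Qv I H) {n : I → ℕ} (x x' : E Q k n) (g : ∀ i, GL (Fin (n i)) k) : Prop :=
  ∀ h, (g (Q.tgt h)).1 * x h = x' h * (g (Q.src h)).1

theorem IsIso.inv {Q : Qv I H} {n : I → ℕ} {x x' : E Q k n} {g : ∀ i, GL (Fin (n i)) k}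
    (hg : IsIso Q x x' g) : IsIso Q x' x (fun i => (g i)⁻¹) := by
  intro h
  have h1 := congrArg (fun M => ((g (Q.tgt h))⁻¹).1 * M * ((g (Q.src h))⁻¹).1) (hg h)
  simp only [← Matrix.mul_assoc] at h1
  rw [← Units.val_mul, inv_mul_cancel, Units.val_one, Matrix.one_mul] at h1
  rw [Matrix.mul_assoc _ (g (Q.src h)).1, ← Units.val_mul, mul_inv_cancel, Units.val_one,
    Matrix.mul_one] at h1
  exact h1.symm

/-- Isomorphism of representations with underlying graded space `k^n`. -/
def isoSetoid (Q : Qv I H) (k : Type*) [Field k] (n : I → ℕ) : Setoid (E Q k n) where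
  r x x' := ∃ g, IsIso Q x x' g
  iseqv :=
    { refl := fun x => ⟨fun _ => 1, fun h => by simp⟩
      symm := by
        rintro x x' ⟨g, hg⟩
        exact ⟨fun i => (g i)⁻¹, hg.inv⟩
      trans := by
        rintro x x' x'' ⟨g, hg⟩ ⟨g', hg'⟩
        refine ⟨fun i => g' i * g i, fun h => ?_⟩
        rw [Units.val_mul, Matrix.mul_assoc, hg h, ← Matrix.mul_assoc, hg' h, Matrix.mul_assoc,
          Units.val_mul] }

/-- The set of isomorphism classes of finite dimensional representations of `Q` over `k`
(every such representation is isomorphic to one on some `k^n`, and `n` is determined). -/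
def IsoClass (Q : Qv I H) (k : Type*) [Field k] : Type _ :=
  Σ n : I → ℕ, Quotient (isoSetoid Q k n)

namespace IsoClass

variable {Q : Qv I H}

/-- The dimension vector of a class. -/
def dim (α : IsoClass Q k) : I → ℕ := α.1

/-- The dimension vector of a class, in `ℤI`. -/
def dimZ (α : IsoClass Q k) : I → ℤ := fun i => (α.dim i : ℤ)

/-- A chosen representation `V_α` in the class `α`. -/
def rep (α : IsoClass Q k) : E Q k α.dim := α.2.out

/-- The total dimension of `V_α`. -/
def totalDim [Fintype I] (α : IsoClass Q k) : ℕ := ∑ i, α.dim i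

/-- The number `a_α` of automorphisms of `V_α`. -/
def autCard (α : IsoClass Q k) : ℕ :=
  Nat.card {g : ∀ i, GL (Fin (α.dim i)) k // IsIso Q α.rep α.rep g}

/-- The class of the simple representation `V_i` with `k` at the vertex `i`, zero elsewhere, and
zero arrows. -/
def simple [DecidableEq I] (Q : Qv I H) (k : Type*) [Field k] (i : I) : IsoClass Q k :=
  ⟨Pi.single i 1, Quotient.mk _ 0⟩

end IsoClass

/-- The graded subspace `W` of `(k^n, x)` is stable under `x`. -/
def IsStable (Q : Qv I H) {n : I → ℕ} (x : E Q k n)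
    (W : ∀ i, Submodule k (Fin (n i) → k)) : Prop :=
  ∀ h, ∀ u ∈ W (Q.src h), x h *ᵥ u ∈ W (Q.tgt h)

/-- The restriction of `x` to the graded subspace `W` is a representation isomorphic to
`(k^m, z)`. -/
def SubIso (Q : Qv I H) {n m : I → ℕ} (x : E Q k n) (W : ∀ i, Submodule k (Fin (n i) → k))
    (z : E Q k m) : Prop :=
  IsStable Q x W ∧ ∃ φ : ∀ i, W i ≃ₗ[k] (Fin (m i) → k), ∀ h (u : W (Q.src h))
    (u' : W (Q.tgt h)), (u' : Fin (n (Q.tgt h)) → k) = x h *ᵥ (u : Fin (n (Q.src h)) → k) →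
      φ (Q.tgt h) u' = z h *ᵥ φ (Q.src h) u

/-- The quotient of `(k^n, x)` by the stable graded subspace `W` is isomorphic to `(k^m, z)`. -/
def QuotIso (Q : Qv I H) {n m : I → ℕ} (x : E Q k n) (W : ∀ i, Submodule k (Fin (n i) → k))
    (z : E Q k m) : Prop :=
  IsStable Q x W ∧ ∃ φ : ∀ i, ((Fin (n i) → k) ⧸ W i) ≃ₗ[k] (Fin (m i) → k),
    ∀ h (u : Fin (n (Q.src h)) → k),
      φ (Q.tgt h) (Submodule.Quotient.mk (x h *ᵥ u)) =
        z h *ᵥ φ (Q.src h) (Submodule.Quotient.mk u)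

/-- The Hall number `g^γ_{αβ}`: the number of subrepresentations `W` of `V_γ` with `W ≅ V_β` and
`V_γ / W ≅ V_α`. -/
def hallNumber {Q : Qv I H} (α β γ : IsoClass Q k) : ℕ :=
  Nat.card {W : ∀ i, Submodule k (Fin (γ.dim i) → k) //
    SubIso Q γ.rep W β.rep ∧ QuotIso Q γ.rep W α.rep}

end Hall

/-! ### Invariant functions on the representation spaces of enlarged quivers -/

/-- `v = √q`, where `q` is the number of elements of `k`. -/
def vv (k : Type*) [Fintype k] : ℂ := ((Real.sqrt (Fintype.card k) : ℝ) : ℂ)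

/-- A dimension vector in `ℕÎ`, split into its parts on `I` and on `{î | i ∈ I}`. -/
abbrev DimVec (I : Type*) : Type _ := (I → ℕ) × (I → ℕ)

/-- The dimension vector as a function on `Î`. -/
abbrev DimVec.fn {I : Type*} (ν : DimVec I) : I ⊕ I → ℕ := Sum.elim ν.1 ν.2

/-- The dimension vector in `ℤÎ`. -/
def DimVec.fnZ {I : Type*} (ν : DimVec I) : I ⊕ I → ℤ := fun j => (ν.fn j : ℤ)

/-- A dimension vector in `ℕI`, regarded in `ℕÎ`. -/
def DimVec.ofI {I : Type*} (n : I → ℕ) : DimVec I := (n, 0)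

section Functions

variable {I A : Type*} {k : Type*} [Field k]

/-- The group `G_{ν,I} = ∏_{i ∈ I} GL(V_i)`. -/
abbrev G (k : Type*) [Field k] (ν : DimVec I) : Type _ := ∀ i : I, GL (Fin (ν.1 i)) k

/-- An element of `G_{ν,I}` acts as the identity on the spaces `V_î`. -/
def G.ext {ν : DimVec I} (g : G k ν) : ∀ j : I ⊕ I, GL (Fin (ν.fn j)) k
  | Sum.inl i => g i
  | Sum.inr _ => 1

/-- The action `g.x = g x g⁻¹` of `G_{ν,I}`. -/
def act (Γ : Qv (I ⊕ I) A) {ν : DimVec I} (g : G k ν) (x : E Γ k ν.fn) : E Γ k ν.fn :=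
  fun a => (g.ext (Γ.tgt a)).1 * x a * ((g.ext (Γ.src a))⁻¹).1

/-- The space of `G_{ν,I}`-invariant functions on `E_ν` (over a finite field every function is
constructible). -/
def Inv (Γ : Qv (I ⊕ I) A) (k : Type*) [Field k] (ν : DimVec I) :
    Submodule ℂ (E Γ k ν.fn → ℂ) where
  carrier := {f | ∀ g x, f (act Γ g x) = f x}
  add_mem' := fun {a b} ha hb g x => by simp [ha g x, hb g x]
  zero_mem' := fun _ _ => rfl
  smul_mem' := fun c f hf g x => by simp [hf g x]

/-- `x` lies in `ⁱE_ν`: the map `⊕_{s(a) = i} x_a : V_i → ⊕_{s(a) = i} V_{t(a)}` is injective.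
The vector of `V_i` is the component at `i` of the family `u`; no other component is used. -/
def InjAt (Γ : Qv (I ⊕ I) A) {ν : DimVec I} (i : I) (x : E Γ k ν.fn) : Prop :=
  ∀ u : (∀ j, Fin (ν.fn j) → k),
    (∀ a, Γ.src a = Sum.inl i → x a *ᵥ u (Γ.src a) = 0) → u (Sum.inl i) = 0

/-- The representation of `Q` on `⊕_{i ∈ I} V_i` underlying a point of the representation space of
the enlarged quiver. -/
def resI {H : Type*} {Q : Qv I H} {ε : I → Bool} {n w : I → ℕ}
    (x : E (Q.hat ε) k (DimVec.fn (n, w))) : E Q k n := fun h => x (Sum.inl h)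

/-- The graded linear maps `V → V'` which are the identity on the spaces `V_î`, given by their
components `y i` at the vertices `i ∈ I`. -/
abbrev Y (k : Type*) (ν ν' : DimVec I) : Type _ := ∀ i : I, Matrix (Fin (ν'.1 i)) (Fin (ν.1 i)) k

/-- The component of the graded map on the dimension vectors `(n, w)`, `(n', w)` at each vertex. -/
def yext {n n' w : I → ℕ} (y : Y k (n, w) (n', w)) :
    ∀ j : I ⊕ I, Matrix (Fin (DimVec.fn (n', w) j)) (Fin (DimVec.fn (n, w) j)) k
  | Sum.inl i => y i
  | Sum.inr i => (1 : Matrix (Fin (w i)) (Fin (w i)) k)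

/-- `(x, x', y)` belongs to `Z`: every `y_i` is injective and `x' y = y x`. -/
def InZ (Γ : Qv (I ⊕ I) A) {n n' w : I → ℕ} (x : E Γ k (DimVec.fn (n, w)))
    (x' : E Γ k (DimVec.fn (n', w))) (y : Y k (n, w) (n', w)) : Prop :=
  (∀ i, Function.Injective (y i).mulVec) ∧
    ∀ a, x' a * yext y (Γ.src a) = yext y (Γ.tgt a) * x a

end Functions

/-! ### Fourier transforms -/

section Fourier

variable {I A : Type*} {k : Type*} [Field k] [Fintype k] [DecidableEq k]

/-- The kernel of the Fourier transform at one arrow between spaces of dimensions `d p` (start) and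
`d q` (terminal): for an arrow that is kept (`b = false`) it is the kernel of the identity, for an
arrow that is reversed (`b = true`) it is `v^{-dim} ψ(tr(X X'))`. -/
def kern {J : Type*} (ψ : AddChar k ℂ) (d : J → ℕ) (p q : J) : ∀ b : Bool,
    Matrix (Fin (d q)) (Fin (d p)) k →
    Matrix (Fin (d (cond b p q))) (Fin (d (cond b q p))) k → ℂ
  | false => fun X X' => if X = X' then 1 else 0
  | true => fun X (X' : Matrix (Fin (d p)) (Fin (d q)) k) =>
      (vv k) ^ (-((d p * d q : ℕ) : ℤ)) * ψ (Matrix.trace (X * X'))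

variable [Fintype A] [DecidableEq A]

/-- The Fourier transform from functions on `E_{ν,Γ}` to functions on `E_{ν,Γ'}`, where `Γ'` is
obtained from `Γ` by reversing the arrows with `r a = true`. -/
def fourier (ψ : AddChar k ℂ) (Γ : Qv (I ⊕ I) A) (r : A → Bool) (ν : DimVec I) :
    (E Γ k ν.fn → ℂ) →ₗ[ℂ] (E (Γ.reorient r) k ν.fn → ℂ) where
  toFun f x' := ∑ x, f x * ∏ a, kern ψ ν.fn (Γ.src a) (Γ.tgt a) (r a) (x a) (x' a)
  map_add' f g := by
    funext x'
    simp [add_mul, Finset.sum_add_distrib]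
  map_smul' c f := by
    funext x'
    simp [Finset.mul_sum, mul_assoc]

/-- The Fourier transform in the opposite direction, from functions on `E_{ν,Γ'}` to functions on
`E_{ν,Γ}`. It is taken with the inverse character, so that it is inverse to `fourier`. -/
def fourierBack (ψ : AddChar k ℂ) (Γ : Qv (I ⊕ I) A) (r : A → Bool) (ν : DimVec I) :
    (E (Γ.reorient r) k ν.fn → ℂ) →ₗ[ℂ] (E Γ k ν.fn → ℂ) where
  toFun f x := ∑ x', f x' * ∏ a, kern ψ⁻¹ ν.fn (Γ.src a) (Γ.tgt a) (r a) (x a) (x' a)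
  map_add' f g := by
    funext x'
    simp [add_mul, Finset.sum_add_distrib]
  map_smul' c f := by
    funext x'
    simp [Finset.mul_sum, mul_assoc]

end Fourier

/-! ### The maps on function spaces -/

section Maps

variable {I A : Type*} {k : Type*} [Field k] [Fintype k] [DecidableEq k]
variable [Fintype I] [DecidableEq I] [Fintype A] [DecidableEq A]

open Classical in
/-- The map `v^{-ν_i} |G_{ν'}|⁻¹ (ⁱp)_! (ⁱp')^*` from functions on `E_{ν'}` to functions on `E_ν`,
where `ν = (n, w)`, `ν' = (n', w)`; it is used for a quiver `Γ` with source `i` and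
`ν' = ν + i`. -/
def eplusSource (Γ : Qv (I ⊕ I) A) (i : I) (n n' w : I → ℕ) :
    (E Γ k (DimVec.fn (n', w)) → ℂ) →ₗ[ℂ] (E Γ k (DimVec.fn (n, w)) → ℂ) where
  toFun f x := (vv k) ^ (-(n i : ℤ)) * (Nat.card (G k (n', w)) : ℂ)⁻¹ *
    ∑ y : Y k (n, w) (n', w), ∑ x', if InZ Γ x x' y ∧ InjAt Γ i x' then f x' else 0
  map_add' f g := by
    funext x
    simp only [Pi.add_apply]
    rw [← mul_add, ← Finset.sum_add_distrib]
    congr 1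
    refine Finset.sum_congr rfl fun y _ => ?_
    rw [← Finset.sum_add_distrib]
    refine Finset.sum_congr rfl fun x' _ => ?_
    split_ifs <;> simp
  map_smul' c f := by
    funext x
    simp only [Pi.smul_apply, smul_eq_mul, RingHom.id_apply]
    rw [mul_left_comm c]
    congr 1
    simp only [Finset.mul_sum, mul_ite, mul_zero]

/-- The map `E⁺_i` on all functions, from `ν' = (n', w)` to `ν = (n, w)`, for a quiver `Γ` and a
reorientation of `Γ` which has the source `i`. -/
def eplusAll (ψ : AddChar k ℂ) (Γ : Qv (I ⊕ I) A) (r : A → Bool) (i : I) (n n' w : I → ℕ) :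
    (E Γ k (DimVec.fn (n', w)) → ℂ) →ₗ[ℂ] (E Γ k (DimVec.fn (n, w)) → ℂ) :=
  fourierBack ψ Γ r (n, w) ∘ₗ eplusSource (Γ.reorient r) i n n' w ∘ₗ fourier ψ Γ r (n', w)

open Classical in
/-- The map `(-v)^{dim V_α} v^{⟨α,ν⟩ + dim V_α} |G_ν|⁻¹ p'_! p^*` from functions on `E_ν` to
functions on `E_{ν'}`, where `ν = (n, w)`, `ν' = (n', w)`, and `p`, `p'` are the projections of the
set of all `(x, x', y)` in `Z` for which `V_{x'} / Im y` lies in the class `α`. (The spaces of this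
quotient at the vertices `î` vanish.) -/
def eminusAll {H : Type*} [Fintype H] [DecidableEq H] (Q : Qv I H) (ε : I → Bool)
    (α : IsoClass Q k) (n n' w : I → ℕ) :
    (E (Q.hat ε) k (DimVec.fn (n, w)) → ℂ) →ₗ[ℂ] (E (Q.hat ε) k (DimVec.fn (n', w)) → ℂ) where
  toFun f x' := (-vv k) ^ α.totalDim *
    (vv k) ^ ((Q.hat ε).euler (DimVec.ofI α.dim).fnZ (DimVec.fnZ (n, w)) + (α.totalDim : ℤ)) *
    (Nat.card (G k (n, w)) : ℂ)⁻¹ *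
    ∑ y : Y k (n, w) (n', w), ∑ x, if InZ (Q.hat ε) x x' y ∧
      QuotIso Q (resI x') (fun i => LinearMap.range (y i).mulVecLin)
        α.rep then f x else 0
  map_add' f g := by
    funext x
    simp only [Pi.add_apply]
    rw [← mul_add, ← Finset.sum_add_distrib]
    congr 1
    refine Finset.sum_congr rfl fun y _ => ?_
    rw [← Finset.sum_add_distrib]
    refine Finset.sum_congr rfl fun x' _ => ?_
    split_ifs <;> simp
  map_smul' c f := by
    funext x
    simp only [Pi.smul_apply, smul_eq_mul, RingHom.id_apply]
    rw [mul_left_comm c]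
    congr 1
    simp only [Finset.mul_sum, mul_ite, mul_zero]

/-! ### These maps take values in the invariant functions -/

section Invariance

theorem act_inv_act (Γ : Qv (I ⊕ I) A) {ν : DimVec I} (g : G k ν) (x : E Γ k ν.fn) :
    act Γ g⁻¹ (act Γ g x) = x := by
  funext a
  have h1 : ∀ j, (G.ext (g⁻¹) j) = (g.ext j)⁻¹ := by
    rintro (j | j)
    · rfl
    · exact inv_one.symm
  simp only [act, h1, inv_inv]
  rw [← Matrix.mul_assoc, ← Matrix.mul_assoc, ← Units.val_mul, inv_mul_cancel, Units.val_one,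
    Matrix.one_mul, Matrix.mul_assoc, ← Units.val_mul, inv_mul_cancel, Units.val_one,
    Matrix.mul_one]

/-- The action of a group element as a permutation. -/
def actEquiv (Γ : Qv (I ⊕ I) A) {ν : DimVec I} (g : G k ν) : E Γ k ν.fn ≃ E Γ k ν.fn where
  toFun := act Γ g
  invFun := act Γ g⁻¹
  left_inv := act_inv_act Γ g
  right_inv x := by simpa using act_inv_act Γ g⁻¹ x

theorem kern_conj {J : Type*} (ψ : AddChar k ℂ) (d : J → ℕ) (p q : J)
    (g : ∀ j, GL (Fin (d j)) k) (b : Bool) (X : Matrix (Fin (d q)) (Fin (d p)) k)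
    (X' : Matrix (Fin (d (cond b p q))) (Fin (d (cond b q p))) k) :
    kern ψ d p q b ((g q).1 * X * ((g p)⁻¹).1)
      ((g (cond b p q)).1 * X' * ((g (cond b q p))⁻¹).1) = kern ψ d p q b X X' := by
  cases b with
  | false =>
    change Matrix (Fin (d q)) (Fin (d p)) k at X'
    change (if (g q).1 * X * ((g p)⁻¹).1 = (g q).1 * X' * ((g p)⁻¹).1 then (1 : ℂ) else 0) =
      if X = X' then 1 else 0
    have : ((g q).1 * X * ((g p)⁻¹).1 = (g q).1 * X' * ((g p)⁻¹).1) ↔ X = X' := by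
      constructor
      · intro h
        have h1 := congrArg (fun M => ((g q)⁻¹).1 * M * (g p).1) h
        simp only [← Matrix.mul_assoc] at h1
        rw [← Units.val_mul, inv_mul_cancel, Units.val_one, Matrix.one_mul, Matrix.one_mul,
          Matrix.mul_assoc, ← Units.val_mul, inv_mul_cancel, Units.val_one, Matrix.mul_one,
          Matrix.mul_assoc, ← Units.val_mul, inv_mul_cancel, Units.val_one, Matrix.mul_one] at h1
        exact h1
      · rintro rfl
        rfl
    exact if_congr this rfl rfl
  | true =>
    change Matrix (Fin (d p)) (Fin (d q)) k at X'
    change _ * ψ (Matrix.trace ((g q).1 * X * ((g p)⁻¹).1 * ((g p).1 * X' * ((g q)⁻¹).1))) =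
      _ * ψ (Matrix.trace (X * X'))
    congr 2
    rw [Matrix.mul_assoc ((g q).1 * X), ← Matrix.mul_assoc ((g p)⁻¹).1,
      ← Matrix.mul_assoc ((g p)⁻¹).1, ← Units.val_mul, inv_mul_cancel, Units.val_one,
      Matrix.one_mul, Matrix.mul_assoc, Matrix.trace_mul_comm, Matrix.mul_assoc, Matrix.mul_assoc,
      ← Units.val_mul, inv_mul_cancel, Units.val_one, Matrix.mul_one]

theorem fourierBack_mem (ψ : AddChar k ℂ) (Γ : Qv (I ⊕ I) A) (r : A → Bool) (ν : DimVec I)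
    (f : E (Γ.reorient r) k ν.fn → ℂ) (hf : f ∈ Inv (Γ.reorient r) k ν) :
    fourierBack ψ Γ r ν f ∈ Inv Γ k ν := by
  intro g x
  change ∑ x', f x' * ∏ a, kern ψ⁻¹ ν.fn (Γ.src a) (Γ.tgt a) (r a) (act Γ g x a) (x' a) =
    ∑ x', f x' * ∏ a, kern ψ⁻¹ ν.fn (Γ.src a) (Γ.tgt a) (r a) (x a) (x' a)
  rw [← Equiv.sum_comp (actEquiv (Γ.reorient r) g)]
  refine Finset.sum_congr rfl fun u _ => ?_
  congr 1
  · exact hf g u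
  · refine Finset.prod_congr rfl fun a _ => ?_
    exact kern_conj ψ⁻¹ ν.fn (Γ.src a) (Γ.tgt a) g.ext (r a) (x a) (u a)

theorem injective_mulVec_mul_unit {m n : ℕ} (y : Matrix (Fin m) (Fin n) k) (g : GL (Fin n) k) :
    Function.Injective (y * g.1).mulVec ↔ Function.Injective y.mulVec := by
  have hb : Function.Bijective g.1.mulVec := by
    refine ⟨fun u w h => ?_, fun u => ⟨g⁻¹.1 *ᵥ u, ?_⟩⟩
    · have := congrArg (fun t => g⁻¹.1 *ᵥ t) h
      simpa [Matrix.mulVec_mulVec, ← Units.val_mul] using this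
    · rw [Matrix.mulVec_mulVec, ← Units.val_mul, mul_inv_cancel, Units.val_one, Matrix.one_mulVec]
  have hc : (y * g.1).mulVec = y.mulVec ∘ g.1.mulVec := by
    funext u
    simp [Matrix.mulVec_mulVec]
  rw [hc]
  exact Function.Injective.of_comp_iff' _ hb

theorem injective_mulVec_unit_mul {m n : ℕ} (y : Matrix (Fin m) (Fin n) k) (g : GL (Fin m) k) :
    Function.Injective (g.1 * y).mulVec ↔ Function.Injective y.mulVec := by
  have hb : Function.Injective g.1.mulVec := by
    intro u w h
    have := congrArg (fun t => g⁻¹.1 *ᵥ t) h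
    simpa [Matrix.mulVec_mulVec, ← Units.val_mul] using this
  have hc : (g.1 * y).mulVec = g.1.mulVec ∘ y.mulVec := by
    funext u
    simp [Matrix.mulVec_mulVec]
  rw [hc]
  exact hb.of_comp_iff _

theorem inZ_act_left (Γ : Qv (I ⊕ I) A) {n n' w : I → ℕ} (g : G k (n, w))
    (x : E Γ k (DimVec.fn (n, w))) (x' : E Γ k (DimVec.fn (n', w))) (y : Y k (n, w) (n', w)) :
    InZ Γ (act Γ g x) x' y ↔ InZ Γ x x' (fun i => y i * (g i).1) := by
  have hy : ∀ j, yext (fun i => y i * (g i).1) j = yext y j * (g.ext j).1 := by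
    rintro (j | j)
    · rfl
    · exact (Matrix.mul_one _).symm
  refine and_congr (forall_congr' fun i => (injective_mulVec_mul_unit _ _).symm)
    (forall_congr' fun a => ?_)
  simp only [hy, act]
  constructor
  · intro h
    rw [← Matrix.mul_assoc, h, ← Matrix.mul_assoc, ← Matrix.mul_assoc,
      Matrix.mul_assoc _ _ (g.ext (Γ.src a)).1, ← Units.val_mul, inv_mul_cancel, Units.val_one, Matrix.mul_one]
  · intro h
    rw [← Matrix.mul_assoc, ← Matrix.mul_assoc, ← h, ← Matrix.mul_assoc, Matrix.mul_assoc,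
      ← Units.val_mul, mul_inv_cancel, Units.val_one, Matrix.mul_one]

theorem inZ_act_right (Γ : Qv (I ⊕ I) A) {n n' w : I → ℕ} (g : G k (n', w))
    (x : E Γ k (DimVec.fn (n, w))) (x' : E Γ k (DimVec.fn (n', w))) (y : Y k (n, w) (n', w)) :
    InZ Γ x (act Γ g x') (fun i => (g i).1 * y i) ↔ InZ Γ x x' y := by
  have hy : ∀ j, yext (fun i => (g i).1 * y i) j = (g.ext j).1 * yext y j := by
    rintro (j | j)
    · rfl
    · exact (Matrix.one_mul _).symm
  refine and_congr (forall_congr' fun i => injective_mulVec_unit_mul _ _)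
    (forall_congr' fun a => ?_)
  simp only [hy, act]
  have e : (g.ext (Γ.tgt a)).1 * x' a * ((g.ext (Γ.src a))⁻¹).1 *
      ((g.ext (Γ.src a)).1 * yext y (Γ.src a)) =
      (g.ext (Γ.tgt a)).1 * (x' a * yext y (Γ.src a)) := by
    rw [← Matrix.mul_assoc, Matrix.mul_assoc _ _ (g.ext (Γ.src a)).1, ← Units.val_mul,
      inv_mul_cancel, Units.val_one, Matrix.mul_one, Matrix.mul_assoc]
  rw [e, Matrix.mul_assoc]
  constructor
  · intro h
    have h1 := congrArg (fun M => ((g.ext (Γ.tgt a))⁻¹).1 * M) h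
    simp only [← Matrix.mul_assoc ((g.ext (Γ.tgt a))⁻¹).1, ← Units.val_mul, inv_mul_cancel,
      Units.val_one, Matrix.one_mul] at h1
    exact h1
  · intro h
    rw [h]

/-- Left multiplication by a group element on graded maps. -/
def yLeft {n n' w : I → ℕ} (g : G k (n', w)) : Y k (n, w) (n', w) ≃ Y k (n, w) (n', w) where
  toFun y i := (g i).1 * y i
  invFun y i := (g i)⁻¹.1 * y i
  left_inv y := by
    funext i
    beta_reduce
    rw [← Matrix.mul_assoc, ← Units.val_mul, inv_mul_cancel, Units.val_one, Matrix.one_mul]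
  right_inv y := by
    funext i
    beta_reduce
    rw [← Matrix.mul_assoc, ← Units.val_mul, mul_inv_cancel, Units.val_one, Matrix.one_mul]

/-- Right multiplication by a group element on graded maps. -/
def yRight {n n' w : I → ℕ} (g : G k (n, w)) : Y k (n, w) (n', w) ≃ Y k (n, w) (n', w) where
  toFun y i := y i * (g i).1
  invFun y i := y i * (g i)⁻¹.1
  left_inv y := by
    funext i
    beta_reduce
    rw [Matrix.mul_assoc, ← Units.val_mul, mul_inv_cancel, Units.val_one, Matrix.mul_one]
  right_inv y := by
    funext i
    beta_reduce
    rw [Matrix.mul_assoc, ← Units.val_mul, inv_mul_cancel, Units.val_one, Matrix.mul_one]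

theorem quotIso_conj {H : Type*} (Q : Qv I H) {n m : I → ℕ} (x x' : E Q k n)
    (W W' : ∀ i, Submodule k (Fin (n i) → k)) (z : E Q k m) (g : ∀ i, GL (Fin (n i)) k)
    (hg : IsIso Q x x' g) (hW : ∀ i u, (g i).1 *ᵥ u ∈ W' i ↔ u ∈ W i)
    (h : QuotIso Q x' W' z) : QuotIso Q x W z := by
  obtain ⟨hs, φ, hφ⟩ := h
  have hgx : ∀ h (u : Fin (n (Q.src h)) → k),
      (g (Q.tgt h)).1 *ᵥ (x h *ᵥ u) = x' h *ᵥ ((g (Q.src h)).1 *ᵥ u) := by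
    intro h u
    rw [Matrix.mulVec_mulVec, Matrix.mulVec_mulVec, hg h]
  refine ⟨fun h u hu => ?_, ?_⟩
  · rw [← hW, hgx]
    exact hs h _ ((hW _ _).2 hu)
  · let L : ∀ i, (Fin (n i) → k) ≃ₗ[k] (Fin (n i) → k) := fun i =>
      LinearEquiv.ofLinearMap (g i).1.mulVecLin ((g i)⁻¹).1.mulVecLin
        (by rw [← Matrix.mulVecLin_mul, ← Units.val_mul, mul_inv_cancel, Units.val_one,
              Matrix.mulVecLin_one])
        (by rw [← Matrix.mulVecLin_mul, ← Units.val_mul, inv_mul_cancel, Units.val_one,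
              Matrix.mulVecLin_one])
    have hL : ∀ i, (W i).map (L i : (Fin (n i) → k) →ₗ[k] (Fin (n i) → k)) = W' i := by
      intro i
      ext u
      constructor
      · rintro ⟨w, hw, rfl⟩
        exact (hW i w).2 hw
      · intro hu
        refine ⟨(L i).symm u, ?_, (L i).apply_symm_apply u⟩
        have := (L i).apply_symm_apply u
        refine (hW i _).1 ?_
        change (L i) ((L i).symm u) ∈ W' i
        rwa [this]
    refine ⟨fun i => (Submodule.Quotient.equiv (W i) (W' i) (L i) (hL i)).trans (φ i), ?_⟩
    intro h u
    change φ (Q.tgt h) (Submodule.Quotient.mk ((g (Q.tgt h)).1 *ᵥ (x h *ᵥ u))) =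
      z h *ᵥ φ (Q.src h) (Submodule.Quotient.mk ((g (Q.src h)).1 *ᵥ u))
    rw [hgx, hφ]

open Classical in
theorem eplusSource_mem (Γ : Qv (I ⊕ I) A) (i : I) (n n' w : I → ℕ)
    (f : E Γ k (DimVec.fn (n', w)) → ℂ) : eplusSource Γ i n n' w f ∈ Inv Γ k (n, w) := by
  intro g x
  simp only [eplusSource, LinearMap.coe_mk, AddHom.coe_mk]
  congr 1
  conv_rhs => rw [← Equiv.sum_comp (yRight g)]
  refine Finset.sum_congr rfl fun y _ => Finset.sum_congr rfl fun x' _ => ?_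
  exact if_congr (and_congr (inZ_act_left Γ g x x' y) Iff.rfl) rfl rfl

theorem eplusAll_mem (ψ : AddChar k ℂ) (Γ : Qv (I ⊕ I) A) (r : A → Bool) (i : I)
    (n n' w : I → ℕ) (f : E Γ k (DimVec.fn (n', w)) → ℂ) :
    eplusAll ψ Γ r i n n' w f ∈ Inv Γ k (n, w) :=
  fourierBack_mem ψ Γ r (n, w) _ (eplusSource_mem (Γ.reorient r) i n n' w _)

theorem quotIso_act {H : Type*} [Fintype H] [DecidableEq H] (Q : Qv I H) (ε : I → Bool)
    (α : IsoClass Q k) {n n' w : I → ℕ} (g : G k (n', w))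
    (x' : E (Q.hat ε) k (DimVec.fn (n', w))) (y : Y k (n, w) (n', w)) :
    QuotIso Q (resI (act (Q.hat ε) g x'))
        (fun i => LinearMap.range ((g i).1 * y i).mulVecLin) α.rep ↔
      QuotIso Q (resI x') (fun i => LinearMap.range (y i).mulVecLin)
        α.rep := by
  have key : ∀ i (h : GL (Fin (n' i)) k) (y : Matrix (Fin (n' i)) (Fin (n i)) k) u,
      h.1 *ᵥ u ∈ LinearMap.range (h.1 * y).mulVecLin ↔ u ∈ LinearMap.range y.mulVecLin := by
    intro i h y u
    constructor
    · rintro ⟨t, ht⟩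
      refine ⟨t, ?_⟩
      have := congrArg (fun t => h⁻¹.1 *ᵥ t) ht
      simpa only [Matrix.mulVecLin_apply, Matrix.mulVec_mulVec, ← Matrix.mul_assoc,
        ← Units.val_mul, inv_mul_cancel, Units.val_one, Matrix.one_mul, Matrix.one_mulVec] using this
    · rintro ⟨t, rfl⟩
      exact ⟨t, by simp [Matrix.mulVec_mulVec]⟩
  have hiso : IsIso Q (resI x') (resI (act (Q.hat ε) g x')) g := by
    intro h
    change (g (Q.tgt h)).1 * resI x' h =
      ((g (Q.tgt h)).1 * resI x' h * ((g (Q.src h))⁻¹).1) * (g (Q.src h)).1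
    rw [Matrix.mul_assoc _ _ (g (Q.src h)).1, ← Units.val_mul, inv_mul_cancel, Units.val_one]
    exact (Matrix.mul_one _).symm
  constructor
  · exact quotIso_conj Q _ _ _ _ _ g hiso fun i u => key i (g i) (y i) u
  · refine quotIso_conj Q _ _ _ _ _ (fun i => (g i)⁻¹) hiso.inv fun i u => ?_
    have := key i (g i)⁻¹ ((g i).1 * y i) u
    rwa [← Matrix.mul_assoc, ← Units.val_mul, inv_mul_cancel, Units.val_one,
      Matrix.one_mul] at this

open Classical in
theorem eminusAll_mem {H : Type*} [Fintype H] [DecidableEq H] (Q : Qv I H) (ε : I → Bool)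
    (α : IsoClass Q k) (n n' w : I → ℕ) (f : E (Q.hat ε) k (DimVec.fn (n, w)) → ℂ) :
    eminusAll Q ε α n n' w f ∈ Inv (Q.hat ε) k (n', w) := by
  intro g x'
  simp only [eminusAll, LinearMap.coe_mk, AddHom.coe_mk]
  congr 1
  conv_lhs => rw [← Equiv.sum_comp (yLeft g)]
  refine Finset.sum_congr rfl fun y _ => Finset.sum_congr rfl fun x _ => ?_
  exact if_congr (and_congr (inZ_act_right (Q.hat ε) g x x' y) (quotIso_act Q ε α g x' y)) rfl rfl
end Invariance

end Maps

/-! ### The quotient space and the operators on it -/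

section Quotient

variable {I A : Type*} {k : Type*} [Field k] [Fintype k] [DecidableEq k]
variable [Fintype I] [DecidableEq I] [Fintype A] [DecidableEq A]

/-- The subspace `N_{ν,Γ,i}` of invariant functions whose Fourier transform to the reorientation
`r` of `Γ`, in which `i` is a source, vanishes on `ⁱE_ν`. -/
def NI (ψ : AddChar k ℂ) (Γ : Qv (I ⊕ I) A) (r : A → Bool) (i : I) (ν : DimVec I) :
    Submodule ℂ (Inv Γ k ν) where
  carrier := {f | ∀ x, InjAt (Γ.reorient r) i x → fourier ψ Γ r ν f.1 x = 0}
  add_mem' := fun {a b} ha hb x hx => by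
    rw [Submodule.coe_add, map_add, Pi.add_apply, ha x hx, hb x hx, add_zero]
  zero_mem' := fun x _ => by rw [Submodule.coe_zero, map_zero, Pi.zero_apply]
  smul_mem' := fun c f hf x hx => by
    rw [Submodule.coe_smul, map_smul, Pi.smul_apply, hf x hx, smul_zero]

/-- The subspace `N_{ν,Γ}` generated by the `N_{ν,Γ,i}`; here `r i` is the chosen reorientation
with source `i`. -/
def NN (ψ : AddChar k ℂ) (Γ : Qv (I ⊕ I) A) (r : I → A → Bool) (ν : DimVec I) :
    Submodule ℂ (Inv Γ k ν) := ⨆ i, NI ψ Γ (r i) i ν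

/-- The quotient `F_{ν,Γ}` of the invariant functions on `E_ν` by `N_{ν,Γ}`. -/
def FNu (ψ : AddChar k ℂ) (Γ : Qv (I ⊕ I) A) (r : I → A → Bool) (ν : DimVec I) : Type _ :=
  Inv Γ k ν ⧸ NN ψ Γ r ν

instance (ψ : AddChar k ℂ) (Γ : Qv (I ⊕ I) A) (r : I → A → Bool) (ν : DimVec I) :
    AddCommGroup (FNu ψ Γ r ν) := Submodule.Quotient.addCommGroup (NN ψ Γ r ν)

instance (ψ : AddChar k ℂ) (Γ : Qv (I ⊕ I) A) (r : I → A → Bool) (ν : DimVec I) :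
    Module ℂ (FNu ψ Γ r ν) := Submodule.Quotient.module (NN ψ Γ r ν)

/-- The projection of the invariant functions on `E_ν` to `F_{ν,Γ}`. -/
def proj (ψ : AddChar k ℂ) (Γ : Qv (I ⊕ I) A) (r : I → A → Bool) (ν : DimVec I) :
    Inv Γ k ν →ₗ[ℂ] FNu ψ Γ r ν := (NN ψ Γ r ν).mkQ

/-- The space `F_Γ = ⨁_ν F_{ν,Γ}`. -/
abbrev FSpace (ψ : AddChar k ℂ) (Γ : Qv (I ⊕ I) A) (r : I → A → Bool) : Type _ :=
  ⨁ ν : DimVec I, FNu ψ Γ r ν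

/-- The class in `F_Γ` of an invariant function on `E_ν`. -/
def cls (ψ : AddChar k ℂ) (Γ : Qv (I ⊕ I) A) (r : I → A → Bool) (ν : DimVec I) :
    Inv Γ k ν →ₗ[ℂ] FSpace ψ Γ r :=
  DirectSum.lof ℂ (DimVec I) (FNu ψ Γ r) ν ∘ₗ proj ψ Γ r ν

/-- The integer `ν̄_i - ν_i`, where `ν̄_i` is the sum of the dimensions at the other ends of the
arrows at `i`, minus `ν_i`. -/
def kWeight (Γ : Qv (I ⊕ I) A) (i : I) (ν : DimVec I) : ℤ :=
  (∑ a, if Γ.src a = Sum.inl i then (ν.fn (Γ.tgt a) : ℤ) else 0) +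
    (∑ a, if Γ.tgt a = Sum.inl i then (ν.fn (Γ.src a) : ℤ) else 0) - (ν.1 i : ℤ) - (ν.1 i : ℤ)

/-- The operator `K_i` on `F_Γ`, which is `v^{ν̄_i - ν_i}` on the summand of `ν`. -/
def opK (ψ : AddChar k ℂ) (Γ : Qv (I ⊕ I) A) (r : I → A → Bool) (i : I) :
    Module.End ℂ (FSpace ψ Γ r) :=
  DirectSum.toModule ℂ (DimVec I) (FSpace ψ Γ r) fun ν => (vv k) ^ (kWeight Γ i ν) •
    DirectSum.lof ℂ (DimVec I) (FNu ψ Γ r) ν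

/-- The operator `K_i⁻¹` on `F_Γ`, which is `v^{-(ν̄_i - ν_i)}` on the summand of `ν`. -/
def opKinv (ψ : AddChar k ℂ) (Γ : Qv (I ⊕ I) A) (r : I → A → Bool) (i : I) :
    Module.End ℂ (FSpace ψ Γ r) :=
  DirectSum.toModule ℂ (DimVec I) (FSpace ψ Γ r) fun ν => (vv k) ^ (-kWeight Γ i ν) •
    DirectSum.lof ℂ (DimVec I) (FNu ψ Γ r) ν

/-- `E⁺_i` on invariant functions, from dimension vector `ν + i` to `ν`, for `ν = (n, w)`. -/
def eplus (ψ : AddChar k ℂ) (Γ : Qv (I ⊕ I) A) (r : I → A → Bool) (i : I) (n w : I → ℕ)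
    (f : Inv Γ k (n + Pi.single i 1, w)) : Inv Γ k (n, w) :=
  ⟨eplusAll ψ Γ (r i) i n (n + Pi.single i 1) w f.1, eplusAll_mem ψ Γ (r i) i _ _ w f.1⟩

/-- `E⁻_α` on invariant functions, from dimension vector `ν` to `ν + α`, for `ν = (n, w)`. -/
def eminus {H : Type*} [Fintype H] [DecidableEq H] (Q : Qv I H) (ε : I → Bool)
    (α : IsoClass Q k) (n w : I → ℕ) (f : Inv (Q.hat ε) k (n, w)) :
    Inv (Q.hat ε) k (n + α.dim, w) :=
  ⟨eminusAll Q ε α n (n + α.dim) w f.1, eminusAll_mem Q ε α _ _ w f.1⟩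

/-- The operator `T` on `F_Γ` is induced by the maps `E⁺_i` (in particular it is zero on the
summands with `ν_i = 0`). -/
def InducedPlus (ψ : AddChar k ℂ) (Γ : Qv (I ⊕ I) A) (r : I → A → Bool) (i : I)
    (T : Module.End ℂ (FSpace ψ Γ r)) : Prop :=
  (∀ n w f, T (cls ψ Γ r (n + Pi.single i 1, w) f) = cls ψ Γ r (n, w) (eplus ψ Γ r i n w f)) ∧
    ∀ n w f, n i = 0 → T (cls ψ Γ r (n, w) f) = 0

/-- The operator `T` on `F_{Q̂}` is induced by the maps `E⁻_α`. -/
def InducedMinus {H : Type*} [Fintype H] [DecidableEq H] (ψ : AddChar k ℂ) (Q : Qv I H)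
    (ε : I → Bool) (r : I → H ⊕ I → Bool) (α : IsoClass Q k)
    (T : Module.End ℂ (FSpace ψ (Q.hat ε) r)) : Prop :=
  ∀ n w f, T (cls ψ (Q.hat ε) r (n, w) f) =
    cls ψ (Q.hat ε) r (n + α.dim, w) (eminus Q ε α n w f)

/-- The balanced quantum factorial `[m]_v! = ∏_{h=1}^m (v^h - v^{-h}) / (v - v⁻¹)`. -/
def qFact (v : ℂ) (m : ℕ) : ℂ :=
  ∏ h ∈ Finset.Icc 1 m, (v ^ h - (v ^ h)⁻¹) / (v - v⁻¹)

/-- The divided power `T^{(m)} = T^m / [m]_v!`. -/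
def divPow {M : Type*} [AddCommGroup M] [Module ℂ M] (v : ℂ) (T : Module.End ℂ M) (m : ℕ) :
    Module.End ℂ M := (qFact v m)⁻¹ • T ^ m

end Quotient

end FramedHall

end

open scoped DirectSum Matrix

set_option linter.unusedSectionVars false

noncomputable section

namespace FramedHall

universe u

/-! ### Framed graded spaces and invariant functions on their representations -/

/-! All dimension vectors are treated at once. An invariant function is regarded as a function F(M,
x) on framed representations: the components of M over Î are mapped to fixed spaces k^{w_i}, and
isomorphisms respect these maps. The framing need not be bijective, so direct sums, subobjects and
quotients (given the framing zero) stay inside the same class of objects; `restr` and `ev` pass to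
the standard spaces and back.

For a representation N, `Rop N` sums F over all extensions with subobject M and quotient N, and `Lop
N` over those with subobject N and quotient M. A three-step filtration can be cut in two ways
(`sum_tri_assoc`); hence the `Rop` multiply as in a Hall algebra, the `Lop` multiply in the opposite
order, and the two kinds commute.

The operators E⁺_i. Summing a Fourier kernel over an off-diagonal block forces the complementary
block of the other variable to vanish (`sum_kernT_tri1`). So A_i and B_i, which are `Rop` and `Lop`
of the simple S_i times suitable powers of v, commute with every Fourier transform and may be
studied in any orientation. If i is a source and x is injective at i, an extension u of S_i by x is
either injective again or of the form x∘σ, and then it splits; there are q^{ν_i} such σ, and the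
split value is that of `Lop`. Therefore the sum over injective extensions that defines E⁺_i agrees
on injective points with D_i = (q - 1)⁻¹(A_i - B_i), which means that E⁺_i is D_i modulo N_{ν,i}
(`eplus_restr_sub_mem`).

Serre relations. The Serre expression is the last term of a chain of iterated quantum commutators
(`serre_eq_qad`). At a source i, the N-th commutator of A_i with A_j is, up to scalars and weights,
the sum over jointly injective families S_i^N → S_j, which is empty once N exceeds the number of
arrows (`serreT_eq_zero`); the same holds for B with v⁻¹. Since A and B quasi-commute with exactly
the weights that the commutators ignore, the relations for A and for B combine to the one for D
(`qad_sub_sub`, `Dop_serre`).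

The operators E⁻_α. Up to a weight they are left Hall multiplication by the characteristic function
of α (`eminus_restr`), so the product formula is associativity of the Hall product. For the mixed
relation, `Rop` and `Lop` of S_i satisfy twisted Leibniz rules (`Rop_hmul`, `Lop_hmul`). The weights
in A_i, B_i and E⁻_α untwist the term in which F is differentiated; this term cancels in the
commutator. What remains contains `Rop` and `Lop` of the characteristic function of α, and
Riedtmann's formula (`sum_ind_tri`) expands these in the classes β, with weights that turn into K_i
and K_i⁻¹.

Descent. Hall multiplication preserves every space of null functions (`hmul_mem_NC`), D_i preserves
the one at j for j ≠ i (`Dop_mem_NC`), and E⁺_i kills the one at i by its definition. The relations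
then hold on the classes of functions on framed representations, which span the quotient. -/

/-- A finite graded `k`-space over `I ⊔ Î` with a framing of its components over `Î`. -/
structure FSp (I : Type*) (k : Type u) [Field k] (w : I → ℕ) where
  V : I ⊕ I → Type u
  [acg : ∀ j, AddCommGroup (V j)]
  [mod : ∀ j, Module k (V j)]
  [fin : ∀ j, Finite (V j)]
  φ : ∀ i, V (Sum.inr i) →ₗ[k] (Fin (w i) → k)

attribute [instance] FSp.acg FSp.mod FSp.fin

instance linearMapFintype {k V W : Type*} [Field k] [AddCommGroup V] [Module k V] [Finite V]
    [AddCommGroup W] [Module k W] [Finite W] : Fintype (V →ₗ[k] W) :=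
  @Fintype.ofFinite _ (DFunLike.finite _)

instance linearEquivFinite {k V W : Type*} [Field k] [AddCommGroup V] [Module k V] [Finite V]
    [AddCommGroup W] [Module k W] [Finite W] : Finite (V ≃ₗ[k] W) :=
  DFunLike.finite _

instance submoduleFintype {k V : Type*} [Field k] [AddCommGroup V] [Module k V] [Finite V] :
    Fintype (Submodule k V) :=
  @Fintype.ofFinite _ (Finite.of_injective (fun W : Submodule k V => (W : Set V))
    SetLike.coe_injective)

section Basic

variable {I A : Type*} {k : Type u} [Field k] {w : I → ℕ}

/-- Families of linear maps along the arrows of `Γ`. -/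
abbrev Hm (Γ : Qv (I ⊕ I) A) (N M : FSp I k w) : Type _ :=
  ∀ a, N.V (Γ.src a) →ₗ[k] M.V (Γ.tgt a)

/-- Representations of `Γ` on the graded space `M`. -/
abbrev Pt (Γ : Qv (I ⊕ I) A) (M : FSp I k w) : Type _ := Hm Γ M M

/-- Graded linear maps. -/
abbrev Hom0 (N M : FSp I k w) : Type _ := ∀ j, N.V j →ₗ[k] M.V j

/-- The dimension vector. -/
def FSp.dim (M : FSp I k w) (j : I ⊕ I) : ℤ := (Module.finrank k (M.V j) : ℤ)

/-- `e` is an isomorphism of framed representations. -/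
def IsoMap (Γ : Qv (I ⊕ I) A) {M M' : FSp I k w} (x : Pt Γ M) (x' : Pt Γ M')
    (e : ∀ j, M.V j ≃ₗ[k] M'.V j) : Prop :=
  (∀ i v, M'.φ i (e (Sum.inr i) v) = M.φ i v) ∧ ∀ a v, e _ (x a v) = x' a (e _ v)

/-- Isomorphism of framed representations. -/
def FIso (Γ : Qv (I ⊕ I) A) {M M' : FSp I k w} (x : Pt Γ M) (x' : Pt Γ M') : Prop :=
  ∃ e, IsoMap Γ x x' e

variable {Γ : Qv (I ⊕ I) A}

theorem IsoMap.symm {M M' : FSp I k w} {x : Pt Γ M} {x' : Pt Γ M'}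
    {e : ∀ j, M.V j ≃ₗ[k] M'.V j} (h : IsoMap Γ x x' e) :
    IsoMap Γ x' x (fun j => (e j).symm) := by
  refine ⟨fun i v => ?_, fun a v => ?_⟩
  · rw [← h.1, LinearEquiv.apply_symm_apply]
  · rw [LinearEquiv.symm_apply_eq, h.2, LinearEquiv.apply_symm_apply]

theorem IsoMap.trans {M M' M'' : FSp I k w} {x : Pt Γ M} {x' : Pt Γ M'} {x'' : Pt Γ M''}
    {e : ∀ j, M.V j ≃ₗ[k] M'.V j} {e' : ∀ j, M'.V j ≃ₗ[k] M''.V j} (h : IsoMap Γ x x' e)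
    (h' : IsoMap Γ x' x'' e') : IsoMap Γ x x'' (fun j => (e j).trans (e' j)) := by
  refine ⟨fun i v => ?_, fun a v => ?_⟩
  · rw [LinearEquiv.trans_apply, h'.1, h.1]
  · rw [LinearEquiv.trans_apply, h.2, h'.2, LinearEquiv.trans_apply]

theorem IsoMap.refl {M : FSp I k w} (x : Pt Γ M) : IsoMap Γ x x (fun _ => LinearEquiv.refl k _) :=
  ⟨fun _ _ => rfl, fun _ _ => rfl⟩

theorem FIso.refl {M : FSp I k w} (x : Pt Γ M) : FIso Γ x x := ⟨_, IsoMap.refl x⟩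

theorem FIso.symm {M M' : FSp I k w} {x : Pt Γ M} {x' : Pt Γ M'} (h : FIso Γ x x') :
    FIso Γ x' x := by
  obtain ⟨e, he⟩ := h
  exact ⟨_, he.symm⟩

theorem FIso.trans {M M' M'' : FSp I k w} {x : Pt Γ M} {x' : Pt Γ M'} {x'' : Pt Γ M''}
    (h : FIso Γ x x') (h' : FIso Γ x' x'') : FIso Γ x x'' := by
  obtain ⟨e, he⟩ := h
  obtain ⟨e', he'⟩ := h'
  exact ⟨_, he.trans he'⟩

theorem FIso.dim_eq {M M' : FSp I k w} {x : Pt Γ M} {x' : Pt Γ M'} (h : FIso Γ x x') :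
    M.dim = M'.dim := by
  obtain ⟨e, -⟩ := h
  funext j
  exact congrArg Nat.cast (e j).finrank_eq

/-- Transport of a representation along graded isomorphisms. -/
def hmCongr {M M' N N' : FSp I k w} (e : ∀ j, N.V j ≃ₗ[k] N'.V j) (e' : ∀ j, M.V j ≃ₗ[k] M'.V j) :
    Hm Γ N M ≃ Hm Γ N' M' :=
  Equiv.piCongrRight fun _ => (LinearEquiv.arrowCongr (e _) (e' _)).toEquiv

theorem hmCongr_apply {M M' N N' : FSp I k w} (e : ∀ j, N.V j ≃ₗ[k] N'.V j)
    (e' : ∀ j, M.V j ≃ₗ[k] M'.V j) (x : Hm Γ N M) (a : A) (v : N'.V (Γ.src a)) :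
    hmCongr e e' x a v = e' _ (x a ((e _).symm v)) := rfl

theorem isoMap_hmCongr {M M' : FSp I k w} (e : ∀ j, M.V j ≃ₗ[k] M'.V j)
    (h : ∀ i v, M'.φ i (e (Sum.inr i) v) = M.φ i v) (x : Pt Γ M) :
    IsoMap Γ x (hmCongr e e x) e :=
  ⟨h, fun a v => by rw [hmCongr_apply, LinearEquiv.symm_apply_apply]⟩

variable (k w Γ) in
/-- Invariant functions on all framed representations of `Γ`. -/
def CF : Submodule ℂ (∀ M : FSp I k w, Pt Γ M → ℂ) where
  carrier := {F | ∀ (M M' : FSp I k w) (x : Pt Γ M) (x' : Pt Γ M'), FIso Γ x x' → F M x = F M' x'}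
  add_mem' := fun {a b} ha hb M M' x x' h => by
    simp only [Pi.add_apply, ha M M' x x' h, hb M M' x x' h]
  zero_mem' := fun _ _ _ _ _ => rfl
  smul_mem' := fun c f hf M M' x x' h => by simp only [Pi.smul_apply, hf M M' x x' h]

theorem CF_iso (F : CF k w Γ) {M M' : FSp I k w} {x : Pt Γ M} {x' : Pt Γ M'} (h : FIso Γ x x') :
    F.1 M x = F.1 M' x' := F.2 M M' x x' h

theorem CF_ext {F F' : CF k w Γ} (h : ∀ M x, F.1 M x = F'.1 M x) : F = F' :=
  Subtype.ext (funext fun M => funext fun x => h M x)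

/-! ### Gluing of representations -/

/-- The direct sum of graded spaces. -/
@[reducible]
def FSp.prod (M N : FSp I k w) : FSp I k w where
  V j := M.V j × N.V j
  φ i := (M.φ i).coprod (N.φ i)

/-- The block upper triangular family of maps. -/
def tri {M N : FSp I k w} (x : Pt Γ M) (u : Hm Γ N M) (c : Pt Γ N) : Pt Γ (M.prod N) :=
  fun a => ((x a).coprod (u a)).prod (c a ∘ₗ LinearMap.snd k _ _)

@[simp]
theorem tri_apply {M N : FSp I k w} (x : Pt Γ M) (u : Hm Γ N M) (c : Pt Γ N) (a : A)
    (p : (M.prod N).V (Γ.src a)) :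
    tri x u c a p = (x a p.1 + u a p.2, c a p.2) := rfl

theorem FSp.dim_prod [Finite k] (M N : FSp I k w) : (M.prod N).dim = M.dim + N.dim := by
  funext j
  simp [FSp.dim, FSp.prod]

theorem tri_iso {M M' N N' : FSp I k w} {x : Pt Γ M} {x' : Pt Γ M'} {c : Pt Γ N} {c' : Pt Γ N'}
    {e : ∀ j, M.V j ≃ₗ[k] M'.V j} {e' : ∀ j, N.V j ≃ₗ[k] N'.V j} (h : IsoMap Γ x x' e)
    (h' : IsoMap Γ c c' e') (u : Hm Γ N M) :
    IsoMap Γ (tri x u c) (tri x' (hmCongr e' e u) c')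
      (M := M.prod N) (M' := M'.prod N') (fun j => LinearEquiv.prodCongr (e j) (e' j)) := by
  refine ⟨fun i v => ?_, fun a v => ?_⟩
  · simp [h.1, h'.1]
  · refine Prod.ext ?_ (h'.2 a v.2)
    change e _ (x a v.1 + u a v.2) = x' a (e _ v.1) + e _ (u a ((e' _).symm (e' _ v.2)))
    rw [map_add, h.2, LinearEquiv.symm_apply_apply]

/-- Conjugation by the unipotent automorphism given by `σ`. -/
theorem tri_shift {M N : FSp I k w} (x : Pt Γ M) (u u' : Hm Γ N M) (c : Pt Γ N) (σ : Hom0 N M)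
    (hφ : ∀ i v, M.φ i (σ (Sum.inr i) v) = 0)
    (hu : ∀ a v, u' a v = u a v - x a (σ _ v) + σ _ (c a v)) :
    FIso Γ (tri x u c) (tri x u' c) := by
  refine ⟨fun j => LinearEquiv.ofLinearMap
    (((LinearMap.fst k _ _) + σ j ∘ₗ LinearMap.snd k _ _).prod (LinearMap.snd k _ _))
    (((LinearMap.fst k _ _) - σ j ∘ₗ LinearMap.snd k _ _).prod (LinearMap.snd k _ _))
    (by ext <;> simp) (by ext <;> simp), fun i v => ?_, fun a v => ?_⟩
  · change M.φ i (v.1 + σ _ v.2) + N.φ i v.2 = M.φ i v.1 + N.φ i v.2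
    rw [map_add, hφ, add_zero]
  · refine Prod.ext ?_ rfl
    change x a v.1 + u a v.2 + σ _ (c a v.2) = x a (v.1 + σ _ v.2) + u' a v.2
    rw [hu, map_add]
    abel

/-- The pair of families with values in a direct sum. -/
def hmPair {M N L : FSp I k w} (p : Hm Γ L M) (t : Hm Γ L N) : Hm Γ L (M.prod N) :=
  fun a => (p a).prod (t a)

/-- The family on a direct sum given by its restrictions. -/
def hmCop {M N L : FSp I k w} (u : Hm Γ M L) (p : Hm Γ N L) : Hm Γ (M.prod N) L :=
  fun a => (u a).coprod (p a)

theorem hmPair_apply {M N L : FSp I k w} (p : Hm Γ L M) (t : Hm Γ L N) (a v) :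
    hmPair p t a v = (p a v, t a v) := rfl

theorem hmCop_apply {M N L : FSp I k w} (u : Hm Γ M L) (p : Hm Γ N L) (a v) :
    hmCop u p a v = u a v.1 + p a v.2 := rfl

/-- Families with values in a direct sum. -/
def hmPairEquiv {M N L : FSp I k w} : Hm Γ L M × Hm Γ L N ≃ Hm Γ L (M.prod N) where
  toFun p := hmPair p.1 p.2
  invFun t := (fun a => LinearMap.fst k _ _ ∘ₗ t a, fun a => LinearMap.snd k _ _ ∘ₗ t a)
  left_inv _ := rfl
  right_inv _ := rfl

/-- Families on a direct sum. -/
def hmCopEquiv {M N L : FSp I k w} : Hm Γ M L × Hm Γ N L ≃ Hm Γ (M.prod N) L where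
  toFun p := hmCop p.1 p.2
  invFun t := (fun a => t a ∘ₗ LinearMap.inl k _ _, fun a => t a ∘ₗ LinearMap.inr k _ _)
  left_inv p := by
    refine Prod.ext ?_ ?_ <;> funext a <;> ext <;> simp [hmCop]
  right_inv p := by
    funext a
    refine LinearMap.ext fun v => ?_
    simp [hmCop]

/-- Both sides are the same upper triangular 3 × 3 block matrix with diagonal x, y, z; only the
bracketing of the direct sum differs. -/
theorem tri_assoc {L M N : FSp I k w} (x : Pt Γ L) (y : Pt Γ M) (z : Pt Γ N) (u : Hm Γ M L)
    (p : Hm Γ N L) (t : Hm Γ N M) :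
    FIso Γ (tri (tri x u y) (hmPair p t) z) (tri x (hmCop u p) (tri y t z)) := by
  refine ⟨fun j => LinearEquiv.prodAssoc k _ _ _, fun i v => ?_, fun a v => ?_⟩
  · simp [add_assoc]
  · refine Prod.ext ?_ rfl
    change x a v.1.1 + u a v.1.2 + p a v.2 = x a v.1.1 + (u a v.1.2 + p a v.2)
    rw [add_assoc]

/-! ### Operators that sum over extensions -/

section Ops

variable [Finite k] [Fintype A] [DecidableEq A]

theorem sum_hmPair {M N L : FSp I k w} (f : Hm Γ L (M.prod N) → ℂ) :
    ∑ t, f t = ∑ p : Hm Γ L M, ∑ t : Hm Γ L N, f (hmPair p t) := by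
  rw [← Fintype.sum_prod_type']
  exact (Fintype.sum_equiv hmPairEquiv _ _ fun _ => rfl).symm

theorem sum_hmCop {M N L : FSp I k w} (f : Hm Γ (M.prod N) L → ℂ) :
    ∑ t, f t = ∑ u : Hm Γ M L, ∑ p : Hm Γ N L, f (hmCop u p) := by
  rw [← Fintype.sum_prod_type']
  exact (Fintype.sum_equiv hmCopEquiv _ _ fun _ => rfl).symm

theorem sum_tri_iso (F : CF k w Γ) {M M' N N' : FSp I k w} {x : Pt Γ M} {x' : Pt Γ M'}
    {c : Pt Γ N} {c' : Pt Γ N'} (h : FIso Γ x x') (h' : FIso Γ c c') :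
    ∑ u, F.1 (M.prod N) (tri x u c) = ∑ u, F.1 (M'.prod N') (tri x' u c') := by
  obtain ⟨e, he⟩ := h
  obtain ⟨e', he'⟩ := h'
  exact Fintype.sum_equiv (hmCongr e' e) _ _ fun u => CF_iso F ⟨_, tri_iso he he' u⟩

/-- Sum over all extensions of `N` by the argument. -/
def Rop (N : FSp I k w) (c : Pt Γ N) : Module.End ℂ (CF k w Γ) where
  toFun F := ⟨fun M x => ∑ u, F.1 (M.prod N) (tri x u c), fun _ _ _ _ h =>
    sum_tri_iso F h (FIso.refl c)⟩
  map_add' F G := CF_ext fun M x => by simp [Finset.sum_add_distrib]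
  map_smul' r F := CF_ext fun M x => by simp [Finset.mul_sum]

/-- Sum over all extensions of the argument by `N`. -/
def Lop (N : FSp I k w) (c : Pt Γ N) : Module.End ℂ (CF k w Γ) where
  toFun F := ⟨fun M x => ∑ u, F.1 (N.prod M) (tri c u x), fun _ _ _ _ h =>
    sum_tri_iso F (FIso.refl c) h⟩
  map_add' F G := CF_ext fun M x => by simp [Finset.sum_add_distrib]
  map_smul' r F := CF_ext fun M x => by simp [Finset.mul_sum]

theorem Rop_apply (N : FSp I k w) (c : Pt Γ N) (F : CF k w Γ) (M : FSp I k w) (x : Pt Γ M) :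
    (Rop N c F).1 M x = ∑ u, F.1 (M.prod N) (tri x u c) := rfl

theorem Lop_apply (N : FSp I k w) (c : Pt Γ N) (F : CF k w Γ) (M : FSp I k w) (x : Pt Γ M) :
    (Lop N c F).1 M x = ∑ u, F.1 (N.prod M) (tri c u x) := rfl

/-- Both sums run over the three off-diagonal blocks of a filtered representation with graded pieces
x, y, z. All three multiplication rules below come from this identity. -/
theorem sum_tri_assoc (F : CF k w Γ) {L M N : FSp I k w} (x : Pt Γ L) (y : Pt Γ M) (z : Pt Γ N) :
    ∑ u, ∑ t, F.1 ((L.prod M).prod N) (tri (tri x u y) t z) =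
      ∑ t, ∑ u, F.1 (L.prod (M.prod N)) (tri x u (tri y t z)) := by
  simp_rw [sum_hmPair, sum_hmCop]
  rw [Finset.sum_comm]
  simp_rw [CF_iso F (tri_assoc x y z _ _ _)]
  conv_lhs => enter [2, p]; rw [Finset.sum_comm]
  rw [Finset.sum_comm]
  refine Finset.sum_congr rfl fun t _ => ?_
  rw [Finset.sum_comm]

theorem Rop_mul_Rop (M N : FSp I k w) (y : Pt Γ M) (z : Pt Γ N) :
    Rop M y * Rop N z = ∑ t, Rop (M.prod N) (tri y t z) := by
  refine LinearMap.ext fun F => CF_ext fun L x => ?_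
  rw [Module.End.mul_apply, Rop_apply]
  simp_rw [Rop_apply]
  rw [sum_tri_assoc]
  simp [LinearMap.sum_apply, Rop_apply]

/-- Here the operator applied last attaches the piece nearer to the argument, so that the order of
factors is opposite to that in `Rop_mul_Rop`. -/
theorem Lop_mul_Lop (L M : FSp I k w) (x : Pt Γ L) (y : Pt Γ M) :
    Lop M y * Lop L x = ∑ t, Lop (L.prod M) (tri x t y) := by
  refine LinearMap.ext fun F => CF_ext fun N z => ?_
  rw [Module.End.mul_apply, Lop_apply]
  simp_rw [Lop_apply]
  rw [← sum_tri_assoc]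
  simp [LinearMap.sum_apply, Lop_apply]

/-- One operator glues at the bottom of the filtration, the other at the top, so the order of the
two does not matter. -/
theorem Rop_mul_Lop (M N : FSp I k w) (y : Pt Γ M) (z : Pt Γ N) :
    Rop N z * Lop M y = Lop M y * Rop N z := by
  refine LinearMap.ext fun F => CF_ext fun L x => ?_
  rw [Module.End.mul_apply, Module.End.mul_apply, Rop_apply, Lop_apply]
  simp_rw [Rop_apply, Lop_apply]
  exact (sum_tri_assoc F y x z).symm

theorem Rop_iso {N N' : FSp I k w} {c : Pt Γ N} {c' : Pt Γ N'} (h : FIso Γ c c') :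
    Rop N c = Rop N' c' :=
  LinearMap.ext fun F => CF_ext fun _ x => sum_tri_iso F (FIso.refl x) h

theorem Lop_iso {N N' : FSp I k w} {c : Pt Γ N} {c' : Pt Γ N'} (h : FIso Γ c c') :
    Lop N c = Lop N' c' :=
  LinearMap.ext fun F => CF_ext fun _ x => sum_tri_iso F h (FIso.refl x)

/-- Multiplication by `v^{χ(dim)}`. -/
def Kop [Fintype k] (χ : (I ⊕ I → ℤ) →+ ℤ) : Module.End ℂ (CF k w Γ) where
  toFun F := ⟨fun M x => vv k ^ χ M.dim * F.1 M x, fun _ _ _ _ h => by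
    dsimp only
    rw [h.dim_eq, CF_iso F h]⟩
  map_add' F G := CF_ext fun M x => by simp [mul_add]
  map_smul' r F := CF_ext fun M x => by simp [mul_left_comm]

theorem Kop_apply [Fintype k] (χ : (I ⊕ I → ℤ) →+ ℤ) (F : CF k w Γ) (M : FSp I k w) (x : Pt Γ M) :
    (Kop χ F).1 M x = vv k ^ χ M.dim * F.1 M x := rfl

end Ops

end Basic

/-! ### The kernel of the Fourier transform and block triangular maps -/

section KernelBlocks

variable {k : Type u} [Field k] [Fintype k]

theorem vv_pos_real : (1 : ℝ) < Real.sqrt (Fintype.card k) := by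
  rw [Real.lt_sqrt zero_le_one]
  have : 1 < Fintype.card k := Fintype.one_lt_card
  exact_mod_cast (by simpa using this)

theorem vv_ne_zero : vv k ≠ 0 := by
  unfold vv
  exact_mod_cast (lt_trans zero_lt_one (vv_pos_real (k := k))).ne'

theorem vv_sq : vv k ^ 2 = Fintype.card k := by
  unfold vv
  rw [← Complex.ofReal_pow, Real.sq_sqrt (Nat.cast_nonneg _), Complex.ofReal_natCast]

theorem card_pow_eq (n : ℕ) : ((Fintype.card k : ℂ)) ^ n = vv k ^ (2 * (n : ℤ)) := by
  rw [← vv_sq, ← pow_mul, ← zpow_natCast]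
  push_cast
  rfl

variable {P Q P' Q' : Type u} [AddCommGroup P] [Module k P] [Finite P] [AddCommGroup Q]
  [Module k Q] [Finite Q] [AddCommGroup P'] [Module k P'] [Finite P'] [AddCommGroup Q']
  [Module k Q'] [Finite Q']

/-- The block upper triangular map. -/
def tri1 (x : P →ₗ[k] Q) (u : P' →ₗ[k] Q) (c : P' →ₗ[k] Q') : P × P' →ₗ[k] Q × Q' :=
  (x.coprod u).prod (c ∘ₗ LinearMap.snd k _ _)

theorem card_hom_eq : (Fintype.card (P →ₗ[k] Q) : ℂ) =
    vv k ^ (2 * ((Module.finrank k P : ℤ) * Module.finrank k Q)) := by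
  rw [Module.card_eq_pow_finrank (K := k), Module.finrank_linearMap]
  push_cast
  rw [card_pow_eq]
  push_cast
  rfl

/-- The summand is an additive character in u, and nondegeneracy of the trace form makes it trivial
only for Y = 0; then orthogonality of characters applies. -/
theorem sum_char_trace {ψ : AddChar k ℂ} (hψ : ψ ≠ 1) (Y : P →ₗ[k] Q) [Decidable (Y = 0)] :
    ∑ u : Q →ₗ[k] P, ψ (LinearMap.trace k Q (Y ∘ₗ u)) =
      if Y = 0 then (Fintype.card (Q →ₗ[k] P) : ℂ) else 0 := by
  let L : (Q →ₗ[k] P) →ₗ[k] k := LinearMap.trace k Q ∘ₗ LinearMap.llcomp k Q P Q Y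
  let χ : AddChar (Q →ₗ[k] P) ℂ := ψ.compAddMonoidHom L.toAddMonoidHom
  have h1 : ∀ u, ψ (LinearMap.trace k Q (Y ∘ₗ u)) = χ u := fun u => rfl
  simp_rw [h1]
  have h2 : χ = 0 ↔ Y = 0 := by
    constructor
    · intro h
      by_contra hY
      obtain ⟨p, hp⟩ : ∃ p, Y p ≠ 0 := by
        by_contra hc
        push Not at hc
        exact hY (LinearMap.ext hc)
      obtain ⟨f, hf⟩ : ∃ f : Q →ₗ[k] k, f (Y p) ≠ 0 := by
        by_contra hc
        push Not at hc
        exact hp ((Module.forall_dual_apply_eq_zero_iff k (Y p)).1 hc)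
      apply hψ
      refine DFunLike.ext _ _ fun c => ?_
      -- A rank-one u scaled so that the trace of Y ∘ u is the prescribed c; it shows that ψ is
      -- trivial.
      have := DFunLike.congr_fun h (f.smulRight ((c * (f (Y p))⁻¹) • p))
      change ψ (LinearMap.trace k Q (Y ∘ₗ f.smulRight ((c * (f (Y p))⁻¹) • p))) = 1 at this
      have e : Y ∘ₗ f.smulRight ((c * (f (Y p))⁻¹) • p) =
          f.smulRight ((c * (f (Y p))⁻¹) • Y p) := by
        ext t
        simp
      rw [e, LinearMap.trace_smulRight, map_smul, smul_eq_mul, inv_mul_cancel_right₀ hf] at this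
      exact this
    · rintro rfl
      refine DFunLike.ext _ _ fun u => ?_
      change ψ (LinearMap.trace k Q (0 ∘ₗ u)) = 1
      simp
  rw [AddChar.sum_eq_ite]
  exact if_congr h2 rfl rfl

/-- Only the lower left block of X meets u. Summation of ψ over u can therefore detect precisely
that block. -/
theorem trace_tri1 (X : P × P' →ₗ[k] Q × Q') (x : Q →ₗ[k] P) (u : Q' →ₗ[k] P) (c : Q' →ₗ[k] P') :
    LinearMap.trace k _ (X ∘ₗ tri1 x u c) =
      LinearMap.trace k _ ((LinearMap.fst k _ _ ∘ₗ X ∘ₗ LinearMap.inl k _ _) ∘ₗ x) +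
      LinearMap.trace k _ ((LinearMap.snd k _ _ ∘ₗ X ∘ₗ LinearMap.inl k _ _) ∘ₗ u) +
      LinearMap.trace k _ ((LinearMap.snd k _ _ ∘ₗ X ∘ₗ LinearMap.inr k _ _) ∘ₗ c) := by
  have key : ∀ f : Q × Q' →ₗ[k] Q × Q', LinearMap.trace k _ f =
      LinearMap.trace k _ (LinearMap.fst k _ _ ∘ₗ f ∘ₗ LinearMap.inl k _ _) +
      LinearMap.trace k _ (LinearMap.snd k _ _ ∘ₗ f ∘ₗ LinearMap.inr k _ _) := by
    intro f
    have h1 := LinearMap.trace_comp_comm' (LinearMap.fst k Q Q') (f ∘ₗ LinearMap.inl k Q Q')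
    have h2 := LinearMap.trace_comp_comm' (LinearMap.snd k Q Q') (f ∘ₗ LinearMap.inr k Q Q')
    rw [← h1, ← h2, ← map_add]
    congr 1
    refine LinearMap.ext fun p => ?_
    simp [← map_add]
  rw [key, add_assoc, ← map_add]
  refine congrArg₂ (· + ·) ?_ ?_
  · congr 1
    refine LinearMap.ext fun p => ?_
    simp [tri1]
  · congr 1
    refine LinearMap.ext fun p => ?_
    simp [tri1, ← Prod.snd_add, ← map_add]

open Classical in
-- The blocks of a triangular map are determined by it, so the sum has at most one nonzero term, and
-- it has one exactly when the lower left block of X vanishes.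
theorem sum_eq_tri1 (X : P × P' →ₗ[k] Q × Q')
    (g : (P →ₗ[k] Q) → (P' →ₗ[k] Q) → (P' →ₗ[k] Q') → ℂ) :
    ∑ t : (P →ₗ[k] Q) × (P' →ₗ[k] Q) × (P' →ₗ[k] Q'),
      (if X = tri1 t.1 t.2.1 t.2.2 then g t.1 t.2.1 t.2.2 else 0) =
    if LinearMap.snd k _ _ ∘ₗ X ∘ₗ LinearMap.inl k _ _ = 0 then
      g (LinearMap.fst k _ _ ∘ₗ X ∘ₗ LinearMap.inl k _ _)
        (LinearMap.fst k _ _ ∘ₗ X ∘ₗ LinearMap.inr k _ _)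
        (LinearMap.snd k _ _ ∘ₗ X ∘ₗ LinearMap.inr k _ _) else 0 := by
  have h : ∀ t : (P →ₗ[k] Q) × (P' →ₗ[k] Q) × (P' →ₗ[k] Q'), X = tri1 t.1 t.2.1 t.2.2 ↔
      LinearMap.snd k _ _ ∘ₗ X ∘ₗ LinearMap.inl k _ _ = 0 ∧
      t = (LinearMap.fst k _ _ ∘ₗ X ∘ₗ LinearMap.inl k _ _,
        LinearMap.fst k _ _ ∘ₗ X ∘ₗ LinearMap.inr k _ _,
        LinearMap.snd k _ _ ∘ₗ X ∘ₗ LinearMap.inr k _ _) := by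
    rintro ⟨x, u, c⟩
    constructor
    · rintro rfl
      refine ⟨?_, ?_⟩
      · ext; simp [tri1]
      · refine Prod.ext ?_ (Prod.ext ?_ ?_) <;> ext <;> simp [tri1]
    · rintro ⟨h0, h1⟩
      simp only [Prod.mk.injEq] at h1
      obtain ⟨rfl, rfl, rfl⟩ := h1
      refine LinearMap.ext fun p => Prod.ext ?_ ?_
      · simp [tri1, ← Prod.fst_add, ← map_add]
      · have := LinearMap.congr_fun h0 p.1
        simp only [LinearMap.comp_apply, LinearMap.inl_apply, LinearMap.snd_apply,
          LinearMap.zero_apply] at this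
        have h2 : X p = X (p.1, 0) + X (0, p.2) := by simp [← map_add]
        rw [h2, Prod.snd_add, this]
        simp [tri1]
  by_cases h0 : LinearMap.snd k _ _ ∘ₗ X ∘ₗ LinearMap.inl k _ _ = 0
  · rw [if_pos h0]
    simp_rw [h, h0, true_and]
    rw [Finset.sum_ite_eq']
    simp
  · rw [if_neg h0]
    simp_rw [h, h0, false_and, if_false]
    simp

/-- The Fourier kernel between `Hom(P, Q)` and `Hom(Q, P)`. -/
def kernT (ψ : AddChar k ℂ) (X : P →ₗ[k] Q) (X' : Q →ₗ[k] P) : ℂ :=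
  vv k ^ (-((Module.finrank k P * Module.finrank k Q : ℕ) : ℤ)) *
    ψ (LinearMap.trace k Q (X ∘ₗ X'))

theorem kernT_symm (ψ : AddChar k ℂ) (X : P →ₗ[k] Q) (X' : Q →ₗ[k] P) :
    kernT ψ X X' = kernT ψ X' X := by
  unfold kernT
  rw [LinearMap.trace_comp_comm', mul_comm (Module.finrank k P)]

open Classical in
-- By `sum_char_trace` the sum over u gives |Hom(Q', P)| if the lower left block of X is zero and 0
-- otherwise. The power of v is what remains of this count after comparing the normalization on the
-- direct sum with those on the two diagonal blocks.
theorem sum_kernT_tri1 {ψ : AddChar k ℂ} (hψ : ψ ≠ 1) (X : P × P' →ₗ[k] Q × Q') (ξ : Q →ₗ[k] P)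
    (ζ : Q' →ₗ[k] P') :
    ∑ u, kernT ψ X (tri1 ξ u ζ) =
      vv k ^ ((Module.finrank k P : ℤ) * Module.finrank k Q' -
        (Module.finrank k P' : ℤ) * Module.finrank k Q) *
      ∑ t : (P →ₗ[k] Q) × (P' →ₗ[k] Q) × (P' →ₗ[k] Q'),
        (if X = tri1 t.1 t.2.1 t.2.2 then kernT ψ t.1 ξ * kernT ψ t.2.2 ζ else 0) := by
  rw [sum_eq_tri1 X (fun x _ c => kernT ψ x ξ * kernT ψ c ζ)]
  unfold kernT
  simp_rw [trace_tri1, AddChar.map_add_eq_mul]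
  rw [← Finset.mul_sum, ← Finset.sum_mul, ← Finset.mul_sum, sum_char_trace hψ]
  split_ifs with h
  · rw [card_hom_eq, Module.finrank_prod, Module.finrank_prod]
    have e : ∀ a b c : ℂ, ∀ l m n o p : ℤ, l + m = n + (o + p) →
        vv k ^ l * (a * vv k ^ m * b) = vv k ^ n * (vv k ^ o * a * (vv k ^ p * b)) := by
      intro a b c l m n o p hl
      have := congrArg (fun t => vv k ^ t) hl
      simp only [zpow_add₀ (vv_ne_zero (k := k))] at this
      linear_combination (a * b) * this
    refine e _ _ 0 _ _ _ _ _ ?_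
    push_cast
    ring
  · simp

end KernelBlocks

/-! ### Fourier transforms of invariant functions -/

section FourierCF

variable {I A : Type*} {k : Type u} [Field k] [Fintype k] {w : I → ℕ}

open Classical in
/-- The kernel of the Fourier transform at one arrow. -/
def kernL (ψ : AddChar k ℂ) (M : FSp I k w) (p q : I ⊕ I) : ∀ b : Bool,
    (M.V p →ₗ[k] M.V q) → (M.V (cond b q p) →ₗ[k] M.V (cond b p q)) → ℂ
  | false => fun X X' => if X = X' then 1 else 0
  | true => fun X X' => kernT ψ X X'

/-- The factor by which a block triangular Fourier kernel differs from the product of the kernels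
of the diagonal blocks. -/
def cfac (M N : FSp I k w) (p q : I ⊕ I) : Bool → ℂ
  | false => 1
  | true => vv k ^ (M.dim p * N.dim q - N.dim p * M.dim q)

open Classical in
-- The right side sums over triangular shapes of X in order that kept and reversed arrows have one
-- common form, which can be multiplied over all arrows.
theorem sum_kernL_tri1 {ψ : AddChar k ℂ} (hψ : ψ ≠ 1) (M N : FSp I k w) (p q : I ⊕ I) :
    ∀ (b : Bool) (X : M.V p × N.V p →ₗ[k] M.V q × N.V q)
      (ξ : M.V (cond b q p) →ₗ[k] M.V (cond b p q)) (ζ : N.V (cond b q p) →ₗ[k] N.V (cond b p q)),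
    ∑ u : N.V (cond b q p) →ₗ[k] M.V (cond b p q),
        kernL ψ (M.prod N) p q b X (tri1 ξ u ζ) =
      cfac M N p q b *
      ∑ t : (M.V p →ₗ[k] M.V q) × (N.V p →ₗ[k] M.V q) × (N.V p →ₗ[k] N.V q),
        (if X = tri1 t.1 t.2.1 t.2.2 then kernL ψ M p q b t.1 ξ * kernL ψ N p q b t.2.2 ζ else 0)
  | true => fun X ξ ζ => sum_kernT_tri1 hψ X ξ ζ
  | false => fun X ξ ζ => by
    change M.V p →ₗ[k] M.V q at ξ
    change N.V p →ₗ[k] N.V q at ζ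
    change ∑ u : N.V p →ₗ[k] M.V q, (if X = tri1 ξ u ζ then (1 : ℂ) else 0) = 1 *
      ∑ t : (M.V p →ₗ[k] M.V q) × (N.V p →ₗ[k] M.V q) × (N.V p →ₗ[k] N.V q),
        (if X = tri1 t.1 t.2.1 t.2.2 then
          (if t.1 = ξ then (1 : ℂ) else 0) * (if t.2.2 = ζ then 1 else 0) else 0)
    rw [one_mul, Fintype.sum_prod_type]
    rw [Finset.sum_eq_single ξ (fun x _ hx => by simp [hx]) (by simp), Fintype.sum_prod_type]
    refine Finset.sum_congr rfl fun u _ => ?_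
    rw [Finset.sum_eq_single ζ (fun x _ hx => by simp [hx]) (by simp)]
    simp

open Classical in
-- The counterpart with the summation in the other variable; for a reversed arrow it follows from
-- the symmetry of the kernel. It serves the proof that Hall multiplication preserves null
-- functions.
theorem sum_kernL_tri1' {ψ : AddChar k ℂ} (hψ : ψ ≠ 1) (M N : FSp I k w) (p q : I ⊕ I) :
    ∀ (b : Bool) (x : M.V p →ₗ[k] M.V q) (c : N.V p →ₗ[k] N.V q)
      (Ξ : M.V (cond b q p) × N.V (cond b q p) →ₗ[k] M.V (cond b p q) × N.V (cond b p q)),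
    ∑ u : N.V p →ₗ[k] M.V q, kernL ψ (M.prod N) p q b (tri1 x u c) Ξ =
      cfac M N q p b *
      ∑ t : (M.V (cond b q p) →ₗ[k] M.V (cond b p q)) ×
          (N.V (cond b q p) →ₗ[k] M.V (cond b p q)) × (N.V (cond b q p) →ₗ[k] N.V (cond b p q)),
        (if Ξ = tri1 t.1 t.2.1 t.2.2 then kernL ψ M p q b x t.1 * kernL ψ N p q b c t.2.2 else 0)
  | true => fun x c Ξ => by
    have h := sum_kernT_tri1 hψ Ξ x c
    simp only [kernT_symm ψ Ξ, kernT_symm ψ _ x, kernT_symm ψ _ c] at h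
    exact h
  | false => fun x c Ξ => by
    change M.V p × N.V p →ₗ[k] M.V q × N.V q at Ξ
    change ∑ u : N.V p →ₗ[k] M.V q, (if tri1 x u c = Ξ then (1 : ℂ) else 0) = 1 *
      ∑ t : (M.V p →ₗ[k] M.V q) × (N.V p →ₗ[k] M.V q) × (N.V p →ₗ[k] N.V q),
        (if Ξ = tri1 t.1 t.2.1 t.2.2 then
          (if x = t.1 then (1 : ℂ) else 0) * (if c = t.2.2 then 1 else 0) else 0)
    rw [one_mul, Fintype.sum_prod_type]
    rw [Finset.sum_eq_single x (fun y _ hx => by simp [hx.symm]) (by simp), Fintype.sum_prod_type]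
    refine Finset.sum_congr rfl fun u _ => ?_
    rw [Finset.sum_eq_single c (fun y _ hx => by simp [hx.symm]) (by simp)]
    simp [eq_comm]

theorem kernT_mul_inv (ψ : AddChar k ℂ) {P Q : Type u} [AddCommGroup P] [Module k P] [Finite P]
    [AddCommGroup Q] [Module k Q] [Finite Q] (X Y : P →ₗ[k] Q) (X' : Q →ₗ[k] P) :
    kernT ψ X X' * kernT ψ⁻¹ Y X' =
      vv k ^ (-(2 * ((Module.finrank k Q : ℤ) * Module.finrank k P))) *
        ψ (LinearMap.trace k Q ((X - Y) ∘ₗ X')) := by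
  unfold kernT
  rw [LinearMap.sub_comp, map_sub, sub_eq_add_neg, AddChar.map_add_eq_mul, AddChar.inv_apply]
  have := congrArg (fun t => vv k ^ t) (show
    (-((Module.finrank k P * Module.finrank k Q : ℕ) : ℤ)) +
    (-((Module.finrank k P * Module.finrank k Q : ℕ) : ℤ)) =
    -(2 * ((Module.finrank k Q : ℤ) * Module.finrank k P)) by push_cast; ring)
  simp only [zpow_add₀ (vv_ne_zero (k := k))] at this
  rw [← this]
  ring

open Classical in
-- For a reversed arrow the product of the two characters depends on X - Y only, and the two
-- normalizations cancel the number of maps X'. This is Fourier inversion at one arrow.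
theorem sum_kernL_right {ψ : AddChar k ℂ} (hψ : ψ ≠ 1) (M : FSp I k w) (p q : I ⊕ I) :
    ∀ (b : Bool) (X Y : M.V p →ₗ[k] M.V q),
    ∑ X', kernL ψ M p q b X X' * kernL ψ⁻¹ M p q b Y X' = if X = Y then 1 else 0
  | false => fun X Y => by
    change ∑ X' : M.V p →ₗ[k] M.V q,
      (if X = X' then (1 : ℂ) else 0) * (if Y = X' then 1 else 0) = _
    rw [Finset.sum_eq_single X (fun y _ hx => by simp [hx.symm]) (by simp)]
    simp [eq_comm]
  | true => fun X Y => by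
    change ∑ X' : M.V q →ₗ[k] M.V p, kernT ψ X X' * kernT ψ⁻¹ Y X' = _
    simp_rw [kernT_mul_inv]
    rw [← Finset.mul_sum, sum_char_trace hψ]
    simp only [sub_eq_zero]
    split_ifs
    · rw [card_hom_eq, ← zpow_add₀ vv_ne_zero, neg_add_cancel, zpow_zero]
    · simp

open Classical in
theorem sum_kernL_left {ψ : AddChar k ℂ} (hψ : ψ ≠ 1) (M : FSp I k w) (p q : I ⊕ I) :
    ∀ (b : Bool) (X' Y' : M.V (cond b q p) →ₗ[k] M.V (cond b p q)),
    ∑ X, kernL ψ M p q b X X' * kernL ψ⁻¹ M p q b X Y' = if X' = Y' then 1 else 0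
  | false => fun X' Y' => by
    change M.V p →ₗ[k] M.V q at X' Y'
    change ∑ X : M.V p →ₗ[k] M.V q,
      (if X = X' then (1 : ℂ) else 0) * (if X = Y' then 1 else 0) = _
    rw [Finset.sum_eq_single X' (fun y _ hx => by simp [hx]) (by simp)]
    simp
  | true => fun X' Y' => by
    change M.V q →ₗ[k] M.V p at X' Y'
    change ∑ X : M.V p →ₗ[k] M.V q, kernT ψ X X' * kernT ψ⁻¹ X Y' = _
    simp_rw [kernT_symm _ _ X', kernT_symm _ _ Y', kernT_mul_inv]
    rw [← Finset.mul_sum, sum_char_trace hψ]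
    simp only [sub_eq_zero]
    split_ifs
    · rw [card_hom_eq, ← zpow_add₀ vv_ne_zero, neg_add_cancel, zpow_zero]
    · simp

open Classical in
theorem kernL_conj (ψ : AddChar k ℂ) {M M' : FSp I k w} (e : ∀ j, M.V j ≃ₗ[k] M'.V j)
    (p q : I ⊕ I) : ∀ (b : Bool) (X : M.V p →ₗ[k] M.V q)
      (X' : M.V (cond b q p) →ₗ[k] M.V (cond b p q)),
    kernL ψ M' p q b (LinearEquiv.arrowCongr (e p) (e q) X)
      (LinearEquiv.arrowCongr (e (cond b q p)) (e (cond b p q)) X') = kernL ψ M p q b X X'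
  | false => fun X X' => by
    change M.V p →ₗ[k] M.V q at X'
    change (if LinearEquiv.arrowCongr (e p) (e q) X = LinearEquiv.arrowCongr (e p) (e q) X'
      then (1 : ℂ) else 0) = if X = X' then 1 else 0
    exact if_congr (LinearEquiv.injective _).eq_iff rfl rfl
  | true => fun X X' => by
    change M.V q →ₗ[k] M.V p at X'
    change kernT ψ (LinearEquiv.arrowCongr (e p) (e q) X) (LinearEquiv.arrowCongr (e q) (e p) X') =
      kernT ψ X X'
    unfold kernT
    rw [(e p).finrank_eq, (e q).finrank_eq, ← LinearMap.trace_conj' (X ∘ₗ X') (e q)]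
    congr 3
    refine LinearMap.ext fun v => ?_
    simp [LinearEquiv.conj_apply]

variable {Γ : Qv (I ⊕ I) A} [Fintype A] [DecidableEq A]

/-- The Fourier kernel on representations. -/
def kernPt (ψ : AddChar k ℂ) (r : A → Bool) (M : FSp I k w) (x : Pt Γ M)
    (ξ : Pt (Γ.reorient r) M) : ℂ :=
  ∏ a, kernL ψ M (Γ.src a) (Γ.tgt a) (r a) (x a) (ξ a)

/-- The product of the factors `cfac`. -/
def cfacPt (Γ : Qv (I ⊕ I) A) (r : A → Bool) (M N : FSp I k w) : ℂ :=
  ∏ a, cfac M N (Γ.src a) (Γ.tgt a) (r a)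

theorem kernPt_conj (ψ : AddChar k ℂ) (r : A → Bool) {M M' : FSp I k w}
    (e : ∀ j, M.V j ≃ₗ[k] M'.V j) (x : Pt Γ M) (ξ : Pt (Γ.reorient r) M) :
    kernPt ψ r M' (hmCongr e e x) (hmCongr e e ξ) = kernPt ψ r M x ξ :=
  Finset.prod_congr rfl fun _ _ => kernL_conj ψ e _ _ _ _ _

theorem IsoMap.eq_hmCongr {M M' : FSp I k w} {x : Pt Γ M} {x' : Pt Γ M'}
    {e : ∀ j, M.V j ≃ₗ[k] M'.V j} (h : IsoMap Γ x x' e) : x' = hmCongr e e x := by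
  funext a
  refine LinearMap.ext fun v => ?_
  rw [hmCongr_apply, h.2, LinearEquiv.apply_symm_apply]

/-- The Fourier transform of invariant functions. -/
def Four (ψ : AddChar k ℂ) (r : A → Bool) : CF k w Γ →ₗ[ℂ] CF k w (Γ.reorient r) where
  toFun F := ⟨fun M ξ => ∑ x : Pt Γ M, F.1 M x * kernPt ψ r M x ξ, by
    rintro M M' ξ ξ' ⟨e, he⟩
    refine Fintype.sum_equiv (hmCongr e e) _ _ fun x => ?_
    rw [he.eq_hmCongr, kernPt_conj, CF_iso F ⟨e, isoMap_hmCongr e he.1 x⟩]⟩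
  map_add' F G := CF_ext fun M x => by simp [add_mul, Finset.sum_add_distrib]
  map_smul' c F := CF_ext fun M x => by simp [Finset.mul_sum, mul_assoc]

/-- The Fourier transform of invariant functions in the opposite direction. -/
def FourBack (ψ : AddChar k ℂ) (r : A → Bool) : CF k w (Γ.reorient r) →ₗ[ℂ] CF k w Γ where
  toFun F := ⟨fun M x => ∑ ξ : Pt (Γ.reorient r) M, F.1 M ξ * kernPt ψ⁻¹ r M x ξ, by
    rintro M M' x x' ⟨e, he⟩
    refine Fintype.sum_equiv (hmCongr e e) _ _ fun ξ => ?_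
    rw [he.eq_hmCongr, kernPt_conj, CF_iso F ⟨e, isoMap_hmCongr e he.1 ξ⟩]⟩
  map_add' F G := CF_ext fun M x => by simp [add_mul, Finset.sum_add_distrib]
  map_smul' c F := CF_ext fun M x => by simp [Finset.mul_sum, mul_assoc]

theorem Four_apply (ψ : AddChar k ℂ) (r : A → Bool) (F : CF k w Γ) (M : FSp I k w)
    (ξ : Pt (Γ.reorient r) M) :
    (Four ψ r F).1 M ξ = ∑ x : Pt Γ M, F.1 M x * kernPt ψ r M x ξ := rfl

theorem FourBack_apply (ψ : AddChar k ℂ) (r : A → Bool) (F : CF k w (Γ.reorient r)) (M : FSp I k w)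
    (x : Pt Γ M) :
    (FourBack ψ r F).1 M x = ∑ ξ, F.1 M ξ * kernPt ψ⁻¹ r M x ξ := rfl

theorem prod_sum_pi {T : A → Type*} [∀ a, Fintype (T a)] (f : ∀ a, T a → ℂ) :
    ∑ t : (∀ a, T a), ∏ a, f a (t a) = ∏ a, ∑ t, f a t := by
  rw [Finset.prod_univ_sum, Fintype.piFinset_univ]

open Classical in
theorem prod_ite_funext {T : A → Type*} (x y : ∀ a, T a) (f : A → ℂ) :
    ∏ a, (if x a = y a then f a else 0) = if x = y then ∏ a, f a else 0 := by
  split_ifs with h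
  · simp [h]
  · obtain ⟨a, ha⟩ := Function.ne_iff.1 h
    exact Finset.prod_eq_zero (Finset.mem_univ a) (if_neg ha)

open Classical in
theorem sum_kernPt_right {ψ : AddChar k ℂ} (hψ : ψ ≠ 1) (r : A → Bool) (M : FSp I k w)
    (x y : Pt Γ M) :
    ∑ ξ, kernPt ψ r M x ξ * kernPt ψ⁻¹ r M y ξ = if x = y then 1 else 0 := by
  unfold kernPt
  simp_rw [← Finset.prod_mul_distrib]
  refine (prod_sum_pi fun a ξ => kernL ψ M (Γ.src a) (Γ.tgt a) (r a) (x a) ξ *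
    kernL ψ⁻¹ M (Γ.src a) (Γ.tgt a) (r a) (y a) ξ).trans ?_
  refine (Finset.prod_congr rfl fun a _ => sum_kernL_right hψ M _ _ (r a) (x a) (y a)).trans ?_
  rw [prod_ite_funext]
  simp

open Classical in
theorem sum_kernPt_left {ψ : AddChar k ℂ} (hψ : ψ ≠ 1) (r : A → Bool) (M : FSp I k w)
    (ξ ζ : Pt (Γ.reorient r) M) :
    ∑ x : Pt Γ M, kernPt ψ r M x ξ * kernPt ψ⁻¹ r M x ζ = if ξ = ζ then 1 else 0 := by
  unfold kernPt
  simp_rw [← Finset.prod_mul_distrib]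
  refine (prod_sum_pi fun a x => kernL ψ M (Γ.src a) (Γ.tgt a) (r a) x (ξ a) *
    kernL ψ⁻¹ M (Γ.src a) (Γ.tgt a) (r a) x (ζ a)).trans ?_
  refine (Finset.prod_congr rfl fun a _ =>
    sum_kernL_left hψ M (Γ.src a) (Γ.tgt a) (r a) (ξ a) (ζ a)).trans ?_
  exact (prod_ite_funext ξ ζ fun _ => 1).trans (by simp)

theorem FourBack_Four {ψ : AddChar k ℂ} (hψ : ψ ≠ 1) (r : A → Bool) (F : CF k w Γ) :
    FourBack ψ r (Four ψ r F) = F := by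
  classical
  refine CF_ext fun M x => ?_
  rw [FourBack_apply]
  simp_rw [Four_apply, Finset.sum_mul]
  rw [Finset.sum_comm]
  simp_rw [mul_assoc, ← Finset.mul_sum, sum_kernPt_right hψ]
  simp

theorem Four_FourBack {ψ : AddChar k ℂ} (hψ : ψ ≠ 1) (r : A → Bool)
    (F : CF k w (Γ.reorient r)) : Four ψ r (FourBack ψ r F) = F := by
  classical
  refine CF_ext fun M x => ?_
  rw [Four_apply]
  simp_rw [FourBack_apply, Finset.sum_mul]
  rw [Finset.sum_comm]
  simp_rw [mul_assoc, ← Finset.mul_sum, mul_comm (kernPt ψ⁻¹ r M _ _), sum_kernPt_left hψ]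
  simp

/-- Triples of families are families of triples. -/
def tripleEquiv (Γ : Qv (I ⊕ I) A) (M N : FSp I k w) : Pt Γ M × Hm Γ N M × Pt Γ N ≃
    (∀ a, (M.V (Γ.src a) →ₗ[k] M.V (Γ.tgt a)) × (N.V (Γ.src a) →ₗ[k] M.V (Γ.tgt a)) ×
      (N.V (Γ.src a) →ₗ[k] N.V (Γ.tgt a))) where
  toFun t a := (t.1 a, t.2.1 a, t.2.2 a)
  invFun t := (fun a => (t a).1, fun a => (t a).2.1, fun a => (t a).2.2)
  left_inv _ := rfl
  right_inv _ := rfl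

open Classical in
theorem sum_kernPt_tri {ψ : AddChar k ℂ} (hψ : ψ ≠ 1) (r : A → Bool) (M N : FSp I k w)
    (X : Pt Γ (M.prod N)) (ξ : Pt (Γ.reorient r) M) (ζ : Pt (Γ.reorient r) N) :
    ∑ u, kernPt ψ r (M.prod N) X (tri ξ u ζ) = cfacPt Γ r M N *
      ∑ t : Pt Γ M × Hm Γ N M × Pt Γ N, if X = tri t.1 t.2.1 t.2.2 then
        kernPt ψ r M t.1 ξ * kernPt ψ r N t.2.2 ζ else 0 := by
  unfold kernPt cfacPt
  refine (prod_sum_pi fun a u => kernL ψ (M.prod N) (Γ.src a) (Γ.tgt a) (r a) (X a)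
    (tri1 (ξ a) u (ζ a))).trans ?_
  refine (Finset.prod_congr rfl fun a _ =>
    sum_kernL_tri1 hψ M N (Γ.src a) (Γ.tgt a) (r a) (X a) (ξ a) (ζ a)).trans ?_
  rw [Finset.prod_mul_distrib]
  congr 1
  simp_rw [← Finset.prod_mul_distrib]
  rw [← prod_sum_pi fun a (t : (M.V (Γ.src a) →ₗ[k] M.V (Γ.tgt a)) ×
    (N.V (Γ.src a) →ₗ[k] M.V (Γ.tgt a)) × (N.V (Γ.src a) →ₗ[k] N.V (Γ.tgt a))) =>
      (if X a = tri1 t.1 t.2.1 t.2.2 then kernL ψ M (Γ.src a) (Γ.tgt a) (r a) t.1 (ξ a) *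
        kernL ψ N (Γ.src a) (Γ.tgt a) (r a) t.2.2 (ζ a) else 0)]
  refine (Fintype.sum_equiv (tripleEquiv Γ M N) _ _ fun t => ?_).symm
  exact (prod_ite_funext X (tri t.1 t.2.1 t.2.2) _).symm

open Classical in
theorem sum_kernPt_tri' {ψ : AddChar k ℂ} (hψ : ψ ≠ 1) (r : A → Bool) (M N : FSp I k w)
    (x : Pt Γ M) (c : Pt Γ N) (Ξ : Pt (Γ.reorient r) (M.prod N)) :
    ∑ u, kernPt ψ r (M.prod N) (tri x u c) Ξ =
      (∏ a, cfac M N (Γ.tgt a) (Γ.src a) (r a)) *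
      ∑ t : Pt (Γ.reorient r) M × Hm (Γ.reorient r) N M × Pt (Γ.reorient r) N,
        if Ξ = tri t.1 t.2.1 t.2.2 then
          kernPt ψ r M x t.1 * kernPt ψ r N c t.2.2 else 0 := by
  unfold kernPt
  refine (prod_sum_pi fun a u => kernL ψ (M.prod N) (Γ.src a) (Γ.tgt a) (r a)
    (tri1 (x a) u (c a)) (Ξ a)).trans ?_
  refine (Finset.prod_congr rfl fun a _ =>
    sum_kernL_tri1' hψ M N (Γ.src a) (Γ.tgt a) (r a) (x a) (c a) (Ξ a)).trans ?_
  rw [Finset.prod_mul_distrib]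
  congr 1
  refine (prod_sum_pi fun a (t : (M.V ((Γ.reorient r).src a) →ₗ[k] M.V ((Γ.reorient r).tgt a)) ×
    (N.V ((Γ.reorient r).src a) →ₗ[k] M.V ((Γ.reorient r).tgt a)) ×
    (N.V ((Γ.reorient r).src a) →ₗ[k] N.V ((Γ.reorient r).tgt a))) =>
      (if Ξ a = tri1 t.1 t.2.1 t.2.2 then kernL ψ M (Γ.src a) (Γ.tgt a) (r a) (x a) t.1 *
        kernL ψ N (Γ.src a) (Γ.tgt a) (r a) (c a) t.2.2 else 0)).symm.trans ?_
  refine (Fintype.sum_equiv (tripleEquiv (Γ.reorient r) M N) _ _ fun t => ?_).symm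
  refine Eq.trans ?_ (prod_ite_funext Ξ (tri t.1 t.2.1 t.2.2) _).symm
  rw [Finset.prod_mul_distrib]
  rfl

/-- The Fourier transform on a direct sum, integrated over the off-diagonal blocks. -/
theorem sum_Four_tri {ψ : AddChar k ℂ} (hψ : ψ ≠ 1) (r : A → Bool) (F : CF k w Γ)
    (M N : FSp I k w) (ξ : Pt (Γ.reorient r) M) (ζ : Pt (Γ.reorient r) N) :
    ∑ u, (Four ψ r F).1 (M.prod N) (tri ξ u ζ) = cfacPt Γ r M N *
      ∑ x : Pt Γ M, ∑ c : Pt Γ N, (∑ u, F.1 (M.prod N) (tri x u c)) *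
        (kernPt ψ r M x ξ * kernPt ψ r N c ζ) := by
  classical
  simp_rw [Four_apply]
  rw [Finset.sum_comm]
  simp_rw [← Finset.mul_sum, sum_kernPt_tri hψ, mul_left_comm _ (cfacPt Γ r M N)]
  rw [← Finset.mul_sum]
  congr 1
  simp_rw [Finset.mul_sum]
  rw [Finset.sum_comm, Fintype.sum_prod_type]
  refine Finset.sum_congr rfl fun x _ => ?_
  rw [Fintype.sum_prod_type, Finset.sum_comm]
  refine Finset.sum_congr rfl fun c _ => ?_
  rw [Finset.sum_mul]
  refine Finset.sum_congr rfl fun u _ => ?_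
  simp [mul_ite]

end FourierCF

/-! ### Extensions by the simple representations -/

section Simple

variable {I A : Type*} {k : Type u} [Field k] {w : I → ℕ}

/-- The space with dimension vector `d` on `I`, and zero on `Î`. -/
@[reducible]
def sp (k : Type u) [Field k] [Finite k] (w : I → ℕ) (d : I → ℕ) : FSp I k w where
  V j := Fin ((Sum.elim d 0 : I ⊕ I → ℕ) j) → k
  φ _ := 0

theorem sp_dim [Finite k] (d : I → ℕ) (j : I ⊕ I) :
    (sp k w d).dim j = ((Sum.elim d 0 : I ⊕ I → ℕ) j : ℤ) := by
  simp [FSp.dim]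

variable [DecidableEq I]

/-- The space of the simple representation at `i`. -/
abbrev spS (k : Type u) [Field k] [Finite k] (w : I → ℕ) (i : I) : FSp I k w :=
  sp k w (Pi.single i 1)

/-- The dimension vector of the simple representation at `i`. -/
abbrev dl (i : I) : I ⊕ I → ℤ := Pi.single (Sum.inl i) 1

theorem spS_dim [Finite k] (i : I) : (spS k w i).dim = dl i := by
  funext j
  rw [sp_dim]
  rcases j with j | j
  · by_cases h : j = i
    · subst h; simp [dl]
    · simp [dl, h]
  · simp [dl]

theorem subsingleton_spS [Finite k] {i : I} {j : I ⊕ I} (h : j ≠ Sum.inl i) :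
    Subsingleton ((spS k w i).V j) := by
  have : (Sum.elim (Pi.single i 1) 0 : I ⊕ I → ℕ) j = 0 := by
    rcases j with j | j
    · have : j ≠ i := fun e => h (by rw [e])
      simp [this]
    · rfl
  have h2 : IsEmpty (Fin ((Sum.elim (Pi.single i 1) 0 : I ⊕ I → ℕ) j)) := by
    rw [this]
    infer_instance
  infer_instance

theorem hm_ext_src {Γ : Qv (I ⊕ I) A} [Finite k] {M : FSp I k w} {i : I} {u u' : Hm Γ (spS k w i) M}
    (h : ∀ a, Γ.src a = Sum.inl i → u a = u' a) : u = u' := by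
  funext a
  by_cases ha : Γ.src a = Sum.inl i
  · exact h a ha
  · have := subsingleton_spS (k := k) (w := w) ha
    exact LinearMap.ext fun v => by rw [Subsingleton.elim v 0, map_zero, map_zero]

theorem hm_ext_tgt {Γ : Qv (I ⊕ I) A} [Finite k] {M : FSp I k w} {i : I} {u u' : Hm Γ M (spS k w i)}
    (h : ∀ a, Γ.tgt a = Sum.inl i → u a = u' a) : u = u' := by
  funext a
  by_cases ha : Γ.tgt a = Sum.inl i
  · exact h a ha
  · have := subsingleton_spS (k := k) (w := w) ha
    exact LinearMap.ext fun v => Subsingleton.elim _ _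

/-- Without loops every arrow has an end different from i, where the simple representation vanishes.
-/
theorem pt_spS_eq_zero {Γ : Qv (I ⊕ I) A} (hΓ : ∀ a, Γ.src a ≠ Γ.tgt a) [Finite k] {i : I}
    (c : Pt Γ (spS k w i)) : c = 0 := by
  refine hm_ext_src fun a ha => ?_
  have := subsingleton_spS (k := k) (w := w) (fun e => hΓ a (ha.trans e.symm))
  exact LinearMap.ext fun v => Subsingleton.elim _ _

variable [Fintype A] [DecidableEq A]

/-- The total dimension at the starting points of the arrows which end at `i`. -/
def inW (Γ : Qv (I ⊕ I) A) (i : I) : (I ⊕ I → ℤ) →+ ℤ :=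
  ∑ a, if Γ.tgt a = Sum.inl i then Pi.evalAddMonoidHom (fun _ : I ⊕ I => ℤ) (Γ.src a) else 0

theorem inW_apply (Γ : Qv (I ⊕ I) A) (i : I) (ν : I ⊕ I → ℤ) :
    inW Γ i ν = ∑ a, if Γ.tgt a = Sum.inl i then ν (Γ.src a) else 0 := by
  unfold inW
  rw [AddMonoidHom.finsetSum_apply]
  refine Finset.sum_congr rfl fun a _ => ?_
  split_ifs <;> rfl

/-- The dimension at `i`. -/
abbrev evW (i : I) : (I ⊕ I → ℤ) →+ ℤ := Pi.evalAddMonoidHom (fun _ : I ⊕ I => ℤ) (Sum.inl i)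

/-- The exponent of the operator `Aop`. -/
def aW (Γ : Qv (I ⊕ I) A) (i : I) : (I ⊕ I → ℤ) →+ ℤ := inW Γ i - 3 • evW i

/-- The exponent of the operator `Bop`. -/
def bW (Γ : Qv (I ⊕ I) A) (i : I) : (I ⊕ I → ℤ) →+ ℤ := - evW i - inW Γ i

theorem aW_apply (Γ : Qv (I ⊕ I) A) (i : I) (ν : I ⊕ I → ℤ) :
    aW Γ i ν = inW Γ i ν - 3 * ν (Sum.inl i) := by
  simp [aW, evW]

theorem bW_apply (Γ : Qv (I ⊕ I) A) (i : I) (ν : I ⊕ I → ℤ) :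
    bW Γ i ν = - ν (Sum.inl i) - inW Γ i ν := by
  simp [bW, evW]

variable [Fintype k] {Γ : Qv (I ⊕ I) A}

theorem prod_zpow_vv {ι : Type*} (s : Finset ι) (f : ι → ℤ) :
    ∏ a ∈ s, vv k ^ f a = vv k ^ ∑ a ∈ s, f a := by
  classical
  induction s using Finset.induction_on with
  | empty => simp
  | insert a s ha ih => rw [Finset.prod_insert ha, Finset.sum_insert ha, ih, zpow_add₀ vv_ne_zero]

theorem cfac_eq (M N : FSp I k w) (p q : I ⊕ I) (b : Bool) :
    cfac M N p q b = vv k ^ (if b then M.dim p * N.dim q - N.dim p * M.dim q else 0) := by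
  cases b <;> simp [cfac]

theorem inW_reorient (r : A → Bool) (i : I) (ν : I ⊕ I → ℤ) :
    inW Γ i ν - inW (Γ.reorient r) i ν =
      ∑ a, if r a then ν (Γ.src a) * dl i (Γ.tgt a) - dl i (Γ.src a) * ν (Γ.tgt a) else 0 := by
  rw [inW_apply, inW_apply, ← Finset.sum_sub_distrib]
  refine Finset.sum_congr rfl fun a _ => ?_
  unfold Qv.reorient
  cases h : r a <;> simp [Pi.single_apply, h]

theorem cfacPt_spS_right (r : A → Bool) (M : FSp I k w) (i : I) :
    cfacPt Γ r M (spS k w i) = vv k ^ (inW Γ i M.dim - inW (Γ.reorient r) i M.dim) := by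
  unfold cfacPt
  simp_rw [cfac_eq, spS_dim]
  rw [prod_zpow_vv, inW_reorient]

theorem cfacPt_spS_left (r : A → Bool) (M : FSp I k w) (i : I) :
    cfacPt Γ r (spS k w i) M = vv k ^ (inW (Γ.reorient r) i M.dim - inW Γ i M.dim) := by
  unfold cfacPt
  simp_rw [cfac_eq, spS_dim]
  rw [prod_zpow_vv, ← neg_sub (inW Γ i M.dim), inW_reorient, ← Finset.sum_neg_distrib]
  congr 1
  refine Finset.sum_congr rfl fun a _ => ?_
  split_ifs <;> ring

theorem kernPt_spS (ψ : AddChar k ℂ) (r : A → Bool) (hΓ : ∀ a, Γ.src a ≠ Γ.tgt a) (i : I) :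
    kernPt ψ r (spS k w i) (0 : Pt Γ (spS k w i)) 0 = 1 := by
  refine Finset.prod_eq_one fun a _ => ?_
  have key : ∀ b : Bool, kernL ψ (spS k w i) (Γ.src a) (Γ.tgt a) b 0 0 = 1 := by
    rintro (b | b)
    · exact if_pos rfl
    · change kernT ψ 0 0 = 1
      unfold kernT
      have : Module.finrank k ((spS k w i).V (Γ.src a)) *
          Module.finrank k ((spS k w i).V (Γ.tgt a)) = 0 := by
        by_cases ha : Γ.src a = Sum.inl i
        · have := subsingleton_spS (k := k) (w := w) (fun e => hΓ a (ha.trans e.symm))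
          rw [Module.finrank_zero_of_subsingleton (M := (spS k w i).V (Γ.tgt a)), mul_zero]
        · have := subsingleton_spS (k := k) (w := w) ha
          rw [Module.finrank_zero_of_subsingleton (M := (spS k w i).V (Γ.src a)), zero_mul]
      rw [this]
      simp
  exact key (r a)

theorem reorient_ne (hΓ : ∀ a, Γ.src a ≠ Γ.tgt a) (r : A → Bool) (a : A) :
    (Γ.reorient r).src a ≠ (Γ.reorient r).tgt a := by
  unfold Qv.reorient
  cases h : r a
  · simpa [h] using hΓ a
  · simpa [h] using (hΓ a).symm

/-- In `sum_Four_tri` the second diagonal block is a representation on S_i, hence zero, and its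
kernel is 1. Only the factor `cfacPt` distinguishes the two orientations. -/
theorem Rop_Four {ψ : AddChar k ℂ} (hψ : ψ ≠ 1) (r : A → Bool) (hΓ : ∀ a, Γ.src a ≠ Γ.tgt a)
    (i : I) (F : CF k w Γ) (M : FSp I k w) (ξ : Pt (Γ.reorient r) M) :
    (Rop (spS k w i) 0 (Four ψ r F)).1 M ξ =
      vv k ^ (inW Γ i M.dim - inW (Γ.reorient r) i M.dim) *
        (Four ψ r (Rop (spS k w i) 0 F)).1 M ξ := by
  rw [Rop_apply, sum_Four_tri hψ, cfacPt_spS_right, Four_apply]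
  congr 1
  refine Finset.sum_congr rfl fun x _ => ?_
  rw [Finset.sum_eq_single 0 (fun c _ hc => (hc (pt_spS_eq_zero hΓ c)).elim) (by simp),
    kernPt_spS ψ r hΓ, mul_one, Rop_apply]

theorem Lop_Four {ψ : AddChar k ℂ} (hψ : ψ ≠ 1) (r : A → Bool) (hΓ : ∀ a, Γ.src a ≠ Γ.tgt a)
    (i : I) (F : CF k w Γ) (M : FSp I k w) (ξ : Pt (Γ.reorient r) M) :
    (Lop (spS k w i) 0 (Four ψ r F)).1 M ξ =
      vv k ^ (inW (Γ.reorient r) i M.dim - inW Γ i M.dim) *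
        (Four ψ r (Lop (spS k w i) 0 F)).1 M ξ := by
  rw [Lop_apply, sum_Four_tri hψ, cfacPt_spS_left, Four_apply]
  congr 1
  rw [Finset.sum_eq_single 0 (fun c _ hc => (hc (pt_spS_eq_zero hΓ c)).elim) (by simp)]
  refine Finset.sum_congr rfl fun x _ => ?_
  rw [kernPt_spS ψ r hΓ, one_mul, Lop_apply]

/-- The normalized operator `Rop` for the simple representation at `i`. -/
def Aop (Γ : Qv (I ⊕ I) A) (k : Type u) [Field k] [Fintype k] (w : I → ℕ) (i : I) :
    Module.End ℂ (CF k w Γ) := Kop (aW Γ i) * Rop (spS k w i) 0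

/-- The normalized operator `Lop` for the simple representation at `i`. -/
def Bop (Γ : Qv (I ⊕ I) A) (k : Type u) [Field k] [Fintype k] (w : I → ℕ) (i : I) :
    Module.End ℂ (CF k w Γ) := Kop (bW Γ i) * Lop (spS k w i) 0

/-- The part `inW` of the exponent `aW` absorbs the factor in `Rop_Four`. The part -3ν_i is
independent of the orientation; it is the factor v^{-ν_i} q^{-ν_i} that occurs for E⁺_i at a source.
-/
theorem Aop_Four {ψ : AddChar k ℂ} (hψ : ψ ≠ 1) (r : A → Bool) (hΓ : ∀ a, Γ.src a ≠ Γ.tgt a)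
    (i : I) (F : CF k w Γ) :
    Aop (Γ.reorient r) k w i (Four ψ r F) = Four ψ r (Aop Γ k w i F) := by
  refine CF_ext fun M ξ => ?_
  have h : (Four ψ r (Aop Γ k w i F)).1 M ξ =
      vv k ^ aW Γ i M.dim * (Four ψ r (Rop (spS k w i) 0 F)).1 M ξ := by
    rw [Four_apply, Four_apply, Finset.mul_sum]
    exact Finset.sum_congr rfl fun x _ => mul_assoc _ _ _
  rw [h, Aop, Module.End.mul_apply, Kop_apply, Rop_Four hψ r hΓ, ← mul_assoc,
    ← zpow_add₀ vv_ne_zero, aW_apply, aW_apply]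
  congr 2
  ring

/-- For `Lop` the factor is inverse, hence the opposite sign of `inW` in `bW`. The part -ν_i is
-3ν_i + 2ν_i, since the split extensions at a source are counted q^{ν_i} times. -/
theorem Bop_Four {ψ : AddChar k ℂ} (hψ : ψ ≠ 1) (r : A → Bool) (hΓ : ∀ a, Γ.src a ≠ Γ.tgt a)
    (i : I) (F : CF k w Γ) :
    Bop (Γ.reorient r) k w i (Four ψ r F) = Four ψ r (Bop Γ k w i F) := by
  refine CF_ext fun M ξ => ?_
  have h : (Four ψ r (Bop Γ k w i F)).1 M ξ =
      vv k ^ bW Γ i M.dim * (Four ψ r (Lop (spS k w i) 0 F)).1 M ξ := by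
    rw [Four_apply, Four_apply, Finset.mul_sum]
    exact Finset.sum_congr rfl fun x _ => mul_assoc _ _ _
  rw [h, Bop, Module.End.mul_apply, Kop_apply, Lop_Four hψ r hΓ, ← mul_assoc,
    ← zpow_add₀ vv_ne_zero, bW_apply, bW_apply]
  congr 2
  ring

/-! ### Commutation with the weight operators -/

theorem Kop_mul (χ χ' : (I ⊕ I → ℤ) →+ ℤ) :
    (Kop χ * Kop χ' : Module.End ℂ (CF k w Γ)) = Kop (χ + χ') := by
  refine LinearMap.ext fun F => CF_ext fun M x => ?_
  rw [Module.End.mul_apply, Kop_apply, Kop_apply, Kop_apply, AddMonoidHom.add_apply,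
    zpow_add₀ vv_ne_zero, mul_assoc]

theorem Rop_mul_Kop (N : FSp I k w) (c : Pt Γ N) (χ : (I ⊕ I → ℤ) →+ ℤ) :
    Rop N c * Kop χ = vv k ^ χ N.dim • (Kop χ * Rop N c) := by
  refine LinearMap.ext fun F => CF_ext fun M x => ?_
  rw [Module.End.mul_apply, Rop_apply]
  simp_rw [Kop_apply, FSp.dim_prod, map_add, zpow_add₀ (vv_ne_zero (k := k))]
  rw [← Finset.mul_sum, mul_comm (vv k ^ χ M.dim), mul_assoc]
  rfl

theorem Lop_mul_Kop (N : FSp I k w) (c : Pt Γ N) (χ : (I ⊕ I → ℤ) →+ ℤ) :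
    Lop N c * Kop χ = vv k ^ χ N.dim • (Kop χ * Lop N c) := by
  refine LinearMap.ext fun F => CF_ext fun M x => ?_
  rw [Module.End.mul_apply, Lop_apply]
  simp_rw [Kop_apply, FSp.dim_prod, map_add, zpow_add₀ (vv_ne_zero (k := k))]
  rw [← Finset.mul_sum, mul_assoc]
  rfl

/-- As `Rop` and `Lop` commute, the scalar arises only from moving each weight operator past the
other extension operator. -/
theorem Aop_mul_Bop (i j : I) : Aop Γ k w i * Bop Γ k w j =
    vv k ^ (bW Γ j (dl i) - aW Γ i (dl j)) • (Bop Γ k w j * Aop Γ k w i) := by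
  have h1 : Aop Γ k w i * Bop Γ k w j =
      vv k ^ bW Γ j (dl i) • (Kop (aW Γ i + bW Γ j) * (Rop (spS k w i) 0 * Lop (spS k w j) 0)) := by
    rw [Aop, Bop, mul_assoc, ← mul_assoc (Rop _ _), Rop_mul_Kop, smul_mul_assoc, mul_smul_comm,
      spS_dim, ← Kop_mul, mul_assoc, mul_assoc]
  have h2 : Bop Γ k w j * Aop Γ k w i =
      vv k ^ aW Γ i (dl j) • (Kop (aW Γ i + bW Γ j) * (Rop (spS k w i) 0 * Lop (spS k w j) 0)) := by
    rw [Aop, Bop, mul_assoc, ← mul_assoc (Lop _ _), Lop_mul_Kop, smul_mul_assoc, mul_smul_comm,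
      spS_dim, add_comm, ← Kop_mul, Rop_mul_Lop, mul_assoc, mul_assoc]
  rw [h1, h2, smul_smul, ← zpow_add₀ vv_ne_zero, sub_add_cancel]

end Simple

/-! ### Iterated quantum commutators -/

section QuantumCommutator

variable {R : Type*} [Ring R] [Algebra ℂ R]

/-- The iterated quantum commutators whose last member is the quantum Serre expression. -/
def qad (v : ℂ) (n : ℤ) (x y : R) : ℕ → R
  | 0 => y
  | N + 1 => qad v n x y N * x - v ^ (2 * (N : ℤ) - n) • (x * qad v n x y N)

/-- The N-th commutator contains x to the power N and y once, so its weight against b is 2N - n.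
This is the exponent in the definition of `qad`. -/
theorem qad_mul {v : ℂ} (hv : v ≠ 0) {n : ℤ} {x y b : R} (hx : x * b = v ^ (2 : ℤ) • (b * x))
    (hy : y * b = v ^ (-n) • (b * y)) (N : ℕ) :
    qad v n x y N * b = v ^ (2 * (N : ℤ) - n) • (b * qad v n x y N) := by
  induction N with
  | zero => simpa [qad] using hy
  | succ N ih =>
    rw [qad]
    set T := qad v n x y N
    have e1 : T * x * b = v ^ (2 * ((N + 1 : ℕ) : ℤ) - n) • (b * (T * x)) := by
      rw [mul_assoc, hx, mul_smul_comm, ← mul_assoc, ih, smul_mul_assoc, smul_smul,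
        ← zpow_add₀ hv, mul_assoc]
      congr 2
      push_cast
      ring
    have e2 : x * T * b = v ^ (2 * ((N + 1 : ℕ) : ℤ) - n) • (b * (x * T)) := by
      rw [mul_assoc, ih, mul_smul_comm, ← mul_assoc, hx, smul_mul_assoc, smul_smul,
        ← zpow_add₀ hv, mul_assoc]
      congr 2
      push_cast
      ring
    rw [sub_mul, smul_mul_assoc, e1, e2, mul_sub, smul_sub, mul_smul_comm, smul_comm]

/-- By `qad_mul` the two terms which b adds to the next commutator cancel. -/
theorem qad_add {v : ℂ} (hv : v ≠ 0) {n : ℤ} {x y b : R} (hx : x * b = v ^ (2 : ℤ) • (b * x))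
    (hy : y * b = v ^ (-n) • (b * y)) (N : ℕ) : qad v n (x + b) y N = qad v n x y N := by
  induction N with
  | zero => rfl
  | succ N ih =>
    rw [qad, qad, ih, mul_add, add_mul, smul_add, qad_mul hv hx hy]
    abel

theorem qad_sub_right (v : ℂ) (n : ℤ) (x y y' : R) (N : ℕ) :
    qad v n x (y - y') N = qad v n x y N - qad v n x y' N := by
  induction N with
  | zero => rfl
  | succ N ih =>
    rw [qad, qad, qad, ih, sub_mul, mul_sub, smul_sub]
    abel

theorem qad_smul_left (v : ℂ) (n : ℤ) (c : ℂ) (x y : R) (N : ℕ) :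
    qad v n (c • x) y N = c ^ N • qad v n x y N := by
  induction N with
  | zero => simp [qad]
  | succ N ih =>
    rw [qad, qad, ih, smul_mul_smul_comm, smul_mul_smul_comm, smul_sub, ← pow_succ, ← pow_succ',
      smul_comm (c ^ (N + 1))]

theorem qad_neg_left_eq_zero {v : ℂ} {n : ℤ} {x y : R} {N : ℕ} (h : qad v n x y N = 0) :
    qad v n (-x) y N = 0 := by
  rw [← neg_one_smul ℂ x, qad_smul_left, h, smul_zero]

/-- The coefficients of the iterated quantum commutators. -/
def qadCoeff (v : ℂ) (n : ℤ) : ℕ → ℕ → ℂ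
  | 0, 0 => 1
  | 0, _ + 1 => 0
  | N + 1, 0 => qadCoeff v n N 0
  | N + 1, m + 1 => qadCoeff v n N (m + 1) - v ^ (2 * (N : ℤ) - n) * qadCoeff v n N m

theorem qadCoeff_eq_zero (v : ℂ) (n : ℤ) : ∀ N m : ℕ, N < m → qadCoeff v n N m = 0
  | 0, 0, h => (lt_irrefl _ h).elim
  | 0, _ + 1, _ => rfl
  | N + 1, 0, h => by omega
  | N + 1, m + 1, h => by
    rw [qadCoeff, qadCoeff_eq_zero v n N _ (by omega), qadCoeff_eq_zero v n N _ (by omega)]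
    simp

theorem qad_eq_sum (v : ℂ) (n : ℤ) (x y : R) (N : ℕ) :
    qad v n x y N = ∑ m ∈ Finset.range (N + 1), qadCoeff v n N m • (x ^ m * y * x ^ (N - m)) := by
  induction N with
  | zero => simp [qad, qadCoeff]
  | succ N ih =>
    rw [qad, Finset.sum_range_succ']
    simp only [qadCoeff, sub_smul, Finset.sum_sub_distrib]
    have e1 : qad v n x y N * x = ∑ m ∈ Finset.range (N + 1),
        qadCoeff v n N (m + 1) • (x ^ (m + 1) * y * x ^ (N + 1 - (m + 1))) +
        qadCoeff v n N 0 • (x ^ 0 * y * x ^ (N + 1 - 0)) := by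
      rw [← Finset.sum_range_succ' (fun m => qadCoeff v n N m • (x ^ m * y * x ^ (N + 1 - m))),
        Finset.sum_range_succ, qadCoeff_eq_zero v n N (N + 1) (by omega), zero_smul, add_zero, ih,
        Finset.sum_mul]
      refine Finset.sum_congr rfl fun m hm => ?_
      have : N + 1 - m = (N - m) + 1 := by
        have := Finset.mem_range.1 hm
        omega
      rw [smul_mul_assoc, this, pow_succ, mul_assoc, mul_assoc]
    have e2 : v ^ (2 * (N : ℤ) - n) • (x * qad v n x y N) = ∑ m ∈ Finset.range (N + 1),
        (v ^ (2 * (N : ℤ) - n) * qadCoeff v n N m) •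
          (x ^ (m + 1) * y * x ^ (N + 1 - (m + 1))) := by
      rw [ih, Finset.mul_sum, Finset.smul_sum]
      refine Finset.sum_congr rfl fun m _ => ?_
      rw [mul_smul_comm, smul_smul, pow_succ', Nat.add_sub_add_right, mul_assoc, mul_assoc,
        mul_assoc]
    rw [e1, e2]
    abel

theorem qFact_succ (v : ℂ) (m : ℕ) :
    qFact v (m + 1) = qFact v m * ((v ^ (m + 1) - (v ^ (m + 1))⁻¹) / (v - v⁻¹)) := by
  unfold qFact
  rw [Finset.prod_Icc_succ_top (by omega)]

/-- This says that the coefficient is (-1)^m v^{m(N-1-n)} times a quantum binomial, with the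
denominators cleared so that no factorial has to be nonzero. The recursion is the quantum Pascal
rule, used by induction on N - m and on m. For N = n + 1 the power of v disappears. -/
theorem qadCoeff_mul {v : ℂ} (hv : v ≠ 0) (n : ℤ) :
    ∀ s m : ℕ, qFact v m * qFact v s * qadCoeff v n (m + s) m =
      (-1) ^ m * v ^ ((m : ℤ) * (((m + s : ℕ) : ℤ) - 1 - n)) * qFact v (m + s) := by
  have h0 : ∀ N : ℕ, qadCoeff v n N 0 = 1 := by
    intro N
    induction N with
    | zero => rfl
    | succ N ih => rw [qadCoeff, ih]
  intro s
  induction s with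
  | zero =>
    intro m
    induction m with
    | zero => simp [qFact, qadCoeff]
    | succ m ih =>
      have h1 : qFact v 0 = 1 := by simp [qFact]
      simp only [h1, mul_one, add_zero] at ih ⊢
      rw [qadCoeff, qadCoeff_eq_zero v n m (m + 1) (by omega), zero_sub, qFact_succ]
      have e := congrArg (fun t => v ^ t) (show ((m + 1 : ℕ) : ℤ) * (((m + 1 : ℕ) : ℤ) - 1 - n) =
        (2 * (m : ℤ) - n) + (m : ℤ) * ((m : ℤ) - 1 - n) by push_cast; ring)
      simp only [zpow_add₀ hv] at e
      rw [e, pow_succ]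
      linear_combination (-(v ^ (2 * (m : ℤ) - n)) *
        ((v ^ (m + 1) - (v ^ (m + 1))⁻¹) / (v - v⁻¹))) * ih
  | succ s ihs =>
    intro m
    induction m with
    | zero => simp [qFact, h0]
    | succ m ihm =>
      have h1 := ihs (m + 1)
      have hN : m + 1 + (s + 1) = (m + (s + 1)) + 1 := by omega
      have hN' : m + 1 + s = m + (s + 1) := by omega
      rw [hN'] at h1
      rw [hN, qadCoeff]
      set N := m + (s + 1) with hNdef
      have e1 := congrArg (fun t => v ^ t) (show ((m + 1 : ℕ) : ℤ) * (((N + 1 : ℕ) : ℤ) - 1 - n) =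
        ((m + 1 : ℕ) : ℤ) * ((N : ℤ) - 1 - n) + ((m + 1 : ℕ) : ℤ) by push_cast; ring)
      have e2 := congrArg (fun t => v ^ t) (show (2 * (N : ℤ) - n) + (m : ℤ) * ((N : ℤ) - 1 - n) +
        ((m + 1 : ℕ) : ℤ) = ((m + 1 : ℕ) : ℤ) * ((N : ℤ) - 1 - n) + ((m + 1 : ℕ) : ℤ) +
        ((N + 1 : ℕ) : ℤ) by push_cast; ring)
      simp only [zpow_add₀ hv, zpow_natCast] at e1 e2
      -- The quantum Pascal rule for N + 1 = (m + 1) + (s + 1).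
      have hpas : (v ^ (N + 1) - (v ^ (N + 1))⁻¹) * v ^ (m + 1) =
          (v ^ (s + 1) - (v ^ (s + 1))⁻¹) +
          (v ^ (m + 1) - (v ^ (m + 1))⁻¹) * v ^ (N + 1) := by
        have e3 : v ^ (N + 1) = v ^ (m + 1) * v ^ (s + 1) := by rw [← pow_add]; congr 1; omega
        rw [e3]
        have := pow_ne_zero (m + 1) hv
        have := pow_ne_zero (s + 1) hv
        field_simp
        ring
      rw [qFact_succ v N, e1]
      have hq1 := qFact_succ v m
      have hq2 := qFact_succ v s
      have hm1 := pow_ne_zero (m + 1) hv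
      set a := v ^ (((m + 1 : ℕ) : ℤ) * ((N : ℤ) - 1 - n))
      set b := v ^ (2 * (N : ℤ) - n)
      set c := v ^ ((m : ℤ) * ((N : ℤ) - 1 - n))
      set f1 := qFact v (m + 1)
      set f2 := qFact v (s + 1)
      set fN := qFact v N
      set d := v - v⁻¹
      set g1 := v ^ (m + 1) - (v ^ (m + 1))⁻¹
      set g2 := v ^ (s + 1) - (v ^ (s + 1))⁻¹
      set gN := v ^ (N + 1) - (v ^ (N + 1))⁻¹
      have hbc : b * c = a * v ^ (N + 1) := mul_right_cancel₀ hm1 (by linear_combination e2)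
      calc f1 * f2 * (qadCoeff v n N (m + 1) - b * qadCoeff v n N m)
          = (f1 * qFact v s * qadCoeff v n N (m + 1)) * (g2 / d) -
            b * (g1 / d) * (qFact v m * f2 * qadCoeff v n N m) := by
              rw [hq1, hq2]
              ring
        _ = ((-1) ^ (m + 1) * a * fN) * (g2 / d) - b * (g1 / d) * ((-1) ^ m * c * fN) := by
              rw [h1, ihm]
        _ = (-1) ^ (m + 1) * fN / d * (a * g2 + g1 * (b * c)) := by rw [pow_succ]; ring
        _ = (-1) ^ (m + 1) * fN / d * a * (g2 + g1 * v ^ (N + 1)) := by rw [hbc]; ring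
        _ = (-1) ^ (m + 1) * (a * v ^ (m + 1)) * (fN * (gN / d)) := by rw [← hpas]; ring

/-- The number v = √q is real and larger than 1, so none of the differences v^m - v^{-m} with m ≥ 1
vanishes. -/
theorem qFact_ne_zero {k : Type u} [Field k] [Fintype k] (m : ℕ) : qFact (vv k) m ≠ 0 := by
  have h : ∀ m : ℕ, vv k ^ (m + 1) - (vv k ^ (m + 1))⁻¹ ≠ 0 := by
    intro m hm
    have h1 := vv_pos_real (k := k)
    unfold vv at hm
    have h2 : (1 : ℝ) < Real.sqrt (Fintype.card k) ^ (m + 1) := one_lt_pow₀ h1 (by omega)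
    have h3 := inv_lt_one_of_one_lt₀ h2
    rw [← Complex.ofReal_pow, ← Complex.ofReal_inv, ← Complex.ofReal_sub,
      Complex.ofReal_eq_zero] at hm
    linarith
  refine Finset.prod_ne_zero_iff.2 fun a ha => ?_
  obtain ⟨a, rfl⟩ : ∃ b, a = b + 1 := ⟨a - 1, by have := (Finset.mem_Icc.1 ha).1; omega⟩
  refine div_ne_zero (h a) ?_
  simpa using h 0

theorem qFact_inv (v : ℂ) (m : ℕ) : qFact v⁻¹ m = qFact v m := by
  refine Finset.prod_congr rfl fun h _ => ?_
  rw [inv_pow, inv_inv, inv_inv, ← neg_sub, ← neg_sub v, neg_div_neg_eq]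

/-- The last quantum commutator is the quantum Serre expression. -/
theorem serre_eq_qad {M : Type*} [AddCommGroup M] [Module ℂ M] {v : ℂ} (hv : v ≠ 0)
    (hq : ∀ m, qFact v m ≠ 0) (n : ℕ) (x y : Module.End ℂ M) :
    qad v n x y (n + 1) = qFact v (n + 1) •
      ∑ m ∈ Finset.range (n + 1 + 1), (-1 : ℂ) ^ m • (divPow v x m * y * divPow v x (n + 1 - m)) := by
  rw [qad_eq_sum, Finset.smul_sum]
  refine Finset.sum_congr rfl fun m hm => ?_
  have hm' : m + (n + 1 - m) = n + 1 := by
    have := Finset.mem_range.1 hm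
    omega
  have h := qadCoeff_mul hv n (n + 1 - m) m
  rw [hm'] at h
  have h0 : ((n + 1 : ℕ) : ℤ) - 1 - (n : ℤ) = 0 := by push_cast; ring
  rw [h0, mul_zero, zpow_zero, mul_one] at h
  unfold divPow
  rw [smul_mul_assoc, smul_mul_assoc, mul_smul_comm, smul_smul, smul_smul, smul_smul]
  congr 1
  have h1 := hq m
  have h2 := hq (n + 1 - m)
  field_simp
  linear_combination h

end QuantumCommutator

/-! ### Injectivity at a vertex -/

section Injectivity

variable {I A : Type*} {k : Type u} [Field k] {w : I → ℕ} {Γ : Qv (I ⊕ I) A}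

/-- The maps of the family starting at `i` are jointly injective. -/
def InjI (i : I) {P L : FSp I k w} (g : Hm Γ P L) : Prop :=
  ∀ u : ∀ j, P.V j, (∀ a, Γ.src a = Sum.inl i → g a (u (Γ.src a)) = 0) → u (Sum.inl i) = 0

variable [DecidableEq I] [Fintype k]

theorem spS_finrank (i : I) : Module.finrank k ((spS k w i).V (Sum.inl i)) = 1 := by
  have h := congrFun (spS_dim (k := k) (w := w) i) (Sum.inl i)
  simp only [FSp.dim, dl, Pi.single_eq_same] at h
  exact_mod_cast h

theorem spS_span {i : I} {s : (spS k w i).V (Sum.inl i)} (hs : s ≠ 0)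
    (t : (spS k w i).V (Sum.inl i)) : ∃ c : k, c • s = t := by
  exact (finrank_eq_one_iff_of_nonzero' s hs).1 (spS_finrank i) t

theorem exists_spS_ne_zero (i : I) : ∃ s : (spS k w i).V (Sum.inl i), s ≠ 0 := by
  have h : 0 < Module.finrank k ((spS k w i).V (Sum.inl i)) := by rw [spS_finrank]; exact one_pos
  have := Module.nontrivial_of_finrank_pos h
  exact exists_ne 0

theorem card_hom0_spS [Fintype I] (i : I) (P : FSp I k w) :
    (Fintype.card (Hom0 (spS k w i) P) : ℂ) = vv k ^ (2 * P.dim (Sum.inl i)) := by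
  rw [Fintype.card_pi]
  push_cast
  rw [Finset.prod_eq_single (Sum.inl i), card_hom_eq]
  · rw [spS_finrank (w := w), Nat.cast_one, one_mul]
    rfl
  · intro j _ hj
    have := subsingleton_spS (k := k) (w := w) hj
    rw [card_hom_eq, Module.finrank_zero_of_subsingleton]
    simp
  · simp

theorem InjI.of_hmCop {i : I} {P L N : FSp I k w} {g : Hm Γ P L} {p : Hm Γ N L}
    (h : InjI i (hmCop g p)) : InjI i g := by
  intro u hu
  have := h (fun j => (u j, 0)) fun a ha => by
    rw [hmCop_apply, map_zero, add_zero]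
    exact hu a ha
  exact congrArg Prod.fst this

/-- A nonzero kernel vector (m, s) has s ≠ 0 because g is injective. As S_i is one-dimensional, p is
determined by its value at s, which is -g(m); so p factors through g. -/
theorem not_injI_hmCop {i : I} {P L : FSp I k w} {g : Hm Γ P L} (hg : InjI i g)
    (p : Hm Γ (spS k w i) L) :
    ¬ InjI i (hmCop g p) ↔ ∃ σ : Hom0 (spS k w i) P, p = fun a => g a ∘ₗ σ (Γ.src a) := by
  constructor
  · intro h
    unfold InjI at h
    push Not at h
    obtain ⟨u, hu, hu0⟩ := h
    have hs : (u (Sum.inl i)).2 ≠ 0 := by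
      intro hs
      apply hu0
      refine Prod.ext (hg (fun j => (u j).1) fun a ha => ?_) hs
      have h1 := hu a ha
      rw [hmCop_apply] at h1
      have h2 : (u (Γ.src a)).2 = 0 := by rw [ha]; exact hs
      rwa [h2, map_zero, add_zero] at h1
    obtain ⟨f, hf⟩ : ∃ f : (spS k w i).V (Sum.inl i) →ₗ[k] k, f (u (Sum.inl i)).2 ≠ 0 := by
      by_contra hc
      push Not at hc
      exact hs ((Module.forall_dual_apply_eq_zero_iff k _).1 hc)
    -- The linear map with s ↦ -m, extended below by zero to the other vertices.
    let σi : (spS k w i).V (Sum.inl i) →ₗ[k] P.V (Sum.inl i) :=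
      f.smulRight (-(f (u (Sum.inl i)).2)⁻¹ • (u (Sum.inl i)).1)
    have hσ : σi (u (Sum.inl i)).2 = - (u (Sum.inl i)).1 := by
      change f (u (Sum.inl i)).2 • (-(f (u (Sum.inl i)).2)⁻¹ • (u (Sum.inl i)).1) = _
      rw [smul_smul, mul_neg, mul_inv_cancel₀ hf, neg_one_smul]
    let σ : Hom0 (spS k w i) P := fun j => if h : j = Sum.inl i then h ▸ σi else 0
    have hσj : ∀ j, j = Sum.inl i → σ j (u j).2 = - (u j).1 := by
      rintro j rfl
      simp only [σ, dif_pos]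
      exact hσ
    refine ⟨σ, hm_ext_src fun a ha => LinearMap.ext fun t => ?_⟩
    have hsp : ∃ c : k, c • (u (Γ.src a)).2 = t := by
      revert t
      rw [ha]
      exact fun t => spS_span hs t
    obtain ⟨c, rfl⟩ := hsp
    have h1 := hu a ha
    rw [hmCop_apply] at h1
    rw [LinearMap.comp_apply, map_smul, map_smul, map_smul, hσj _ ha, map_neg,
      eq_neg_of_add_eq_zero_right h1]
  · rintro ⟨σ, rfl⟩ h
    obtain ⟨s, hs⟩ := exists_spS_ne_zero (k := k) (w := w) i
    let t : ∀ j, (spS k w i).V j := fun j => if h : j = Sum.inl i then h ▸ s else 0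
    -- For p = g ∘ σ the vector (-σ(t), t) lies in the kernel.
    have := h (fun j => (-σ j (t j), t j)) fun a _ => by
      rw [hmCop_apply, LinearMap.comp_apply, map_neg, neg_add_cancel]
    have h2 := congrArg Prod.snd this
    simp only [t, dif_pos] at h2
    exact hs h2

open Classical in
/-- Splitting a sum over the families on the simple representation at `i`. -/
theorem sum_injI_split [Fintype I] [Fintype A] [DecidableEq A] {i : I} {P L : FSp I k w}
    {g : Hm Γ P L} (hg : InjI i g) {V : Type*} [AddCommGroup V] (f : Hm Γ (spS k w i) L → V) :
    ∑ p, f p = (∑ p, if InjI i (hmCop g p) then f p else 0) +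
      ∑ σ : Hom0 (spS k w i) P, f (fun a => g a ∘ₗ σ (Γ.src a)) := by
  have h1 : ∑ p, f p = (∑ p, if InjI i (hmCop g p) then f p else 0) +
      ∑ p, if ¬ InjI i (hmCop g p) then f p else 0 := by
    rw [← Finset.sum_add_distrib]
    refine Finset.sum_congr rfl fun p _ => ?_
    by_cases h : InjI i (hmCop g p) <;> simp [h]
  rw [h1]
  congr 1
  rw [← Finset.sum_filter]
  symm
  refine Finset.sum_bij (fun σ _ => fun a => g a ∘ₗ σ (Γ.src a)) ?_ ?_ ?_ ?_
  · intro σ _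
    rw [Finset.mem_filter]
    exact ⟨Finset.mem_univ _, (not_injI_hmCop hg _).2 ⟨σ, rfl⟩⟩
  -- Distinct σ give distinct families because g is jointly injective at i and S_i lives only at i.
  · intro σ _ τ _ h
    funext j
    by_cases hj : j = Sum.inl i
    · subst hj
      refine LinearMap.ext fun s => ?_
      let t : ∀ j, (spS k w i).V j := fun j => if h : j = Sum.inl i then h ▸ s else 0
      have := hg (fun j => σ j (t j) - τ j (t j)) fun a _ => by
        rw [map_sub, sub_eq_zero]
        exact LinearMap.congr_fun (congrFun h a) _
      simp only [t, dif_pos] at this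
      exact sub_eq_zero.1 this
    · have := subsingleton_spS (k := k) (w := w) hj
      exact LinearMap.ext fun v => by rw [Subsingleton.elim v 0, map_zero, map_zero]
  · intro p hp
    rw [Finset.mem_filter] at hp
    obtain ⟨σ, rfl⟩ := (not_injI_hmCop hg p).1 hp.2
    exact ⟨σ, Finset.mem_univ _, rfl⟩
  · intro σ _
    rfl

end Injectivity

/-! ### The quantum Serre relation at a source -/

/-- The unipotent automorphism of a direct sum given by `σ`. -/
def shear {k V W : Type*} [Field k] [AddCommGroup V] [Module k V] [AddCommGroup W] [Module k W]
    (σ : W →ₗ[k] V) : (V × W) ≃ₗ[k] (V × W) :=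
  LinearEquiv.ofLinearMap
    (((LinearMap.fst k _ _) + σ ∘ₗ LinearMap.snd k _ _).prod (LinearMap.snd k _ _))
    (((LinearMap.fst k _ _) - σ ∘ₗ LinearMap.snd k _ _).prod (LinearMap.snd k _ _))
    (by ext <;> simp) (by ext <;> simp)

section HallSerre

variable {I A : Type*} {k : Type u} [Field k] {w : I → ℕ} {Γ : Qv (I ⊕ I) A}
variable [DecidableEq I] [Fintype k]

variable (k w) in
/-- The direct sum of `N` copies of the simple representation at `i`. -/
def npow (i : I) : ℕ → FSp I k w
  | 0 => sp k w 0
  | N + 1 => (npow i N).prod (spS k w i)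

theorem npow_dim (i : I) (N : ℕ) : (npow k w i N).dim = N • dl i := by
  induction N with
  | zero =>
    funext j
    rw [npow, sp_dim]
    rcases j with j | j <;> simp
  | succ N ih => rw [npow, FSp.dim_prod, ih, spS_dim, succ_nsmul]

theorem subsingleton_npow {i : I} {j : I ⊕ I} (h : j ≠ Sum.inl i) (N : ℕ) :
    Subsingleton ((npow k w i N).V j) := by
  have h1 := congrFun (npow_dim (k := k) (w := w) i N) j
  simp only [FSp.dim, Pi.smul_apply, dl, Pi.single_apply, h, if_false, smul_zero] at h1
  exact Module.finrank_zero_iff.1 (by exact_mod_cast h1)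

variable [Fintype A] [DecidableEq A] [Fintype I]

open Classical in
/-- The sum of the extensions of copies of the simple representation at `i` by the one at `j`
given by jointly injective maps. -/
def serreT {R : Type*} [Ring R] (𝒪 : ∀ N : FSp I k w, Pt Γ N → R) (i j : I) (N : ℕ) : R :=
  ∑ g : Hm Γ (npow k w i N) (spS k w j), if InjI i g then
    𝒪 ((spS k w j).prod (npow k w i N)) (tri 0 g 0) else 0

theorem tri_zero {M N : FSp I k w} : tri (0 : Pt Γ M) (0 : Hm Γ N M) 0 = 0 := by
  funext a
  refine LinearMap.ext fun v => ?_
  rw [tri_apply]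
  simp

/-- Multiplication by S_i on the right adds a column p to the family g. Either (g, p) is still
injective, or p = g∘σ can be sheared away; the q^N choices of σ then all give the product with S_i
on the left. The ring and the map 𝒪 are arbitrary so that one argument covers `Rop` and the opposite
of `Lop`. -/
theorem serre_step {R : Type*} [Ring R] [Algebra ℂ R] {𝒪 : ∀ N : FSp I k w, Pt Γ N → R}
    (hiso : ∀ {M N : FSp I k w} {x : Pt Γ M} {y : Pt Γ N}, FIso Γ x y → 𝒪 M x = 𝒪 N y)
    (hmul : ∀ (M N : FSp I k w) (y : Pt Γ M) (z : Pt Γ N),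
      𝒪 M y * 𝒪 N z = ∑ t, 𝒪 (M.prod N) (tri y t z)) (i j : I)
    (hi : Γ.IsSource (Sum.inl i)) (N : ℕ) :
    serreT 𝒪 i j N * 𝒪 (spS k w i) 0 =
      serreT 𝒪 i j (N + 1) + vv k ^ (2 * (N : ℤ)) • (𝒪 (spS k w i) 0 * serreT 𝒪 i j N) := by
  classical
  have h1 : ∀ g : Hm Γ (npow k w i N) (spS k w j),
      𝒪 ((spS k w j).prod (npow k w i N)) (tri 0 g 0) * 𝒪 (spS k w i) 0 =
      ∑ p, 𝒪 ((spS k w j).prod (npow k w i (N + 1))) (tri 0 (hmCop g p) 0) := by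
    intro g
    rw [hmul]
    refine ((Fintype.sum_equiv hmPairEquiv.symm _
      (fun t => 𝒪 _ (tri (tri 0 g 0) (hmPair t.1 t.2) 0)) fun t => rfl)).trans ?_
    rw [Fintype.sum_prod_type]
    refine Finset.sum_congr rfl fun p _ => ?_
    rw [Finset.sum_eq_single 0]
    · rw [hiso (tri_assoc _ _ _ _ _ _), tri_zero]
      rfl
    · intro t _ ht
      refine (ht ?_).elim
      funext a
      have := subsingleton_npow (k := k) (w := w) (hi a) N
      exact LinearMap.ext fun v => Subsingleton.elim _ _
    · simp
  have h2 : ∀ g : Hm Γ (npow k w i N) (spS k w j),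
      𝒪 (spS k w i) 0 * 𝒪 ((spS k w j).prod (npow k w i N)) (tri 0 g 0) =
      𝒪 ((spS k w j).prod (npow k w i (N + 1))) (tri 0 (hmCop g 0) 0) := by
    intro g
    -- No arrow ends at the source i, so the only extension with S_i as subobject is the split one.
    rw [hmul, Finset.sum_eq_single 0]
    · refine hiso ⟨fun j => (LinearEquiv.prodComm k _ _).trans (LinearEquiv.prodAssoc k _ _ _),
        fun l v => ?_, fun a v => ?_⟩
      · change (spS k w j).φ l v.2.1 + ((npow k w i N).φ l v.2.2 + (spS k w i).φ l v.1) =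
          (spS k w i).φ l v.1 + ((spS k w j).φ l v.2.1 + (npow k w i N).φ l v.2.2)
        abel
      · refine Prod.ext ?_ (Prod.ext rfl ?_)
        · change (0 : Pt Γ (spS k w j)) a v.2.1 + g a v.2.2 =
            (0 : Pt Γ (spS k w j)) a v.2.1 + (g a v.2.2 + (0 : Hm Γ (spS k w i) (spS k w j)) a v.1)
          simp
        · change (0 : Pt Γ (spS k w i)) a v.1 + (0 : Hm Γ _ (spS k w i)) a v.2 = 0
          simp
    · intro t _ ht
      exact (ht (hm_ext_tgt fun a ha => (hi a ha).elim)).elim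
    · simp
  have h3 : ∀ (g : Hm Γ (npow k w i N) (spS k w j)) (σ : Hom0 (spS k w i) (npow k w i N)),
      𝒪 ((spS k w j).prod (npow k w i (N + 1)))
        (tri 0 (hmCop g fun a => g a ∘ₗ σ (Γ.src a)) 0) =
      𝒪 ((spS k w j).prod (npow k w i (N + 1))) (tri 0 (hmCop g 0) 0) := by
    intro g σ
    -- The unipotent automorphism of S_i^{N+1} given by σ carries the column g∘σ to 0.
    let e : ∀ j, (npow k w i (N + 1)).V j ≃ₗ[k] (npow k w i (N + 1)).V j := fun j =>
      shear (σ j)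
    have he : IsoMap Γ (0 : Pt Γ (npow k w i (N + 1))) 0 e := by
      refine ⟨fun l v => ?_, fun a v => map_zero _⟩
      have := subsingleton_spS (k := k) (w := w) (i := i) (j := Sum.inr l) (by simp)
      have h0 : v.2 = 0 := Subsingleton.elim _ _
      change (npow k w i N).φ l (v.1 + σ _ v.2) + (spS k w i).φ l v.2 =
        (npow k w i N).φ l v.1 + (spS k w i).φ l v.2
      rw [h0, map_zero, add_zero]
    have := tri_iso (IsoMap.refl (0 : Pt Γ (spS k w j))) he
      (hmCop g fun a => g a ∘ₗ σ (Γ.src a))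
    refine (hiso ⟨_, this⟩).trans ?_
    congr 2
    funext a
    refine LinearMap.ext fun v => ?_
    change g a (v.1 - σ _ v.2) + g a (σ _ v.2) = g a v.1 + 0
    rw [← map_add, sub_add_cancel, add_zero]
  unfold serreT
  rw [Finset.sum_mul, Finset.mul_sum, Finset.smul_sum]
  have h4 : ∀ f : Hm Γ (npow k w i (N + 1)) (spS k w j) → R,
      ∑ h, f h = ∑ g : Hm Γ (npow k w i N) (spS k w j), ∑ p : Hm Γ (spS k w i) (spS k w j),
        f (hmCop g p) := by
    intro f
    rw [← Fintype.sum_prod_type']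
    exact (Fintype.sum_equiv hmCopEquiv _ _ fun _ => rfl).symm
  rw [h4, ← Finset.sum_add_distrib]
  refine Finset.sum_congr rfl fun g _ => ?_
  by_cases hg : InjI i g
  · simp only [if_pos hg]
    rw [h1, h2, sum_injI_split hg]
    simp_rw [h3]
    rw [Finset.sum_const, Finset.card_univ, ← Nat.cast_smul_eq_nsmul ℂ, card_hom0_spS, npow_dim]
    simp
    rfl
  · simp only [if_neg hg]
    rw [zero_mul, mul_zero, smul_zero, add_zero]
    symm
    exact Finset.sum_eq_zero fun p _ => if_neg fun h => hg h.of_hmCop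

theorem serreT_zero {R : Type*} [Ring R] {𝒪 : ∀ N : FSp I k w, Pt Γ N → R}
    (hiso : ∀ {M N : FSp I k w} {x : Pt Γ M} {y : Pt Γ N}, FIso Γ x y → 𝒪 M x = 𝒪 N y)
    (i j : I) : serreT 𝒪 i j 0 = 𝒪 (spS k w j) 0 := by
  classical
  have hs : ∀ l, Subsingleton ((npow k w i 0).V l) := by
    intro l
    have h1 := congrFun (npow_dim (k := k) (w := w) i 0) l
    simp only [FSp.dim, zero_smul, Pi.zero_apply] at h1
    exact Module.finrank_zero_iff.1 (by exact_mod_cast h1)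
  unfold serreT
  rw [Finset.sum_eq_single 0]
  · have hI : InjI i (0 : Hm Γ (npow k w i 0) (spS k w j)) := fun u _ => Subsingleton.elim _ _
    rw [if_pos hI, tri_zero]
    refine hiso ⟨fun l => LinearEquiv.ofLinearMap (LinearMap.fst k _ _) (LinearMap.inl k _ _)
      (by ext; simp) ?_, fun l v => ?_, fun a v => rfl⟩
    · refine LinearMap.ext fun v => Prod.ext rfl (Subsingleton.elim _ _)
    · change (spS k w j).φ l v.1 = (spS k w j).φ l v.1 + (npow k w i 0).φ l v.2
      rw [Subsingleton.elim v.2 0, map_zero, add_zero]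
  · intro g _ hg
    refine (hg ?_).elim
    funext a
    exact LinearMap.ext fun v => by rw [Subsingleton.elim v 0, map_zero, map_zero]
  · exact fun h => (h (Finset.mem_univ _)).elim

/-- A jointly injective family embeds k^N into a product of one line for each of the n arrows from i
to j, which is impossible for n < N. -/
theorem serreT_eq_zero {R : Type*} [Ring R] (𝒪 : ∀ N : FSp I k w, Pt Γ N → R) {i j : I} {n N : ℕ}
    (hn : inW Γ j (dl i) = n) (hN : n < N) : serreT 𝒪 i j N = 0 := by
  classical
  refine Finset.sum_eq_zero fun g _ => if_neg fun hg => ?_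
  let T := {a // Γ.src a = Sum.inl i ∧ Γ.tgt a = Sum.inl j}
  let L : (npow k w i N).V (Sum.inl i) →ₗ[k] ∀ a : T, (spS k w j).V (Γ.tgt a.1) :=
    LinearMap.pi fun a => g a.1 ∘ₗ LinearMap.proj (Γ.src a.1) ∘ₗ
      LinearMap.single k (fun l => (npow k w i N).V l) (Sum.inl i)
  have hL : Function.Injective L := by
    rw [← LinearMap.ker_eq_bot, LinearMap.ker_eq_bot']
    intro v hv
    have := hg (Pi.single (Sum.inl i) v) fun a ha => by
      by_cases hj : Γ.tgt a = Sum.inl j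
      · exact congrFun hv ⟨a, ha, hj⟩
      · have := subsingleton_spS (k := k) (w := w) hj
        exact Subsingleton.elim _ _
    simpa using this
  have h1 := LinearMap.finrank_le_finrank_of_injective hL
  rw [Module.finrank_pi_fintype] at h1
  have h2 : ∀ a : T, Module.finrank k ((spS k w j).V (Γ.tgt a.1)) = 1 := by
    intro a
    rw [a.2.2, spS_finrank]
  simp only [h2, Finset.sum_const, Finset.card_univ, smul_eq_mul, mul_one] at h1
  have h3 := congrFun (npow_dim (k := k) (w := w) i N) (Sum.inl i)
  simp only [FSp.dim, Pi.smul_apply, dl, Pi.single_eq_same, nsmul_eq_mul, mul_one] at h3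
  rw [inW_apply] at hn
  have h4 : (Fintype.card T : ℤ) = n := by
    rw [← hn, Fintype.card_subtype, Finset.card_filter]
    push_cast
    refine Finset.sum_congr rfl fun a _ => ?_
    by_cases h : Γ.tgt a = Sum.inl j <;> simp [h, Pi.single_apply]
  omega

end HallSerre

/-! ### Quantum Serre relations for invariant functions -/

theorem qad_smul_right {R : Type*} [Ring R] [Algebra ℂ R] (v : ℂ) (n : ℤ) (c : ℂ) (x y : R)
    (N : ℕ) : qad v n x (c • y) N = c • qad v n x y N := by
  induction N with
  | zero => rfl
  | succ N ih =>
    rw [qad, qad, ih, smul_mul_assoc, mul_smul_comm, smul_sub, smul_comm c]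

/-- At this step both sides are the Serre expression, and quantum factorials do not change under v ↦
v⁻¹. -/
theorem qad_inv {M : Type*} [AddCommGroup M] [Module ℂ M] {v : ℂ} (hv : v ≠ 0)
    (hq : ∀ m, qFact v m ≠ 0) (n : ℕ) (x y : Module.End ℂ M) :
    qad v⁻¹ n x y (n + 1) = qad v n x y (n + 1) := by
  rw [serre_eq_qad hv hq, serre_eq_qad (inv_ne_zero hv) fun m => by rw [qFact_inv]; exact hq m]
  simp only [divPow, qFact_inv]

theorem qad_intertwine {M M' : Type*} [AddCommGroup M] [Module ℂ M] [AddCommGroup M'] [Module ℂ M']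
    (L : M →ₗ[ℂ] M') {x y : Module.End ℂ M} {x' y' : Module.End ℂ M'}
    (hx : ∀ f, x' (L f) = L (x f)) (hy : ∀ f, y' (L f) = L (y f)) (v : ℂ) (n : ℤ) (N : ℕ) (f : M) :
    qad v n x' y' N (L f) = L (qad v n x y N f) := by
  induction N generalizing f with
  | zero => exact hy f
  | succ N ih =>
    rw [qad, qad, LinearMap.sub_apply, LinearMap.smul_apply, Module.End.mul_apply,
      Module.End.mul_apply, hx, ih, ih, hx, LinearMap.sub_apply, LinearMap.smul_apply,
      Module.End.mul_apply, Module.End.mul_apply, map_sub, map_smul]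

/-- Scalar bookkeeping for one commutator step: all weight operators are moved to the left, `h6`
makes the remaining scalars agree, and `h5` is the recursion of `serre_step`. -/
theorem qad_step_right {R : Type*} [Ring R] [Algebra ℂ R] {KN Ki K' T T' X : R} {a b d e : ℂ} (c : ℂ)
    (h1 : KN * Ki = K') (h2 : Ki * KN = K') (h3 : T * Ki = a • (Ki * T))
    (h4 : X * KN = b • (KN * X)) (h5 : T * X = T' + d • (X * T)) (h6 : e * b = a * d) :
    c • (KN * T) * (Ki * X) - e • (Ki * X * c • (KN * T)) = (c * a) • (K' * T') := by
  have f1 : c • (KN * T) * (Ki * X) = (c * a) • (K' * (T * X)) := by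
    rw [smul_mul_assoc, ← h1, mul_assoc, ← mul_assoc T, h3, smul_mul_assoc, mul_smul_comm,
      smul_smul, mul_assoc, mul_assoc]
  have f2 : e • (Ki * X * c • (KN * T)) = (c * a) • (K' * d • (X * T)) := by
    rw [mul_smul_comm, ← h2, mul_assoc, ← mul_assoc X, h4, smul_mul_assoc, mul_smul_comm,
      smul_smul, smul_smul, mul_smul_comm, smul_smul, mul_assoc, mul_assoc, mul_assoc]
    congr 1
    · linear_combination c * h6
    · simp only [mul_assoc]
  rw [f1, f2, h5, ← smul_sub, ← mul_sub, add_sub_cancel_right]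

/-- The version for the reversed products of `Lop`: now X T contains the new term T', whence the
minus sign and the other balance of scalars in `h6`. -/
theorem qad_step_left {R : Type*} [Ring R] [Algebra ℂ R] {KN Ki K' T T' X : R} {a b d e : ℂ} (c : ℂ)
    (h1 : KN * Ki = K') (h2 : Ki * KN = K') (h3 : T * Ki = a • (Ki * T))
    (h4 : X * KN = b • (KN * X)) (h5 : X * T = T' + d • (T * X)) (h6 : e * b * d = a) :
    c • (KN * T) * (Ki * X) - e • (Ki * X * c • (KN * T)) = (-(c * (e * b))) • (K' * T') := by
  have f1 : c • (KN * T) * (Ki * X) = (c * (e * b)) • (K' * d • (T * X)) := by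
    rw [smul_mul_assoc, ← h1, mul_assoc, ← mul_assoc T, h3, smul_mul_assoc, mul_smul_comm,
      smul_smul, mul_smul_comm, smul_smul, ← h6, mul_assoc c]
    simp only [mul_assoc]
  have f2 : e • (Ki * X * c • (KN * T)) = (c * (e * b)) • (K' * (X * T)) := by
    rw [mul_smul_comm, ← h2, mul_assoc, ← mul_assoc X, h4, smul_mul_assoc, mul_smul_comm,
      smul_smul, smul_smul, mul_assoc, mul_assoc, mul_assoc]
    congr 1
    · ring
  rw [f1, f2, h5, ← smul_sub, ← mul_sub, sub_add_cancel_right, mul_neg, smul_neg, neg_smul]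

/-- The sum of two parts which quasi-commute. -/
theorem qad_sub_sub {R : Type*} [Ring R] [Algebra ℂ R] {v : ℂ} (hv : v ≠ 0) {n : ℕ}
    {x x' y y' : R} (hxx : x * x' = v ^ (2 : ℤ) • (x' * x)) (hxy : x * y' = v ^ (-(n : ℤ)) • (y' * x))
    (hyx : y * x' = v ^ (-(n : ℤ)) • (x' * y)) (hA : qad v n x y (n + 1) = 0)
    (hB : qad v⁻¹ n x' y' (n + 1) = 0)
    (hinv : qad v⁻¹ n (x - x') y' (n + 1) = qad v n (x - x') y' (n + 1)) :
    qad v n (x - x') (y - y') (n + 1) = 0 := by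
  have h1 : qad v n (x - x') y (n + 1) = 0 := by
    rw [sub_eq_add_neg, qad_add hv, hA]
    · rw [mul_neg, neg_mul, smul_neg, hxx]
    · rw [mul_neg, neg_mul, smul_neg, hyx]
  -- Here -x' is the main variable and x is the ignored summand; passing to v⁻¹ inverts the weights,
  -- as `qad_add` then requires.
  have h2 : qad v n (x - x') y' (n + 1) = 0 := by
    rw [← hinv, sub_eq_add_neg, add_comm, qad_add (inv_ne_zero hv), qad_neg_left_eq_zero hB]
    · rw [neg_mul, mul_neg, smul_neg, hxx, smul_smul, inv_zpow', ← zpow_add₀ hv,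
        neg_add_cancel, zpow_zero, one_smul]
    · rw [hxy, smul_smul, inv_zpow', neg_neg, ← zpow_add₀ hv, add_neg_cancel, zpow_zero,
        one_smul]
  rw [qad_sub_right, h1, h2, sub_zero]

theorem smul_mul_comm_ite {R : Type*} [Ring R] [Algebra ℂ R] {p : Prop} [Decidable p] {t x : R}
    {c : ℂ} (h : t * x = c • (x * t)) :
    (if p then t else 0) * x = c • (x * if p then t else 0) := by
  split_ifs
  · exact h
  · rw [zero_mul, mul_zero, smul_zero]

/-! ### The Serre relations for A, for B and for their difference -/

section SerreCF

variable {I A : Type*} {k : Type u} [Field k] {w : I → ℕ} {Γ : Qv (I ⊕ I) A}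
variable [DecidableEq I] [Fintype k] [Fintype A] [DecidableEq A] [Fintype I]

theorem inW_of_isSource {i : I} (hi : Γ.IsSource (Sum.inl i)) (ν : I ⊕ I → ℤ) : inW Γ i ν = 0 := by
  rw [inW_apply]
  exact Finset.sum_eq_zero fun a _ => if_neg (hi a)

theorem sum_smul_mul_comm {R ι : Type*} [Ring R] [Algebra ℂ R] (s : Finset ι) (f : ι → R) (x : R)
    (c : ℂ) (h : ∀ t ∈ s, f t * x = c • (x * f t)) : (∑ t ∈ s, f t) * x = c • (x * ∑ t ∈ s, f t) := by
  rw [Finset.sum_mul, Finset.mul_sum, Finset.smul_sum]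
  exact Finset.sum_congr rfl h

variable (k w Γ) in
/-- The sum `serreT` for the operators `Rop`. -/
def serreR (i j : I) (N : ℕ) : Module.End ℂ (CF k w Γ) :=
  serreT (Γ := Γ) (R := Module.End ℂ (CF k w Γ)) (fun N c => Rop N c) i j N

/-- The opposite of `Lop`. -/
def LopOp (N : FSp I k w) (c : Pt Γ N) : (Module.End ℂ (CF k w Γ))ᵐᵒᵖ := MulOpposite.op (Lop N c)

variable (k w Γ) in
/-- The sum `serreT` for the operators `Lop`. -/
def serreL (i j : I) (N : ℕ) : Module.End ℂ (CF k w Γ) :=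
  (serreT (Γ := Γ) (R := (Module.End ℂ (CF k w Γ))ᵐᵒᵖ) (fun N c => LopOp N c) i j N).unop

theorem LopOp_iso {N N' : FSp I k w} {c : Pt Γ N} {c' : Pt Γ N'} (h : FIso Γ c c') :
    LopOp N c = LopOp N' c' := congrArg MulOpposite.op (Lop_iso h)

theorem LopOp_mul (M N : FSp I k w) (y : Pt Γ M) (z : Pt Γ N) :
    LopOp M y * LopOp N z = ∑ t, LopOp (M.prod N) (tri y t z) := by
  exact (congrArg MulOpposite.op (Lop_mul_Lop M N y z)).trans (Finset.op_sum _ _)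

theorem serreR_mul_Kop (i j : I) (N : ℕ) (χ : (I ⊕ I → ℤ) →+ ℤ) :
    serreR k w Γ i j N * Kop χ =
      vv k ^ χ (dl j + N • dl i) • (Kop χ * serreR k w Γ i j N) := by
  classical
  refine sum_smul_mul_comm (R := Module.End ℂ (CF k w Γ)) _ _ _ _ fun g _ => ?_
  refine smul_mul_comm_ite ?_
  rw [Rop_mul_Kop, FSp.dim_prod, spS_dim, npow_dim]

theorem serreL_mul_Kop (i j : I) (N : ℕ) (χ : (I ⊕ I → ℤ) →+ ℤ) :
    serreL k w Γ i j N * Kop χ =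
      vv k ^ χ (dl j + N • dl i) • (Kop χ * serreL k w Γ i j N) := by
  unfold serreL serreT
  rw [Finset.unop_sum]
  classical
  refine sum_smul_mul_comm (R := Module.End ℂ (CF k w Γ)) _ _ _ _ fun g _ => ?_
  rw [apply_ite MulOpposite.unop, MulOpposite.unop_zero]
  refine smul_mul_comm_ite ?_
  change Lop _ _ * _ = _ • (_ * Lop _ _)
  rw [Lop_mul_Kop, FSp.dim_prod, spS_dim, npow_dim]

theorem serreR_step (i j : I) (hi : Γ.IsSource (Sum.inl i)) (N : ℕ) :
    serreR k w Γ i j N * Rop (spS k w i) 0 = serreR k w Γ i j (N + 1) +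
      vv k ^ (2 * (N : ℤ)) • (Rop (spS k w i) 0 * serreR k w Γ i j N) :=
  serre_step (R := Module.End ℂ (CF k w Γ)) (fun h => Rop_iso h) Rop_mul_Rop i j hi N

theorem serreL_step (i j : I) (hi : Γ.IsSource (Sum.inl i)) (N : ℕ) :
    Lop (spS k w i) 0 * serreL k w Γ i j N = serreL k w Γ i j (N + 1) +
      vv k ^ (2 * (N : ℤ)) • (serreL k w Γ i j N * Lop (spS k w i) 0) :=
  congrArg MulOpposite.unop (serre_step (R := (Module.End ℂ (CF k w Γ))ᵐᵒᵖ) (fun h => LopOp_iso h) LopOp_mul i j hi N)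

theorem serreR_zero (i j : I) : serreR k w Γ i j 0 = Rop (spS k w j) 0 :=
  serreT_zero (R := Module.End ℂ (CF k w Γ)) (fun h => Rop_iso h) i j

theorem serreL_zero (i j : I) : serreL k w Γ i j 0 = Lop (spS k w j) 0 :=
  congrArg MulOpposite.unop (serreT_zero (R := (Module.End ℂ (CF k w Γ))ᵐᵒᵖ) (fun h => LopOp_iso h) i j)

/-- By induction the N-th commutator is a scalar times a weight operator times the sum over
injective families S_i^N → S_j. For N = n + 1 there is no such family. -/
theorem Aop_serre_source {i j : I} (hij : i ≠ j) (hi : Γ.IsSource (Sum.inl i)) {n : ℕ}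
    (hn : inW Γ j (dl i) = n) : qad (vv k) n (Aop Γ k w i) (Aop Γ k w j) (n + 1) = 0 := by
  have key : ∀ N : ℕ, ∃ c : ℂ, qad (vv k) n (Aop Γ k w i) (Aop Γ k w j) N =
      c • (Kop (aW Γ j + N • aW Γ i) * serreR k w Γ i j N) := by
    intro N
    induction N with
    | zero =>
      refine ⟨1, ?_⟩
      rw [qad, serreR_zero, zero_smul, add_zero, one_smul]
      rfl
    | succ N ih =>
      obtain ⟨c, hc⟩ := ih
      refine ⟨c * vv k ^ (-3 * (N : ℤ)), ?_⟩
      have hstep := serreR_step (Γ := Γ) (k := k) (w := w) i j hi N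
      have e1 : aW Γ i (dl j + N • dl i) = -3 * (N : ℤ) := by
        rw [aW_apply, inW_of_isSource hi]
        simp [dl, hij]
      have e2 : (aW Γ j + N • aW Γ i) (dl i) = n - 3 * (N : ℤ) := by
        rw [AddMonoidHom.add_apply, AddMonoidHom.nsmul_apply, aW_apply, aW_apply,
          inW_of_isSource hi, hn]
        simp [dl, hij.symm]
        ring
      have e3 := serreR_mul_Kop (Γ := Γ) (k := k) (w := w) i j N (aW Γ i)
      have e4 := Rop_mul_Kop (spS k w i) (0 : Pt Γ _) (aW Γ j + N • aW Γ i)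
      rw [e1] at e3
      rw [spS_dim, e2] at e4
      have hKK : Kop (aW Γ i) * Kop (aW Γ j + N • aW Γ i) =
          (Kop (aW Γ j + (N + 1) • aW Γ i) : Module.End ℂ (CF k w Γ)) := by
        rw [Kop_mul, succ_nsmul']
        congr 1
        abel
      have hKK' : Kop (aW Γ j + N • aW Γ i) * Kop (aW Γ i) =
          (Kop (aW Γ j + (N + 1) • aW Γ i) : Module.End ℂ (CF k w Γ)) := by
        rw [Kop_mul, succ_nsmul]
        congr 1
        abel
      rw [qad, hc]
      refine qad_step_right (R := Module.End ℂ (CF k w Γ)) c hKK' hKK e3 e4 hstep ?_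
      rw [← zpow_add₀ vv_ne_zero, ← zpow_add₀ vv_ne_zero]
      congr 1
      ring
  obtain ⟨c, hc⟩ := key (n + 1)
  rw [hc, serreR, serreT_eq_zero _ hn (Nat.lt_succ_self n), mul_zero, smul_zero]

/-- The recursion is the one for A with all products reversed. This turns v into v⁻¹ in the quantum
commutators. -/
theorem Bop_serre_source {i j : I} (hij : i ≠ j) (hi : Γ.IsSource (Sum.inl i)) {n : ℕ}
    (hn : inW Γ j (dl i) = n) : qad (vv k)⁻¹ n (Bop Γ k w i) (Bop Γ k w j) (n + 1) = 0 := by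
  have key : ∀ N : ℕ, ∃ c : ℂ, qad (vv k)⁻¹ n (Bop Γ k w i) (Bop Γ k w j) N =
      c • (Kop (bW Γ j + N • bW Γ i) * serreL k w Γ i j N) := by
    intro N
    induction N with
    | zero =>
      refine ⟨1, ?_⟩
      rw [qad, serreL_zero, zero_smul, add_zero, one_smul]
      rfl
    | succ N ih =>
      obtain ⟨c, hc⟩ := ih
      refine ⟨-(c * ((vv k)⁻¹ ^ (2 * (N : ℤ) - n) * vv k ^ (-(n : ℤ) - N))), ?_⟩
      have hstep := serreL_step (Γ := Γ) (k := k) (w := w) i j hi N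
      have e1 : bW Γ i (dl j + N • dl i) = -(N : ℤ) := by
        rw [bW_apply, inW_of_isSource hi]
        simp [dl, hij]
      have e2 : (bW Γ j + N • bW Γ i) (dl i) = - n - (N : ℤ) := by
        rw [AddMonoidHom.add_apply, AddMonoidHom.nsmul_apply, bW_apply, bW_apply,
          inW_of_isSource hi, hn]
        simp [dl, hij.symm]
        ring
      have e3 := serreL_mul_Kop (Γ := Γ) (k := k) (w := w) i j N (bW Γ i)
      have e4 := Lop_mul_Kop (spS k w i) (0 : Pt Γ _) (bW Γ j + N • bW Γ i)
      rw [e1] at e3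
      rw [spS_dim, e2] at e4
      have hKK : Kop (bW Γ i) * Kop (bW Γ j + N • bW Γ i) =
          (Kop (bW Γ j + (N + 1) • bW Γ i) : Module.End ℂ (CF k w Γ)) := by
        rw [Kop_mul, succ_nsmul']
        congr 1
        abel
      have hKK' : Kop (bW Γ j + N • bW Γ i) * Kop (bW Γ i) =
          (Kop (bW Γ j + (N + 1) • bW Γ i) : Module.End ℂ (CF k w Γ)) := by
        rw [Kop_mul, succ_nsmul]
        congr 1
        abel
      rw [qad, hc]
      refine qad_step_left (R := Module.End ℂ (CF k w Γ)) c hKK' hKK e3 e4 hstep ?_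
      rw [inv_zpow', ← zpow_add₀ vv_ne_zero, ← zpow_add₀ vv_ne_zero]
      congr 1
      ring
  obtain ⟨c, hc⟩ := key (n + 1)
  rw [hc, serreL, serreT_eq_zero _ hn (Nat.lt_succ_self n), MulOpposite.unop_zero, mul_zero, smul_zero]

theorem edges_reorient (r : A → Bool) (i j : I) :
    inW (Γ.reorient r) j (dl i) + inW (Γ.reorient r) i (dl j) =
      inW Γ j (dl i) + inW Γ i (dl j) := by
  have h1 := inW_reorient (Γ := Γ) r j (dl i)
  have h2 := inW_reorient (Γ := Γ) r i (dl j)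
  have h3 : inW Γ j (dl i) - inW (Γ.reorient r) j (dl i) +
      (inW Γ i (dl j) - inW (Γ.reorient r) i (dl j)) = 0 := by
    rw [h1, h2, ← Finset.sum_add_distrib]
    refine Finset.sum_eq_zero fun a _ => ?_
    split_ifs
    · ring
    · rfl
  linarith

variable (Γ k w) in
/-- The operator on invariant functions which induces `E⁺_i`. -/
def Dop (i : I) : Module.End ℂ (CF k w Γ) :=
  ((Fintype.card k : ℂ) - 1)⁻¹ • (Aop Γ k w i - Bop Γ k w i)

/-- Fourier transform to an orientation with source i gives the relations for A and for B
separately, since both operators are intertwined and the transform is invertible. The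
quasi-commutation of A with B then yields the relation for the difference. -/
theorem Dop_serre {ψ : AddChar k ℂ} (hψ : ψ ≠ 1) (hΓ : ∀ a, Γ.src a ≠ Γ.tgt a) {i j : I}
    (hij : i ≠ j) (r : A → Bool) (hi : (Γ.reorient r).IsSource (Sum.inl i)) {n : ℕ}
    (hn : inW Γ j (dl i) + inW Γ i (dl j) = n) :
    qad (vv k) n (Dop k w Γ i) (Dop k w Γ j) (n + 1) = 0 := by
  have hn' : inW (Γ.reorient r) j (dl i) = n := by
    rw [← hn, ← edges_reorient r, inW_of_isSource hi, add_zero]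
  have hA : qad (vv k) n (Aop Γ k w i) (Aop Γ k w j) (n + 1) = 0 := by
    refine LinearMap.ext fun F => ?_
    rw [← FourBack_Four hψ r (qad (vv k) n (Aop Γ k w i) (Aop Γ k w j) (n + 1) F),
      ← qad_intertwine (Four ψ r) (Aop_Four hψ r hΓ i) (Aop_Four hψ r hΓ j),
      Aop_serre_source hij hi hn', LinearMap.zero_apply, map_zero, LinearMap.zero_apply]
  have hB : qad (vv k)⁻¹ n (Bop Γ k w i) (Bop Γ k w j) (n + 1) = 0 := by
    refine LinearMap.ext fun F => ?_
    rw [← FourBack_Four hψ r (qad (vv k)⁻¹ n (Bop Γ k w i) (Bop Γ k w j) (n + 1) F),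
      ← qad_intertwine (Four ψ r) (Bop_Four hψ r hΓ i) (Bop_Four hψ r hΓ j),
      Bop_serre_source hij hi hn', LinearMap.zero_apply, map_zero, LinearMap.zero_apply]
  have hl : ∀ l : I, inW Γ l (dl l) = 0 := by
    intro l
    rw [inW_apply]
    refine Finset.sum_eq_zero fun a _ => ?_
    split_ifs with h
    · exact Pi.single_eq_of_ne (fun e => hΓ a (e.trans h.symm)) _
    · rfl
  -- The weights needed in `qad_sub_sub`: 2 for equal indices, minus the number of edges for
  -- different ones.
  have hc : ∀ l l', bW Γ l' (dl l) - aW Γ l (dl l') =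
      if l = l' then 2 else -(inW Γ l' (dl l) + inW Γ l (dl l')) := by
    intro l l'
    rw [bW_apply, aW_apply]
    split_ifs with h
    · subst h
      rw [hl]
      simp [dl]
    · simp [dl, h, Ne.symm h]
      ring
  have hii := Aop_mul_Bop (Γ := Γ) (k := k) (w := w) i i
  have hij' := Aop_mul_Bop (Γ := Γ) (k := k) (w := w) i j
  have hji' := Aop_mul_Bop (Γ := Γ) (k := k) (w := w) j i
  rw [hc, if_pos rfl] at hii
  rw [hc, if_neg hij, hn] at hij'
  rw [hc, if_neg hij.symm, add_comm, hn] at hji'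
  have h := qad_sub_sub vv_ne_zero hii hij' hji' hA hB (qad_inv vv_ne_zero qFact_ne_zero _ _ _)
  unfold Dop
  rw [qad_smul_left, qad_smul_right, h, smul_zero, smul_zero]

end SerreCF

/-! ### Representations on the standard spaces -/

section Std

variable {I A : Type*} {k : Type u} [Field k] [Finite k] {w : I → ℕ}

variable (k w) in
/-- The standard framed space with dimension vector `(n, w)`. -/
@[reducible]
def std (n : I → ℕ) : FSp I k w where
  V j := Fin (DimVec.fn (n, w) j) → k
  φ _ := LinearMap.id

theorem std_dim (n : I → ℕ) : (std k w n).dim = DimVec.fnZ (n, w) := by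
  funext j
  simp [FSp.dim, DimVec.fnZ]

variable {Γ : Qv (I ⊕ I) A} {n : I → ℕ}

/-- Matrices as linear maps. -/
def toPt : E Γ k (DimVec.fn (n, w)) ≃ Pt Γ (std k w n) :=
  Equiv.piCongrRight fun _ => Matrix.toLin'.toEquiv

theorem mulVec_inv_mulVec {m : ℕ} (g : GL (Fin m) k) (v : Fin m → k) :
    g⁻¹.1 *ᵥ (g.1 *ᵥ v) = v := by
  rw [Matrix.mulVec_mulVec, ← Units.val_mul, inv_mul_cancel, Units.val_one, Matrix.one_mulVec]

/-- An invertible matrix as a linear automorphism. -/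
def glEquiv {m : ℕ} (g : GL (Fin m) k) : (Fin m → k) ≃ₗ[k] (Fin m → k) where
  toFun v := g.1 *ᵥ v
  map_add' := Matrix.mulVec_add _
  map_smul' c v := Matrix.mulVec_smul _ c v
  invFun v := g⁻¹.1 *ᵥ v
  left_inv v := mulVec_inv_mulVec g v
  right_inv v := by
    have := mulVec_inv_mulVec g⁻¹ v
    rwa [inv_inv] at this

theorem exists_glEquiv {m : ℕ} (e : (Fin m → k) ≃ₗ[k] (Fin m → k)) : ∃ g : GL (Fin m) k,
    ∀ v, g.1 *ᵥ v = e v := by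
  refine ⟨⟨LinearMap.toMatrix' e.toLinearMap, LinearMap.toMatrix' e.symm.toLinearMap, ?_, ?_⟩,
    fun v => LinearMap.toMatrix'_mulVec _ v⟩
  · rw [← LinearMap.toMatrix'_comp, LinearEquiv.comp_symm, LinearMap.toMatrix'_id]
  · rw [← LinearMap.toMatrix'_comp, LinearEquiv.symm_comp, LinearMap.toMatrix'_id]

theorem fIso_act (g : G k (n, w)) (X : E Γ k (DimVec.fn (n, w))) :
    FIso Γ (toPt X) (toPt (act Γ g X)) := by
  refine ⟨fun j => glEquiv (g.ext j), fun i v => Matrix.one_mulVec v, fun a v => ?_⟩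
  change (g.ext (Γ.tgt a)).1 *ᵥ (X a *ᵥ v) = ((g.ext (Γ.tgt a)).1 * X a * ((g.ext (Γ.src a))⁻¹).1) *ᵥ
    ((g.ext (Γ.src a)).1 *ᵥ v)
  rw [← Matrix.mulVec_mulVec, mulVec_inv_mulVec, Matrix.mulVec_mulVec]

/-- Both framings are the identity, so an isomorphism is the identity over Î. Hence it is an element
of the group acting at the vertices of I only. -/
theorem exists_act_of_fIso {X X' : E Γ k (DimVec.fn (n, w))} (h : FIso Γ (toPt X) (toPt X')) :
    ∃ g : G k (n, w), act Γ g X = X' := by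
  obtain ⟨e, h1, h2⟩ := h
  choose g hg using fun i : I => exists_glEquiv (k := k) (e (Sum.inl i))
  have hg' : ∀ j v, (G.ext (ν := (n, w)) g j).1 *ᵥ v = e j v := by
    rintro (i | i) v
    · exact hg i v
    · exact (Matrix.one_mulVec v).trans (h1 i v).symm
  refine ⟨g, funext fun a => ?_⟩
  refine Matrix.toLin'.injective (LinearMap.ext fun v => ?_)
  rw [Matrix.toLin'_apply, Matrix.toLin'_apply]
  unfold act
  rw [← Matrix.mulVec_mulVec, ← Matrix.mulVec_mulVec, hg']
  have h3 := h2 a (((G.ext (ν := (n, w)) g (Γ.src a))⁻¹).1 *ᵥ v)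
  refine h3.trans ?_
  rw [← hg']
  have h4 := mulVec_inv_mulVec (G.ext (ν := (n, w)) g (Γ.src a))⁻¹ v
  rw [inv_inv] at h4
  rw [h4]
  rfl

/-- A function on framed representations restricts to an invariant function on each standard
representation space. -/
def restr (n : I → ℕ) : CF k w Γ →ₗ[ℂ] Inv Γ k (n, w) where
  toFun F := ⟨fun X => F.1 (std k w n) (toPt X), fun g X => (CF_iso F (fIso_act g X)).symm⟩
  map_add' _ _ := rfl
  map_smul' _ _ := rfl

theorem restr_apply (F : CF k w Γ) (X : E Γ k (DimVec.fn (n, w))) :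
    (restr n F).1 X = F.1 (std k w n) (toPt X) := rfl

open Classical in
/-- The extension by zero of a function on a standard representation space. -/
def evFun (f : E Γ k (DimVec.fn (n, w)) → ℂ) (M : FSp I k w) (x : Pt Γ M) : ℂ :=
  if h : ∃ X : E Γ k (DimVec.fn (n, w)), FIso Γ x (toPt X) then f h.choose else 0

/-- Any two standard models of a framed representation lie in one orbit of the group, so the choice
of the model does not matter for invariant f. -/
theorem evFun_iso {f : E Γ k (DimVec.fn (n, w)) → ℂ} (hf : f ∈ Inv Γ k (n, w)) (M M' : FSp I k w)
    (x : Pt Γ M) (x' : Pt Γ M') (h : FIso Γ x x') : evFun f M x = evFun f M' x' := by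
  unfold evFun
  by_cases hx : ∃ X : E Γ k (DimVec.fn (n, w)), FIso Γ x (toPt X)
  · have hx' : ∃ X : E Γ k (DimVec.fn (n, w)), FIso Γ x' (toPt X) :=
      ⟨_, h.symm.trans hx.choose_spec⟩
    rw [dif_pos hx, dif_pos hx']
    obtain ⟨g, hg⟩ := exists_act_of_fIso
      (hx.choose_spec.symm.trans (h.trans hx'.choose_spec))
    rw [← hg, hf]
  · have hx' : ¬ ∃ X : E Γ k (DimVec.fn (n, w)), FIso Γ x' (toPt X) := fun ⟨X, hX⟩ =>
      hx ⟨X, h.trans hX⟩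
    rw [dif_neg hx, dif_neg hx']

/-- The extension by zero of an invariant function on a standard representation space. -/
def ev (n : I → ℕ) : Inv Γ k (n, w) →ₗ[ℂ] CF k w Γ where
  toFun f := ⟨evFun f.1, evFun_iso f.2⟩
  map_add' f g := CF_ext fun M x => by
    change evFun (f.1 + g.1) M x = evFun f.1 M x + evFun g.1 M x
    unfold evFun
    split_ifs
    · rfl
    · rw [add_zero]
  map_smul' c f := CF_ext fun M x => by
    change evFun (c • f.1) M x = c • evFun f.1 M x
    unfold evFun
    split_ifs
    · rfl
    · rw [smul_zero]

open Classical in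
theorem restr_ev (f : Inv Γ k (n, w)) : restr n (ev n f) = f := by
  refine Subtype.ext (funext fun X => ?_)
  have h : ∃ X' : E Γ k (DimVec.fn (n, w)), FIso Γ (toPt X) (toPt X') := ⟨X, FIso.refl _⟩
  change dite _ _ _ = _
  rw [dif_pos h]
  obtain ⟨g, hg⟩ := exists_act_of_fIso h.choose_spec
  rw [← f.2 g X, hg]

theorem ev_eq_zero (f : Inv Γ k (n, w)) {M : FSp I k w} {x : Pt Γ M}
    (h : ∀ X : E Γ k (DimVec.fn (n, w)), ¬ FIso Γ x (toPt X)) : (ev n f).1 M x = 0 :=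
  dif_neg fun ⟨X, hX⟩ => h X hX

/-- A bijective framing supplies the coordinates over Î; over I any basis will do. -/
theorem exists_fIso_toPt {M : FSp I k w} (x : Pt Γ M) (hd : M.dim = DimVec.fnZ (n, w))
    (hφ : ∀ i, Function.Bijective (M.φ i)) :
    ∃ X : E Γ k (DimVec.fn (n, w)), FIso Γ x (toPt X) := by
  have h1 : ∀ i : I, Module.finrank k (M.V (Sum.inl i)) =
      Module.finrank k ((std k w n).V (Sum.inl i)) := by
    intro i
    have h2 := congrFun hd (Sum.inl i)
    rw [← std_dim (k := k)] at h2
    exact Nat.cast_injective h2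
  let e : ∀ j, M.V j ≃ₗ[k] (std k w n).V j := fun j => match j with
    | Sum.inl i => LinearEquiv.ofFinrankEq _ _ (h1 i)
    | Sum.inr i => LinearEquiv.ofBijective (M.φ i) (hφ i)
  refine ⟨toPt.symm (hmCongr e e x), ?_⟩
  rw [Equiv.apply_symm_apply]
  exact ⟨e, isoMap_hmCongr e (fun i v => rfl) x⟩

theorem eq_of_fIso_toPt {M : FSp I k w} {x : Pt Γ M} {X : E Γ k (DimVec.fn (n, w))}
    (h : FIso Γ x (toPt X)) :
    M.dim = DimVec.fnZ (n, w) ∧ ∀ i, Function.Bijective (M.φ i) := by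
  refine ⟨h.dim_eq.trans (std_dim n), fun i => ?_⟩
  obtain ⟨e, h1, -⟩ := h
  have : (M.φ i : M.V (Sum.inr i) → (Fin (w i) → k)) = e (Sum.inr i) := funext fun v => (h1 i v).symm
  rw [this]
  exact (e (Sum.inr i)).bijective

theorem injAt_iff {i : I} {X : E Γ k (DimVec.fn (n, w))} :
    InjAt Γ i X ↔ InjI i (toPt X) := Iff.rfl

end Std

/-! ### Agreement of the matrix Fourier transforms with those on framed representations -/

section StdFourier

variable {I A : Type*} {k : Type u} [Field k] [Fintype k] [DecidableEq k] {w : I → ℕ}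

theorem kernL_std (ψ : AddChar k ℂ) (n : I → ℕ) (p q : I ⊕ I) : ∀ (b : Bool)
    (X : Matrix (Fin (DimVec.fn (n, w) q)) (Fin (DimVec.fn (n, w) p)) k)
    (X' : Matrix (Fin (DimVec.fn (n, w) (cond b p q))) (Fin (DimVec.fn (n, w) (cond b q p))) k),
    kernL ψ (std k w n) p q b (Matrix.toLin' X) (Matrix.toLin' X') =
      kern ψ (DimVec.fn (n, w)) p q b X X'
  | false => fun X X' => by
    have h : Matrix.toLin' X = Matrix.toLin' X' ↔ X = X' := Matrix.toLin'.injective.eq_iff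
    unfold kernL kern
    by_cases hX : X = X'
    · exact (if_pos (h.2 hX)).trans (if_pos hX).symm
    · exact (if_neg (mt h.1 hX)).trans (if_neg hX).symm
  | true => fun X X' => by
    change kernT ψ (Matrix.toLin' X) (Matrix.toLin' (R := k) (m := Fin (DimVec.fn (n, w) p))
      (n := Fin (DimVec.fn (n, w) q)) X') = _ * ψ (Matrix.trace (X * _))
    unfold kernT
    rw [← Matrix.toLin'_mul, Matrix.trace_toLin'_eq]
    simp [mul_comm]

variable [Fintype A] [DecidableEq A] {Γ : Qv (I ⊕ I) A}

theorem kernPt_std (ψ : AddChar k ℂ) (r : A → Bool) (n : I → ℕ) (X : E Γ k (DimVec.fn (n, w)))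
    (X' : E (Γ.reorient r) k (DimVec.fn (n, w))) :
    kernPt ψ r (std k w n) (toPt X) (toPt X') =
      ∏ a, kern ψ (DimVec.fn (n, w)) (Γ.src a) (Γ.tgt a) (r a) (X a) (X' a) :=
  Finset.prod_congr rfl fun _ _ => kernL_std ψ n _ _ _ _ _

theorem fourier_restr (ψ : AddChar k ℂ) (r : A → Bool) (n : I → ℕ) (F : CF k w Γ) :
    fourier ψ Γ r (n, w) (restr n F).1 = (restr n (Four ψ r F)).1 := by
  funext X'
  rw [restr_apply, Four_apply]
  exact Fintype.sum_equiv toPt _ _ fun X => by rw [kernPt_std, restr_apply]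

theorem fourierBack_restr (ψ : AddChar k ℂ) (r : A → Bool) (n : I → ℕ)
    (F : CF k w (Γ.reorient r)) :
    fourierBack ψ Γ r (n, w) (restr n F).1 = (restr n (FourBack ψ r F)).1 := by
  funext X
  rw [restr_apply, FourBack_apply]
  exact Fintype.sum_equiv toPt _ _ fun X' => by rw [kernPt_std, restr_apply]

end StdFourier

/-! ### The operators `E⁺_i` in terms of extensions by simple representations -/

theorem exists_prod_equiv {k P Q S : Type*} [Field k] [AddCommGroup P] [Module k P]
    [AddCommGroup Q] [Module k Q] [AddCommGroup S] [Module k S] [FiniteDimensional k P]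
    [FiniteDimensional k Q] [FiniteDimensional k S] {f : P →ₗ[k] Q} (hf : Function.Injective f)
    (h : Module.finrank k Q = Module.finrank k P + Module.finrank k S) :
    ∃ e : (P × S) ≃ₗ[k] Q, ∀ p, e (p, 0) = f p := by
  obtain ⟨C, hC⟩ := Submodule.exists_isCompl (LinearMap.range f)
  have h1 := Submodule.finrank_add_eq_of_isCompl hC
  rw [LinearMap.finrank_range_of_inj hf, h] at h1
  refine ⟨(LinearEquiv.prodCongr (LinearEquiv.ofInjective f hf)
    (LinearEquiv.ofFinrankEq S C (by omega))).trans (Submodule.prodEquivOfIsCompl _ C hC),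
    fun p => ?_⟩
  simp

/-! ### Counting injective matrices -/

section InjCount

variable {k : Type*} [Field k] [Fintype k]

theorem card_injective_mulVec {m n : ℕ} (h : n ≤ m) :
    Nat.card {B : Matrix (Fin m) (Fin n) k // Function.Injective B.mulVec} =
      ∏ i : Fin n, (Fintype.card k ^ m - Fintype.card k ^ (i : ℕ)) := by
  have h1 := card_linearIndependent (K := k) (V := Fin m → k) (k := n) (by simpa using h)
  rw [Module.finrank_fin_fun] at h1
  rw [← h1]
  refine Nat.card_congr ((Equiv.subtypeEquiv (Matrix.transposeAddEquiv _ _ k).toEquiv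
    fun B => ?_))
  rw [Matrix.mulVec_injective_iff]
  rfl

theorem card_injective_mulVec_self (n : ℕ) :
    Nat.card {B : Matrix (Fin n) (Fin n) k // Function.Injective B.mulVec} =
      Nat.card (GL (Fin n) k) := by
  rw [card_injective_mulVec le_rfl, Matrix.card_GL_field]

/-- A matrix with n independent columns is completed by any vector outside their span, and there are
q^{n+1} - q^n such vectors. -/
theorem card_GL_succ (n : ℕ) : (Nat.card (GL (Fin (n + 1)) k) : ℂ) =
    Nat.card {B : Matrix (Fin (n + 1)) (Fin n) k // Function.Injective B.mulVec} *
      ((Fintype.card k : ℂ) ^ n * (Fintype.card k - 1)) := by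
  rw [card_injective_mulVec (Nat.le_succ n), Matrix.card_GL_field, Fin.prod_univ_castSucc]
  push_cast
  congr 1
  rw [Nat.cast_sub (Nat.pow_le_pow_right Fintype.card_pos (Nat.le_succ n))]
  push_cast
  rw [Nat.succ_eq_add_one]
  ring

variable {I : Type*} [Fintype I] [DecidableEq I] [DecidableEq k]

open Classical in
-- Away from i the injective matrices are square and are counted by the general linear group; at i
-- one uses `card_GL_succ`. This is the source of the factor (q - 1)⁻¹ in D_i.
theorem sum_injective_Y (i : I) (n w : I → ℕ) :
    (Nat.card (G k (n + Pi.single i 1, w)) : ℂ)⁻¹ *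
      ∑ y : Y k (n, w) (n + Pi.single i 1, w),
        (if ∀ l, Function.Injective (y l).mulVec then (1 : ℂ) else 0) =
      ((Fintype.card k : ℂ) ^ n i)⁻¹ * (Fintype.card k - 1 : ℂ)⁻¹ := by
  have h1 : ∑ y : Y k (n, w) (n + Pi.single i 1, w),
      (if ∀ l, Function.Injective (y l).mulVec then (1 : ℂ) else 0) =
      ∏ l, (Nat.card {B : Matrix (Fin ((n + Pi.single i 1 : I → ℕ) l)) (Fin (n l)) k //
        Function.Injective B.mulVec} : ℂ) := by
    simp_rw [Nat.card_eq_fintype_card, Fintype.card_subtype, ← Finset.sum_boole]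
    rw [Finset.prod_univ_sum, Fintype.piFinset_univ]
    refine Finset.sum_congr rfl fun y _ => ?_
    rw [Finset.prod_boole]
    simp
  have h2 : (Nat.card (G k (n + Pi.single i 1, w)) : ℂ) =
      (∏ l, (Nat.card {B : Matrix (Fin ((n + Pi.single i 1 : I → ℕ) l)) (Fin (n l)) k //
        Function.Injective B.mulVec} : ℂ)) *
      ∏ l, if l = i then ((Fintype.card k : ℂ) ^ n i * (Fintype.card k - 1)) else 1 := by
    rw [← Finset.prod_mul_distrib]
    rw [Nat.card_pi]
    push_cast
    refine Finset.prod_congr rfl fun l _ => ?_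
    by_cases hl : l = i
    · subst hl
      rw [if_pos rfl]
      have e : (n + Pi.single l 1 : I → ℕ) l = n l + 1 := by simp
      change (Nat.card (GL (Fin ((n + Pi.single l 1 : I → ℕ) l)) k) : ℂ) = _
      rw [e, card_GL_succ]
    · rw [if_neg hl, mul_one]
      have e : (n + Pi.single i 1 : I → ℕ) l = n l := by simp [hl]
      change (Nat.card (GL (Fin ((n + Pi.single i 1 : I → ℕ) l)) k) : ℂ) = _
      rw [e, card_injective_mulVec_self]
  rw [h1, h2, Finset.prod_ite_eq' Finset.univ i, if_pos (Finset.mem_univ i)]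
  have h3 : ∏ l, (Nat.card {B : Matrix (Fin ((n + Pi.single i 1 : I → ℕ) l)) (Fin (n l)) k //
      Function.Injective B.mulVec} : ℂ) ≠ 0 := by
    have h4 : (Nat.card (G k (n + Pi.single i 1, w)) : ℂ) ≠ 0 :=
      Nat.cast_ne_zero.2 Nat.card_pos.ne'
    rw [h2] at h4
    exact left_ne_zero_of_mul h4
  rw [mul_inv, mul_comm _⁻¹ _⁻¹, mul_assoc, inv_mul_cancel₀ h3, mul_one, mul_inv]

end InjCount

/-! ### E⁺_i as a normalized difference of two extension operators -/

section Main

variable {I A : Type*} {k : Type u} [Field k] [Fintype k] {w : I → ℕ} {Γ : Qv (I ⊕ I) A}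

theorem tri_eq_hmCop {M N : FSp I k w} (x : Pt Γ M) (u : Hm Γ N M) (c : Pt Γ N) :
    tri x u c = hmCop (hmPair x 0) (hmPair u c) := by
  funext a
  refine LinearMap.ext fun v => ?_
  rw [hmCop_apply, hmPair_apply, hmPair_apply, Prod.mk_add_mk]
  exact Prod.ext rfl (zero_add _).symm

open Classical in
-- The condition fixes the first block column of Z and leaves the second one, (u, c), free.
theorem sum_extending [Fintype A] [DecidableEq A] {M N : FSp I k w} (x : Pt Γ M)
    (f : Pt Γ (M.prod N) → ℂ) :
    ∑ Z : Pt Γ (M.prod N), (if ∀ a m, Z a (m, 0) = (x a m, 0) then f Z else 0) =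
      ∑ u : Hm Γ N M, ∑ c : Pt Γ N, f (tri x u c) := by
  refine (sum_hmCop (M := M) (N := N) (L := M.prod N) _).trans ?_
  have h1 : ∀ (Z : Hm Γ M (M.prod N)) (p : Hm Γ N (M.prod N)),
      (∀ a m, hmCop Z p a (m, 0) = (x a m, 0)) ↔ Z = hmPair x 0 := by
    intro Z p
    rw [funext_iff]
    refine forall_congr' fun a => ?_
    rw [LinearMap.ext_iff]
    refine forall_congr' fun m => ?_
    rw [hmCop_apply, map_zero, add_zero]
    rfl
  simp_rw [h1]
  rw [Finset.sum_comm]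
  simp_rw [Finset.sum_ite_eq', Finset.mem_univ, if_true]
  refine (sum_hmPair _).trans ?_
  simp_rw [← tri_eq_hmCop]

theorem injI_hmCongr {M M' N N' : FSp I k w} (e : ∀ j, N.V j ≃ₗ[k] N'.V j)
    (e' : ∀ j, M.V j ≃ₗ[k] M'.V j) {i : I} {g : Hm Γ N M} :
    InjI i (hmCongr e e' g) ↔ InjI i g := by
  constructor
  · intro h v hv
    have := h (fun j => e j (v j)) fun a ha => by
      rw [hmCongr_apply, LinearEquiv.symm_apply_apply, hv a ha, map_zero]
    exact (LinearEquiv.map_eq_zero_iff _).1 this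
  · intro h v hv
    have := h (fun j => (e j).symm (v j)) fun a ha => by
      have h2 := hv a ha
      rw [hmCongr_apply] at h2
      exact (LinearEquiv.map_eq_zero_iff _).1 h2
    exact (LinearEquiv.map_eq_zero_iff _).1 this

theorem injI_tri_zero {M N : FSp I k w} {i : I} {x : Pt Γ M} {u : Hm Γ N M} :
    InjI i (tri x u 0) ↔ InjI i (hmCop x u) :=
  forall_congr' fun _ => imp_congr
    (forall_congr' fun _ => imp_congr Iff.rfl ⟨fun h => congrArg Prod.fst h, fun h => Prod.ext h rfl⟩)
    Iff.rfl

variable [DecidableEq k] [Fintype I] [DecidableEq I] [Fintype A] [DecidableEq A]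

theorem InjI.iso {M M' : FSp I k w} {i : I} {x : Pt Γ M} {x' : Pt Γ M'} (h : FIso Γ x x')
    (hx : InjI i x) : InjI i x' := by
  obtain ⟨e, he⟩ := h
  rw [he.eq_hmCongr]
  exact (injI_hmCongr e e).2 hx

/-- An injective y is completed by a complement isomorphic to S_i. The framings match because y is
the identity and S_i vanishes over Î. -/
theorem exists_std_equiv {n : I → ℕ} {i : I} {y : Y k (n, w) (n + Pi.single i 1, w)}
    (hy : ∀ l, Function.Injective (y l).mulVec) :
    ∃ e : ∀ j, ((std k w n).prod (spS k w i)).V j ≃ₗ[k] (std k w (n + Pi.single i 1)).V j,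
      (∀ j p, e j (p, 0) = yext y j *ᵥ p) ∧
      ∀ l v, (std k w (n + Pi.single i 1)).φ l (e (Sum.inr l) v) =
        ((std k w n).prod (spS k w i)).φ l v := by
  have h1 : ∀ j, ∃ e : ((std k w n).prod (spS k w i)).V j ≃ₗ[k] (std k w (n + Pi.single i 1)).V j,
      ∀ p, e (p, 0) = yext y j *ᵥ p := by
    intro j
    refine exists_prod_equiv (f := (yext y j).mulVecLin) ?_ ?_
    · rcases j with j | j
      · exact hy j
      · intro p p' h
        exact (Matrix.one_mulVec p).symm.trans (h.trans (Matrix.one_mulVec p'))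
    · have h2 := congrFun (std_dim (k := k) (w := w) (n + Pi.single i 1)) j
      have h3 := congrFun (std_dim (k := k) (w := w) n) j
      have h4 := congrFun (spS_dim (k := k) (w := w) i) j
      simp only [FSp.dim] at h2 h3 h4
      zify
      rw [h2, h3, h4]
      rcases j with j | j
      · by_cases hj : j = i
        · subst hj; simp [DimVec.fnZ, dl]
        · simp [DimVec.fnZ, dl, hj]
      · simp [DimVec.fnZ, dl]
  choose e he using h1
  refine ⟨e, he, fun l v => ?_⟩
  have := subsingleton_spS (k := k) (w := w) (i := i) (j := Sum.inr l) (by simp)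
  obtain ⟨p, s⟩ := v
  obtain rfl : s = 0 := Subsingleton.elim _ _
  refine (he _ p).trans ((Matrix.one_mulVec p).trans ?_)
  exact (add_zero (M := Fin (w l) → k) p).symm

open Classical in
-- After y is completed to an isomorphism from the direct sum with S_i, the points x' over (x, y)
-- become precisely the extensions of S_i by x.
theorem sum_inZ_inj {n : I → ℕ} {i : I} (hΓ : ∀ a, Γ.src a ≠ Γ.tgt a) (F : CF k w Γ)
    (X : E Γ k (DimVec.fn (n, w)))
    {y : Y k (n, w) (n + Pi.single i 1, w)} (hy : ∀ l, Function.Injective (y l).mulVec) :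
    ∑ X' : E Γ k (DimVec.fn (n + Pi.single i 1, w)), (if InZ Γ X X' y ∧ InjAt Γ i X' then
        (restr (n + Pi.single i 1) F).1 X' else 0) =
      ∑ u : Hm Γ (spS k w i) (std k w n), if InjI i (hmCop (toPt X) u) then
        F.1 ((std k w n).prod (spS k w i)) (tri (toPt X) u 0) else 0 := by
  obtain ⟨e, he, hφ⟩ := exists_std_equiv (k := k) (w := w) hy
  have h1 : ∀ u : Hm Γ (spS k w i) (std k w n), (∑ c : Pt Γ (spS k w i),
      if InjI i (tri (toPt X) u c) then
        F.1 ((std k w n).prod (spS k w i)) (tri (toPt X) u c) else 0) =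
      if InjI i (hmCop (toPt X) u) then
        F.1 ((std k w n).prod (spS k w i)) (tri (toPt X) u 0) else 0 := by
    intro u
    rw [Fintype.sum_eq_single 0 fun c hc => absurd (pt_spS_eq_zero hΓ c) hc]
    exact if_congr injI_tri_zero rfl rfl
  simp_rw [← h1]
  rw [← sum_extending (toPt X) fun Z => if InjI i Z then F.1 _ Z else 0]
  symm
  refine Fintype.sum_equiv ((hmCongr e e).trans toPt.symm) _ _ fun Z => ?_
  have h2 : toPt (toPt.symm (hmCongr e e Z) : E Γ k (DimVec.fn (n + Pi.single i 1, w))) =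
      hmCongr e e Z := Equiv.apply_symm_apply _ _
  have h3 : InjAt Γ i (toPt.symm (hmCongr e e Z) : E Γ k (DimVec.fn (n + Pi.single i 1, w))) ↔
      InjI i Z := by
    rw [injAt_iff, h2, injI_hmCongr]
  have h4 : InZ Γ X (toPt.symm (hmCongr e e Z)) y ↔ ∀ a m, Z a (m, 0) = (toPt X a m, 0) := by
    unfold InZ
    rw [and_iff_right hy]
    refine forall_congr' fun a => ?_
    rw [← Matrix.toLin'.injective.eq_iff, LinearMap.ext_iff]
    refine forall_congr' fun m => ?_
    rw [Matrix.toLin'_mul_apply, Matrix.toLin'_mul_apply, Matrix.toLin'_apply, Matrix.toLin'_apply,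
      Matrix.toLin'_apply, Matrix.toLin'_apply, ← he, ← he]
    change toPt (toPt.symm (hmCongr e e Z) : E Γ k (DimVec.fn (n + Pi.single i 1, w))) a _ = _ ↔ _
    rw [h2, hmCongr_apply, LinearEquiv.symm_apply_apply, (e _).injective.eq_iff]
    rfl
  have h5 : (restr (n + Pi.single i 1) F).1 (toPt.symm (hmCongr e e Z)) = F.1 _ Z := by
    rw [restr_apply, h2]
    exact (CF_iso F ⟨e, isoMap_hmCongr e hφ Z⟩).symm
  change _ = ite (InZ Γ X (toPt.symm (hmCongr e e Z)) y ∧ InjAt Γ i (toPt.symm (hmCongr e e Z)))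
    ((restr (n + Pi.single i 1) F).1 (toPt.symm (hmCongr e e Z))) 0
  rw [h5, ← ite_and]
  by_cases hZ : (∀ a m, Z a (m, 0) = (toPt X a m, 0)) ∧ InjI i Z
  · exact (if_pos hZ).trans (if_pos ⟨h4.2 hZ.1, h3.2 hZ.2⟩).symm
  · exact (if_neg hZ).trans (if_neg fun h => hZ ⟨h4.1 h.1, h3.1 h.2⟩).symm

open Classical in
theorem eplusSource_apply (i : I) (n n' : I → ℕ) (f : E Γ k (DimVec.fn (n', w)) → ℂ)
    (X : E Γ k (DimVec.fn (n, w))) :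
    eplusSource Γ i n n' w f X = vv k ^ (-(n i : ℤ)) * (Nat.card (G k (n', w)) : ℂ)⁻¹ *
      ∑ y : Y k (n, w) (n', w), ∑ X', if InZ Γ X X' y ∧ InjAt Γ i X' then f X' else 0 := rfl

open Classical in
-- The inner sum is the same for every injective y, so only the number of these y enters.
theorem eplusSource_eq_sum {n : I → ℕ} {i : I} (hΓ : ∀ a, Γ.src a ≠ Γ.tgt a) (F : CF k w Γ)
    (X : E Γ k (DimVec.fn (n, w))) :
    eplusSource Γ i n (n + Pi.single i 1) w (restr _ F).1 X =
      vv k ^ (-(n i : ℤ)) * (((Fintype.card k : ℂ) ^ n i)⁻¹ * (Fintype.card k - 1 : ℂ)⁻¹) *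
      ∑ u : Hm Γ (spS k w i) (std k w n), if InjI i (hmCop (toPt X) u) then
        F.1 ((std k w n).prod (spS k w i)) (tri (toPt X) u 0) else 0 := by
  rw [eplusSource_apply, ← sum_injective_Y i n w, ← mul_assoc,
    mul_assoc _ (∑ y : Y k (n, w) (n + Pi.single i 1, w), _), Finset.sum_mul]
  congr 1
  refine Finset.sum_congr rfl fun y _ => ?_
  by_cases hy : ∀ l, Function.Injective (y l).mulVec
  · rw [if_pos hy, one_mul, ← sum_inZ_inj hΓ F X hy]
  · rw [if_neg hy, zero_mul]
    exact Finset.sum_eq_zero fun X' _ => if_neg fun h => hy h.1.1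

theorem Dop_Four {ψ : AddChar k ℂ} (hψ : ψ ≠ 1) (r : A → Bool) (hΓ : ∀ a, Γ.src a ≠ Γ.tgt a)
    (i : I) (F : CF k w Γ) :
    Dop k w (Γ.reorient r) i (Four ψ r F) = Four ψ r (Dop k w Γ i F) := by
  unfold Dop
  rw [LinearMap.smul_apply, LinearMap.smul_apply, LinearMap.sub_apply, LinearMap.sub_apply,
    Aop_Four hψ _ hΓ, Bop_Four hψ _ hΓ, map_smul, map_sub]

/-- Removing the non-injective extensions from `Rop` is the same as subtracting q^{ν_i} times `Lop`.
With the normalizing powers of v at a source, this difference is D_i. -/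
theorem eplusSource_restr {n : I → ℕ} {i : I} (hΓ : ∀ a, Γ.src a ≠ Γ.tgt a)
    (hi : Γ.IsSource (Sum.inl i)) (F : CF k w Γ) {X : E Γ k (DimVec.fn (n, w))}
    (hX : InjAt Γ i X) :
    eplusSource Γ i n (n + Pi.single i 1) w (restr _ F).1 X = (restr n (Dop k w Γ i F)).1 X := by
  classical
  set T : ℂ := ∑ u : Hm Γ (spS k w i) (std k w n), if InjI i (hmCop (toPt X) u) then
        F.1 ((std k w n).prod (spS k w i)) (tri (toPt X) u 0) else 0 with hT
  -- No arrow ends at i, hence the only extension with S_i as subobject is the direct sum.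
  have hL : (Lop (spS k w i) 0 F).1 (std k w n) (toPt X) =
      F.1 ((std k w n).prod (spS k w i)) (tri (toPt X) 0 0) := by
    rw [Lop_apply, Fintype.sum_eq_single 0 fun u hu =>
      absurd (hm_ext_tgt fun a ha => absurd ha (hi a)) hu]
    refine CF_iso F ⟨fun j => LinearEquiv.prodComm k _ _, fun i v => ?_, fun a v => ?_⟩
    · exact add_comm _ _
    · refine Prod.ext ?_ ?_
      · change toPt X a v.2 = toPt X a v.2 + 0
        rw [add_zero]
      · change (0 : (spS k w i).V _) + 0 = 0
        rw [add_zero]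
  -- The non-injective u are the maps x∘σ; each is conjugate to 0 by a shear, and there are q^{ν_i}
  -- of them.
  have hR : (Rop (spS k w i) 0 F).1 (std k w n) (toPt X) =
      T + (Fintype.card k : ℂ) ^ n i * (Lop (spS k w i) 0 F).1 (std k w n) (toPt X) := by
    rw [Rop_apply, sum_injI_split (injAt_iff.1 hX), hL, ← hT]
    congr 1
    have h1 : ∀ σ : Hom0 (spS k w i) (std k w n),
        F.1 ((std k w n).prod (spS k w i)) (tri (toPt X) (fun a => toPt X a ∘ₗ σ (Γ.src a)) 0) =
        F.1 ((std k w n).prod (spS k w i)) (tri (toPt X) 0 0) := by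
      intro σ
      refine CF_iso F (tri_shift _ _ _ _ σ (fun l v => ?_) fun a v => ?_)
      · have := subsingleton_spS (k := k) (w := w) (i := i) (j := Sum.inr l) (by simp)
        obtain rfl : v = 0 := Subsingleton.elim _ _
        rw [map_zero, map_zero]
      · simp
    rw [Finset.sum_congr rfl fun σ _ => h1 σ, Finset.sum_const, Finset.card_univ, nsmul_eq_mul,
      card_hom0_spS, zpow_mul, std_dim]
    congr 1
    have h2 : vv k ^ (2 : ℤ) = Fintype.card k := by exact_mod_cast vv_sq (k := k)
    rw [h2]
    exact zpow_natCast _ _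
  rw [eplusSource_eq_sum hΓ, ← hT, restr_apply]
  have hD : (Dop k w Γ i F).1 (std k w n) (toPt X) = (Fintype.card k - 1 : ℂ)⁻¹ *
      (vv k ^ (aW Γ i (std k w n).dim) * (Rop (spS k w i) 0 F).1 (std k w n) (toPt X) -
        vv k ^ (bW Γ i (std k w n).dim) * (Lop (spS k w i) 0 F).1 (std k w n) (toPt X)) := rfl
  have hd : (std k w n).dim (Sum.inl i) = n i := by rw [std_dim]; rfl
  have h2 : (Fintype.card k : ℂ) = vv k ^ (2 : ℤ) := by
    rw [← vv_sq (k := k)]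
    exact (zpow_natCast _ 2).symm
  rw [hD, hR, aW_apply, bW_apply, inW_of_isSource hi, hd, mul_add, ← mul_assoc (vv k ^ (0 - _))]
  have h3 : (Fintype.card k : ℂ) ^ n i = vv k ^ (2 * (n i : ℤ)) := by
    rw [h2, ← zpow_natCast, ← zpow_mul]
  rw [h3, ← zpow_neg, ← zpow_add₀ vv_ne_zero, show (0 - 3 * (n i : ℤ) + 2 * n i) = - n i - 0 by ring,
    add_sub_cancel_right, show (0 - 3 * (n i : ℤ)) = - n i + -(2 * n i) by ring,
    zpow_add₀ vv_ne_zero]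
  ring

/-- Membership is tested after Fourier transform and on injective points only. There E⁺_i becomes
`eplusSource`, D_i becomes the operator D_i of the new orientation, and the two agree by
`eplusSource_restr`. -/
theorem eplus_restr_sub_mem {ψ : AddChar k ℂ} (hψ : ψ ≠ 1) (hΓ : ∀ a, Γ.src a ≠ Γ.tgt a)
    {r : I → A → Bool} {i : I} (hi : (Γ.reorient (r i)).IsSource (Sum.inl i)) (n : I → ℕ)
    (F : CF k w Γ) :
    eplus ψ Γ r i n w (restr _ F) - restr n (Dop k w Γ i F) ∈ NI ψ Γ (r i) i (n, w) := by
  intro X hX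
  rw [Submodule.coe_sub, map_sub, Pi.sub_apply, sub_eq_zero, fourier_restr]
  -- Fourier inversion for invariant functions on one standard space, obtained by extending them by
  -- zero to all framed representations.
  have h1 : ∀ g : E (Γ.reorient (r i)) k (DimVec.fn (n, w)) → ℂ, g ∈ Inv (Γ.reorient (r i)) k (n, w) →
      fourier ψ Γ (r i) (n, w) (fourierBack ψ Γ (r i) (n, w) g) = g := by
    intro g hg
    have h2 := restr_ev ⟨g, hg⟩
    have h3 : g = (restr n (ev n ⟨g, hg⟩)).1 := by rw [h2]
    rw [h3, fourierBack_restr, fourier_restr, Four_FourBack hψ]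
  have h4 : fourier ψ Γ (r i) (n, w) (eplus ψ Γ r i n w (restr _ F)).1 =
      eplusSource (Γ.reorient (r i)) i n (n + Pi.single i 1) w
        (fourier ψ Γ (r i) (n + Pi.single i 1, w) (restr _ F).1) :=
    h1 _ (eplusSource_mem _ _ _ _ _ _)
  rw [h4, fourier_restr, eplusSource_restr (reorient_ne hΓ _) hi _ hX, Dop_Four hψ _ hΓ]

end Main

/-! ### Subrepresentations and quotients -/

instance quotientFinite {k V : Type*} [Field k] [AddCommGroup V] [Module k V] [Finite V]
    (W : Submodule k V) : Finite (V ⧸ W) := Quotient.finite _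

section SubQuot

variable {I A : Type*} {k : Type u} [Field k] {w : I → ℕ} {Γ : Qv (I ⊕ I) A}

/-- Graded subspaces. -/
abbrev GSub (M : FSp I k w) : Type _ := ∀ j, Submodule k (M.V j)

/-- The graded subspace `W` is stable under `x`. -/
def Stable {M : FSp I k w} (x : Pt Γ M) (W : GSub M) : Prop :=
  ∀ a, ∀ v ∈ W (Γ.src a), x a v ∈ W (Γ.tgt a)

/-- A graded subspace as a framed space. -/
@[reducible]
def FSp.sub (M : FSp I k w) (W : GSub M) : FSp I k w where
  V j := W j
  φ i := M.φ i ∘ₗ (W (Sum.inr i)).subtype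

/-- The quotient by a graded subspace, with the framing zero. -/
@[reducible]
def FSp.quot (M : FSp I k w) (W : GSub M) : FSp I k w where
  V j := M.V j ⧸ W j
  φ _ := 0

/-- The restriction of a representation to a stable subspace. -/
def subPt {M : FSp I k w} (x : Pt Γ M) {W : GSub M} (h : Stable x W) : Pt Γ (M.sub W) :=
  fun a => (x a).restrict (h a)

/-- The representation induced on the quotient by a stable subspace. -/
def quotPt {M : FSp I k w} (x : Pt Γ M) {W : GSub M} (h : Stable x W) : Pt Γ (M.quot W) :=
  fun a => Submodule.mapQ _ _ (x a) (h a)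

theorem FSp.dim_sub_add_dim_quot (M : FSp I k w) (W : GSub M) :
    (M.sub W).dim + (M.quot W).dim = M.dim := by
  funext j
  have := Submodule.finrank_quotient_add_finrank (W j)
  simp only [Pi.add_apply, FSp.dim]
  rw [← this]
  push_cast
  ring

theorem fIso_subPt {M P : FSp I k w} {x : Pt Γ M} {p : Pt Γ P} {W : GSub M} (h : Stable x W)
    (f : Hom0 P M) (hf : ∀ j, Function.Injective (f j)) (hfW : ∀ j, LinearMap.range (f j) = W j)
    (hφ : ∀ i v, M.φ i (f _ v) = P.φ i v) (hfx : ∀ a v, f _ (p a v) = x a (f _ v)) :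
    FIso Γ p (subPt x h) :=
  ⟨fun j => (LinearEquiv.ofInjective (f j) (hf j)).trans (LinearEquiv.ofEq _ _ (hfW j)), hφ,
    fun a v => Subtype.ext (hfx a v)⟩

theorem fIso_quotPt {M N : FSp I k w} {x : Pt Γ M} {c : Pt Γ N} {W : GSub M} (h : Stable x W)
    (g : Hom0 M N) (hg : ∀ j, Function.Surjective (g j)) (hgW : ∀ j, LinearMap.ker (g j) = W j)
    (hN : ∀ i v, N.φ i v = 0) (hgx : ∀ a v, g _ (x a v) = c a (g _ v)) :
    FIso Γ (quotPt x h) c := by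
  refine ⟨fun j => (Submodule.quotEquivOfEq _ _ (hgW j).symm).trans
    ((g j).quotKerEquivOfSurjective (hg j)), fun i v => hN i _, fun a v => ?_⟩
  obtain ⟨v, rfl⟩ := Submodule.Quotient.mk_surjective _ v
  exact hgx a v

variable [Finite k] [Fintype A] [DecidableEq A] [Fintype I] [DecidableEq I]

theorem sum_gSub_sub {M : FSp I k w} (U : GSub M) [∀ W : GSub M, Decidable (∀ j, W j ≤ U j)]
    (f : GSub (M.sub U) → ℂ) :
    ∑ W, f W = ∑ W : GSub M, if ∀ j, W j ≤ U j then f (fun j => (W j).comap (U j).subtype) else 0 := by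
  refine Fintype.sum_of_injective
    (fun W : GSub (M.sub U) => (fun j => (W j).map (U j).subtype : GSub M)) ?_ _ _ ?_ ?_
  · intro W W' h
    funext j
    exact Submodule.map_injective_of_injective (U j).injective_subtype (congrFun h j)
  · intro W hW
    refine if_neg fun h => hW ⟨fun j => (W j).comap (U j).subtype, funext fun j => ?_⟩
    exact (Submodule.map_comap_subtype _ _).trans (inf_eq_right.2 (h j))
  · intro W
    rw [if_pos fun j => Submodule.map_subtype_le _ _]
    congr 1
    funext j
    exact (Submodule.comap_map_eq_of_injective (U j).injective_subtype _).symm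

theorem sum_gSub_quot {M : FSp I k w} (U : GSub M) [∀ W : GSub M, Decidable (∀ j, U j ≤ W j)]
    (f : GSub (M.quot U) → ℂ) :
    ∑ W, f W = ∑ W : GSub M, if ∀ j, U j ≤ W j then f (fun j => (W j).map (U j).mkQ) else 0 := by
  refine Fintype.sum_of_injective
    (fun W : GSub (M.quot U) => (fun j => (W j).comap (U j).mkQ : GSub M)) ?_ _ _ ?_ ?_
  · intro W W' h
    funext j
    exact Submodule.comap_injective_of_surjective (U j).mkQ_surjective (congrFun h j)
  · intro W hW
    refine if_neg fun h => hW ⟨fun j => (W j).map (U j).mkQ, funext fun j => ?_⟩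
    exact (Submodule.comap_map_mkQ _ _).trans (sup_eq_right.2 (h j))
  · intro W
    rw [if_pos fun j => Submodule.le_comap_mkQ _ _]
    congr 1
    funext j
    exact (Submodule.map_comap_eq_of_surjective (U j).mkQ_surjective _).symm

/-! ### The Hall product -/

open Classical in
/-- The summand of the subspace `W` in the Hall product. -/
def hterm (θ F : CF k w Γ) {M : FSp I k w} (x : Pt Γ M) (W : GSub M) : ℂ :=
  if h : Stable x W then θ.1 _ (quotPt x h) * F.1 _ (subPt x h) else 0

theorem hterm_of_stable (θ F : CF k w Γ) {M : FSp I k w} {x : Pt Γ M} {W : GSub M}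
    (h : Stable x W) : hterm θ F x W = θ.1 _ (quotPt x h) * F.1 _ (subPt x h) := dif_pos h

theorem hterm_of_not_stable (θ F : CF k w Γ) {M : FSp I k w} {x : Pt Γ M} {W : GSub M}
    (h : ¬ Stable x W) : hterm θ F x W = 0 := dif_neg h

/-- Allows a summand to be computed from any exact sequence 0 → P → M → N → 0 with image W, instead
of the literal subspace and quotient. The framing of N has to be zero, as it is on quotients by
definition. -/
theorem hterm_eq (θ F : CF k w Γ) {M P N : FSp I k w} {x : Pt Γ M} {p : Pt Γ P} {c : Pt Γ N}
    {W : GSub M} (f : Hom0 P M) (g : Hom0 M N) (hf : ∀ j, Function.Injective (f j))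
    (hfW : ∀ j, LinearMap.range (f j) = W j) (hg : ∀ j, Function.Surjective (g j))
    (hgW : ∀ j, LinearMap.ker (g j) = W j) (hφ : ∀ i v, M.φ i (f _ v) = P.φ i v)
    (hN : ∀ i v, N.φ i v = 0) (hfx : ∀ a v, f _ (p a v) = x a (f _ v))
    (hgx : ∀ a v, g _ (x a v) = c a (g _ v)) : hterm θ F x W = θ.1 N c * F.1 P p := by
  have h : Stable x W := by
    intro a v hv
    rw [← hgW, LinearMap.mem_ker] at hv ⊢
    rw [hgx, hv, map_zero]
  rw [hterm_of_stable θ F h, CF_iso θ (fIso_quotPt h g hg hgW hN hgx),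
    CF_iso F (fIso_subPt h f hf hfW hφ hfx)]

theorem Stable.map_iff {M M' : FSp I k w} {x : Pt Γ M} {x' : Pt Γ M'}
    {e : ∀ j, M.V j ≃ₗ[k] M'.V j} (he : IsoMap Γ x x' e) {W : GSub M} :
    Stable x' (fun j => (W j).map (e j : M.V j →ₗ[k] M'.V j)) ↔ Stable x W := by
  constructor
  · intro h a v hv
    obtain ⟨v', hv', h'⟩ := h a (e _ v) ⟨v, hv, rfl⟩
    have h2 : e _ v' = e _ (x a v) := by
      rw [he.2]
      exact h'
    rwa [← (e _).injective h2]
  · rintro h a _ ⟨v, hv, rfl⟩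
    exact ⟨x a v, h a v hv, he.2 a v⟩

theorem hterm_iso (θ F : CF k w Γ) {M M' : FSp I k w} {x : Pt Γ M} {x' : Pt Γ M'}
    {e : ∀ j, M.V j ≃ₗ[k] M'.V j} (he : IsoMap Γ x x' e) (W : GSub M) :
    hterm θ F x' (fun j => (W j).map (e j : M.V j →ₗ[k] M'.V j)) = hterm θ F x W := by
  by_cases h : Stable x W
  · rw [hterm_of_stable θ F h]
    refine hterm_eq θ F (fun j => (e j : M.V j →ₗ[k] M'.V j) ∘ₗ (W j).subtype)
      (fun j => (W j).mkQ ∘ₗ ((e j).symm : M'.V j →ₗ[k] M.V j)) ?_ ?_ ?_ ?_ ?_ ?_ ?_ ?_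
    · exact fun j => (e j).injective.comp (W j).injective_subtype
    · intro j
      rw [LinearMap.range_comp, Submodule.range_subtype]
    · exact fun j => (W j).mkQ_surjective.comp (e j).symm.surjective
    · intro j
      rw [LinearMap.ker_comp, Submodule.ker_mkQ]
      exact (Submodule.map_equiv_eq_comap_symm (e j) (W j)).symm
    · exact fun i v => he.1 i _
    · exact fun i v => rfl
    · exact fun a v => he.2 a _
    · intro a v
      refine congrArg (W _).mkQ ?_
      exact he.symm.2 a v
  · rw [hterm_of_not_stable θ F h, hterm_of_not_stable θ F (mt (Stable.map_iff he).1 h)]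

/-- Transport of graded subspaces. -/
def gSubEquiv {M M' : FSp I k w} (e : ∀ j, M.V j ≃ₗ[k] M'.V j) : GSub M ≃ GSub M' :=
  Equiv.piCongrRight fun j => (Submodule.orderIsoMapComap (e j)).toEquiv

theorem sum_hterm_iso (θ F : CF k w Γ) {M M' : FSp I k w} {x : Pt Γ M} {x' : Pt Γ M'}
    (h : FIso Γ x x') : ∑ W, hterm θ F x W = ∑ W, hterm θ F x' W := by
  obtain ⟨e, he⟩ := h
  exact Fintype.sum_equiv (gSubEquiv e) _ _ fun W => (hterm_iso θ F he W).symm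

theorem hterm_add (θ F G : CF k w Γ) {M : FSp I k w} (x : Pt Γ M) (W : GSub M) :
    hterm θ (F + G) x W = hterm θ F x W + hterm θ G x W := by
  unfold hterm
  split_ifs
  · exact mul_add _ _ _
  · rw [add_zero]

theorem hterm_smul (θ F : CF k w Γ) (r : ℂ) {M : FSp I k w} (x : Pt Γ M) (W : GSub M) :
    hterm θ (r • F) x W = r * hterm θ F x W := by
  unfold hterm
  split_ifs
  · exact mul_left_comm _ _ _
  · rw [mul_zero]

theorem hterm_add_left (θ η F : CF k w Γ) {M : FSp I k w} (x : Pt Γ M) (W : GSub M) :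
    hterm (θ + η) F x W = hterm θ F x W + hterm η F x W := by
  unfold hterm
  split_ifs
  · exact add_mul _ _ _
  · rw [add_zero]

theorem hterm_smul_left (θ F : CF k w Γ) (r : ℂ) {M : FSp I k w} (x : Pt Γ M) (W : GSub M) :
    hterm (r • θ) F x W = r * hterm θ F x W := by
  unfold hterm
  split_ifs
  · exact mul_assoc _ _ _
  · rw [mul_zero]

/-- The value of the Hall product. -/
def hsum (θ F : CF k w Γ) (M : FSp I k w) (x : Pt Γ M) : ℂ := ∑ W, hterm θ F x W

variable (k w Γ) in
/-- The Hall product of invariant functions: the sum over all subrepresentations of the value of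
the first function on the quotient times the value of the second on the subrepresentation. -/
def hmul : CF k w Γ →ₗ[ℂ] Module.End ℂ (CF k w Γ) :=
  LinearMap.mk₂ ℂ (fun θ F => ⟨hsum θ F, fun _ _ _ _ h => sum_hterm_iso θ F h⟩)
    (fun θ η F => CF_ext fun M x => by
      change hsum (θ + η) F M x = hsum θ F M x + hsum η F M x
      unfold hsum
      simp_rw [hterm_add_left, Finset.sum_add_distrib])
    (fun r θ F => CF_ext fun M x => by
      change hsum (r • θ) F M x = r * hsum θ F M x
      unfold hsum
      simp_rw [hterm_smul_left, Finset.mul_sum])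
    (fun θ F G => CF_ext fun M x => by
      change hsum θ (F + G) M x = hsum θ F M x + hsum θ G M x
      unfold hsum
      simp_rw [hterm_add, Finset.sum_add_distrib])
    (fun r θ F => CF_ext fun M x => by
      change hsum θ (r • F) M x = r * hsum θ F M x
      unfold hsum
      simp_rw [hterm_smul, Finset.mul_sum])

theorem hmul_apply (θ F : CF k w Γ) (M : FSp I k w) (x : Pt Γ M) :
    (hmul k w Γ θ F).1 M x = ∑ W, hterm θ F x W := rfl

/-- Isomorphism theorems for W ⊆ U ⊆ M: the quotient of M/W by U/W is M/U, and U/W is both a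
subobject of M/W and a quotient of U. -/
theorem hterm_assoc (θ η F : CF k w Γ) {M : FSp I k w} (x : Pt Γ M) {W U : GSub M}
    (h : ∀ j, W j ≤ U j) (hU : Stable x U) (hW : Stable x W) :
    θ.1 _ (quotPt x hU) * hterm η F (subPt x hU) (fun j => (W j).comap (U j).subtype) =
      hterm θ η (quotPt x hW) (fun j => (U j).map (W j).mkQ) * F.1 _ (subPt x hW) := by
  let W' : GSub (M.sub U) := fun j => (W j).comap (U j).subtype
  have hW' : Stable (subPt x hU) W' := fun a v hv => hW a _ hv
  have h1 : hterm η F (subPt x hU) W' = η.1 _ (quotPt (subPt x hU) hW') * F.1 _ (subPt x hW) := by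
    refine hterm_eq η F (fun j => Submodule.inclusion (h j)) (fun j => (W' j).mkQ) ?_ ?_ ?_ ?_ ?_ ?_
      ?_ ?_
    · exact fun j => Submodule.inclusion_injective (h j)
    · exact fun j => Submodule.range_inclusion _ _ (h j)
    · exact fun j => (W' j).mkQ_surjective
    · exact fun j => Submodule.ker_mkQ _
    · exact fun i v => rfl
    · exact fun i v => rfl
    · exact fun a v => rfl
    · exact fun a v => rfl
  have h2 : hterm θ η (quotPt x hW) (fun j => (U j).map (W j).mkQ) =
      θ.1 _ (quotPt x hU) * η.1 _ (quotPt (subPt x hU) hW') := by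
    refine hterm_eq θ η (fun j => Submodule.mapQ _ _ (U j).subtype le_rfl)
      (fun j => Submodule.factor (h j)) ?_ ?_ ?_ ?_ ?_ ?_ ?_ ?_
    · intro j
      rw [← LinearMap.ker_eq_bot, Submodule.ker_mapQ]
      exact Submodule.mkQ_map_self _
    · intro j
      rw [Submodule.range_mapQ, Submodule.range_subtype]
    · exact fun j => Submodule.factor_surjective (h j)
    · intro j
      refine (Submodule.ker_mapQ (W j) (U j) LinearMap.id (h j)).trans ?_
      rw [Submodule.comap_id]
    · exact fun i v => rfl
    · exact fun i v => rfl
    · intro a v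
      obtain ⟨v, rfl⟩ := Submodule.Quotient.mk_surjective _ v
      rfl
    · intro a v
      obtain ⟨v, rfl⟩ := Submodule.Quotient.mk_surjective _ v
      rfl
  change _ * hterm η F (subPt x hU) W' = _
  rw [h1, h2, mul_assoc]

/-- Both sides sum θ(M/U) η(U/W) F(W) over flags W ⊆ U of subrepresentations. The remaining work
excludes flags in which only one member is stable. -/
theorem hmul_mul_hmul (θ η : CF k w Γ) :
    hmul k w Γ θ * hmul k w Γ η = hmul k w Γ (hmul k w Γ θ η) := by
  classical
  refine LinearMap.ext fun F => CF_ext fun M x => ?_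
  rw [Module.End.mul_apply, hmul_apply, hmul_apply]
  have h1 : ∀ U : GSub M, hterm θ (hmul k w Γ η F) x U = ∑ W : GSub M, if ∀ j, W j ≤ U j then
      (if h : Stable x U then θ.1 _ (quotPt x h) *
        hterm η F (subPt x h) (fun j => (W j).comap (U j).subtype) else 0) else 0 := by
    intro U
    by_cases h : Stable x U
    · simp_rw [dif_pos h]
      rw [hterm_of_stable _ _ h, hmul_apply, sum_gSub_sub, Finset.mul_sum]
      exact Finset.sum_congr rfl fun W _ => by rw [mul_ite, mul_zero]
    · simp_rw [dif_neg h]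
      rw [hterm_of_not_stable _ _ h]
      simp
  have h2 : ∀ W : GSub M, hterm (hmul k w Γ θ η) F x W = ∑ U : GSub M, if ∀ j, W j ≤ U j then
      (if h : Stable x W then 
        hterm θ η (quotPt x h) (fun j => (U j).map (W j).mkQ) * F.1 _ (subPt x h) else 0) else 0 := by
    intro W
    by_cases h : Stable x W
    · simp_rw [dif_pos h]
      rw [hterm_of_stable _ _ h, hmul_apply, sum_gSub_quot, Finset.sum_mul]
      exact Finset.sum_congr rfl fun W _ => by rw [ite_mul, zero_mul]
    · simp_rw [dif_neg h]
      rw [hterm_of_not_stable _ _ h]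
      simp
  simp_rw [h1, h2]
  rw [Finset.sum_comm]
  refine Finset.sum_congr rfl fun W _ => Finset.sum_congr rfl fun U _ => ?_
  by_cases h : ∀ j, W j ≤ U j
  · rw [if_pos h, if_pos h]
    by_cases hU : Stable x U
    · rw [dif_pos hU]
      by_cases hW : Stable x W
      · rw [dif_pos hW]
        exact hterm_assoc θ η F x h hU hW
      · rw [dif_neg hW, hterm_of_not_stable, mul_zero]
        exact fun hs => hW fun a v hv => hs a ⟨v, h _ hv⟩ hv
    · rw [dif_neg hU]
      by_cases hW : Stable x W
      · rw [dif_pos hW, hterm_of_not_stable, zero_mul]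
        intro hs
        refine hU fun a v hv => ?_
        obtain ⟨v', hv', e⟩ := hs a (Submodule.Quotient.mk v) ⟨v, hv, rfl⟩
        have e2 : v' - x a v ∈ W (Γ.tgt a) := (Submodule.Quotient.eq _).1 e
        have := (U _).sub_mem hv' (h _ e2)
        rwa [sub_sub_cancel] at this
      · rw [dif_neg hW]
  · rw [if_neg h, if_neg h]

end SubQuot

/-! ### Counting lemmas -/

/-- The points outside P are parametrized by Φ, and each point over y is hit exactly c(y) times;
dividing by c(y) corrects the multiplicity. -/
theorem sum_ite_eq_sum_fibers {X Y Z : Type*} [Fintype X] [Fintype Y] [Fintype Z] (Φ : Y → Z → X)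
    (π : X → Y) (P : X → Prop) [DecidablePred P] (f : X → ℂ) {c : Y → ℂ} (hc0 : ∀ y, c y ≠ 0)
    (hπ : ∀ y z, π (Φ y z) = y) (hP : ∀ y z, ¬ P (Φ y z))
    (hc : ∀ x, ¬ P x → (Nat.card {z // Φ (π x) z = x} : ℂ) = c (π x)) :
    ∑ x, (if P x then 0 else f x) = ∑ y, (c y)⁻¹ * ∑ z, f (Φ y z) := by
  classical
  have h1 : ∀ y, (c y)⁻¹ * ∑ z, f (Φ y z) =
      ∑ x, ∑ z, if Φ y z = x then (c y)⁻¹ * f x else 0 := by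
    intro y
    rw [Finset.sum_comm, Finset.mul_sum]
    exact Finset.sum_congr rfl fun z _ => by rw [Finset.sum_ite_eq, if_pos (Finset.mem_univ _)]
  simp_rw [h1]
  rw [Finset.sum_comm]
  refine Finset.sum_congr rfl fun x _ => ?_
  split_ifs with hx
  · refine (Finset.sum_eq_zero fun y _ => Finset.sum_eq_zero fun z _ => if_neg ?_).symm
    rintro rfl
    exact hP y z hx
  · rw [Fintype.sum_eq_single (π x), ← Finset.sum_filter, Finset.sum_const, nsmul_eq_mul,
      ← mul_assoc, ← hc x hx, Nat.card_eq_fintype_card, Fintype.card_subtype, mul_inv_cancel₀,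
      one_mul]
    · rw [← Fintype.card_subtype, ← Nat.card_eq_fintype_card, hc x hx]
      exact hc0 _
    · intro y hy
      refine Finset.sum_eq_zero fun z _ => if_neg ?_
      rintro rfl
      exact hy (hπ y z).symm

theorem sum_comp_surjective {G H : Type*} [AddGroup G] [AddGroup H] [Fintype G] [Fintype H]
    (p : G →+ H) (hp : Function.Surjective p) (f : H → ℂ) :
    ∑ x, f (p x) = (Fintype.card G : ℂ) / Fintype.card H * ∑ y, f y := by
  classical
  have h1 : ∀ g : H → ℂ, ∑ x, g (p x) =
      ((Finset.univ.filter fun x => p x = 0).card : ℂ) * ∑ y, g y := by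
    intro g
    rw [← Finset.sum_fiberwise Finset.univ p, Finset.mul_sum]
    refine Finset.sum_congr rfl fun y _ => ?_
    rw [Finset.sum_congr rfl fun x hx => congrArg g (Finset.mem_filter.1 hx).2, Finset.sum_const,
      nsmul_eq_mul, AddMonoidHom.card_fiber_eq_of_mem_range p (hp y) (hp 0)]
  -- The common size of the fibres is read off from the constant function 1.
  have h2 := h1 fun _ => 1
  rw [Finset.sum_const, Finset.sum_const, nsmul_one, nsmul_one, Finset.card_univ,
    Finset.card_univ] at h2
  have h3 : (Fintype.card H : ℂ) ≠ 0 := Nat.cast_ne_zero.2 Fintype.card_ne_zero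
  rw [h1, h2, mul_div_cancel_right₀ _ h3]

/-! ### Families of maps through subspaces and quotients -/

section HallDerivation

variable {I A : Type*} {k : Type u} [Field k] [Fintype k] {w : I → ℕ} {Γ : Qv (I ⊕ I) A}
variable [Fintype A] [DecidableEq A] [Fintype I] [DecidableEq I]

theorem card_hm (N M : FSp I k w) : (Fintype.card (Hm Γ N M) : ℂ) =
    vv k ^ (2 * ∑ a, N.dim (Γ.src a) * M.dim (Γ.tgt a)) := by
  rw [Fintype.card_pi]
  push_cast
  simp_rw [card_hom_eq]
  rw [prod_zpow_vv, Finset.mul_sum]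
  rfl

theorem card_hom0 (N M : FSp I k w) : (Fintype.card (Hom0 N M) : ℂ) =
    vv k ^ (2 * ∑ j, N.dim j * M.dim j) := by
  rw [Fintype.card_pi]
  push_cast
  simp_rw [card_hom_eq]
  rw [prod_zpow_vv, Finset.mul_sum]
  rfl

/-- Composition with the projection is a surjective homomorphism whose kernel consists of the
families with values in W. -/
theorem sum_mkQ_comp (N : FSp I k w) {M : FSp I k w} (W : GSub M) (f : Hm Γ N (M.quot W) → ℂ) :
    ∑ u : Hm Γ N M, f (fun a => (W (Γ.tgt a)).mkQ ∘ₗ u a) =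
      Fintype.card (Hm Γ N (M.sub W)) * ∑ u, f u := by
  refine (sum_comp_surjective (AddMonoidHom.mk' (fun u : Hm Γ N M => (fun a =>
    (W (Γ.tgt a)).mkQ ∘ₗ u a : Hm Γ N (M.quot W))) fun u u' => funext fun a =>
      LinearMap.comp_add _ _ _) ?_ f).trans ?_
  · intro u
    refine ⟨fun a => ((W (Γ.tgt a)).mkQ.exists_rightInverse_of_surjective
      (Submodule.range_mkQ _)).choose ∘ₗ u a, funext fun a => ?_⟩
    have := ((W (Γ.tgt a)).mkQ.exists_rightInverse_of_surjective
      (Submodule.range_mkQ _)).choose_spec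
    change (W (Γ.tgt a)).mkQ ∘ₗ (_ ∘ₗ u a) = u a
    rw [← LinearMap.comp_assoc, this, LinearMap.id_comp]
  · congr 1
    rw [card_hm, card_hm, card_hm, ← zpow_sub₀ vv_ne_zero, ← M.dim_sub_add_dim_quot W]
    congr 1
    rw [← mul_sub, ← Finset.sum_sub_distrib]
    congr 1
    exact Finset.sum_congr rfl fun a _ => by rw [Pi.add_apply]; ring

theorem sum_comp_subtype (N : FSp I k w) {M : FSp I k w} (W : GSub M) (f : Hm Γ (M.sub W) N → ℂ) :
    ∑ u : Hm Γ M N, f (fun a => u a ∘ₗ (W (Γ.src a)).subtype) =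
      Fintype.card (Hm Γ (M.quot W) N) * ∑ u, f u := by
  refine (sum_comp_surjective (AddMonoidHom.mk' (fun u : Hm Γ M N => (fun a =>
    u a ∘ₗ (W (Γ.src a)).subtype : Hm Γ (M.sub W) N)) fun u u' => funext fun a =>
      LinearMap.add_comp _ _ _) ?_ f).trans ?_
  · intro u
    refine ⟨fun a => u a ∘ₗ ((W (Γ.src a)).subtype.exists_leftInverse_of_injective
      (Submodule.ker_subtype _)).choose, funext fun a => ?_⟩
    have := ((W (Γ.src a)).subtype.exists_leftInverse_of_injective
      (Submodule.ker_subtype _)).choose_spec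
    change (u a ∘ₗ _) ∘ₗ (W (Γ.src a)).subtype = u a
    rw [LinearMap.comp_assoc, this, LinearMap.comp_id]
  · congr 1
    rw [card_hm, card_hm, card_hm, ← zpow_sub₀ vv_ne_zero, ← M.dim_sub_add_dim_quot W]
    congr 1
    rw [← mul_sub, ← Finset.sum_sub_distrib]
    congr 1
    exact Finset.sum_congr rfl fun a _ => by rw [Pi.add_apply]; ring

/-! ### Subspaces of a direct sum with a simple representation -/

/-- The direct sum of graded subspaces. -/
def GSub.prod {M N : FSp I k w} (W : GSub M) (W' : GSub N) : GSub (M.prod N) :=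
  fun j => (W j).prod (W' j)

/-- The image of a graded subspace under a unipotent automorphism. -/
def GSub.shear {M N : FSp I k w} (σ : Hom0 N M) (W : GSub (M.prod N)) : GSub (M.prod N) :=
  fun j => (W j).map (FramedHall.shear (σ j) : M.V j × N.V j →ₗ[k] M.V j × N.V j)

theorem GSub.mem_shear {M N : FSp I k w} (σ : Hom0 N M) (W : GSub (M.prod N)) (j : I ⊕ I)
    (v : M.V j × N.V j) : v ∈ W.shear σ j ↔ (v.1 - σ j v.2, v.2) ∈ W j := by
  constructor
  · rintro ⟨v, hv, rfl⟩
    change (v.1 + σ j v.2 - σ j v.2, v.2) ∈ W j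
    rwa [add_sub_cancel_right]
  · intro h
    exact ⟨_, h, Prod.ext (sub_add_cancel _ _) rfl⟩

open Classical in
-- A subspace of M ⊕ S_i projects to 0 or onto S_i. In the first case it is W ⊕ 0. In the second it
-- is a shear of W ⊕ S_i, where W is its intersection with M and σ is unique up to maps into W.
theorem sum_gSub_prod_spS (M : FSp I k w) (i : I) (f : GSub (M.prod (spS k w i)) → ℂ) :
    ∑ W, f W = ∑ W : GSub M, f (W.prod ⊥) + ∑ W : GSub M,
      (Fintype.card (Hom0 (spS k w i) (M.sub W)) : ℂ)⁻¹ *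
        ∑ σ : Hom0 (spS k w i) M, f ((W.prod ⊤).shear σ) := by
  let P : GSub (M.prod (spS k w i)) → Prop := fun W => ∀ j, ∀ v ∈ W j, v.2 = 0
  have h1 : ∑ W, f W = ∑ W, (if P W then f W else 0) + ∑ W, (if P W then 0 else f W) := by
    rw [← Finset.sum_add_distrib]
    refine Finset.sum_congr rfl fun W _ => ?_
    split_ifs
    · rw [add_zero]
    · rw [zero_add]
  rw [h1]
  congr 1
  · symm
    refine Fintype.sum_of_injective (fun W : GSub M => W.prod ⊥) ?_ _ _ ?_ ?_
    · intro W W' h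
      funext j
      ext v
      have h2 : (v ∈ W j ∧ (0 : (spS k w i).V j) = 0) ↔ (v ∈ W' j ∧ (0 : (spS k w i).V j) = 0) :=
        SetLike.ext_iff.1 (congrFun h j) (v, 0)
      rwa [and_iff_left rfl, and_iff_left rfl] at h2
    · intro W hW
      refine if_neg fun h => hW ⟨fun j => (W j).comap (LinearMap.inl k _ _), funext fun j => ?_⟩
      ext v
      constructor
      · rintro ⟨h1, h2⟩
        have h3 : v = (v.1, 0) := Prod.ext rfl h2
        rw [h3]
        exact h1
      · intro h'
        have h2 : v.2 = 0 := h j v h'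
        have h3 : v = (v.1, 0) := Prod.ext rfl h2
        refine ⟨?_, h2⟩
        rw [h3] at h'
        exact h'
    · intro W
      exact (if_pos fun j v hv => hv.2).symm
  · refine sum_ite_eq_sum_fibers
      (fun (W : GSub M) (σ : Hom0 (spS k w i) M) => GSub.shear σ (GSub.prod W ⊤))
      (fun W j => (W j).comap (LinearMap.inl k _ _)) P f (fun W => Nat.cast_ne_zero.2
        Fintype.card_ne_zero) ?_ ?_ ?_
    · intro W σ
      funext j
      ext m
      refine (GSub.mem_shear σ _ j (m, 0)).trans ?_
      rw [map_zero, sub_zero]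
      exact and_iff_left trivial
    · intro W σ h
      obtain ⟨s, hs⟩ := exists_spS_ne_zero (k := k) (w := w) i
      refine hs (h (Sum.inl i) (σ _ s, s) ((GSub.mem_shear σ _ _ _).2 ?_))
      rw [sub_self]
      exact ⟨Submodule.zero_mem _, trivial⟩
    · intro W hW
      -- A linear section of the projection to S_i, with values in W.
      have h2 : ∀ j, ∃ τ : (spS k w i).V j →ₗ[k] M.V j, ∀ s, (τ s, s) ∈ W j := by
        intro j
        have hs : Function.Surjective (LinearMap.snd k (M.V j) ((spS k w i).V j) ∘ₗ (W j).subtype) := by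
          intro s
          by_cases hj : j = Sum.inl i
          · subst hj
            have h3 : ∃ v ∈ W (Sum.inl i), v.2 ≠ 0 := by
              by_contra hc
              push Not at hc
              refine hW fun j v hv => ?_
              by_cases hj : j = Sum.inl i
              · subst hj
                exact hc v hv
              · have := subsingleton_spS (k := k) (w := w) hj
                exact Subsingleton.elim _ _
            obtain ⟨v, hv, hv0⟩ := h3
            obtain ⟨c, rfl⟩ := spS_span hv0 s
            exact ⟨⟨c • v, (W _).smul_mem c hv⟩, rfl⟩
          · have := subsingleton_spS (k := k) (w := w) hj
            exact ⟨0, Subsingleton.elim _ _⟩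
        obtain ⟨g, hg⟩ := LinearMap.exists_rightInverse_of_surjective _ (LinearMap.range_eq_top.2 hs)
        refine ⟨LinearMap.fst k _ _ ∘ₗ (W j).subtype ∘ₗ g, fun s => ?_⟩
        have h4 : ((g s : M.V j × (spS k w i).V j)).2 = s := LinearMap.congr_fun hg s
        have h5 := (g s).2
        have h6 : ((g s : M.V j × (spS k w i).V j).1, s) = (g s : M.V j × (spS k w i).V j) :=
          Prod.ext rfl h4.symm
        change ((g s : M.V j × (spS k w i).V j).1, s) ∈ W j
        rw [h6]
        exact h5
      choose τ hτ using h2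
      have h7 : ∀ σ : Hom0 (spS k w i) M,
          GSub.shear σ (GSub.prod (fun j => (W j).comap (LinearMap.inl k _ _)) ⊤) = W ↔
            ∀ j s, (σ j s, s) ∈ W j := by
        intro σ
        constructor
        · intro h j s
          rw [← h, GSub.mem_shear, sub_self]
          exact ⟨Submodule.zero_mem _, trivial⟩
        · intro h
          funext j
          ext v
          have h8 : (v.1 - σ j v.2, (0 : (spS k w i).V j)) + (σ j v.2, v.2) = v := by
            rw [Prod.mk_add_mk, sub_add_cancel, zero_add]
          rw [GSub.mem_shear]
          constructor
          · intro hv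
            rw [← h8]
            exact (W j).add_mem hv.1 (h j v.2)
          · intro hv
            refine ⟨?_, trivial⟩
            rw [← h8] at hv
            exact ((W j).add_mem_iff_left (h j v.2)).1 hv
      rw [← Nat.card_eq_fintype_card]
      refine congrArg Nat.cast (Nat.card_congr ?_)
      -- The admissible σ form a torsor under the maps into the intersection with M; τ is the base
      -- point.
      refine (Equiv.subtypeEquivRight h7).trans
        { toFun := fun σ j => LinearMap.codRestrict _ (σ.1 j - τ j) fun s => ?_
          invFun := fun ρ => ⟨fun j => τ j + Submodule.subtype _ ∘ₗ ρ j, fun j s => ?_⟩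
          left_inv := fun σ => ?_
          right_inv := fun ρ => ?_ }
      · have := (W j).sub_mem (σ.2 j s) (hτ j s)
        rwa [Prod.mk_sub_mk, sub_self] at this
      · have := (W j).add_mem (hτ j s) (ρ j s).2
        change (_, _ + 0) ∈ W j at this
        rwa [add_zero] at this
      · refine Subtype.ext (funext fun j => LinearMap.ext fun s => ?_)
        exact add_sub_cancel (τ j s) (σ.1 j s)
      · funext j
        refine LinearMap.ext fun s => Subtype.ext ?_
        exact add_sub_cancel_left (τ j s) (ρ j s : M.V j)

open Classical in
-- Dually, a subspace of S_i ⊕ M contains S_i or meets it in 0. In the second case it is the graph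
-- of a map on its projection W to M, and extensions of that map to M differ by maps on M/W.
theorem sum_gSub_spS_prod (M : FSp I k w) (i : I) (f : GSub ((spS k w i).prod M) → ℂ) :
    ∑ W, f W = ∑ W : GSub M, f (GSub.prod ⊤ W) + ∑ W : GSub M,
      (Fintype.card (Hom0 (M.quot W) (spS k w i)) : ℂ)⁻¹ *
        ∑ σ : Hom0 M (spS k w i), f ((GSub.prod ⊥ W).shear σ) := by
  let P : GSub ((spS k w i).prod M) → Prop := fun W => ∀ j s, (s, 0) ∈ W j
  have h1 : ∑ W, f W = ∑ W, (if P W then f W else 0) + ∑ W, (if P W then 0 else f W) := by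
    rw [← Finset.sum_add_distrib]
    refine Finset.sum_congr rfl fun W _ => ?_
    split_ifs
    · rw [add_zero]
    · rw [zero_add]
  rw [h1]
  congr 1
  · symm
    refine Fintype.sum_of_injective (fun W : GSub M => GSub.prod ⊤ W) ?_ _ _ ?_ ?_
    · intro W W' h
      funext j
      ext v
      have h2 : (True ∧ v ∈ W j) ↔ (True ∧ v ∈ W' j) := SetLike.ext_iff.1 (congrFun h j) (0, v)
      rwa [true_and, true_and] at h2
    · intro W hW
      refine if_neg fun h => hW ⟨fun j => (W j).comap (LinearMap.inr k _ _), funext fun j => ?_⟩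
      ext ⟨s, m⟩
      have h2 : (s, (0 : M.V j)) + (0, m) = (s, m) := by
        rw [Prod.mk_add_mk, add_zero, zero_add]
      rw [← h2, (W j).add_mem_iff_right (h j s), h2]
      exact and_iff_right trivial
    · intro W
      exact (if_pos fun j s => ⟨trivial, (W j).zero_mem⟩).symm
  · refine sum_ite_eq_sum_fibers
      (fun (W : GSub M) (σ : Hom0 M (spS k w i)) => GSub.shear σ (GSub.prod ⊥ W))
      (fun W j => (W j).map (LinearMap.snd k _ _)) P f (fun W => Nat.cast_ne_zero.2
        Fintype.card_ne_zero) ?_ ?_ ?_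
    · intro W σ
      funext j
      ext m
      constructor
      · rintro ⟨v, hv, rfl⟩
        exact ((GSub.mem_shear σ _ j v).1 hv).2
      · intro hm
        refine ⟨(σ j m, m), (GSub.mem_shear σ _ j _).2 ?_, rfl⟩
        rw [sub_self]
        exact ⟨Submodule.zero_mem _, hm⟩
    · intro W σ h
      obtain ⟨s, hs⟩ := exists_spS_ne_zero (k := k) (w := w) i
      have h2 := ((GSub.mem_shear σ _ _ _).1 (h (Sum.inl i) s)).1
      rw [map_zero, sub_zero] at h2
      exact hs h2
    · intro W hW
      have h0 : ∀ j s, (s, 0) ∈ W j → s = 0 := by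
        intro j s hs
        by_cases hj : j = Sum.inl i
        · subst hj
          by_contra hs0
          refine hW fun j t => ?_
          by_cases hj : j = Sum.inl i
          · subst hj
            obtain ⟨c, rfl⟩ := spS_span hs0 t
            have := (W _).smul_mem c hs
            rwa [Prod.smul_mk, smul_zero] at this
          · have := subsingleton_spS (k := k) (w := w) hj
            rw [Subsingleton.elim t 0]
            exact (W j).zero_mem
        · have := subsingleton_spS (k := k) (w := w) hj
          exact Subsingleton.elim _ _
      -- The projection to M is injective on W, so its first coordinate is a linear function of the
      -- second.
      have h2 : ∀ j, ∃ τ : M.V j →ₗ[k] (spS k w i).V j, ∀ v ∈ W j, v.1 = τ v.2 := by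
        intro j
        have hs : LinearMap.ker (LinearMap.snd k ((spS k w i).V j) (M.V j) ∘ₗ (W j).subtype) = ⊥ := by
          rw [LinearMap.ker_eq_bot']
          rintro ⟨⟨s, m⟩, hv⟩ h
          obtain rfl : m = 0 := h
          obtain rfl := h0 j s hv
          rfl
        obtain ⟨g, hg⟩ := LinearMap.exists_leftInverse_of_injective _ hs
        refine ⟨LinearMap.fst k _ _ ∘ₗ (W j).subtype ∘ₗ g, fun v hv => ?_⟩
        have h4 : g v.2 = ⟨v, hv⟩ := LinearMap.congr_fun hg ⟨v, hv⟩
        change v.1 = (g v.2 : (spS k w i).V j × M.V j).1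
        rw [h4]
      choose τ hτ using h2
      have h7 : ∀ σ : Hom0 M (spS k w i),
          GSub.shear σ (GSub.prod ⊥ (fun j => (W j).map (LinearMap.snd k _ _))) = W ↔
            ∀ j, ∀ v ∈ W j, v.1 = σ j v.2 := by
        intro σ
        constructor
        · intro h j v hv
          rw [← h, GSub.mem_shear] at hv
          exact sub_eq_zero.1 hv.1
        · intro h
          funext j
          ext v
          rw [GSub.mem_shear]
          constructor
          · rintro ⟨hv, v', hv', e⟩
            have e1 : v.1 = σ j v.2 := sub_eq_zero.1 hv
            have e2 : v'.2 = v.2 := e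
            have e3 : v' = v := Prod.ext (by rw [h j v' hv', e2, e1]) e2
            rwa [← e3]
          · intro hv
            refine ⟨?_, v, hv, rfl⟩
            rw [h j v hv, sub_self]
            exact Submodule.zero_mem _
      rw [← Nat.card_eq_fintype_card]
      refine congrArg Nat.cast (Nat.card_congr ?_)
      refine (Equiv.subtypeEquivRight h7).trans
        { toFun := fun σ j => Submodule.liftQ _ (σ.1 j - τ j) ?_
          invFun := fun ρ => ⟨fun j => τ j + ρ j ∘ₗ Submodule.mkQ _, fun j v hv => ?_⟩
          left_inv := fun σ => ?_
          right_inv := fun ρ => ?_ }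
      · rintro _ ⟨v, hv, rfl⟩
        exact sub_eq_zero.2 ((σ.2 j v hv).symm.trans (hτ j v hv))
      · have h8 : ρ j (Submodule.Quotient.mk v.2) = 0 := by
          have h9 : (Submodule.Quotient.mk v.2 :
              M.V j ⧸ (W j).map (LinearMap.snd k ((spS k w i).V j) (M.V j))) = 0 :=
            (Submodule.Quotient.mk_eq_zero _).2 ⟨v, hv, rfl⟩
          exact (congrArg (ρ j) h9).trans (map_zero _)
        exact (hτ j v hv).trans ((add_zero _).symm.trans (congrArg (τ j v.2 + ·) h8.symm))
      · refine Subtype.ext (funext fun j => LinearMap.ext fun s => ?_)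
        exact add_sub_cancel (τ j s) (σ.1 j s)
      · funext j
        refine LinearMap.ext fun v => ?_
        obtain ⟨v, rfl⟩ := Submodule.Quotient.mk_surjective _ v
        exact add_sub_cancel_left (τ j v) (ρ j (Submodule.Quotient.mk v))

end HallDerivation

/-! ### The operators `Rop` and `Lop` are twisted derivations of the Hall product -/

section Derivation

variable {I A : Type*} {k : Type u} [Field k] [Fintype k] {w : I → ℕ} {Γ : Qv (I ⊕ I) A}
variable [Fintype A] [DecidableEq A] [Fintype I] [DecidableEq I]

theorem hterm_prod_bot (θ F : CF k w Γ) {M N : FSp I k w} (hN : ∀ i v, N.φ i v = 0) (x : Pt Γ M)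
    (u : Hm Γ N M) (c : Pt Γ N) {W : GSub M} (h : Stable x W) :
    hterm θ F (tri x u c) (GSub.prod W ⊥) =
      θ.1 ((M.quot W).prod N) (tri (quotPt x h) (fun a => (W (Γ.tgt a)).mkQ ∘ₗ u a) c) *
        F.1 (M.sub W) (subPt x h) := by
  refine hterm_eq θ F (M := M.prod N) (N := (M.quot W).prod N)
    (fun j => LinearMap.inl k _ _ ∘ₗ (W j).subtype)
    (fun j => LinearMap.prodMap (W j).mkQ LinearMap.id) ?_ ?_ ?_ ?_ ?_ ?_ ?_ ?_
  · exact fun j => LinearMap.inl_injective.comp (W j).injective_subtype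
  · intro j
    rw [LinearMap.range_comp, Submodule.range_subtype]
    exact Submodule.map_inl _
  · exact fun j => Prod.map_surjective.2 ⟨(W j).mkQ_surjective, Function.surjective_id⟩
  · intro j
    rw [LinearMap.ker_prodMap, Submodule.ker_mkQ, LinearMap.ker_id]
    rfl
  · intro i v
    change M.φ i v + N.φ i 0 = M.φ i v
    rw [map_zero, add_zero]
  · intro i v
    exact (zero_add _).trans (hN i v.2)
  · intro a v
    change (_, (0 : N.V _)) = (x a v + u a 0, c a 0)
    rw [map_zero, map_zero, add_zero]
    rfl
  · exact fun a v => rfl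

theorem hterm_prod_bot_of_not_stable (θ F : CF k w Γ) {M N : FSp I k w} (x : Pt Γ M)
    (u : Hm Γ N M) (c : Pt Γ N) {W : GSub M} (h : ¬ Stable x W) :
    hterm θ F (tri x u c) (GSub.prod W ⊥) = 0 := by
  refine hterm_of_not_stable θ F fun hs => h fun a v hv => ?_
  have := (hs a (v, 0) ⟨hv, rfl⟩).1
  change x a v + u a 0 ∈ _ at this
  rwa [map_zero, add_zero] at this

theorem hterm_prod_top (θ F : CF k w Γ) {M N : FSp I k w} (x : Pt Γ M)
    (c : Pt Γ N) {W : GSub M} (h : Stable x W) (u : Hm Γ N (M.sub W)) :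
    hterm θ F (tri x (fun a => (W (Γ.tgt a)).subtype ∘ₗ u a) c) (GSub.prod W ⊤) =
      θ.1 (M.quot W) (quotPt x h) * F.1 ((M.sub W).prod N) (tri (subPt x h) u c) := by
  refine hterm_eq θ F (M := M.prod N) (P := (M.sub W).prod N)
    (fun j => LinearMap.prodMap (W j).subtype LinearMap.id)
    (fun j => (W j).mkQ ∘ₗ LinearMap.fst k _ _) ?_ ?_ ?_ ?_ ?_ ?_ ?_ ?_
  · exact fun j => Prod.map_injective.2 ⟨(W j).injective_subtype, Function.injective_id⟩
  · intro j
    rw [LinearMap.range_prodMap, Submodule.range_subtype, LinearMap.range_id]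
    rfl
  · exact fun j => (W j).mkQ_surjective.comp LinearMap.fst_surjective
  · intro j
    ext v
    rw [LinearMap.mem_ker]
    exact (Submodule.Quotient.mk_eq_zero _).trans (and_iff_left trivial).symm
  · exact fun i v => rfl
  · exact fun i v => rfl
  · exact fun a v => rfl
  · intro a v
    refine (Submodule.Quotient.eq _).2 ?_
    change x a v.1 + (u a v.2 : M.V _) - x a v.1 ∈ _
    rw [add_sub_cancel_left]
    exact (u a v.2).2

theorem hterm_prod_top_of_not_mem (θ F : CF k w Γ) {M N : FSp I k w} (x : Pt Γ M)
    (u : Hm Γ N M) (c : Pt Γ N) {W : GSub M} (h : ¬ (Stable x W ∧ ∀ a v, u a v ∈ W (Γ.tgt a))) :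
    hterm θ F (tri x u c) (GSub.prod W ⊤) = 0 := by
  refine hterm_of_not_stable θ F fun hs => h ⟨fun a v hv => ?_, fun a v => ?_⟩
  · have := (hs a (v, 0) ⟨hv, trivial⟩).1
    change x a v + u a 0 ∈ _ at this
    rwa [map_zero, add_zero] at this
  · have := (hs a (0, v) ⟨Submodule.zero_mem _, trivial⟩).1
    change x a 0 + u a v ∈ _ at this
    rwa [map_zero, zero_add] at this

/-- The subspace W ⊕ N is stable only if u takes values in W; such u are the extensions of N by the
subrepresentation W. -/
theorem sum_hterm_prod_top (θ F : CF k w Γ) {M N : FSp I k w} (x : Pt Γ M)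
    (c : Pt Γ N) {W : GSub M} (h : Stable x W) :
    ∑ u, hterm θ F (tri x u c) (GSub.prod W ⊤) =
      θ.1 (M.quot W) (quotPt x h) * ∑ u, F.1 ((M.sub W).prod N) (tri (subPt x h) u c) := by
  rw [Finset.mul_sum]
  symm
  refine Fintype.sum_of_injective (fun u : Hm Γ N (M.sub W) =>
    (fun a => (W (Γ.tgt a)).subtype ∘ₗ u a : Hm Γ N M)) ?_ _ _ ?_ ?_
  · intro u u' e
    funext a
    refine LinearMap.ext fun v => Subtype.ext ?_
    exact LinearMap.congr_fun (congrFun e a) v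
  · intro u hu
    refine hterm_prod_top_of_not_mem θ F x u c fun hs => hu ⟨fun a => (u a).codRestrict _ (hs.2 a), ?_⟩
    rfl
  · exact fun u => (hterm_prod_top θ F x c h u).symm

theorem hterm_top_prod (θ F : CF k w Γ) {M N : FSp I k w} (c : Pt Γ N) (u : Hm Γ M N) (x : Pt Γ M)
    {W : GSub M} (h : Stable x W) :
    hterm θ F (tri c u x) (GSub.prod ⊤ W) = θ.1 (M.quot W) (quotPt x h) *
      F.1 (N.prod (M.sub W)) (tri c (fun a => u a ∘ₗ (W (Γ.src a)).subtype) (subPt x h)) := by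
  refine hterm_eq θ F (M := N.prod M) (P := N.prod (M.sub W))
    (fun j => LinearMap.prodMap LinearMap.id (W j).subtype)
    (fun j => (W j).mkQ ∘ₗ LinearMap.snd k _ _) ?_ ?_ ?_ ?_ ?_ ?_ ?_ ?_
  · exact fun j => Prod.map_injective.2 ⟨Function.injective_id, (W j).injective_subtype⟩
  · intro j
    rw [LinearMap.range_prodMap, Submodule.range_subtype, LinearMap.range_id]
    rfl
  · exact fun j => (W j).mkQ_surjective.comp LinearMap.snd_surjective
  · intro j
    ext v
    rw [LinearMap.mem_ker]
    exact (Submodule.Quotient.mk_eq_zero _).trans (and_iff_right trivial).symm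
  · exact fun i v => rfl
  · exact fun i v => rfl
  · exact fun a v => rfl
  · exact fun a v => rfl

theorem hterm_top_prod_of_not_stable (θ F : CF k w Γ) {M N : FSp I k w} (c : Pt Γ N) (u : Hm Γ M N)
    (x : Pt Γ M) {W : GSub M} (h : ¬ Stable x W) : hterm θ F (tri c u x) (GSub.prod ⊤ W) = 0 :=
  hterm_of_not_stable θ F fun hs => h fun a v hv => (hs a (0, v) ⟨trivial, hv⟩).2

theorem hterm_bot_prod (θ F : CF k w Γ) {M N : FSp I k w} (hN : ∀ i v, N.φ i v = 0) (c : Pt Γ N)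
    (x : Pt Γ M) {W : GSub M} (h : Stable x W) (u : Hm Γ (M.quot W) N) :
    hterm θ F (tri c (fun a => u a ∘ₗ (W (Γ.src a)).mkQ) x) (GSub.prod ⊥ W) =
      θ.1 (N.prod (M.quot W)) (tri c u (quotPt x h)) * F.1 (M.sub W) (subPt x h) := by
  refine hterm_eq θ F (M := N.prod M) (N := N.prod (M.quot W))
    (fun j => LinearMap.inr k _ _ ∘ₗ (W j).subtype)
    (fun j => LinearMap.prodMap LinearMap.id (W j).mkQ) ?_ ?_ ?_ ?_ ?_ ?_ ?_ ?_
  · exact fun j => LinearMap.inr_injective.comp (W j).injective_subtype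
  · intro j
    rw [LinearMap.range_comp, Submodule.range_subtype]
    exact Submodule.map_inr _
  · exact fun j => Prod.map_surjective.2 ⟨Function.surjective_id, (W j).mkQ_surjective⟩
  · intro j
    rw [LinearMap.ker_prodMap, Submodule.ker_mkQ, LinearMap.ker_id]
    rfl
  · intro i v
    change N.φ i 0 + M.φ i v = M.φ i v
    rw [map_zero, zero_add]
  · intro i v
    exact (add_zero _).trans (hN i v.1)
  · intro a v
    refine Prod.ext ?_ rfl
    change (0 : N.V _) = c a 0 + u a (Submodule.Quotient.mk (v : M.V _))
    rw [(Submodule.Quotient.mk_eq_zero _).2 v.2, map_zero, map_zero, add_zero]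
  · exact fun a v => rfl

theorem hterm_bot_prod_of_not_stable (θ F : CF k w Γ) {M N : FSp I k w} (c : Pt Γ N) (u : Hm Γ M N)
    (x : Pt Γ M) {W : GSub M} (h : ¬ (Stable x W ∧ ∀ a, ∀ v ∈ W (Γ.src a), u a v = 0)) :
    hterm θ F (tri c u x) (GSub.prod ⊥ W) = 0 := by
  refine hterm_of_not_stable θ F fun hs => h ⟨fun a v hv => (hs a (0, v) ⟨rfl, hv⟩).2,
    fun a v hv => ?_⟩
  have := (hs a (0, v) ⟨rfl, hv⟩).1
  change c a 0 + u a v = 0 at this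
  rwa [map_zero, zero_add] at this

/-- The subspace 0 ⊕ W is stable only if u vanishes on W; such u are the extensions of the quotient
M/W by N. -/
theorem sum_hterm_bot_prod (θ F : CF k w Γ) {M N : FSp I k w} (hN : ∀ i v, N.φ i v = 0)
    (c : Pt Γ N) (x : Pt Γ M) {W : GSub M} (h : Stable x W) :
    ∑ u, hterm θ F (tri c u x) (GSub.prod ⊥ W) =
      (∑ u, θ.1 (N.prod (M.quot W)) (tri c u (quotPt x h))) * F.1 (M.sub W) (subPt x h) := by
  rw [Finset.sum_mul]
  symm
  refine Fintype.sum_of_injective (fun u : Hm Γ (M.quot W) N =>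
    (fun a => u a ∘ₗ (W (Γ.src a)).mkQ : Hm Γ M N)) ?_ _ _ ?_ ?_
  · intro u u' e
    funext a
    refine LinearMap.ext fun v => ?_
    obtain ⟨v, rfl⟩ := Submodule.Quotient.mk_surjective _ v
    exact LinearMap.congr_fun (congrFun e a) v
  · intro u hu
    refine hterm_bot_prod_of_not_stable θ F c u x fun hs => hu ⟨fun a => Submodule.liftQ _ (u a)
      (hs.2 a), ?_⟩
    funext a
    exact Submodule.liftQ_mkQ _ _ _
  · exact fun u => (hterm_bot_prod θ F hN c x h u).symm

/-- Conjugation by the shear only translates u, and a sum over all u does not notice a translation.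
-/
theorem sum_hterm_shear (θ F : CF k w Γ) {M N : FSp I k w} (x : Pt Γ M) (c : Pt Γ N)
    (σ : Hom0 N M) (hσ : ∀ i v, M.φ i (σ (Sum.inr i) v) = 0) (W : GSub (M.prod N)) :
    ∑ u, hterm θ F (tri x u c) (W.shear σ) = ∑ u, hterm θ F (tri x u c) W := by
  refine Fintype.sum_equiv (Equiv.addRight
    (fun a => x a ∘ₗ σ (Γ.src a) - σ (Γ.tgt a) ∘ₗ c a : Hm Γ N M)) _ _ fun u => ?_
  refine hterm_iso θ F (M := M.prod N) (M' := M.prod N) (e := fun j => shear (σ j)) ⟨fun i v => ?_,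
    fun a v => Prod.ext ?_ rfl⟩ W
  · change M.φ i (v.1 + σ _ v.2) + N.φ i v.2 = M.φ i v.1 + N.φ i v.2
    rw [map_add, hσ, add_zero]
  · change x a v.1 + (u a v.2 + (x a (σ _ v.2) - σ _ (c a v.2))) + σ _ (c a v.2) =
      x a (v.1 + σ _ v.2) + u a v.2
    rw [map_add]
    abel

/-- The total dimension at the end points of the arrows which start at `i`. -/
def outW (Γ : Qv (I ⊕ I) A) (i : I) : (I ⊕ I → ℤ) →+ ℤ :=
  ∑ a, if Γ.src a = Sum.inl i then Pi.evalAddMonoidHom (fun _ : I ⊕ I => ℤ) (Γ.tgt a) else 0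

theorem outW_apply (Γ : Qv (I ⊕ I) A) (i : I) (ν : I ⊕ I → ℤ) :
    outW Γ i ν = ∑ a, if Γ.src a = Sum.inl i then ν (Γ.tgt a) else 0 := by
  unfold outW
  rw [AddMonoidHom.finsetSum_apply]
  refine Finset.sum_congr rfl fun a _ => ?_
  split_ifs <;> rfl

theorem card_hm_spS_left (i : I) (M : FSp I k w) :
    (Fintype.card (Hm Γ (spS k w i) M) : ℂ) = vv k ^ ((2 • outW Γ i) M.dim) := by
  rw [card_hm, spS_dim, AddMonoidHom.nsmul_apply, outW_apply, nsmul_eq_mul]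
  congr 2
  refine Finset.sum_congr rfl fun a _ => ?_
  rw [dl, Pi.single_apply, ite_mul, one_mul, zero_mul]

theorem card_hm_spS_right (i : I) (M : FSp I k w) :
    (Fintype.card (Hm Γ M (spS k w i)) : ℂ) = vv k ^ ((2 • inW Γ i) M.dim) := by
  rw [card_hm, spS_dim, AddMonoidHom.nsmul_apply, inW_apply, nsmul_eq_mul]
  congr 2
  refine Finset.sum_congr rfl fun a _ => ?_
  rw [dl, Pi.single_apply, mul_ite, mul_one, mul_zero]

theorem card_hom0_spS_left (i : I) (M : FSp I k w) :
    (Fintype.card (Hom0 (spS k w i) M) : ℂ) = vv k ^ ((2 • evW i) M.dim) := by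
  rw [card_hom0_spS, AddMonoidHom.nsmul_apply, nsmul_eq_mul]
  rfl

theorem card_hom0_spS_right (i : I) (M : FSp I k w) :
    (Fintype.card (Hom0 M (spS k w i)) : ℂ) = vv k ^ ((2 • evW i) M.dim) := by
  rw [← card_hom0_spS_left, card_hom0, card_hom0]
  simp_rw [mul_comm]

/-- Subrepresentations of an extension of S_i by M either map onto S_i, and then F sees the
extension, or lie in M, and then θ sees it. The weights count shears modulo W in the first case and
lifts of u from M/W to M in the second. -/
theorem Rop_hmul (i : I) (θ F : CF k w Γ) :
    Rop (spS k w i) 0 (hmul k w Γ θ F) =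
      hmul k w Γ (Kop (2 • evW i) θ) (Rop (spS k w i) 0 F) +
        hmul k w Γ (Rop (spS k w i) 0 θ) (Kop (2 • outW Γ i) F) := by
  refine CF_ext fun M x => ?_
  change _ = (hmul k w Γ (Kop (2 • evW i) θ) (Rop (spS k w i) 0 F)).1 M x +
    (hmul k w Γ (Rop (spS k w i) 0 θ) (Kop (2 • outW Γ i) F)).1 M x
  rw [Rop_apply, hmul_apply, hmul_apply]
  simp_rw [hmul_apply, sum_gSub_prod_spS]
  rw [Finset.sum_add_distrib, add_comm]
  congr 1
  · rw [Finset.sum_comm]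
    refine Finset.sum_congr rfl fun W _ => ?_
    rw [← Finset.mul_sum, Finset.sum_comm]
    have hσ : ∀ (σ : Hom0 (spS k w i) M) (l : I) (v : (spS k w i).V (Sum.inr l)),
        M.φ l (σ (Sum.inr l) v) = 0 := by
      intro σ l v
      have := subsingleton_spS (k := k) (w := w) (i := i) (j := Sum.inr l) (by simp)
      rw [Subsingleton.elim v 0, map_zero, map_zero]
    -- Every shear contributes equally, so the sum over σ is the factor |Hom(S_i, M)| / |Hom(S_i,
    -- W)|, the weight of M/W at i.
    rw [Finset.sum_congr rfl fun σ _ => sum_hterm_shear θ F x 0 σ (hσ σ) _, Finset.sum_const,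
      nsmul_eq_mul, Finset.card_univ, ← mul_assoc, card_hom0_spS_left, card_hom0_spS_left]
    by_cases h : Stable x W
    · rw [sum_hterm_prod_top θ F x 0 h, hterm_of_stable _ _ h, Kop_apply, Rop_apply,
        ← M.dim_sub_add_dim_quot W, map_add, zpow_add₀ vv_ne_zero, ← mul_assoc,
        inv_mul_cancel_left₀ (zpow_ne_zero _ vv_ne_zero)]
    · rw [hterm_of_not_stable _ _ h, Finset.sum_eq_zero, mul_zero]
      exact fun u _ => hterm_prod_top_of_not_mem θ F x u 0 fun hs => h hs.1
  · rw [Finset.sum_comm]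
    refine Finset.sum_congr rfl fun W _ => ?_
    by_cases h : Stable x W
    · rw [Finset.sum_congr rfl fun u _ => hterm_prod_bot θ F (fun _ _ => rfl) x u 0 h,
        ← Finset.sum_mul, hterm_of_stable _ _ h, Kop_apply, Rop_apply,
        sum_mkQ_comp (spS k w i) W fun u => θ.1 _ (tri (quotPt x h) u 0), card_hm_spS_left]
      ring
    · rw [hterm_of_not_stable _ _ h, Finset.sum_eq_zero]
      exact fun u _ => hterm_prod_bot_of_not_stable θ F x u 0 h

/-- The dual rule: subrepresentations of an extension of M by S_i either contain S_i or meet it in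
zero. -/
theorem Lop_hmul (i : I) (θ F : CF k w Γ) :
    Lop (spS k w i) 0 (hmul k w Γ θ F) =
      hmul k w Γ (Kop (2 • inW Γ i) θ) (Lop (spS k w i) 0 F) +
        hmul k w Γ (Lop (spS k w i) 0 θ) (Kop (2 • evW i) F) := by
  refine CF_ext fun M x => ?_
  change _ = (hmul k w Γ (Kop (2 • inW Γ i) θ) (Lop (spS k w i) 0 F)).1 M x +
    (hmul k w Γ (Lop (spS k w i) 0 θ) (Kop (2 • evW i) F)).1 M x
  rw [Lop_apply, hmul_apply, hmul_apply]
  simp_rw [hmul_apply, sum_gSub_spS_prod]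
  rw [Finset.sum_add_distrib]
  congr 1
  · rw [Finset.sum_comm]
    refine Finset.sum_congr rfl fun W _ => ?_
    by_cases h : Stable x W
    · rw [Finset.sum_congr rfl fun u _ => hterm_top_prod θ F 0 u x h,
        ← Finset.mul_sum, hterm_of_stable _ _ h, Kop_apply, Lop_apply,
        sum_comp_subtype (spS k w i) W fun u => F.1 _ (tri 0 u (subPt x h)), card_hm_spS_right]
      ring
    · rw [hterm_of_not_stable _ _ h, Finset.sum_eq_zero]
      exact fun u _ => hterm_top_prod_of_not_stable θ F 0 u x h
  · rw [Finset.sum_comm]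
    refine Finset.sum_congr rfl fun W _ => ?_
    rw [← Finset.mul_sum, Finset.sum_comm]
    rw [Finset.sum_congr rfl fun σ _ => sum_hterm_shear θ F 0 x σ (fun _ _ => rfl) _,
      Finset.sum_const, nsmul_eq_mul, Finset.card_univ, ← mul_assoc, card_hom0_spS_right,
      card_hom0_spS_right]
    by_cases h : Stable x W
    · rw [sum_hterm_bot_prod θ F (fun _ _ => rfl) 0 x h, hterm_of_stable _ _ h, Kop_apply, Lop_apply,
        ← M.dim_sub_add_dim_quot W, map_add, add_comm, zpow_add₀ vv_ne_zero, ← mul_assoc,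
        inv_mul_cancel_left₀ (zpow_ne_zero _ vv_ne_zero)]
      ring
    · rw [hterm_of_not_stable _ _ h, Finset.sum_eq_zero, mul_zero]
      exact fun u _ => hterm_bot_prod_of_not_stable θ F 0 u x fun hs => h hs.1

theorem Kop_hmul (χ : (I ⊕ I → ℤ) →+ ℤ) (θ F : CF k w Γ) :
    Kop χ (hmul k w Γ θ F) = hmul k w Γ (Kop χ θ) (Kop χ F) := by
  refine CF_ext fun M x => ?_
  rw [Kop_apply, hmul_apply, hmul_apply, Finset.mul_sum]
  refine Finset.sum_congr rfl fun W _ => ?_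
  by_cases h : Stable x W
  · rw [hterm_of_stable _ _ h, hterm_of_stable _ _ h, Kop_apply, Kop_apply,
      ← M.dim_sub_add_dim_quot W, map_add, zpow_add₀ vv_ne_zero]
    ring
  · rw [hterm_of_not_stable _ _ h, hterm_of_not_stable _ _ h, mul_zero]

end Derivation

/-! ### Isomorphism classes of representations of `Q` -/

section Classes

variable {I H : Type*} {k : Type u} [Field k] [Finite k] {w : I → ℕ} {Q : Qv I H} {ε : I → Bool}

/-- The components over `Î` vanish. -/
def Unframed (N : FSp I k w) : Prop := ∀ i, Subsingleton (N.V (Sum.inr i))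

/-- The arrow h_i has one end over Î, where the spaces vanish, so these arrows impose no condition
on unframed representations. -/
theorem Unframed.hm_inr_eq {N N' : FSp I k w} (hN : Unframed N) (hN' : Unframed N') (i : I)
    (f g : N.V ((Q.hat ε).src (Sum.inr i)) →ₗ[k] N'.V ((Q.hat ε).tgt (Sum.inr i))) : f = g := by
  have h : Subsingleton (N.V ((Q.hat ε).src (Sum.inr i))) ∨
      Subsingleton (N'.V ((Q.hat ε).tgt (Sum.inr i))) := by
    cases h : ε i
    · right
      have : (Q.hat ε).tgt (Sum.inr i) = Sum.inr i := by simp [Qv.hat, h]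
      rw [this]
      exact hN' i
    · left
      have : (Q.hat ε).src (Sum.inr i) = Sum.inr i := by simp [Qv.hat, h]
      rw [this]
      exact hN i
  rcases h with h | h
  · exact LinearMap.ext fun v => by rw [Subsingleton.elim v 0, map_zero, map_zero]
  · exact LinearMap.ext fun v => Subsingleton.elim _ _

theorem Unframed.phi_eq_zero {N : FSp I k w} (hN : Unframed N) (i : I) (v : N.V (Sum.inr i)) :
    N.φ i v = 0 := by
  have := hN i
  rw [Subsingleton.elim v 0, map_zero]

theorem Unframed.of_fIso {A : Type*} {Γ : Qv (I ⊕ I) A} {N N' : FSp I k w} {c : Pt Γ N}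
    {c' : Pt Γ N'} (h : FIso Γ c c') (hN : Unframed N) : Unframed N' := by
  obtain ⟨e, -⟩ := h
  exact fun i => have := hN i; (e (Sum.inr i)).symm.injective.subsingleton

theorem unframed_sp (d : I → ℕ) : Unframed (sp k w d) := fun i => by
  change Subsingleton (Fin 0 → k)
  infer_instance

/-- A representation of `Q` on `k^d` as a representation of the enlarged quiver. -/
def spt {d : I → ℕ} (z : E Q k d) : Pt (Q.hat ε) (sp k w d)
  | Sum.inl h => (z h).mulVecLin
  | Sum.inr _ => 0

theorem fIso_spt_iff {N : FSp I k w} (hN : Unframed N) {d : I → ℕ} (c : Pt (Q.hat ε) N)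
    (z : E Q k d) : FIso (Q.hat ε) c (spt z : Pt (Q.hat ε) (sp k w d)) ↔
      ∃ φ : ∀ i, N.V (Sum.inl i) ≃ₗ[k] (Fin (d i) → k), ∀ h (v : N.V (Sum.inl (Q.src h))),
        φ (Q.tgt h) (c (Sum.inl h) v) = z h *ᵥ φ (Q.src h) v := by
  constructor
  · rintro ⟨e, -, h2⟩
    exact ⟨fun i => e (Sum.inl i), fun h v => h2 (Sum.inl h) v⟩
  · rintro ⟨φ, hφ⟩
    have h0 := unframed_sp (k := k) (w := w) d
    let e : ∀ j, N.V j ≃ₗ[k] (sp k w d).V j := fun j => match j with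
      | Sum.inl i => φ i
      | Sum.inr i => have := hN i; have := h0 i; 0
    refine ⟨e, fun i v => (hN.phi_eq_zero i v).symm, ?_⟩
    rintro (h | i) v
    · exact hφ h v
    · have h3 := hN.hm_inr_eq h0 (Q := Q) (ε := ε) i ((e ((Q.hat ε).tgt (Sum.inr i))).toLinearMap ∘ₗ c (Sum.inr i))
        (spt z (Sum.inr i) ∘ₗ (e ((Q.hat ε).src (Sum.inr i))).toLinearMap)
      exact LinearMap.congr_fun h3 v

theorem fIso_spt_spt {d : I → ℕ} {z z' : E Q k d} :
    FIso (Q.hat ε) (spt z : Pt (Q.hat ε) (sp k w d)) (spt z' : Pt (Q.hat ε) (sp k w d)) ↔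
      ∃ g, IsIso Q z z' g := by
  rw [fIso_spt_iff (unframed_sp d)]
  have key : ∀ (φ : ∀ i, (Fin (d i) → k) ≃ₗ[k] (Fin (d i) → k)) (g : ∀ i, GL (Fin (d i)) k),
      (∀ i v, (g i).1 *ᵥ v = φ i v) →
      ((∀ h v, φ (Q.tgt h) (z h *ᵥ v) = z' h *ᵥ φ (Q.src h) v) ↔ IsIso Q z z' g) := by
    intro φ g hg
    refine forall_congr' fun h => ?_
    rw [← Matrix.toLin'.injective.eq_iff, LinearMap.ext_iff]
    refine forall_congr' fun v => ?_
    rw [Matrix.toLin'_mul_apply, Matrix.toLin'_mul_apply, Matrix.toLin'_apply, Matrix.toLin'_apply,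
      Matrix.toLin'_apply, Matrix.toLin'_apply, hg, hg]
  constructor
  · rintro ⟨φ, hφ⟩
    choose g hg using fun i => exists_glEquiv (φ i)
    exact ⟨g, (key φ g hg).1 hφ⟩
  · rintro ⟨g, hg⟩
    exact ⟨fun i => glEquiv (g i), (key (fun i => glEquiv (g i)) g fun _ _ => rfl).2 hg⟩

/-- The chosen representation in a class, as a representation of the enlarged quiver. -/
abbrev rpt (w : I → ℕ) (ε : I → Bool) (α : IsoClass Q k) : Pt (Q.hat ε) (sp k w α.dim) := spt α.rep

theorem exists_fIso_rpt {N : FSp I k w} (hN : Unframed N) (c : Pt (Q.hat ε) N) :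
    ∃ α : IsoClass Q k, FIso (Q.hat ε) c (rpt w ε α) := by
  let d : I → ℕ := fun i => Module.finrank k (N.V (Sum.inl i))
  let φ : ∀ i, N.V (Sum.inl i) ≃ₗ[k] (Fin (d i) → k) := fun i =>
    LinearEquiv.ofFinrankEq _ _ (by simp [d])
  let z : E Q k d := fun h => LinearMap.toMatrix' ((φ (Q.tgt h)).toLinearMap ∘ₗ
    (c (Sum.inl h) : N.V (Sum.inl (Q.src h)) →ₗ[k] N.V (Sum.inl (Q.tgt h))) ∘ₗ
      (φ (Q.src h)).symm.toLinearMap)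
  refine ⟨⟨d, Quotient.mk _ z⟩, ?_⟩
  have h1 : FIso (Q.hat ε) c (spt z : Pt (Q.hat ε) (sp k w d)) := by
    refine (fIso_spt_iff hN c z).2 ⟨φ, fun h v => ?_⟩
    rw [LinearMap.toMatrix'_mulVec]
    change _ = φ (Q.tgt h) (c (Sum.inl h) ((φ (Q.src h)).symm (φ (Q.src h) v)))
    rw [LinearEquiv.symm_apply_apply]
  refine h1.trans (fIso_spt_spt.2 ?_)
  exact (isoSetoid Q k d).symm (Quotient.mk_out (s := isoSetoid Q k d) z)

theorem eq_of_fIso_rpt {α β : IsoClass Q k} (h : FIso (Q.hat ε) (rpt w ε α) (rpt w ε β)) :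
    α = β := by
  have h1 : α.dim = β.dim := by
    funext i
    have := congrFun h.dim_eq (Sum.inl i)
    rw [sp_dim, sp_dim] at this
    exact_mod_cast this
  obtain ⟨n, a⟩ := α
  obtain ⟨m, b⟩ := β
  obtain rfl : n = m := h1
  have h2 : (isoSetoid Q k n).r a.out b.out := fIso_spt_spt.1 h
  have h3 : a = b := by
    rw [← Quotient.out_eq a, ← Quotient.out_eq b]
    exact Quotient.sound h2
  rw [h3]

open Classical in
/-- The characteristic function of an isomorphism class. -/
def ind (w : I → ℕ) (ε : I → Bool) (α : IsoClass Q k) : CF k w (Q.hat ε) :=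
  ⟨fun _ c => if FIso (Q.hat ε) c (rpt w ε α) then 1 else 0, fun _ _ _ _ h => by
    refine if_congr ⟨fun h' => h.symm.trans h', fun h' => h.trans h'⟩ rfl rfl⟩

open Classical in
theorem ind_apply (α : IsoClass Q k) (N : FSp I k w) (c : Pt (Q.hat ε) N) :
    (ind w ε α).1 N c = if FIso (Q.hat ε) c (rpt w ε α) then 1 else 0 := rfl

theorem ind_of_fIso {α β : IsoClass Q k} {N : FSp I k w} {c : Pt (Q.hat ε) N}
    (h : FIso (Q.hat ε) c (rpt w ε α)) [Decidable (β = α)] :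
    (ind w ε β).1 N c = if β = α then 1 else 0 := by
  classical
  rw [ind_apply]
  refine (if_congr ⟨fun h' => eq_of_fIso_rpt (h'.symm.trans h), ?_⟩ rfl rfl)
  rintro rfl
  exact h

theorem ind_of_not_unframed {α : IsoClass Q k} {N : FSp I k w} {c : Pt (Q.hat ε) N}
    (h : ¬ Unframed N) : (ind w ε α).1 N c = 0 :=
  if_neg fun h' => h (Unframed.of_fIso h'.symm (unframed_sp _))

/-- A function supported on finitely many classes is a combination of characteristic functions. -/
theorem eq_sum_ind {θ : CF k w (Q.hat ε)} (h0 : ∀ N c, ¬ Unframed N → θ.1 N c = 0)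
    (T : Finset (IsoClass Q k)) (hT : ∀ α, θ.1 _ (rpt w ε α) ≠ 0 → α ∈ T) :
    θ = ∑ α ∈ T, θ.1 _ (rpt w ε α) • ind w ε α := by
  classical
  refine CF_ext fun N c => ?_
  have h1 : (∑ α ∈ T, θ.1 _ (rpt w ε α) • ind w ε α : CF k w (Q.hat ε)).1 N c =
      ∑ α ∈ T, θ.1 _ (rpt w ε α) * (ind w ε α).1 N c := by
    rw [Submodule.coe_sum, Finset.sum_apply, Finset.sum_apply]
    rfl
  rw [h1]
  by_cases hN : Unframed N
  · obtain ⟨α, hα⟩ := exists_fIso_rpt hN c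
    rw [CF_iso θ hα]
    simp_rw [ind_of_fIso hα, mul_ite, mul_one, mul_zero, Finset.sum_ite_eq']
    split_ifs with h
    · rfl
    · exact by_contra fun h2 => h (hT α h2)
  · rw [h0 N c hN]
    exact (Finset.sum_eq_zero fun α _ => by rw [ind_of_not_unframed hN, mul_zero]).symm

theorem finite_dim_eq [Finite H] [Finite I] (d : I → ℕ) : {α : IsoClass Q k | α.dim = d}.Finite := by
  have h1 : Finite (E Q k d) := Pi.finite
  have h2 : Finite (Quotient (isoSetoid Q k d)) := Quotient.finite _
  refine (Set.finite_range fun a : Quotient (isoSetoid Q k d) => (⟨d, a⟩ : IsoClass Q k)).subset ?_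
  rintro ⟨n, a⟩ h
  obtain rfl : n = d := h
  exact ⟨a, rfl⟩

/-- The automorphism group of a representation. -/
def aut {A : Type*} {Γ : Qv (I ⊕ I) A} {N : FSp I k w} (c : Pt Γ N) : ℕ :=
  Nat.card {e : ∀ j, N.V j ≃ₗ[k] N.V j // IsoMap Γ c c e}

theorem aut_rpt (α : IsoClass Q k) : aut (rpt w ε α) = α.autCard := by
  symm
  have h0 := unframed_sp (k := k) (w := w) α.dim
  let f : {g : ∀ i, GL (Fin (α.dim i)) k // IsIso Q α.rep α.rep g} →
      (∀ j, (sp k w α.dim).V j ≃ₗ[k] (sp k w α.dim).V j) := fun g j => match j with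
    | Sum.inl i => glEquiv (g.1 i)
    | Sum.inr i => LinearEquiv.refl _ _
  have hf : ∀ g, IsoMap (Q.hat ε) (rpt w ε α) (rpt w ε α) (f g) := by
    intro g
    refine ⟨fun i v => rfl, ?_⟩
    rintro (h | i) v
    · have key : ∀ v : Fin (α.dim (Q.src h)) → k,
          (g.1 (Q.tgt h)).1 *ᵥ (α.rep h *ᵥ v) = α.rep h *ᵥ ((g.1 (Q.src h)).1 *ᵥ v) := by
        intro v
        rw [Matrix.mulVec_mulVec, Matrix.mulVec_mulVec, g.2 h]
      exact key v
    · exact LinearMap.congr_fun (h0.hm_inr_eq h0 (Q := Q) (ε := ε) i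
        ((f g ((Q.hat ε).tgt (Sum.inr i))).toLinearMap ∘ₗ spt α.rep (Sum.inr i))
        (spt α.rep (Sum.inr i) ∘ₗ (f g ((Q.hat ε).src (Sum.inr i))).toLinearMap)) v
  refine Nat.card_eq_of_bijective (fun g => ⟨f g, hf g⟩) ⟨fun g g' h => ?_, fun e => ?_⟩
  · refine Subtype.ext (funext fun i => Units.ext (Matrix.toLin'.injective (LinearMap.ext fun v => ?_)))
    exact congrArg (fun t : {e : ∀ j, (sp k w α.dim).V j ≃ₗ[k] (sp k w α.dim).V j //
      IsoMap (Q.hat ε) (rpt w ε α) (rpt w ε α) e} => t.1 (Sum.inl i) v) h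
  · choose g hg using fun i => exists_glEquiv (k := k) (m := α.dim i) (e.1 (Sum.inl i))
    have hg' : IsIso Q α.rep α.rep g := by
      intro h
      refine Matrix.toLin'.injective (LinearMap.ext fun v => ?_)
      rw [Matrix.toLin'_mul_apply, Matrix.toLin'_mul_apply, Matrix.toLin'_apply, Matrix.toLin'_apply,
        Matrix.toLin'_apply, Matrix.toLin'_apply, hg, hg]
      exact e.2.2 (Sum.inl h) v
    refine ⟨⟨g, hg'⟩, Subtype.ext (funext fun j => ?_)⟩
    rcases j with i | i
    · exact LinearEquiv.ext fun v => hg i v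
    · have := h0 i
      exact LinearEquiv.ext fun v => Subsingleton.elim _ _

theorem autCard_ne_zero [Finite I] (α : IsoClass Q k) : (α.autCard : ℂ) ≠ 0 := by
  have h1 : Nonempty {g : ∀ i, GL (Fin (α.dim i)) k // IsIso Q α.rep α.rep g} :=
    ⟨⟨fun _ => 1, fun h => by simp⟩⟩
  have h2 : Finite {g : ∀ i, GL (Fin (α.dim i)) k // IsIso Q α.rep α.rep g} := Subtype.finite
  exact Nat.cast_ne_zero.2 Nat.card_pos.ne'

end Classes

/-! ### Hall numbers as values of the Hall product -/

section HallNumber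

variable {I H : Type*} {k : Type u} [Field k] [Fintype k] {w : I → ℕ} {Q : Qv I H} {ε : I → Bool}
variable [Fintype H] [DecidableEq H] [Fintype I] [DecidableEq I]

theorem hallNumber_eq (α β γ : IsoClass Q k) : (hallNumber α β γ : ℂ) =
    (hmul k w (Q.hat ε) (ind w ε α) (ind w ε β)).1 _ (rpt w ε γ) := by
  classical
  have h0 := unframed_sp (k := k) (w := w) γ.dim
  let f : (∀ i, Submodule k (Fin (γ.dim i) → k)) ≃ GSub (sp k w γ.dim) :=
    { toFun := fun W j => match j with
        | Sum.inl i => W i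
        | Sum.inr _ => ⊥
      invFun := fun W i => W (Sum.inl i)
      left_inv := fun W => rfl
      right_inv := fun W => by
        funext j
        rcases j with i | i
        · rfl
        · have := h0 i
          exact (Submodule.eq_bot_of_subsingleton).symm }
  rw [hmul_apply, hallNumber, Nat.card_eq_fintype_card, Fintype.card_subtype, ← Finset.sum_boole]
  refine Fintype.sum_equiv f _ _ fun W => ?_
  have hs : Stable (rpt w ε γ) (f W) ↔ IsStable Q γ.rep W := by
    constructor
    · exact fun h a v hv => h (Sum.inl a) v hv
    · rintro h (a | i) v hv
      · exact h a v hv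
      · exact Submodule.zero_mem _
  by_cases h : IsStable Q γ.rep W
  · have h' := hs.2 h
    have hu1 : Unframed ((sp k w γ.dim).quot (f W)) := fun i =>
      have := h0 i; (Submodule.mkQ_surjective _).subsingleton
    have hu2 : Unframed ((sp k w γ.dim).sub (f W)) := fun i =>
      have := h0 i; (Submodule.injective_subtype _).subsingleton
    have hq : QuotIso Q γ.rep W α.rep ↔ FIso (Q.hat ε) (quotPt (rpt w ε γ) h') (rpt w ε α) := by
      rw [fIso_spt_iff hu1]
      refine (and_iff_right h).trans (exists_congr fun φ => forall_congr' fun a => ?_)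
      constructor
      · intro hφ v
        obtain ⟨v, rfl⟩ := Submodule.Quotient.mk_surjective _ v
        exact hφ v
      · exact fun hφ v => hφ (Submodule.Quotient.mk v)
    have hsub : SubIso Q γ.rep W β.rep ↔ FIso (Q.hat ε) (subPt (rpt w ε γ) h') (rpt w ε β) := by
      rw [fIso_spt_iff hu2]
      refine (and_iff_right h).trans (exists_congr fun φ => forall_congr' fun a => ?_)
      refine forall_congr' fun v => ⟨fun hφ => hφ _ rfl, fun hφ v' hv' => ?_⟩
      have e : v' = subPt (rpt w ε γ) h' (Sum.inl a) v := Subtype.ext hv'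
      rw [e]
      exact hφ
    rw [hterm_of_stable _ _ h', ind_apply, ind_apply]
    simp only [← hq, ← hsub]
    by_cases h1 : SubIso Q γ.rep W β.rep <;> by_cases h2 : QuotIso Q γ.rep W α.rep <;> simp [h1, h2]
  · rw [hterm_of_not_stable _ _ (mt hs.1 h), if_neg fun h2 => h h2.1.1]

theorem hmul_ind_of_not_unframed (α β : IsoClass Q k) (N : FSp I k w) (c : Pt (Q.hat ε) N)
    (hN : ¬ Unframed N) : (hmul k w (Q.hat ε) (ind w ε α) (ind w ε β)).1 N c = 0 := by
  rw [hmul_apply]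
  refine Finset.sum_eq_zero fun W _ => ?_
  by_cases h : Stable c W
  · rw [hterm_of_stable _ _ h]
    by_cases h1 : Unframed (N.quot W)
    · by_cases h2 : Unframed (N.sub W)
      · refine absurd (fun i => ⟨fun u v => ?_⟩) hN
        have h3 := h1 i
        have h4 := h2 i
        have key : ∀ v : N.V (Sum.inr i), v = 0 := fun v => by
          have hv : v ∈ W (Sum.inr i) := by
            rw [← Submodule.Quotient.mk_eq_zero]
            exact h3.elim _ _
          exact congrArg Subtype.val (h4.elim ⟨v, hv⟩ ⟨0, Submodule.zero_mem _⟩)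
        rw [key u, key v]
      · rw [ind_of_not_unframed h2, mul_zero]
    · rw [ind_of_not_unframed h1, zero_mul]
  · exact hterm_of_not_stable _ _ h

end HallNumber

/-! ### The number of extensions in a given class -/

section Triangular

variable {k P N M : Type*} [Field k] [AddCommGroup P] [Module k P] [AddCommGroup N] [Module k N]
  [AddCommGroup M] [Module k M] {W : Submodule k M}

/-- A splitting of a subspace. -/
def IsSplitting (W : Submodule k M) (θ : (W × (M ⧸ W)) ≃ₗ[k] M) : Prop :=
  ∀ s, θ (s, 0) = s ∧ ∀ t, Submodule.Quotient.mk (θ (s, t)) = t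

theorem exists_isSplitting (W : Submodule k M) : ∃ θ, IsSplitting W θ := by
  obtain ⟨C, hC⟩ := Submodule.exists_isCompl W
  refine ⟨(LinearEquiv.prodCongr (LinearEquiv.refl k W) (W.quotientEquivOfIsCompl C hC)).trans
    (Submodule.prodEquivOfIsCompl W C hC), fun s => ⟨by simp, fun t => ?_⟩⟩
  have h1 : ((LinearEquiv.prodCongr (LinearEquiv.refl k W) (W.quotientEquivOfIsCompl C hC)).trans
    (Submodule.prodEquivOfIsCompl W C hC)) (s, t) = (s : M) + (W.quotientEquivOfIsCompl C hC t : M) := by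
    simp
  rw [h1, Submodule.Quotient.mk_add, (Submodule.Quotient.mk_eq_zero W).2 s.2, zero_add,
    Submodule.mk_quotientEquivOfIsCompl_apply]

/-- The isomorphism adapted to a splitting with given diagonal blocks and unipotent part. -/
def triE (θ : (W × (M ⧸ W)) ≃ₗ[k] M) (f : P ≃ₗ[k] W) (g : (M ⧸ W) ≃ₗ[k] N) (σ : N →ₗ[k] P) :
    (P × N) ≃ₗ[k] M :=
  (shear σ).trans ((LinearEquiv.prodCongr f g.symm).trans θ)

theorem triE_apply (θ : (W × (M ⧸ W)) ≃ₗ[k] M) (f : P ≃ₗ[k] W) (g : (M ⧸ W) ≃ₗ[k] N)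
    (σ : N →ₗ[k] P) (t : P × N) : triE θ f g σ t = θ (f (t.1 + σ t.2), g.symm t.2) := rfl

variable {θ : (W × (M ⧸ W)) ≃ₗ[k] M}

theorem IsSplitting.triE_inl (h : IsSplitting W θ) (f : P ≃ₗ[k] W) (g : (M ⧸ W) ≃ₗ[k] N)
    (σ : N →ₗ[k] P) (t : P) : triE θ f g σ (t, 0) = f t := by
  rw [triE_apply, map_zero, map_zero, add_zero, (h _).1]

theorem IsSplitting.mk_triE (h : IsSplitting W θ) (f : P ≃ₗ[k] W) (g : (M ⧸ W) ≃ₗ[k] N)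
    (σ : N →ₗ[k] P) (t : P × N) :
    g (Submodule.Quotient.mk (triE θ f g σ t)) = t.2 := by
  rw [triE_apply, (h _).2, LinearEquiv.apply_symm_apply]

theorem IsSplitting.range_triE (h : IsSplitting W θ) (f : P ≃ₗ[k] W) (g : (M ⧸ W) ≃ₗ[k] N)
    (σ : N →ₗ[k] P) :
    LinearMap.range ((triE θ f g σ).toLinearMap ∘ₗ LinearMap.inl k P N) = W := by
  ext v
  constructor
  · rintro ⟨t, rfl⟩
    change triE θ f g σ (t, 0) ∈ W
    rw [h.triE_inl]
    exact (f t).2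
  · intro hv
    refine ⟨f.symm ⟨v, hv⟩, ?_⟩
    change triE θ f g σ (_, 0) = v
    rw [h.triE_inl]
    exact congrArg Subtype.val (f.apply_symm_apply ⟨v, hv⟩)

theorem IsSplitting.triE_injective (h : IsSplitting W θ) {f f' : P ≃ₗ[k] W}
    {g g' : (M ⧸ W) ≃ₗ[k] N} {σ σ' : N →ₗ[k] P} (he : triE θ f g σ = triE θ f' g' σ') :
    f = f' ∧ g = g' ∧ σ = σ' := by
  have h1 : f = f' := LinearEquiv.ext fun t => Subtype.ext <| by
    rw [← h.triE_inl f g σ, ← h.triE_inl f' g' σ', he]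
  have h2 : ∀ n, (f (σ n), g.symm n) = (f' (σ' n), g'.symm n) := fun n => by
    have := LinearEquiv.congr_fun he (0, n)
    rw [triE_apply, triE_apply, zero_add, zero_add] at this
    exact θ.injective this
  refine ⟨h1, ?_, LinearMap.ext fun n => ?_⟩
  · have : g.symm = g'.symm := LinearEquiv.ext fun n => congrArg Prod.snd (h2 n)
    rw [← LinearEquiv.symm_symm g, this, LinearEquiv.symm_symm]
  · subst h1
    exact f.injective (congrArg Prod.fst (h2 n))

/-- Together with `IsSplitting.triE_injective` this shows that isomorphisms from P ⊕ N to M taking P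
onto W correspond to triples: an isomorphism of P with W, one of M/W with N, and an arbitrary map N
→ P. -/
theorem IsSplitting.exists_triE (h : IsSplitting W θ) (e : (P × N) ≃ₗ[k] M)
    (he : LinearMap.range (e.toLinearMap ∘ₗ LinearMap.inl k P N) = W) :
    ∃ f g σ, triE θ f g σ = e := by
  have hi : Function.Injective (e.toLinearMap ∘ₗ LinearMap.inl k P N) :=
    e.injective.comp LinearMap.inl_injective
  let f : P ≃ₗ[k] W := (LinearEquiv.ofInjective _ hi).trans (LinearEquiv.ofEq _ _ he)
  have hf : ∀ t, (f t : M) = e (t, 0) := fun t => rfl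
  let g' : N →ₗ[k] M ⧸ W := W.mkQ ∘ₗ e.toLinearMap ∘ₗ LinearMap.inr k P N
  have hg' : Function.Bijective g' := by
    constructor
    · rw [← LinearMap.ker_eq_bot, LinearMap.ker_eq_bot']
      intro n hn
      have h1 : e (0, n) ∈ W := (Submodule.Quotient.mk_eq_zero W).1 hn
      rw [← he] at h1
      obtain ⟨t, ht⟩ := h1
      have h2 : (t, (0 : N)) = (0, n) := e.injective ht
      exact (congrArg Prod.snd h2).symm
    · intro v
      obtain ⟨v, rfl⟩ := Submodule.Quotient.mk_surjective _ v
      obtain ⟨t, rfl⟩ := e.surjective v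
      refine ⟨t.2, ?_⟩
      change Submodule.Quotient.mk (e (0, t.2)) = _
      rw [eq_comm, Submodule.Quotient.eq, ← map_sub]
      have : t - (0, t.2) = (t.1, 0) := by ext <;> simp
      rw [this, ← hf]
      exact (f t.1).2
  refine ⟨f, (LinearEquiv.ofBijective g' hg').symm,
    f.symm.toLinearMap ∘ₗ LinearMap.fst k _ _ ∘ₗ θ.symm.toLinearMap ∘ₗ e.toLinearMap ∘ₗ
      LinearMap.inr k P N, LinearEquiv.ext fun t => ?_⟩
  rw [triE_apply, map_add]
  change θ (f t.1 + f (f.symm (θ.symm (e (0, t.2))).1), g' t.2) = _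
  rw [LinearEquiv.apply_symm_apply]
  have h3 : g' t.2 = (θ.symm (e (0, t.2))).2 := by
    change Submodule.Quotient.mk (e (0, t.2)) = _
    conv_lhs => rw [← θ.apply_symm_apply (e (0, t.2))]
    exact (h _).2 _
  rw [h3]
  have h4 : (f t.1 + (θ.symm (e (0, t.2))).1, (θ.symm (e (0, t.2))).2) =
      (f t.1, 0) + θ.symm (e (0, t.2)) := by ext <;> simp
  rw [h4, map_add, (h _).1, LinearEquiv.apply_symm_apply, hf, ← map_add]
  congr 1
  ext <;> simp

end Triangular

/-! ### Counting isomorphisms from extensions to a fixed representation -/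

section Riedtmann

variable {I A : Type*} {k : Type u} [Field k] [Finite k] {w : I → ℕ} {Γ : Qv (I ⊕ I) A}

/-- The number of isomorphisms between two representations. -/
def isoCard {M M' : FSp I k w} (x : Pt Γ M) (x' : Pt Γ M') : ℕ := Nat.card {e // IsoMap Γ x x' e}

theorem isoCard_of_fIso {M M' : FSp I k w} {x : Pt Γ M} {x' : Pt Γ M'} (h : FIso Γ x x') :
    isoCard x x' = aut x' := by
  obtain ⟨e, he⟩ := h
  refine Nat.card_congr ⟨fun f => ⟨_, he.symm.trans f.2⟩, fun f => ⟨_, he.trans f.2⟩, fun f => ?_,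
    fun f => ?_⟩
  · refine Subtype.ext (funext fun j => LinearEquiv.ext fun v => ?_)
    exact congrArg (f.1 j) ((e j).symm_apply_apply v)
  · refine Subtype.ext (funext fun j => LinearEquiv.ext fun v => ?_)
    exact congrArg (f.1 j) ((e j).apply_symm_apply v)

theorem isoCard_symm {M M' : FSp I k w} (x : Pt Γ M) (x' : Pt Γ M') :
    isoCard x x' = isoCard x' x :=
  Nat.card_congr ⟨fun f => ⟨_, f.2.symm⟩, fun f => ⟨_, f.2.symm⟩, fun _ => rfl, fun _ => rfl⟩

theorem isoCard_of_not_fIso {M M' : FSp I k w} {x : Pt Γ M} {x' : Pt Γ M'} (h : ¬ FIso Γ x x') :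
    isoCard x x' = 0 :=
  Nat.card_eq_zero.2 (Or.inl ⟨fun e => h ⟨e.1, e.2⟩⟩)

variable {M N P : FSp I k w}

/-- The graded isomorphism `e` embeds `p` as a subrepresentation with quotient `c`. -/
def Adapted (p : Pt Γ P) (c : Pt Γ N) (x : Pt Γ M) (e : ∀ j, (P.prod N).V j ≃ₗ[k] M.V j) : Prop :=
  (∀ a v, e _ (p a v, 0) = x a (e _ (v, 0))) ∧
    ∀ a t, ((e _).symm (x a (e _ t))).2 = c a t.2

/-- The diagonal blocks are conditions on e, while the off-diagonal block u is determined by e. So u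
may be eliminated from the count. -/
theorem isoMap_tri_iff (hM : Unframed M) (hN : Unframed N) (hP : Unframed P) {p : Pt Γ P}
    {c : Pt Γ N} {x : Pt Γ M} {e : ∀ j, (P.prod N).V j ≃ₗ[k] M.V j} {u : Hm Γ N P} :
    IsoMap Γ (tri p u c) x e ↔ Adapted p c x e ∧
      ∀ a n, u a n = ((e _).symm (x a (e _ (0, n)))).1 := by
  constructor
  · rintro ⟨-, h⟩
    refine ⟨⟨fun a v => ?_, fun a t => ?_⟩, fun a n => ?_⟩
    · have : tri p u c a (v, 0) = (p a v, 0) := by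
        rw [tri_apply, map_zero, map_zero, add_zero]
      rw [← this, h]
    · rw [← h, LinearEquiv.symm_apply_apply]
      rfl
    · rw [← h, LinearEquiv.symm_apply_apply, tri_apply, map_zero, zero_add]
  · rintro ⟨⟨h1, h2⟩, h3⟩
    refine ⟨fun i v => ?_, fun a t => ?_⟩
    · rw [hM.phi_eq_zero]
      change _ = P.φ i v.1 + N.φ i v.2
      rw [hP.phi_eq_zero, hN.phi_eq_zero, add_zero]
    · have h4 : t = (t.1, 0) + (0, t.2) := Prod.ext (add_zero _).symm (zero_add _).symm
      have h5 : tri p u c a t = (p a t.1, 0) + (u a t.2, c a t.2) :=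
        Prod.ext rfl (zero_add _).symm
      have h6 : (u a t.2, c a t.2) = (e _).symm (x a (e _ (0, t.2))) := by
        refine Prod.ext (h3 a t.2) ?_
        exact (h2 a (0, t.2)).symm
      rw [h5, map_add, h1, h6, LinearEquiv.apply_symm_apply]
      conv_rhs => rw [h4, map_add, map_add]

/-- The off-diagonal part determined by an adapted isomorphism. -/
def offDiag (x : Pt Γ M) (e : ∀ j, (P.prod N).V j ≃ₗ[k] M.V j) : Hm Γ N P := fun a =>
  LinearMap.fst k (P.V (Γ.tgt a)) (N.V (Γ.tgt a)) ∘ₗ (e (Γ.tgt a)).symm.toLinearMap ∘ₗ x a ∘ₗ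
    (e (Γ.src a)).toLinearMap ∘ₗ LinearMap.inr k (P.V (Γ.src a)) (N.V (Γ.src a))

variable [Fintype A] [DecidableEq A] [Fintype I] [DecidableEq I]

theorem sum_isoCard_tri (hM : Unframed M) (hN : Unframed N) (hP : Unframed P) (p : Pt Γ P)
    (c : Pt Γ N) (x : Pt Γ M) :
    ∑ u, isoCard (tri p u c) x = Nat.card {e // Adapted p c x e} := by
  refine (Nat.card_sigma (β := fun u => {e // IsoMap Γ (tri p u c) x e})).symm.trans ?_
  refine Nat.card_congr ⟨fun s => ⟨s.2.1, ((isoMap_tri_iff hM hN hP).1 s.2.2).1⟩,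
    fun e => ⟨offDiag x e.1, e.1, (isoMap_tri_iff hM hN hP).2 ⟨e.2, fun _ _ => rfl⟩⟩, ?_, fun _ => rfl⟩
  rintro ⟨u, e, he⟩
  have h := ((isoMap_tri_iff hM hN hP).1 he).2
  obtain rfl : u = offDiag x e := funext fun a => LinearMap.ext fun n => h a n
  rfl

/-- The image of the first summand. -/
def headRange (e : ∀ j, (P.prod N).V j ≃ₗ[k] M.V j) : GSub M :=
  fun j => LinearMap.range ((e j).toLinearMap ∘ₗ LinearMap.inl k (P.V j) (N.V j))

theorem Adapted.stable {p : Pt Γ P} {c : Pt Γ N} {x : Pt Γ M}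
    {e : ∀ j, (P.prod N).V j ≃ₗ[k] M.V j} (h : Adapted p c x e) : Stable x (headRange e) := by
  rintro a _ ⟨v, rfl⟩
  exact ⟨p a v, h.1 a v⟩

/-- In the coordinates of `triE` being adapted constrains only the two diagonal blocks; the
unipotent part is free and contributes |Hom(N, P)|. -/
theorem card_adapted_headRange (hM : Unframed M) (hN : Unframed N) (hP : Unframed P) (p : Pt Γ P)
    (c : Pt Γ N) (x : Pt Γ M) {W : GSub M} (h : Stable x W) :
    Nat.card {e : {e // Adapted p c x e} // headRange e.1 = W} =
      isoCard p (subPt x h) * isoCard (quotPt x h) c * Fintype.card (Hom0 N P) := by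
  choose θ hθ using fun j => exists_isSplitting (W j)
  have key : ∀ (f : ∀ j, P.V j ≃ₗ[k] W j) (g : ∀ j, (M.V j ⧸ W j) ≃ₗ[k] N.V j) (σ : Hom0 N P),
      Adapted p c x (fun j => triE (θ j) (f j) (g j) (σ j)) ↔
        IsoMap Γ p (subPt x h) f ∧ IsoMap Γ (quotPt x h) c g := by
    intro f g σ
    have h2 : ∀ j v, ((triE (θ j) (f j) (g j) (σ j)).symm v).2 = g j (Submodule.Quotient.mk v) := by
      intro j v
      rw [← (hθ j).mk_triE (f j) (g j) (σ j), LinearEquiv.apply_symm_apply]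
    refine and_congr ?_ ?_
    · constructor
      · intro h1
        refine ⟨fun i v => ?_, fun a v => Subtype.ext ?_⟩
        · rw [hP.phi_eq_zero]
          exact hM.phi_eq_zero _ _
        · have := h1 a v
          rw [(hθ _).triE_inl, (hθ _).triE_inl] at this
          exact this
      · intro h1 a v
        rw [(hθ _).triE_inl, (hθ _).triE_inl]
        exact congrArg Subtype.val (h1.2 a v)
    · constructor
      · intro h1
        refine ⟨fun i v => hN.phi_eq_zero _ _, fun a v => ?_⟩
        obtain ⟨v, rfl⟩ := Submodule.Quotient.mk_surjective _ v
        have := h1 a ((triE (θ _) (f _) (g _) (σ _)).symm v)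
        rw [LinearEquiv.apply_symm_apply, h2, h2] at this
        exact this
      · intro h1 a t
        rw [h2]
        refine (h1.2 a (Submodule.Quotient.mk (triE (θ _) (f _) (g _) (σ _) t))).trans ?_
        rw [(hθ _).mk_triE]
  rw [isoCard, isoCard, ← Nat.card_eq_fintype_card, ← Nat.card_prod, ← Nat.card_prod]
  symm
  refine Nat.card_eq_of_bijective (fun s => ⟨⟨fun j => triE (θ j) (s.1.1.1 j) (s.1.2.1 j) (s.2 j),
    (key _ _ _).2 ⟨s.1.1.2, s.1.2.2⟩⟩, funext fun j => (hθ j).range_triE _ _ _⟩) ⟨?_, ?_⟩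
  · rintro ⟨⟨f, g⟩, σ⟩ ⟨⟨f', g'⟩, σ'⟩ hs
    have h1 : ∀ j, triE (θ j) (f.1 j) (g.1 j) (σ j) = triE (θ j) (f'.1 j) (g'.1 j) (σ' j) :=
      fun j => congrFun (congrArg (fun s : {e : {e // Adapted p c x e} // headRange e.1 = W} =>
        s.1.1) hs) j
    have h2 := fun j => (hθ j).triE_injective (h1 j)
    refine Prod.ext (Prod.ext (Subtype.ext (funext fun j => (h2 j).1))
      (Subtype.ext (funext fun j => (h2 j).2.1))) (funext fun j => (h2 j).2.2)
  · rintro ⟨⟨e, he⟩, hW⟩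
    choose f g σ hs using fun j => (hθ j).exists_triE (e j) (congrFun hW j)
    obtain rfl : (fun j => triE (θ j) (f j) (g j) (σ j)) = e := funext hs
    have h1 := (key f g σ).1 he
    exact ⟨⟨⟨⟨f, h1.1⟩, ⟨g, h1.2⟩⟩, σ⟩, rfl⟩

/-- Adapted isomorphisms are sorted by the image of P, which is always a stable subspace. -/
theorem card_adapted (hM : Unframed M) (hN : Unframed N) (hP : Unframed P) (p : Pt Γ P)
    (c : Pt Γ N) (x : Pt Γ M) [∀ W : GSub M, Decidable (Stable x W)] :
    Nat.card {e // Adapted p c x e} = ∑ W : GSub M, if h : Stable x W then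
      isoCard p (subPt x h) * isoCard (quotPt x h) c * Fintype.card (Hom0 N P) else 0 := by
  rw [Nat.card_congr (Equiv.sigmaFiberEquiv fun e : {e // Adapted p c x e} => headRange e.1).symm,
    Nat.card_sigma]
  refine Finset.sum_congr rfl fun W _ => ?_
  split_ifs with h
  · exact card_adapted_headRange hM hN hP p c x h
  · refine Nat.card_eq_zero.2 (Or.inl ⟨fun e => h ?_⟩)
    rw [← e.2]
    exact e.1.2.stable

end Riedtmann

/-! ### Riedtmann's formula and extensions by simple representations -/

section Classes

variable {I H : Type*} {k : Type u} [Field k] [Fintype k] {w : I → ℕ} {Q : Qv I H} {ε : I → Bool}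
variable [Fintype H] [DecidableEq H] [Fintype I] [DecidableEq I]

theorem isoCard_eq_ind {M N : FSp I k w} {c : Pt (Q.hat ε) N} {γ : IsoClass Q k}
    (h : FIso (Q.hat ε) c (rpt w ε γ)) (x : Pt (Q.hat ε) M) :
    (isoCard x c : ℂ) = (ind w ε γ).1 _ x * γ.autCard := by
  rw [ind_apply]
  split_ifs with hx
  · rw [one_mul, isoCard_symm, isoCard_of_fIso (h.trans hx.symm), ← isoCard_of_fIso (h.trans hx.symm),
      isoCard_symm, isoCard_of_fIso (hx.trans h.symm), ← isoCard_of_fIso h.symm, isoCard_symm,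
      isoCard_of_fIso h, aut_rpt]
  · rw [zero_mul, isoCard_of_not_fIso fun h' => hx (h'.trans h), Nat.cast_zero]

/-- Riedtmann's formula. -/
theorem sum_ind_tri {N P : FSp I k w} {c : Pt (Q.hat ε) N} {p : Pt (Q.hat ε) P} {β γ : IsoClass Q k}
    (hc : FIso (Q.hat ε) c (rpt w ε γ)) (hp : FIso (Q.hat ε) p (rpt w ε β)) (α : IsoClass Q k) :
    (∑ u, (ind w ε α).1 _ (tri p u c)) * (α.autCard : ℂ) =
      hallNumber γ β α * (γ.autCard * β.autCard * Fintype.card (Hom0 N P)) := by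
  classical
  have hM := unframed_sp (k := k) (w := w) α.dim
  have hN : Unframed N := Unframed.of_fIso hc.symm (unframed_sp _)
  have hP : Unframed P := Unframed.of_fIso hp.symm (unframed_sp _)
  rw [Finset.sum_mul]
  simp_rw [← isoCard_eq_ind (FIso.refl (rpt w ε α))]
  rw [← Nat.cast_sum, sum_isoCard_tri hM hN hP, card_adapted hM hN hP, hallNumber_eq (w := w)
    (ε := ε), hmul_apply, Nat.cast_sum, Finset.sum_mul]
  refine Finset.sum_congr rfl fun W _ => ?_
  by_cases h : Stable (rpt w ε α) W
  · rw [dif_pos h, hterm_of_stable _ _ h, Nat.cast_mul, Nat.cast_mul, isoCard_symm,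
      isoCard_eq_ind hp, isoCard_eq_ind hc]
    ring
  · rw [dif_neg h, hterm_of_not_stable _ _ h, Nat.cast_zero, zero_mul]

theorem hat_src_ne_tgt (hQ : ∀ h, Q.src h ≠ Q.tgt h) (a : H ⊕ I) :
    (Q.hat ε).src a ≠ (Q.hat ε).tgt a := by
  rcases a with h | i
  · exact fun e => hQ h (Sum.inl_injective e)
  · cases h : ε i <;> simp [Qv.hat, h]

variable (w ε) in
theorem fIso_simple (i : I) (c : Pt (Q.hat ε) (spS k w i)) (hQ : ∀ h, Q.src h ≠ Q.tgt h) :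
    FIso (Q.hat ε) c (rpt w ε (IsoClass.simple Q k i)) := by
  have h1 : ∀ a, (Q.hat ε).src a ≠ (Q.hat ε).tgt a := hat_src_ne_tgt hQ
  have h2 : (rpt w ε (IsoClass.simple Q k i) : Pt (Q.hat ε) (spS k w i)) = c :=
    (pt_spS_eq_zero h1 _).trans (pt_spS_eq_zero h1 _).symm
  exact h2 ▸ FIso.refl _

theorem autCard_simple (hQ : ∀ h, Q.src h ≠ Q.tgt h) (i : I) :
    ((IsoClass.simple Q k i).autCard : ℂ) = Fintype.card k - 1 := by
  have h1 : ∀ g, IsIso Q (IsoClass.simple Q k i).rep (IsoClass.simple Q k i).rep g := by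
    intro g h
    have h2 : IsEmpty (Fin ((IsoClass.simple Q k i).dim (Q.src h))) ∨
        IsEmpty (Fin ((IsoClass.simple Q k i).dim (Q.tgt h))) := by
      by_cases h3 : Q.src h = i
      · right
        have : Q.tgt h ≠ i := fun h4 => hQ h (h3.trans h4.symm)
        simp only [IsoClass.simple, IsoClass.dim, Pi.single_apply, if_neg this]
        infer_instance
      · left
        simp only [IsoClass.simple, IsoClass.dim, Pi.single_apply, if_neg h3]
        infer_instance
    rcases h2 with h2 | h2
    · ext a b
      exact isEmptyElim b
    · ext a b
      exact isEmptyElim a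
  rw [IsoClass.autCard, Nat.card_congr (Equiv.subtypeUnivEquiv h1), Nat.card_pi,
    Finset.prod_eq_single i]
  · have h2 : (IsoClass.simple Q k i).dim i = 1 := Pi.single_eq_same _ _
    rw [h2, Matrix.card_GL_field]
    simp [Nat.cast_pred (R := ℂ) (Fintype.card_pos (α := k))]
  · intro j _ hj
    have h2 : (IsoClass.simple Q k i).dim j = 0 := Pi.single_eq_of_ne hj _
    rw [h2, Matrix.card_GL_field]
    simp
  · exact fun h => absurd (Finset.mem_univ i) h

theorem hallNumber_dim {α β γ : IsoClass Q k} (h : hallNumber α β γ ≠ 0) :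
    α.dim + β.dim = γ.dim := by
  obtain ⟨W, ⟨-, φ, -⟩, ⟨-, φ', -⟩⟩ := (Nat.card_ne_zero.1 h).1
  funext i
  have h1 := (φ i).finrank_eq
  have h2 := (φ' i).finrank_eq
  have h3 := Submodule.finrank_quotient_add_finrank (W i)
  rw [h1, h2] at h3
  simpa using h3

/-- Riedtmann's formula with quotient S_i: the factor q - 1 is the number of automorphisms of S_i,
and v^{2β_i} is the number of graded maps S_i → V_β. -/
theorem Rop_ind (hQ : ∀ h, Q.src h ≠ Q.tgt h) (α : IsoClass Q k) (i : I) (T : Finset (IsoClass Q k))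
    (hT : ∀ β, hallNumber (IsoClass.simple Q k i) β α ≠ 0 → β ∈ T) :
    Rop (spS k w i) 0 (ind w ε α) = ∑ β ∈ T, ((hallNumber (IsoClass.simple Q k i) β α : ℂ) *
      ((Fintype.card k - 1) * β.autCard / α.autCard * vv k ^ (2 * (β.dim i : ℤ)))) • ind w ε β := by
  have key : ∀ β, (Rop (spS k w i) 0 (ind w ε α)).1 _ (rpt w ε β) =
      (hallNumber (IsoClass.simple Q k i) β α : ℂ) *
      ((Fintype.card k - 1) * β.autCard / α.autCard * vv k ^ (2 * (β.dim i : ℤ))) := by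
    intro β
    have h := sum_ind_tri (fIso_simple w ε i 0 hQ) (FIso.refl (rpt w ε β)) α
    rw [autCard_simple hQ, card_hom0_spS_left] at h
    rw [Rop_apply, eq_div_of_mul_eq (autCard_ne_zero α) h]
    simp [sp_dim]
    ring
  refine (eq_sum_ind ?_ T fun β hβ => hT β ?_).trans (Finset.sum_congr rfl fun β _ => by rw [key])
  · intro N c hN
    rw [Rop_apply]
    refine Finset.sum_eq_zero fun u _ => ind_of_not_unframed fun h => hN fun j => ?_
    have := h j
    exact (Prod.fst_surjective (β := (spS k w i).V (Sum.inr j))).subsingleton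
  · rw [key] at hβ
    exact fun h => hβ (by rw [h, Nat.cast_zero, zero_mul])

theorem Lop_ind (hQ : ∀ h, Q.src h ≠ Q.tgt h) (α : IsoClass Q k) (i : I) (T : Finset (IsoClass Q k))
    (hT : ∀ β, hallNumber β (IsoClass.simple Q k i) α ≠ 0 → β ∈ T) :
    Lop (spS k w i) 0 (ind w ε α) = ∑ β ∈ T, ((hallNumber β (IsoClass.simple Q k i) α : ℂ) *
      ((Fintype.card k - 1) * β.autCard / α.autCard * vv k ^ (2 * (β.dim i : ℤ)))) • ind w ε β := by
  have key : ∀ β, (Lop (spS k w i) 0 (ind w ε α)).1 _ (rpt w ε β) =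
      (hallNumber β (IsoClass.simple Q k i) α : ℂ) *
      ((Fintype.card k - 1) * β.autCard / α.autCard * vv k ^ (2 * (β.dim i : ℤ))) := by
    intro β
    have h := sum_ind_tri (FIso.refl (rpt w ε β)) (fIso_simple w ε i 0 hQ) α
    rw [autCard_simple hQ, card_hom0_spS_right] at h
    rw [Lop_apply, eq_div_of_mul_eq (autCard_ne_zero α) h]
    simp [sp_dim]
    ring
  refine (eq_sum_ind ?_ T fun β hβ => hT β ?_).trans (Finset.sum_congr rfl fun β _ => by rw [key])
  · intro N c hN
    rw [Lop_apply]
    refine Finset.sum_eq_zero fun u _ => ind_of_not_unframed fun h => hN fun j => ?_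
    have := h j
    exact (Prod.snd_surjective (α := (spS k w i).V (Sum.inr j))).subsingleton
  · rw [key] at hβ
    exact fun h => hβ (by rw [h, Nat.cast_zero, zero_mul])

end Classes

/-! ### The operators `E⁻_α` -/

section Frames

variable {k : Type*} [Field k] [Finite k]

theorem exists_eq_mul_GL {m n : ℕ} {y y' : Matrix (Fin m) (Fin n) k}
    (hy : Function.Injective y.mulVec) (hy' : Function.Injective y'.mulVec)
    (h : LinearMap.range y'.mulVecLin = LinearMap.range y.mulVecLin) :
    ∃ g : GL (Fin n) k, y' = y * g.1 := by
  let e : (Fin n → k) ≃ₗ[k] _ := LinearEquiv.ofInjective y.mulVecLin hy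
  let e' : (Fin n → k) ≃ₗ[k] _ := (LinearEquiv.ofInjective y'.mulVecLin hy').trans
    (LinearEquiv.ofEq _ _ h)
  obtain ⟨g, hg⟩ := exists_glEquiv (e'.trans e.symm)
  refine ⟨g, Matrix.toLin'.injective (LinearMap.ext fun v => ?_)⟩
  rw [Matrix.toLin'_mul_apply, Matrix.toLin'_apply, Matrix.toLin'_apply, Matrix.toLin'_apply, hg]
  have h1 : e (e.symm (e' v)) = e' v := e.apply_symm_apply _
  exact (congrArg Subtype.val h1).symm

theorem exists_injective_range {m n : ℕ} {W : Submodule k (Fin m → k)}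
    (h : Module.finrank k W = n) : ∃ y : Matrix (Fin m) (Fin n) k,
      Function.Injective y.mulVec ∧ LinearMap.range y.mulVecLin = W := by
  let e : (Fin n → k) ≃ₗ[k] W := LinearEquiv.ofFinrankEq _ _ (by simp [h])
  refine ⟨LinearMap.toMatrix' (W.subtype ∘ₗ e.toLinearMap), ?_, ?_⟩
  · intro v v' hv
    rw [LinearMap.toMatrix'_mulVec, LinearMap.toMatrix'_mulVec] at hv
    exact e.injective (Subtype.ext hv)
  · rw [← Matrix.toLin'_apply', Matrix.toLin'_toMatrix', LinearMap.range_comp, LinearEquiv.range,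
      Submodule.map_top, Submodule.range_subtype]

theorem exists_mul_eq {m n m' n' : ℕ} {y : Matrix (Fin m') (Fin m) k}
    {y' : Matrix (Fin n') (Fin n) k} (X' : Matrix (Fin n') (Fin m') k)
    (h : ∀ v, X' *ᵥ (y *ᵥ v) ∈ LinearMap.range y'.mulVecLin) :
    ∃ X : Matrix (Fin n) (Fin m) k, X' * y = y' * X := by
  choose z hz using fun c => h (Pi.single c 1)
  refine ⟨Matrix.of fun a c => z c a, Matrix.ext_of_mulVec_single fun c => ?_⟩
  rw [← Matrix.mulVec_mulVec, ← hz, ← Matrix.mulVec_mulVec, Matrix.mulVec_single_one]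
  rfl

theorem eq_of_mul_eq {m n n' : ℕ} {y : Matrix (Fin n') (Fin n) k} (hy : Function.Injective y.mulVec)
    {X X' : Matrix (Fin n) (Fin m) k} (h : y * X = y * X') : X = X' := by
  refine Matrix.ext_of_mulVec_single fun c => hy ?_
  rw [Matrix.mulVec_mulVec, Matrix.mulVec_mulVec, h]

end Frames

/-! ### The maps E⁻_α as Hall multiplication -/

section Minus

variable {I H : Type*} {k : Type u} [Field k] [Fintype k] [DecidableEq k] {w : I → ℕ} {Q : Qv I H}
  {ε : I → Bool}
variable [Fintype I] [DecidableEq I]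

/-- The image of a graded map. -/
def rangeY {n n' : I → ℕ} (y : Y k (n, w) (n', w)) : GSub (std k w n') :=
  fun j => LinearMap.range (yext y j).mulVecLin

theorem yext_injective {n n' : I → ℕ} {y : Y k (n, w) (n', w)}
    (hy : ∀ i, Function.Injective (y i).mulVec) :
    ∀ j, Function.Injective (yext y j).mulVec
  | Sum.inl i => hy i
  | Sum.inr _ => fun v v' h => (Matrix.one_mulVec v).symm.trans (h.trans (Matrix.one_mulVec v'))

theorem rangeY_inr {n n' : I → ℕ} (y : Y k (n, w) (n', w)) (i : I) : rangeY y (Sum.inr i) = ⊤ := by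
  refine LinearMap.range_eq_top.2 fun v => ⟨v, Matrix.one_mulVec v⟩

/-- The injective y with a prescribed image form a torsor under the group; this cancels the factor
|G_ν|⁻¹ in E⁻_α. -/
theorem card_rangeY_eq {n n' : I → ℕ} {W : GSub (std k w n')} (hW : ∀ i, W (Sum.inr i) = ⊤)
    (hn : ∀ i, Module.finrank k (W (Sum.inl i)) = n i) :
    Nat.card {y : Y k (n, w) (n', w) // (∀ i, Function.Injective (y i).mulVec) ∧ rangeY y = W} =
      Nat.card (G k (n, w)) := by
  obtain ⟨y, hy, hyW⟩ : ∃ y : Y k (n, w) (n', w), (∀ i, Function.Injective (y i).mulVec) ∧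
      ∀ i, LinearMap.range (y i).mulVecLin = W (Sum.inl i) := by
    choose y hy hyW using fun i => exists_injective_range (hn i)
    exact ⟨y, hy, hyW⟩
  symm
  refine Nat.card_eq_of_bijective (fun g => ⟨fun i => y i * (g i).1, fun i => ?_, ?_⟩) ⟨?_, ?_⟩
  · have h : (y i * (g i).1).mulVec = (y i).mulVec ∘ glEquiv (g i) :=
      funext fun v => (Matrix.mulVec_mulVec v _ _).symm
    change Function.Injective (y i * (g i).1).mulVec
    rw [h]
    exact (hy i).comp (glEquiv (g i)).injective
  · funext j
    rcases j with i | i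
    · change LinearMap.range (y i * (g i).1).mulVecLin = _
      rw [Matrix.mulVecLin_mul, LinearMap.range_comp_of_range_eq_top, hyW]
      exact LinearMap.range_eq_top.2 (glEquiv (g i)).surjective
    · exact (rangeY_inr _ i).trans (hW i).symm
  · intro g g' h
    funext i
    exact Units.ext (eq_of_mul_eq (hy i) (congrFun (congrArg Subtype.val h) i))
  · rintro ⟨y', h1, h2⟩
    choose g hg using fun i => exists_eq_mul_GL (hy i) (h1 i)
      ((congrFun h2 (Sum.inl i)).trans (hyW i).symm)
    exact ⟨g, Subtype.ext (funext fun i => (hg i).symm)⟩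

variable [Fintype H] [DecidableEq H]

open Classical in
-- As y is injective there is at most one x, and there is one exactly when the image of y is stable.
-- It is then isomorphic to the subrepresentation on that image.
theorem sum_inZ_quotIso {n n' : I → ℕ} (α : IsoClass Q k) (F : CF k w (Q.hat ε))
    (X' : E (Q.hat ε) k (DimVec.fn (n', w))) {y : Y k (n, w) (n', w)}
    (hy : ∀ i, Function.Injective (y i).mulVec) :
    ∑ X, (if InZ (Q.hat ε) X X' y ∧ QuotIso Q (resI X') (fun i => LinearMap.range (y i).mulVecLin)
      α.rep then (restr n F).1 X else 0) = hterm (ind w ε α) F (toPt X') (rangeY y) := by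
  have hy' := yext_injective (w := w) hy
  by_cases h : Stable (toPt X') (rangeY y)
  · choose X₀ hX₀ using fun a => exists_mul_eq (y := yext y ((Q.hat ε).src a))
      (y' := yext y ((Q.hat ε).tgt a)) (X' a) fun v => h a _ ⟨v, rfl⟩
    have h1 : ∀ X, InZ (Q.hat ε) X X' y ↔ X = X₀ := by
      intro X
      constructor
      · intro hX
        funext a
        exact eq_of_mul_eq (hy' _) ((hX.2 a).symm.trans (hX₀ a))
      · rintro rfl
        exact ⟨hy, hX₀⟩
    have h2 : QuotIso Q (resI X') (fun i => LinearMap.range (y i).mulVecLin) α.rep ↔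
        FIso (Q.hat ε) (quotPt (toPt X') h) (rpt w ε α) := by
      rw [fIso_spt_iff]
      · refine (and_iff_right fun a => h (Sum.inl a)).trans
          (exists_congr fun φ => forall_congr' fun a => ?_)
        constructor
        · intro hφ v
          obtain ⟨v, rfl⟩ := Submodule.Quotient.mk_surjective _ v
          exact hφ v
        · exact fun hφ v => hφ (Submodule.Quotient.mk v)
      · intro i
        exact Submodule.Quotient.subsingleton_iff.2 (rangeY_inr y i)
    have h3 : FIso (Q.hat ε) (toPt X₀) (subPt (toPt X') h) := by
      refine fIso_subPt h (fun j => (yext y j).mulVecLin) hy' (fun j => rfl)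
        (fun i v => Matrix.one_mulVec v) fun a v => ?_
      change yext y _ *ᵥ (X₀ a *ᵥ v) = X' a *ᵥ (yext y _ *ᵥ v)
      rw [Matrix.mulVec_mulVec, Matrix.mulVec_mulVec, hX₀]
    simp_rw [h1, ite_and]
    rw [Finset.sum_ite_eq', if_pos (Finset.mem_univ _), hterm_of_stable _ _ h, ind_apply, h2,
      restr_apply, CF_iso F h3, ite_mul, one_mul, zero_mul]
  · rw [hterm_of_not_stable _ _ h]
    refine Finset.sum_eq_zero fun X _ => if_neg fun hX => h ?_
    rintro a _ ⟨v, rfl⟩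
    refine ⟨X a *ᵥ v, ?_⟩
    change yext y _ *ᵥ (X a *ᵥ v) = X' a *ᵥ (yext y _ *ᵥ v)
    rw [Matrix.mulVec_mulVec, Matrix.mulVec_mulVec, hX.1.2]

/-- If the summand of `W` in the product with a characteristic function does not vanish, then `W`
has the complementary dimension. -/
theorem of_hterm_ind_ne_zero {α : IsoClass Q k} {F : CF k w (Q.hat ε)} {M : FSp I k w}
    {x : Pt (Q.hat ε) M} {W : GSub M} (h : hterm (ind w ε α) F x W ≠ 0) :
    (∀ i, W (Sum.inr i) = ⊤) ∧ M.dim = (M.sub W).dim + (sp k w α.dim).dim := by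
  have h1 : Stable x W := by_contra fun h' => h (hterm_of_not_stable _ _ h')
  rw [hterm_of_stable _ _ h1] at h
  have h2 : FIso (Q.hat ε) (quotPt x h1) (rpt w ε α) :=
    by_contra fun h' => left_ne_zero_of_mul h (if_neg h')
  refine ⟨fun i => ?_, ?_⟩
  · exact Submodule.Quotient.subsingleton_iff.1
      (Unframed.of_fIso h2.symm (unframed_sp _) i)
  · rw [← h2.dim_eq, M.dim_sub_add_dim_quot]

open Classical in
theorem sum_quotIso {n : I → ℕ} (α : IsoClass Q k) (F : CF k w (Q.hat ε))
    (X' : E (Q.hat ε) k (DimVec.fn (n + α.dim, w))) :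
    ∑ y : Y k (n, w) (n + α.dim, w), ∑ X, (if InZ (Q.hat ε) X X' y ∧
      QuotIso Q (resI X') (fun i => LinearMap.range (y i).mulVecLin) α.rep then
        (restr n F).1 X else 0) =
      Nat.card (G k (n, w)) * (hmul k w (Q.hat ε) (ind w ε α) F).1 _ (toPt X') := by
  rw [hmul_apply, Finset.mul_sum]
  have h1 : ∀ y : Y k (n, w) (n + α.dim, w), ∑ X, (if InZ (Q.hat ε) X X' y ∧
      QuotIso Q (resI X') (fun i => LinearMap.range (y i).mulVecLin) α.rep then
        (restr n F).1 X else 0) = ∑ W, if (∀ i, Function.Injective (y i).mulVec) ∧ rangeY y = W then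
          hterm (ind w ε α) F (toPt X') W else 0 := by
    intro y
    by_cases hy : ∀ i, Function.Injective (y i).mulVec
    · rw [sum_inZ_quotIso α F X' hy]
      simp_rw [and_iff_right hy]
      rw [Finset.sum_ite_eq, if_pos (Finset.mem_univ _)]
    · rw [Finset.sum_eq_zero fun X _ => if_neg fun h => hy h.1.1,
        Finset.sum_eq_zero fun W _ => if_neg fun h => hy h.1]
  simp_rw [h1]
  rw [Finset.sum_comm]
  refine Finset.sum_congr rfl fun W _ => ?_
  by_cases h : hterm (ind w ε α) F (toPt X') W = 0
  · simp_rw [h, ite_self, Finset.sum_const_zero, mul_zero]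
  · obtain ⟨h2, h3⟩ := of_hterm_ind_ne_zero h
    have h4 : ∀ i, Module.finrank k (W (Sum.inl i)) = n i := by
      intro i
      have := congrFun h3 (Sum.inl i)
      rw [std_dim, Pi.add_apply, sp_dim] at this
      have h5 : ((n i + α.dim i : ℕ) : ℤ) = Module.finrank k (W (Sum.inl i)) + α.dim i := this
      omega
    rw [← card_rangeY_eq h2 h4, Nat.card_eq_fintype_card, Fintype.card_subtype, ← Finset.sum_boole,
      Finset.sum_mul]
    exact Finset.sum_congr rfl fun y _ => by rw [ite_mul, one_mul, zero_mul]

/-- The Euler form of the enlarged quiver with a dimension vector of `Q` on the left. -/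
def eulerHom (Q : Qv I H) (ε : I → Bool) (n : I → ℕ) : (I ⊕ I → ℤ) →+ ℤ :=
  AddMonoidHom.mk' (fun ν => (Q.hat ε).euler (DimVec.ofI n).fnZ ν) fun ν ν' => by
    simp only [Qv.euler, Pi.add_apply, mul_add, Finset.sum_add_distrib]
    ring

theorem eulerHom_apply (n : I → ℕ) (ν : I ⊕ I → ℤ) :
    eulerHom Q ε n ν = (Q.hat ε).euler (DimVec.ofI n).fnZ ν := rfl

/-- The operator `E⁻_α` on all functions. -/
def Eop (w : I → ℕ) (ε : I → Bool) (α : IsoClass Q k) : Module.End ℂ (CF k w (Q.hat ε)) :=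
  ((-vv k) ^ α.totalDim * vv k ^ (α.totalDim : ℤ)) •
    (hmul k w (Q.hat ε) (ind w ε α) * Kop (eulerHom Q ε α.dim))

theorem Eop_apply (α : IsoClass Q k) (F : CF k w (Q.hat ε)) (M : FSp I k w)
    (x : Pt (Q.hat ε) M) : (Eop w ε α F).1 M x =
      ((-vv k) ^ α.totalDim * vv k ^ (α.totalDim : ℤ)) *
        ∑ W, hterm (ind w ε α) (Kop (eulerHom Q ε α.dim) F) x W := rfl

/-- Each W in the Hall product is the image of |G_ν| maps y, and the class α of the quotient forces
W to have dimension ν. Hence the weight operator inside the product is the constant v^{⟨α,ν⟩}. In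
contrast to E⁺_i this is an equality of functions, not only of classes. -/
theorem eminus_restr (α : IsoClass Q k) (n : I → ℕ) (F : CF k w (Q.hat ε)) :
    eminus Q ε α n w (restr n F) = restr (n + α.dim) (Eop w ε α F) := by
  refine Subtype.ext (funext fun X' => ?_)
  have h1 : (hmul k w (Q.hat ε) (ind w ε α) (Kop (eulerHom Q ε α.dim) F)).1 _ (toPt X') =
      vv k ^ ((Q.hat ε).euler (DimVec.ofI α.dim).fnZ (DimVec.fnZ (n, w))) *
        (hmul k w (Q.hat ε) (ind w ε α) F).1 _ (toPt X') := by
    rw [hmul_apply, hmul_apply, Finset.mul_sum]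
    refine Finset.sum_congr rfl fun W _ => ?_
    by_cases h : Stable (toPt X') W
    · rw [hterm_of_stable _ _ h, hterm_of_stable _ _ h, Kop_apply]
      by_cases h2 : hterm (ind w ε α) F (toPt X') W = 0
      · rw [hterm_of_stable _ _ h] at h2
        rw [mul_left_comm, h2, mul_zero, mul_zero]
      · have h3 := (of_hterm_ind_ne_zero h2).2
        have h4 : ((std k w (n + α.dim)).sub W).dim = DimVec.fnZ (n, w) := by
          funext j
          have := congrFun h3 j
          rw [std_dim, Pi.add_apply, sp_dim] at this
          rcases j with j | j <;> simp [DimVec.fnZ] at this ⊢ <;> omega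
        rw [h4, eulerHom_apply]
        ring
    · rw [hterm_of_not_stable _ _ h, hterm_of_not_stable _ _ h, mul_zero]
  have hG : (Nat.card (G k (n, w)) : ℂ) ≠ 0 := Nat.cast_ne_zero.2 Nat.card_pos.ne'
  rw [restr_apply, Eop_apply, ← hmul_apply, h1]
  change (-vv k) ^ α.totalDim * _ * _ * _ = (_ : ℂ)
  rw [sum_quotIso, zpow_add₀ vv_ne_zero, mul_assoc _ (_ : ℂ)⁻¹, inv_mul_cancel_left₀ hG]
  ring

end Minus

/-! ### Functions whose Fourier transform vanishes on injective representations -/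

section NullFunctions

variable {I A : Type*} {k : Type u} [Field k] [Fintype k] {w : I → ℕ} {Γ : Qv (I ⊕ I) A}
variable [Fintype A] [DecidableEq A]

/-- The invariant functions whose Fourier transform vanishes at the representations which are
injective at `j`. -/
def NC (ψ : AddChar k ℂ) (r : A → Bool) (j : I) : Submodule ℂ (CF k w Γ) where
  carrier := {F | ∀ M ξ, InjI j ξ → (Four ψ r F).1 M ξ = 0}
  add_mem' {F G} hF hG M ξ h := by
    rw [map_add]
    exact (congrArg₂ (· + ·) (hF M ξ h) (hG M ξ h)).trans (add_zero 0)
  zero_mem' M ξ _ := by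
    rw [map_zero]
    rfl
  smul_mem' c F hF M ξ h := by
    rw [map_smul]
    exact (congrArg (c * ·) (hF M ξ h)).trans (mul_zero c)

theorem injI_tri_left {M N : FSp I k w} {j : I} {x : Pt Γ M} {u : Hm Γ N M} {c : Pt Γ N}
    (h : InjI j (tri x u c)) : InjI j x := by
  intro v hv
  refine congrArg Prod.fst (h (fun l => (v l, 0)) fun a ha => ?_)
  change (x a (v _) + u a 0, c a 0) = 0
  rw [map_zero, map_zero, hv a ha, add_zero]
  rfl

/-- The sum over u forces Ξ to be triangular. Its first diagonal block is a restriction of Ξ, hence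
injective at j, and there the Fourier transform of F vanishes. -/
theorem sum_mul_kernPt_tri {ψ : AddChar k ℂ} (hψ : ψ ≠ 1) {r : A → Bool} {j : I} {F : CF k w Γ}
    (hF : F ∈ NC ψ r j) {M N : FSp I k w} (c : Pt Γ N) {Ξ : Pt (Γ.reorient r) (M.prod N)}
    (hΞ : InjI j Ξ) : ∑ p, F.1 M p * ∑ u, kernPt ψ r (M.prod N) (tri p u c) Ξ = 0 := by
  simp_rw [sum_kernPt_tri' hψ, Finset.mul_sum]
  rw [Finset.sum_comm]
  refine Finset.sum_eq_zero fun t _ => ?_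
  by_cases h : Ξ = tri t.1 t.2.1 t.2.2
  · have h1 := hF M t.1 (injI_tri_left (h ▸ hΞ))
    rw [Four_apply] at h1
    simp_rw [if_pos h]
    calc _ = (∏ a, cfac M N (Γ.tgt a) (Γ.src a) (r a)) * kernPt ψ r N c t.2.2 *
          ∑ x, F.1 M x * kernPt ψ r M x t.1 := by
          rw [Finset.mul_sum]
          exact Finset.sum_congr rfl fun x _ => by ring
      _ = 0 := by rw [h1, mul_zero]
  · simp_rw [if_neg h, mul_zero, Finset.sum_const_zero]

theorem sum_tri_of_support {M N : FSp I k w} (f : Pt Γ (M.prod N) → ℂ)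
    (hf : ∀ Z, (¬ ∀ a m, (Z a (m, 0)).2 = 0) → f Z = 0) :
    ∑ Z, f Z = ∑ p, ∑ u, ∑ c, f (tri p u c) := by
  refine (sum_hmCop (M := M) (N := N) (L := M.prod N) f).trans ?_
  refine (sum_hmPair (M := M) (N := N) (L := M) fun Z => ∑ p, f (hmCop Z p)).trans ?_
  refine Finset.sum_congr rfl fun p _ => ?_
  rw [Finset.sum_eq_single 0]
  · refine (sum_hmPair (M := M) (N := N) (L := N) fun Z => f (hmCop (hmPair p 0) Z)).trans ?_
    simp_rw [← tri_eq_hmCop]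
  · intro t _ ht
    refine Finset.sum_eq_zero fun s _ => hf _ fun h => ht ?_
    funext a
    refine LinearMap.ext fun m => ?_
    have := h a m
    rw [hmCop_apply, map_zero, add_zero] at this
    exact this
  · exact fun h => absurd (Finset.mem_univ _) h

variable [Fintype I] [DecidableEq I]

/-- After a splitting of W the points x with W stable are the triangular ones, and
`sum_mul_kernPt_tri` applies for each quotient block c. If M/W is not unframed, θ kills the summand.
-/
theorem sum_hterm_kernPt {ψ : AddChar k ℂ} (hψ : ψ ≠ 1) {r : A → Bool} {j : I} {θ F : CF k w Γ}
    (hθ : ∀ N c, ¬ Unframed N → θ.1 N c = 0) (hF : F ∈ NC ψ r j) {M : FSp I k w} (W : GSub M)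
    {ξ : Pt (Γ.reorient r) M} (hξ : InjI j ξ) :
    ∑ x, hterm θ F x W * kernPt ψ r M x ξ = 0 := by
  by_cases hN : Unframed (M.quot W)
  · obtain ⟨e, he⟩ : ∃ e : ∀ l, ((M.sub W).prod (M.quot W)).V l ≃ₗ[k] M.V l,
        ∀ l, IsSplitting (W l) (e l) :=
      ⟨fun l => (exists_isSplitting (W l)).choose, fun l => (exists_isSplitting (W l)).choose_spec⟩
    -- The splitting respects the framings because M/W vanishes over Î.
    have hφ : ∀ i v, M.φ i (e (Sum.inr i) v) = ((M.sub W).prod (M.quot W)).φ i v := by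
      intro i v
      have h1 := hN i
      have h2 : v = (v.1, 0) := Prod.ext rfl (Subsingleton.elim _ _)
      rw [h2, (he _ _).1]
      exact (add_zero _).symm
    have h1 : ∀ Z : Pt Γ ((M.sub W).prod (M.quot W)), Stable (hmCongr e e Z) W ↔
        ∀ a m, (Z a (m, 0)).2 = 0 := by
      intro Z
      have h2 : ∀ a (m : W (Γ.src a)), (Submodule.Quotient.mk (hmCongr e e Z a m) :
          M.V (Γ.tgt a) ⧸ W (Γ.tgt a)) = (Z a (m, 0)).2 := by
        intro a m
        have h3 : hmCongr e e Z a m = e _ (Z a (m, 0)) := by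
          rw [hmCongr_apply, ← (he _ m).1, LinearEquiv.symm_apply_apply]
        rw [h3]
        exact (he _ _).2 _
      constructor
      · intro h a m
        rw [← h2, Submodule.Quotient.mk_eq_zero]
        exact h a _ m.2
      · intro h a v hv
        rw [← Submodule.Quotient.mk_eq_zero]
        exact (h2 a ⟨v, hv⟩).trans (h a ⟨v, hv⟩)
    have h4 : ∀ p u c, hterm θ F (hmCongr e e (tri p u c) : Pt Γ M) W =
        θ.1 (M.quot W) c * F.1 (M.sub W) p := by
      intro p u c
      refine hterm_eq θ F (fun l => (W l).subtype) (fun l => (W l).mkQ)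
        (fun l => (W l).injective_subtype) (fun l => Submodule.range_subtype _)
        (fun l => (W l).mkQ_surjective) (fun l => Submodule.ker_mkQ _) (fun i v => rfl)
        (fun i v => rfl) (fun a v => ?_) (fun a v => ?_)
      · change (p a v : M.V (Γ.tgt a)) = hmCongr e e (tri p u c) a v
        rw [hmCongr_apply]
        conv_rhs => rw [← (he _ v).1, LinearEquiv.symm_apply_apply]
        rw [tri_apply, map_zero, map_zero, add_zero, (he _ _).1]
      · obtain ⟨t, rfl⟩ := (e _).surjective v
        rw [hmCongr_apply, LinearEquiv.symm_apply_apply]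
        refine ((he _ _).2 _).trans ?_
        exact congrArg (c a) ((he _ _).2 _).symm
    set Ξ : Pt (Γ.reorient r) ((M.sub W).prod (M.quot W)) := (hmCongr e e).symm ξ with hΞ
    have h5 : ξ = hmCongr e e Ξ := ((hmCongr e e).apply_symm_apply ξ).symm
    have h6 : InjI j Ξ := by
      rw [h5, injI_hmCongr] at hξ
      exact hξ
    rw [← Equiv.sum_comp (hmCongr e e)]
    simp_rw [h5, kernPt_conj]
    rw [sum_tri_of_support]
    · simp_rw [h4]
      calc _ = ∑ c, θ.1 (M.quot W) c * ∑ p, F.1 (M.sub W) p *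
            ∑ u, kernPt ψ r _ (tri p u c) Ξ := by
            simp_rw [Finset.mul_sum]
            conv_rhs => rw [Finset.sum_comm]
            refine Finset.sum_congr rfl fun p _ => ?_
            conv_rhs => rw [Finset.sum_comm]
            exact Finset.sum_congr rfl fun u _ => Finset.sum_congr rfl fun c _ => by ring
        _ = 0 := Finset.sum_eq_zero fun c _ => by rw [sum_mul_kernPt_tri hψ hF c h6, mul_zero]
    · intro Z hZ
      rw [hterm_of_not_stable _ _ (mt (h1 Z).1 hZ), zero_mul]
  · refine Finset.sum_eq_zero fun x _ => ?_
    by_cases h : Stable x W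
    · rw [hterm_of_stable _ _ h, hθ _ _ hN, zero_mul, zero_mul]
    · rw [hterm_of_not_stable _ _ h, zero_mul]

theorem hmul_mem_NC {ψ : AddChar k ℂ} (hψ : ψ ≠ 1) {r : A → Bool} {j : I} {θ F : CF k w Γ}
    (hθ : ∀ N c, ¬ Unframed N → θ.1 N c = 0) (hF : F ∈ NC ψ r j) : hmul k w Γ θ F ∈ NC ψ r j := by
  intro M ξ hξ
  rw [Four_apply]
  simp_rw [hmul_apply, Finset.sum_mul]
  rw [Finset.sum_comm]
  exact Finset.sum_eq_zero fun W _ => sum_hterm_kernPt hψ hθ hF W hξ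

theorem Kop_mem_NC {ψ : AddChar k ℂ} {r : A → Bool} {j : I} {F : CF k w Γ}
    (χ : (I ⊕ I → ℤ) →+ ℤ) (hF : F ∈ NC ψ r j) : Kop χ F ∈ NC ψ r j := by
  intro M ξ hξ
  rw [Four_apply]
  simp_rw [Kop_apply, mul_assoc, ← Finset.mul_sum]
  rw [← Four_apply, hF M ξ hξ, mul_zero]

theorem injI_tri_spS_right {M : FSp I k w} {i j : I} (hij : i ≠ j) {x : Pt Γ M}
    (hx : InjI j x) (u : Hm Γ (spS k w i) M) : InjI j (tri x u 0) := by
  intro v hv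
  have h1 := subsingleton_spS (k := k) (w := w) (i := i) (j := Sum.inl j)
    fun h => hij (Sum.inl_injective h).symm
  refine Prod.ext (hx (fun l => (v l).1) fun a ha => ?_) (Subsingleton.elim _ _)
  have h2 := congrArg Prod.fst (hv a ha)
  have h3 : (v (Γ.src a)).2 = 0 := by
    rw [← ha] at h1
    exact Subsingleton.elim _ _
  change x a (v (Γ.src a)).1 + u a (v (Γ.src a)).2 = 0 at h2
  rwa [h3, map_zero, add_zero] at h2

theorem injI_tri_spS_left {M : FSp I k w} {i j : I} (hij : i ≠ j) {x : Pt Γ M}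
    (hx : InjI j x) (u : Hm Γ M (spS k w i)) : InjI j (tri 0 u x) := by
  intro v hv
  have h1 := subsingleton_spS (k := k) (w := w) (i := i) (j := Sum.inl j)
    fun h => hij (Sum.inl_injective h).symm
  exact Prod.ext (Subsingleton.elim _ _)
    (hx (fun l => (v l).2) fun a ha => congrArg Prod.snd (hv a ha))

variable [DecidableEq k]

/-- After D_i is moved past the Fourier transform, gluing S_i with i ≠ j leaves the space at j
unchanged. Both kinds of extension of an injective point are therefore injective at j, where the
transform of F is zero. -/
theorem Dop_mem_NC {ψ : AddChar k ℂ} (hψ : ψ ≠ 1) (hΓ : ∀ a, Γ.src a ≠ Γ.tgt a) {r : A → Bool}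
    {i j : I} (hij : i ≠ j) {F : CF k w Γ} (hF : F ∈ NC ψ r j) : Dop k w Γ i F ∈ NC ψ r j := by
  intro M ξ hξ
  rw [← Dop_Four hψ r hΓ]
  have h1 : (Rop (spS k w i) 0 (Four ψ r F)).1 M ξ = 0 :=
    Finset.sum_eq_zero fun u _ => hF _ _ (injI_tri_spS_right hij hξ u)
  have h2 : (Lop (spS k w i) 0 (Four ψ r F)).1 M ξ = 0 :=
    Finset.sum_eq_zero fun u _ => hF _ _ (injI_tri_spS_left hij hξ u)
  have h3 : (Dop k w (Γ.reorient r) i (Four ψ r F)).1 M ξ = (Fintype.card k - 1 : ℂ)⁻¹ *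
      (vv k ^ (aW (Γ.reorient r) i M.dim) * (Rop (spS k w i) 0 (Four ψ r F)).1 M ξ -
        vv k ^ (bW (Γ.reorient r) i M.dim) * (Lop (spS k w i) 0 (Four ψ r F)).1 M ξ) := rfl
  rw [h3, h1, h2, mul_zero, mul_zero, sub_zero, mul_zero]

/-- The Fourier transform keeps the framed space, so outside the isomorphism type of the standard
space all its summands vanish, and on that type the hypothesis applies. -/
theorem ev_mem_NC {ψ : AddChar k ℂ} {r : A → Bool} {j : I} {n : I → ℕ} {f : Inv Γ k (n, w)}
    (hf : f ∈ NI ψ Γ r j (n, w)) : ev n f ∈ NC ψ r j := by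
  intro M ξ hξ
  by_cases h : M.dim = DimVec.fnZ (n, w) ∧ ∀ i, Function.Bijective (M.φ i)
  · obtain ⟨X, hX⟩ := exists_fIso_toPt ξ h.1 h.2
    rw [CF_iso _ hX, ← restr_apply, ← fourier_restr, restr_ev]
    exact hf X (InjI.iso hX hξ)
  · rw [Four_apply]
    exact Finset.sum_eq_zero fun x _ => by
      rw [ev_eq_zero f fun X hX => h (eq_of_fIso_toPt hX), zero_mul]

theorem restr_mem_NI {ψ : AddChar k ℂ} {r : A → Bool} {j : I} (n : I → ℕ) {F : CF k w Γ}
    (hF : F ∈ NC ψ r j) : restr n F ∈ NI ψ Γ r j (n, w) := by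
  intro X hX
  rw [fourier_restr, restr_apply]
  exact hF _ _ hX

/-- Only points that are injective at i enter `eplusSource`, and there the Fourier transform of f is
zero. -/
theorem eplus_eq_zero {ψ : AddChar k ℂ} {r : I → A → Bool} {i : I} {n : I → ℕ}
    {f : Inv Γ k (n + Pi.single i 1, w)} (hf : f ∈ NI ψ Γ (r i) i (n + Pi.single i 1, w)) :
    eplus ψ Γ r i n w f = 0 := by
  classical
  refine Subtype.ext ?_
  have h1 : eplusSource (Γ.reorient (r i)) i n (n + Pi.single i 1) w
      (fourier ψ Γ (r i) (n + Pi.single i 1, w) f.1) = 0 := by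
    funext X
    rw [eplusSource_apply, Finset.sum_eq_zero, mul_zero]
    · rfl
    · refine fun y _ => Finset.sum_eq_zero fun X' _ => ?_
      split_ifs with h
      · exact hf X' h.2
      · rfl
  change fourierBack ψ Γ (r i) (n, w) (eplusSource (Γ.reorient (r i)) i n (n + Pi.single i 1) w
      (fourier ψ Γ (r i) (n + Pi.single i 1, w) f.1)) = 0
  rw [h1, map_zero]

end NullFunctions

/-! ### Weights -/

section Weights

variable {I A : Type*} [Fintype I] [DecidableEq I] [Fintype A] [DecidableEq A]

theorem euler_add_left (Γ : Qv (I ⊕ I) A) (μ μ' ν : I ⊕ I → ℤ) :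
    Γ.euler (μ + μ') ν = Γ.euler μ ν + Γ.euler μ' ν := by
  simp only [Qv.euler, Pi.add_apply, add_mul, Finset.sum_add_distrib]
  ring

theorem euler_dl_right (Γ : Qv (I ⊕ I) A) (μ : I ⊕ I → ℤ) (i : I) :
    Γ.euler μ (dl i) = μ (Sum.inl i) - inW Γ i μ := by
  rw [Qv.euler, inW_apply]
  congr 1
  · simp [dl, Pi.single_apply]
  · exact Finset.sum_congr rfl fun a _ => by simp [dl, Pi.single_apply]

theorem euler_dl_left (Γ : Qv (I ⊕ I) A) (ν : I ⊕ I → ℤ) (i : I) :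
    Γ.euler (dl i) ν = ν (Sum.inl i) - outW Γ i ν := by
  rw [Qv.euler, outW_apply]
  congr 1
  · simp [dl, Pi.single_apply]
  · exact Finset.sum_congr rfl fun a _ => by simp [dl, Pi.single_apply]

/-- The exponent of the operator `K_i`. -/
def kW (Γ : Qv (I ⊕ I) A) (i : I) : (I ⊕ I → ℤ) →+ ℤ := inW Γ i + outW Γ i - 2 • evW i

theorem kW_apply (Γ : Qv (I ⊕ I) A) (i : I) (ν : I ⊕ I → ℤ) :
    kW Γ i ν = inW Γ i ν + outW Γ i ν - 2 * ν (Sum.inl i) := by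
  simp [kW, evW]

theorem kW_fnZ (Γ : Qv (I ⊕ I) A) (i : I) (ν : DimVec I) : kW Γ i ν.fnZ = kWeight Γ i ν := by
  rw [kW_apply, inW_apply, outW_apply, kWeight]
  simp only [DimVec.fnZ, Sum.elim_inl]
  ring

/-- A dimension vector on `I` extended by zero. -/
def inc (μ : I → ℤ) : I ⊕ I → ℤ := Sum.elim μ 0

theorem inc_single (i : I) : inc (Pi.single i 1) = dl i := by
  funext j
  rcases j with j | j
  · by_cases h : j = i
    · subst h; simp [inc, dl]
    · simp [inc, dl, h]
  · simp [inc, dl]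

theorem fnZ_ofI (n : I → ℕ) : (DimVec.ofI n).fnZ = inc fun i => (n i : ℤ) := by
  funext j
  rcases j with j | j <;> simp [inc, DimVec.fnZ, DimVec.ofI]

variable {H : Type*} [Fintype H] [DecidableEq H]

theorem euler_hat_inc (Q : Qv I H) (ε : I → Bool) (μ ν : I → ℤ) :
    (Q.hat ε).euler (inc μ) (inc ν) = Q.euler μ ν := by
  rw [Qv.euler, Qv.euler, Fintype.sum_sum_type, Fintype.sum_sum_type]
  have h : ∀ i, inc μ ((Q.hat ε).src (Sum.inr i)) * inc ν ((Q.hat ε).tgt (Sum.inr i)) = 0 := by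
    intro i
    cases h : ε i <;> simp [Qv.hat, inc, h]
  rw [Finset.sum_congr rfl fun i _ => h i]
  simp [inc, Qv.hat]

theorem kW_inc (Q : Qv I H) (ε : I → Bool) (i : I) (μ : I → ℤ) :
    kW (Q.hat ε) i (inc μ) = -Q.symEuler μ (Pi.single i 1) := by
  rw [Qv.symEuler, ← euler_hat_inc Q ε, ← euler_hat_inc Q ε, inc_single, euler_dl_left,
    euler_dl_right, kW_apply]
  ring

end Weights

/-! ### Relations between operators on invariant functions -/

section OpRelations

variable {I H : Type*} {k : Type u} [Field k] [Fintype k] [DecidableEq k] {w : I → ℕ} {Q : Qv I H}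
  {ε : I → Bool}
variable [Fintype I] [DecidableEq I] [Fintype H] [DecidableEq H]

theorem Kop_Kop {A : Type*} [Fintype A] [DecidableEq A] {Γ : Qv (I ⊕ I) A}
    (χ χ' : (I ⊕ I → ℤ) →+ ℤ) (F : CF k w Γ) : Kop χ (Kop χ' F) = Kop (χ + χ') F :=
  LinearMap.congr_fun (Kop_mul χ χ') F

theorem Kop_ind (χ : (I ⊕ I → ℤ) →+ ℤ) (α : IsoClass Q k) :
    Kop χ (ind w ε α) = vv k ^ χ (DimVec.ofI α.dim).fnZ • ind w ε α := by
  refine CF_ext fun N c => ?_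
  change vv k ^ χ N.dim * (ind w ε α).1 N c = _ * (ind w ε α).1 N c
  by_cases h : FIso (Q.hat ε) c (rpt w ε α)
  · have h1 : (sp k w α.dim).dim = (DimVec.ofI α.dim).fnZ := funext fun j => sp_dim _ _
    rw [h.dim_eq, h1]
  · rw [ind_apply, if_neg h, mul_zero, mul_zero]

theorem Eop_eq (α : IsoClass Q k) (F : CF k w (Q.hat ε)) :
    Eop w ε α F = (-(Fintype.card k : ℂ)) ^ α.totalDim •
      hmul k w (Q.hat ε) (ind w ε α) (Kop (eulerHom Q ε α.dim) F) := by
  have h : (-vv k) ^ α.totalDim * vv k ^ (α.totalDim : ℤ) = (-(Fintype.card k : ℂ)) ^ α.totalDim := by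
    rw [zpow_natCast, ← mul_pow, ← vv_sq (k := k)]
    ring
  rw [← h]
  rfl

theorem hmul_ind_ind (α β : IsoClass Q k) (T : Finset (IsoClass Q k))
    (hT : ∀ γ, hallNumber α β γ ≠ 0 → γ ∈ T) :
    hmul k w (Q.hat ε) (ind w ε α) (ind w ε β) =
      ∑ γ ∈ T, (hallNumber α β γ : ℂ) • ind w ε γ := by
  refine (eq_sum_ind (hmul_ind_of_not_unframed α β) T fun γ hγ => hT γ ?_).trans
    (Finset.sum_congr rfl fun γ _ => by rw [hallNumber_eq (w := w) (ε := ε)])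
  rw [← hallNumber_eq] at hγ
  exact Nat.cast_ne_zero.1 hγ

theorem totalDim_of_hallNumber {α β γ : IsoClass Q k} (h : hallNumber α β γ ≠ 0) :
    γ.totalDim = α.totalDim + β.totalDim := by
  simp only [IsoClass.totalDim, ← hallNumber_dim h, Pi.add_apply, Finset.sum_add_distrib]

theorem fnZ_of_hallNumber {α β γ : IsoClass Q k} (h : hallNumber α β γ ≠ 0) :
    (DimVec.ofI γ.dim).fnZ = (DimVec.ofI α.dim).fnZ + (DimVec.ofI β.dim).fnZ := by
  rw [← hallNumber_dim h]
  funext j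
  rcases j with j | j <;> simp [DimVec.fnZ, DimVec.ofI]

theorem eulerHom_of_hallNumber {α β γ : IsoClass Q k} (h : hallNumber α β γ ≠ 0) :
    eulerHom Q ε γ.dim = eulerHom Q ε α.dim + eulerHom Q ε β.dim := by
  refine AddMonoidHom.ext fun ν => ?_
  rw [AddMonoidHom.add_apply, eulerHom_apply, eulerHom_apply, eulerHom_apply, fnZ_of_hallNumber h,
    euler_add_left]

/-- Moving the weight v^{⟨α,·⟩} past the characteristic function of β produces v^{⟨α,β⟩}; the rest
is associativity of the Hall product and additivity of dimensions. -/
theorem Eop_Eop (α β : IsoClass Q k) (T : Finset (IsoClass Q k))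
    (hT : ∀ γ, hallNumber α β γ ≠ 0 → γ ∈ T) (F : CF k w (Q.hat ε)) :
    Eop w ε α (Eop w ε β F) = vv k ^ Q.euler α.dimZ β.dimZ •
      ∑ γ ∈ T, (hallNumber α β γ : ℂ) • Eop w ε γ F := by
  have h1 : Eop w ε α (Eop w ε β F) = ((-(Fintype.card k : ℂ)) ^ α.totalDim *
      (-(Fintype.card k : ℂ)) ^ β.totalDim * vv k ^ Q.euler α.dimZ β.dimZ) •
      hmul k w (Q.hat ε) (hmul k w (Q.hat ε) (ind w ε α) (ind w ε β))
        (Kop (eulerHom Q ε α.dim + eulerHom Q ε β.dim) F) := by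
    rw [Eop_eq, Eop_eq, map_smul, Kop_hmul, Kop_ind, Kop_Kop, map_smul, map_smul,
      LinearMap.smul_apply, map_smul, smul_smul, smul_smul, ← hmul_mul_hmul, Module.End.mul_apply,
      eulerHom_apply, fnZ_ofI, fnZ_ofI, euler_hat_inc]
    rfl
  rw [h1, hmul_ind_ind α β T hT, map_sum, LinearMap.sum_apply, Finset.smul_sum, Finset.smul_sum]
  refine Finset.sum_congr rfl fun γ _ => ?_
  by_cases h : hallNumber α β γ = 0
  · rw [h, Nat.cast_zero, zero_smul, map_zero, LinearMap.zero_apply, smul_zero, zero_smul, smul_zero]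
  · rw [map_smul, LinearMap.smul_apply, Eop_eq, totalDim_of_hallNumber h, eulerHom_of_hallNumber h,
      smul_smul, smul_smul, smul_smul, pow_add]
    congr 1
    ring

/-- The Leibniz rule for `Rop`, where the weights are such that the term with A_i F carries no
scalar. This term will cancel in the commutator. -/
theorem Aop_hmul_ind (i : I) (α : IsoClass Q k) (F : CF k w (Q.hat ε)) :
    Aop (Q.hat ε) k w i (hmul k w (Q.hat ε) (ind w ε α) (Kop (eulerHom Q ε α.dim) F)) =
      hmul k w (Q.hat ε) (ind w ε α) (Kop (eulerHom Q ε α.dim) (Aop (Q.hat ε) k w i F)) +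
      hmul k w (Q.hat ε) (Kop (aW (Q.hat ε) i) (Rop (spS k w i) 0 (ind w ε α)))
        (Kop (aW (Q.hat ε) i + (2 • outW (Q.hat ε) i + eulerHom Q ε α.dim)) F) := by
  have h1 : Rop (spS k w i) (0 : Pt (Q.hat ε) (spS k w i)) (Kop (eulerHom Q ε α.dim) F) =
      vv k ^ eulerHom Q ε α.dim (dl i) •
        Kop (eulerHom Q ε α.dim) (Rop (spS k w i) 0 F) := by
    rw [← spS_dim (k := k) (w := w)]
    exact LinearMap.congr_fun (Rop_mul_Kop _ _ _) F
  unfold Aop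
  rw [Module.End.mul_apply, Module.End.mul_apply, Rop_hmul, map_add, Kop_hmul, Kop_hmul, Kop_Kop,
    Kop_Kop, Kop_Kop, Kop_Kop, h1, Kop_ind, map_smul, map_smul, map_smul, LinearMap.smul_apply,
    smul_smul, Kop_Kop, ← zpow_add₀ vv_ne_zero, add_comm (eulerHom Q ε α.dim) (aW _ _)]
  -- The total weight of the first Leibniz term is zero, since ⟨α, i⟩ = α_i - `inW` α.
  have h2 : eulerHom Q ε α.dim (dl i) + (aW (Q.hat ε) i + 2 • evW i) (DimVec.ofI α.dim).fnZ = 0 := by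
    rw [eulerHom_apply, euler_dl_right, AddMonoidHom.add_apply, aW_apply]
    simp [evW]
    ring
  rw [h2, zpow_zero, one_smul, add_assoc]

theorem Bop_hmul_ind (i : I) (α : IsoClass Q k) (F : CF k w (Q.hat ε)) :
    Bop (Q.hat ε) k w i (hmul k w (Q.hat ε) (ind w ε α) (Kop (eulerHom Q ε α.dim) F)) =
      hmul k w (Q.hat ε) (ind w ε α) (Kop (eulerHom Q ε α.dim) (Bop (Q.hat ε) k w i F)) +
      hmul k w (Q.hat ε) (Kop (bW (Q.hat ε) i) (Lop (spS k w i) 0 (ind w ε α)))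
        (Kop (bW (Q.hat ε) i + (2 • evW i + eulerHom Q ε α.dim)) F) := by
  have h1 : Lop (spS k w i) (0 : Pt (Q.hat ε) (spS k w i)) (Kop (eulerHom Q ε α.dim) F) =
      vv k ^ eulerHom Q ε α.dim (dl i) •
        Kop (eulerHom Q ε α.dim) (Lop (spS k w i) 0 F) := by
    rw [← spS_dim (k := k) (w := w)]
    exact LinearMap.congr_fun (Lop_mul_Kop _ _ _) F
  unfold Bop
  rw [Module.End.mul_apply, Module.End.mul_apply, Lop_hmul, map_add, Kop_hmul, Kop_hmul, Kop_Kop,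
    Kop_Kop, Kop_Kop, Kop_Kop, h1, Kop_ind, map_smul, map_smul, map_smul, LinearMap.smul_apply,
    smul_smul, Kop_Kop, ← zpow_add₀ vv_ne_zero, add_comm (eulerHom Q ε α.dim) (bW _ _)]
  have h2 : eulerHom Q ε α.dim (dl i) +
      (bW (Q.hat ε) i + 2 • inW (Q.hat ε) i) (DimVec.ofI α.dim).fnZ = 0 := by
    rw [eulerHom_apply, euler_dl_right, AddMonoidHom.add_apply, bW_apply]
    simp
    ring
  rw [h2, zpow_zero, one_smul, add_assoc]

/-- The untwisted Leibniz terms cancel, and `Rop_ind` and `Lop_ind` expand the others. Since dim α =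
dim β + i, the surplus ⟨i, ·⟩ of the Euler weight combines with those of A_i and B_i to the
exponents of K_i and K_i⁻¹. The sign and the factor q come from (-q)^{dim α} = -q (-q)^{dim β}, and
(q - 1)⁻¹ cancels the automorphisms of S_i. -/
theorem Eop_commutator (hQ : ∀ h, Q.src h ≠ Q.tgt h) (α : IsoClass Q k) (i : I)
    (T : Finset (IsoClass Q k))
    (hT : ∀ β, hallNumber (IsoClass.simple Q k i) β α ≠ 0 → β ∈ T)
    (hT' : ∀ β, hallNumber β (IsoClass.simple Q k i) α ≠ 0 → β ∈ T) (F : CF k w (Q.hat ε)) :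
    Eop w ε α (Dop k w (Q.hat ε) i F) - Dop k w (Q.hat ε) i (Eop w ε α F) =
      ((Fintype.card k : ℂ) / α.autCard) • ∑ β ∈ T, (β.autCard : ℂ) •
        ((vv k ^ (-Q.euler β.dimZ (Pi.single i 1)) * (hallNumber (IsoClass.simple Q k i) β α : ℂ)) •
          Eop w ε β (Kop (kW (Q.hat ε) i) F) -
        (vv k ^ Q.euler β.dimZ (Pi.single i 1) * (hallNumber β (IsoClass.simple Q k i) α : ℂ)) •
          Eop w ε β (Kop (-kW (Q.hat ε) i) F)) := by
  have hq1 : (Fintype.card k - 1 : ℂ) ≠ 0 := by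
    have : (1 : ℂ) ≠ Fintype.card k := by
      exact_mod_cast (Fintype.one_lt_card (α := k)).ne
    exact sub_ne_zero.2 this.symm
  have hR := Rop_ind (w := w) (ε := ε) hQ α i T hT
  have hL := Lop_ind (w := w) (ε := ε) hQ α i T hT'
  have h1 : Eop w ε α (Dop k w (Q.hat ε) i F) - Dop k w (Q.hat ε) i (Eop w ε α F) =
      (-((-(Fintype.card k : ℂ)) ^ α.totalDim) * (Fintype.card k - 1 : ℂ)⁻¹) •
      (hmul k w (Q.hat ε) (Kop (aW (Q.hat ε) i) (Rop (spS k w i) 0 (ind w ε α)))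
        (Kop (aW (Q.hat ε) i + (2 • outW (Q.hat ε) i + eulerHom Q ε α.dim)) F) -
      hmul k w (Q.hat ε) (Kop (bW (Q.hat ε) i) (Lop (spS k w i) 0 (ind w ε α)))
        (Kop (bW (Q.hat ε) i + (2 • evW i + eulerHom Q ε α.dim)) F)) := by
    unfold Dop
    rw [LinearMap.smul_apply, LinearMap.smul_apply, LinearMap.sub_apply, LinearMap.sub_apply,
      Eop_eq, Eop_eq, map_smul, map_smul, map_smul, map_smul, map_sub, map_sub, Aop_hmul_ind,
      Bop_hmul_ind]
    module
  have hA : ∀ β, hallNumber (IsoClass.simple Q k i) β α ≠ 0 →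
      hmul k w (Q.hat ε) (Kop (aW (Q.hat ε) i) (ind w ε β)) (Kop (aW (Q.hat ε) i + (2 • outW (Q.hat ε) i + eulerHom Q ε α.dim)) F) =
      (((-(Fintype.card k : ℂ)) ^ β.totalDim)⁻¹ * vv k ^ aW (Q.hat ε) i (DimVec.ofI β.dim).fnZ) •
        Eop w ε β (Kop (kW (Q.hat ε) i) F) := by
    intro β h
    have h2 : aW (Q.hat ε) i + (2 • outW (Q.hat ε) i + eulerHom Q ε α.dim) = eulerHom Q ε β.dim + kW (Q.hat ε) i := by
      rw [eulerHom_of_hallNumber h]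
      refine AddMonoidHom.ext fun ν => ?_
      have h3 : eulerHom Q ε (IsoClass.simple Q k i).dim ν = ν (Sum.inl i) - outW (Q.hat ε) i ν := by
        rw [eulerHom_apply, fnZ_ofI, ← euler_dl_left, ← inc_single]
        congr 2
        funext l
        by_cases hl : l = i
        · subst hl; simp [IsoClass.simple, IsoClass.dim]
        · simp [IsoClass.simple, IsoClass.dim, hl]
      simp only [AddMonoidHom.add_apply, h3, aW_apply, kW_apply, AddMonoidHom.nsmul_apply]
      simp
      ring
    have h4 : (-(Fintype.card k : ℂ)) ^ β.totalDim ≠ 0 :=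
      pow_ne_zero _ (neg_ne_zero.2 (Nat.cast_ne_zero.2 Fintype.card_ne_zero))
    rw [h2, Kop_ind, map_smul, LinearMap.smul_apply, Eop_eq, Kop_Kop, smul_smul]
    congr 1
    field_simp
  have hB : ∀ β, hallNumber β (IsoClass.simple Q k i) α ≠ 0 →
      hmul k w (Q.hat ε) (Kop (bW (Q.hat ε) i) (ind w ε β)) (Kop (bW (Q.hat ε) i + (2 • evW i + eulerHom Q ε α.dim)) F) =
      (((-(Fintype.card k : ℂ)) ^ β.totalDim)⁻¹ * vv k ^ bW (Q.hat ε) i (DimVec.ofI β.dim).fnZ) •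
        Eop w ε β (Kop (-kW (Q.hat ε) i) F) := by
    intro β h
    have h2 : bW (Q.hat ε) i + (2 • evW i + eulerHom Q ε α.dim) = eulerHom Q ε β.dim + -kW (Q.hat ε) i := by
      rw [eulerHom_of_hallNumber h]
      refine AddMonoidHom.ext fun ν => ?_
      have h3 : eulerHom Q ε (IsoClass.simple Q k i).dim ν = ν (Sum.inl i) - outW (Q.hat ε) i ν := by
        rw [eulerHom_apply, fnZ_ofI, ← euler_dl_left, ← inc_single]
        congr 2
        funext l
        by_cases hl : l = i
        · subst hl; simp [IsoClass.simple, IsoClass.dim]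
        · simp [IsoClass.simple, IsoClass.dim, hl]
      simp only [AddMonoidHom.add_apply, h3, bW_apply, kW_apply, AddMonoidHom.nsmul_apply,
        AddMonoidHom.neg_apply]
      simp
      ring
    have h4 : (-(Fintype.card k : ℂ)) ^ β.totalDim ≠ 0 :=
      pow_ne_zero _ (neg_ne_zero.2 (Nat.cast_ne_zero.2 Fintype.card_ne_zero))
    rw [h2, Kop_ind, map_smul, LinearMap.smul_apply, Eop_eq, Kop_Kop, smul_smul]
    congr 1
    field_simp
  have hs : (IsoClass.simple Q k i).totalDim = 1 := by
    simp [IsoClass.totalDim, IsoClass.simple, IsoClass.dim]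
  have hβ : ∀ β : IsoClass Q k, Q.euler β.dimZ (Pi.single i 1) =
      (β.dim i : ℤ) - inW (Q.hat ε) i (DimVec.ofI β.dim).fnZ := by
    intro β
    rw [← euler_hat_inc Q ε, inc_single, euler_dl_right, fnZ_ofI]
    rfl
  have hβi : ∀ β : IsoClass Q k, (DimVec.ofI β.dim).fnZ (Sum.inl i) = β.dim i := fun β => rfl
  have hq0 : (Fintype.card k : ℂ) ≠ 0 := Nat.cast_ne_zero.2 Fintype.card_ne_zero
  have ha := autCard_ne_zero α
  rw [h1, hR, hL, map_sum, map_sum, map_sum, map_sum, LinearMap.sum_apply, LinearMap.sum_apply,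
    ← Finset.sum_sub_distrib, Finset.smul_sum, Finset.smul_sum]
  refine Finset.sum_congr rfl fun β _ => ?_
  rw [smul_sub, smul_sub, smul_sub]
  congr 1
  · by_cases h : hallNumber (IsoClass.simple Q k i) β α = 0
    · rw [h, Nat.cast_zero, zero_mul, zero_smul, map_zero, map_zero, LinearMap.zero_apply, smul_zero,
        mul_zero, zero_smul, smul_zero, smul_zero]
    · rw [map_smul, map_smul, LinearMap.smul_apply, hA β h, smul_smul, smul_smul, smul_smul, smul_smul]
      congr 1
      -- The exponent 2β_i from Riedtmann's formula and the weight of A_i at β add up to -⟨β, i⟩.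
      have e : -Q.euler β.dimZ (Pi.single i 1) = 2 * (β.dim i : ℤ) + aW (Q.hat ε) i (DimVec.ofI β.dim).fnZ := by
        rw [hβ, aW_apply, hβi]
        ring
      rw [totalDim_of_hallNumber h, hs, e, zpow_add₀ vv_ne_zero, pow_add, pow_one]
      field_simp
  · by_cases h : hallNumber β (IsoClass.simple Q k i) α = 0
    · rw [h, Nat.cast_zero, zero_mul, zero_smul, map_zero, map_zero, LinearMap.zero_apply, smul_zero,
        mul_zero, zero_smul, smul_zero, smul_zero]
    · rw [map_smul, map_smul, LinearMap.smul_apply, hB β h, smul_smul, smul_smul, smul_smul, smul_smul]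
      congr 1
      have e : Q.euler β.dimZ (Pi.single i 1) = 2 * (β.dim i : ℤ) + bW (Q.hat ε) i (DimVec.ofI β.dim).fnZ := by
        rw [hβ, bW_apply, hβi]
        ring
      rw [totalDim_of_hallNumber h, hs, e, zpow_add₀ vv_ne_zero, pow_add, pow_one]
      field_simp

end OpRelations

/-! ### Operators on the quotient space -/

section Descent

variable {I A : Type*} {k : Type u} [Field k] [Fintype k] [DecidableEq k]
variable [Fintype I] [DecidableEq I] [Fintype A] [DecidableEq A]
variable {ψ : AddChar k ℂ} {Γ : Qv (I ⊕ I) A} {r : I → A → Bool}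

theorem cls_eq_zero {ν : DimVec I} {j : I} {f : Inv Γ k ν} (hf : f ∈ NI ψ Γ (r j) j ν) :
    cls ψ Γ r ν f = 0 := by
  have h : proj ψ Γ r ν f = 0 :=
    (Submodule.Quotient.mk_eq_zero _).2 (Submodule.mem_iSup_of_mem j hf)
  rw [cls, LinearMap.comp_apply, h, map_zero]

theorem cls_eq_of_sub_mem {ν : DimVec I} {j : I} {f g : Inv Γ k ν}
    (hf : f - g ∈ NI ψ Γ (r j) j ν) : cls ψ Γ r ν f = cls ψ Γ r ν g := by
  rw [← sub_eq_zero, ← map_sub, cls_eq_zero hf]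

/-- The operator on the quotient space induced by a family of maps. -/
def descend (Ψ : ∀ ν, Inv Γ k ν →ₗ[ℂ] FSpace ψ Γ r)
    (hΨ : ∀ ν j, ∀ f ∈ NI ψ Γ (r j) j ν, Ψ ν f = 0) : Module.End ℂ (FSpace ψ Γ r) :=
  DirectSum.toModule ℂ (DimVec I) (FSpace ψ Γ r) fun ν =>
    (NN ψ Γ r ν).liftQ (Ψ ν) (iSup_le fun j f hf => hΨ ν j f hf)

theorem descend_cls (Ψ : ∀ ν, Inv Γ k ν →ₗ[ℂ] FSpace ψ Γ r)
    (hΨ : ∀ ν j, ∀ f ∈ NI ψ Γ (r j) j ν, Ψ ν f = 0) (ν : DimVec I) (f : Inv Γ k ν) :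
    descend Ψ hΨ (cls ψ Γ r ν f) = Ψ ν f :=
  (DirectSum.toModule_lof ℂ ν _).trans rfl

theorem opK_cls (i : I) (ν : DimVec I) (f : Inv Γ k ν) :
    opK ψ Γ r i (cls ψ Γ r ν f) = vv k ^ kWeight Γ i ν • cls ψ Γ r ν f :=
  (DirectSum.toModule_lof ℂ ν _).trans rfl

theorem opKinv_cls (i : I) (ν : DimVec I) (f : Inv Γ k ν) :
    opKinv ψ Γ r i (cls ψ Γ r ν f) = vv k ^ (-kWeight Γ i ν) • cls ψ Γ r ν f :=
  (DirectSum.toModule_lof ℂ ν _).trans rfl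

theorem end_ext_cls {T T' : Module.End ℂ (FSpace ψ Γ r)}
    (h : ∀ ν f, T (cls ψ Γ r ν f) = T' (cls ψ Γ r ν f)) : T = T' := by
  refine DirectSum.linearMap_ext ℂ fun ν => LinearMap.ext fun f => ?_
  obtain ⟨f, rfl⟩ := Submodule.Quotient.mk_surjective (NN ψ Γ r ν) f
  exact h ν f

variable (ψ r) in
/-- The class of a function on framed representations in the component of the dimension vector
`(d, w)`, which is zero if `d` is not non-negative. -/
def cl {w : I → ℕ} (d : I → ℤ) : CF k w Γ →ₗ[ℂ] FSpace ψ Γ r :=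
  haveI := Classical.dec (∀ i, 0 ≤ d i)
  if ∀ i, 0 ≤ d i then cls ψ Γ r (fun i => (d i).toNat, w) ∘ₗ restr fun i => (d i).toNat else 0

variable {w : I → ℕ}

theorem cl_natCast {d : I → ℤ} {n : I → ℕ} (h : ∀ i, d i = n i) (F : CF k w Γ) :
    cl ψ r d F = cls ψ Γ r (n, w) (restr n F) := by
  obtain rfl : n = fun i => (d i).toNat := funext fun i => by rw [h, Int.toNat_natCast]
  unfold cl
  rw [if_pos fun i => by rw [h]; positivity]
  rfl

theorem cl_of_neg {d : I → ℤ} (h : ¬ ∀ i, 0 ≤ d i) (F : CF k w Γ) : cl ψ r d F = 0 := by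
  unfold cl
  rw [if_neg h]
  rfl

theorem exists_natCast {d : I → ℤ} (h : ∀ i, 0 ≤ d i) : ∃ n : I → ℕ, ∀ i, d i = n i :=
  ⟨fun i => (d i).toNat, fun i => (Int.toNat_of_nonneg (h i)).symm⟩

theorem cl_Kop (χ : (I ⊕ I → ℤ) →+ ℤ) (d : I → ℤ) (F : CF k w Γ) :
    cl ψ r d (Kop χ F) = vv k ^ χ (Sum.elim d fun i => (w i : ℤ)) • cl ψ r d F := by
  by_cases h : ∀ i, 0 ≤ d i
  · obtain ⟨n, hn⟩ := exists_natCast h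
    rw [cl_natCast hn, cl_natCast hn, ← map_smul]
    congr 1
    refine Subtype.ext (funext fun X => ?_)
    have h1 : (std k w n).dim = Sum.elim d fun i => (w i : ℤ) := by
      rw [std_dim]
      funext j
      rcases j with j | j
      · exact (hn j).symm
      · rfl
    rw [restr_apply, Kop_apply, h1]
    rfl
  · rw [cl_of_neg h, cl_of_neg h, smul_zero]

theorem kWeight_eq {d : I → ℤ} {n : I → ℕ} (h : ∀ i, d i = n i) (i : I) :
    kW Γ i (Sum.elim d fun i => (w i : ℤ)) = kWeight Γ i (n, w) := by
  rw [← kW_fnZ]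
  congr 1
  funext j
  rcases j with j | j
  · exact h j
  · rfl

theorem opK_cl (i : I) (d : I → ℤ) (F : CF k w Γ) :
    opK ψ Γ r i (cl ψ r d F) = cl ψ r d (Kop (kW Γ i) F) := by
  rw [cl_Kop]
  by_cases h : ∀ i, 0 ≤ d i
  · obtain ⟨n, hn⟩ := exists_natCast h
    rw [cl_natCast hn, opK_cls, kWeight_eq hn]
  · rw [cl_of_neg h, map_zero, smul_zero]

theorem opKinv_cl (i : I) (d : I → ℤ) (F : CF k w Γ) :
    opKinv ψ Γ r i (cl ψ r d F) = cl ψ r d (Kop (-kW Γ i) F) := by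
  rw [cl_Kop]
  by_cases h : ∀ i, 0 ≤ d i
  · obtain ⟨n, hn⟩ := exists_natCast h
    rw [cl_natCast hn, opKinv_cls, AddMonoidHom.neg_apply, kWeight_eq hn]
  · rw [cl_of_neg h, map_zero, smul_zero]

theorem end_ext_cl {T T' : Module.End ℂ (FSpace ψ Γ r)}
    (h : ∀ (w : I → ℕ) (d : I → ℤ) (F : CF k w Γ), T (cl ψ r d F) = T' (cl ψ r d F)) : T = T' := by
  refine end_ext_cls fun ν f => ?_
  have h1 := h ν.2 (fun i => (ν.1 i : ℤ)) (ev ν.1 f)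
  rwa [cl_natCast fun i => rfl, restr_ev] at h1

/-! ### The operators `E⁺_i` -/

theorem cls_restr_Dop (hψ : ψ ≠ 1) (hΓ : ∀ a, Γ.src a ≠ Γ.tgt a)
    (hr : ∀ i, (Γ.reorient (r i)).IsSource (Sum.inl i)) (i : I) (m : I → ℕ) (F : CF k w Γ) :
    cls ψ Γ r (m, w) (restr m (Dop k w Γ i F)) =
      cls ψ Γ r (m, w) (eplus ψ Γ r i m w (restr (m + Pi.single i 1) F)) :=
  (cls_eq_of_sub_mem (eplus_restr_sub_mem hψ hΓ (hr i) m F)).symm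

theorem cl_eq_zero {j : I} {F : CF k w Γ} (hF : F ∈ NC ψ (r j) j) (d : I → ℤ) :
    cl ψ r d F = 0 := by
  by_cases h : ∀ i, 0 ≤ d i
  · obtain ⟨n, hn⟩ := exists_natCast h
    rw [cl_natCast hn, cls_eq_zero (restr_mem_NI n hF)]
  · exact cl_of_neg h F

theorem exists_eq_add_single {n : I → ℕ} {i : I}
    (h : ∀ l, 0 ≤ ((fun l => (n l : ℤ)) - Pi.single i 1 : I → ℤ) l) :
    ∃ m : I → ℕ, n = m + Pi.single i 1 ∧
      ∀ l, ((fun l => (n l : ℤ)) - Pi.single i 1 : I → ℤ) l = m l := by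
  obtain ⟨m, hm⟩ := exists_natCast h
  refine ⟨m, funext fun l => ?_, hm⟩
  have h1 := hm l
  by_cases hl : l = i
  · subst hl
    simp at h1 ⊢
    omega
  · simp [hl] at h1 ⊢
    omega

/-- For j = i one replaces D_i by E⁺_i, which kills the null functions at i. For j ≠ i, D_i itself
preserves the null functions at j. -/
theorem cl_Dop_ev (hψ : ψ ≠ 1) (hΓ : ∀ a, Γ.src a ≠ Γ.tgt a)
    (hr : ∀ i, (Γ.reorient (r i)).IsSource (Sum.inl i)) (i : I) (n : I → ℕ) (j : I)
    (f : Inv Γ k (n, w)) (hf : f ∈ NI ψ Γ (r j) j (n, w)) :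
    cl ψ r ((fun l => (n l : ℤ)) - Pi.single i 1) (Dop k w Γ i (ev n f)) = 0 := by
  by_cases hij : i = j
  · subst hij
    by_cases h : ∀ l, 0 ≤ ((fun l => (n l : ℤ)) - Pi.single i 1 : I → ℤ) l
    · obtain ⟨m, rfl, hm⟩ := exists_eq_add_single h
      rw [cl_natCast hm, cls_restr_Dop hψ hΓ hr, restr_ev, eplus_eq_zero hf, map_zero]
    · exact cl_of_neg h _
  · exact cl_eq_zero (Dop_mem_NC hψ hΓ hij (ev_mem_NC hf)) _

/-- The operator `E⁺_i` on the quotient space. -/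
def opE (hψ : ψ ≠ 1) (hΓ : ∀ a, Γ.src a ≠ Γ.tgt a)
    (hr : ∀ i, (Γ.reorient (r i)).IsSource (Sum.inl i)) (i : I) : Module.End ℂ (FSpace ψ Γ r) :=
  descend (fun ν => cl ψ r ((fun l => (ν.1 l : ℤ)) - Pi.single i 1) ∘ₗ Dop k ν.2 Γ i ∘ₗ ev ν.1)
    fun ν => cl_Dop_ev hψ hΓ hr i ν.1

theorem opE_cls (hψ : ψ ≠ 1) (hΓ : ∀ a, Γ.src a ≠ Γ.tgt a)
    (hr : ∀ i, (Γ.reorient (r i)).IsSource (Sum.inl i)) (i : I) (n : I → ℕ) (f : Inv Γ k (n, w)) :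
    opE hψ hΓ hr i (cls ψ Γ r (n, w) f) =
      cl ψ r ((fun l => (n l : ℤ)) - Pi.single i 1) (Dop k w Γ i (ev n f)) :=
  descend_cls _ _ _ _

/-- D_i of F and of the extension by zero of its restriction may differ as functions, but both are
congruent to E⁺_i of that restriction. From here on relations between the D_i pass to the quotient.
-/
theorem opE_cl (hψ : ψ ≠ 1) (hΓ : ∀ a, Γ.src a ≠ Γ.tgt a)
    (hr : ∀ i, (Γ.reorient (r i)).IsSource (Sum.inl i)) (i : I) (d : I → ℤ) (F : CF k w Γ) :
    opE hψ hΓ hr i (cl ψ r d F) = cl ψ r (d - Pi.single i 1) (Dop k w Γ i F) := by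
  by_cases h : ∀ l, 0 ≤ d l
  · obtain ⟨n, hn⟩ := exists_natCast h
    obtain rfl : d = fun l => (n l : ℤ) := funext hn
    rw [cl_natCast hn, opE_cls]
    by_cases h' : ∀ l, 0 ≤ ((fun l => (n l : ℤ)) - Pi.single i 1 : I → ℤ) l
    · obtain ⟨m, rfl, hm⟩ := exists_eq_add_single h'
      rw [cl_natCast hm, cl_natCast hm, cls_restr_Dop hψ hΓ hr, cls_restr_Dop hψ hΓ hr, restr_ev]
    · rw [cl_of_neg h', cl_of_neg h']
  · rw [cl_of_neg h, map_zero, cl_of_neg]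
    refine fun h' => h fun l => (h' l).trans ?_
    rw [Pi.sub_apply, sub_le_self_iff]
    rw [Pi.single_apply]
    split_ifs <;> norm_num

theorem inducedPlus_opE (hψ : ψ ≠ 1) (hΓ : ∀ a, Γ.src a ≠ Γ.tgt a)
    (hr : ∀ i, (Γ.reorient (r i)).IsSource (Sum.inl i)) (i : I) :
    InducedPlus ψ Γ r i (opE hψ hΓ hr i) := by
  refine ⟨fun n w f => ?_, fun n w f hn => ?_⟩
  · have h : ∀ l, ((fun l => ((n + Pi.single i 1 : I → ℕ) l : ℤ)) - Pi.single i 1 : I → ℤ) l = n l := by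
      intro l
      by_cases hl : l = i
      · subst hl; simp
      · simp [hl]
    rw [opE_cls, cl_natCast h, cls_restr_Dop hψ hΓ hr, restr_ev]
  · rw [opE_cls, cl_of_neg]
    intro h
    have := h i
    simp [hn] at this

theorem qad_opE_cl (hψ : ψ ≠ 1) (hΓ : ∀ a, Γ.src a ≠ Γ.tgt a)
    (hr : ∀ i, (Γ.reorient (r i)).IsSource (Sum.inl i)) (i j : I) (v : ℂ) (n : ℤ) (N : ℕ)
    (d : I → ℤ) (F : CF k w Γ) :
    qad v n (opE hψ hΓ hr i) (opE hψ hΓ hr j) N (cl ψ r d F) =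
      cl ψ r (d - N • Pi.single i 1 - Pi.single j 1)
        (qad v n (Dop k w Γ i) (Dop k w Γ j) N F) := by
  induction N generalizing d F with
  | zero => rw [qad, qad, opE_cl, zero_nsmul, sub_zero]
  | succ N ih =>
    have h1 : d - Pi.single i 1 - N • Pi.single i 1 - Pi.single j 1 =
        d - (N + 1) • Pi.single i 1 - Pi.single j 1 := by
      rw [succ_nsmul]
      abel
    have h2 : d - N • Pi.single i 1 - Pi.single j 1 - Pi.single i 1 =
        d - (N + 1) • Pi.single i 1 - Pi.single j 1 := by
      rw [succ_nsmul]
      abel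
    rw [qad, qad, LinearMap.sub_apply, LinearMap.smul_apply, Module.End.mul_apply,
      Module.End.mul_apply, opE_cl, ih, ih, opE_cl, h1, h2, LinearMap.sub_apply,
      LinearMap.smul_apply, Module.End.mul_apply, Module.End.mul_apply, map_sub, map_smul]

theorem opK_mul_opKinv (i : I) : opK ψ Γ r i * opKinv ψ Γ r i = 1 := by
  refine end_ext_cls fun ν f => ?_
  rw [Module.End.mul_apply, opKinv_cls, map_smul, opK_cls, smul_smul, ← zpow_add₀ vv_ne_zero,
    neg_add_cancel, zpow_zero, one_smul, Module.End.one_apply]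

theorem opKinv_mul_opK (i : I) : opKinv ψ Γ r i * opK ψ Γ r i = 1 := by
  refine end_ext_cls fun ν f => ?_
  rw [Module.End.mul_apply, opK_cls, map_smul, opKinv_cls, smul_smul, ← zpow_add₀ vv_ne_zero,
    add_neg_cancel, zpow_zero, one_smul, Module.End.one_apply]

theorem opK_mul_opK (i j : I) : opK ψ Γ r i * opK ψ Γ r j = opK ψ Γ r j * opK ψ Γ r i := by
  refine end_ext_cls fun ν f => ?_
  rw [Module.End.mul_apply, Module.End.mul_apply, opK_cls, map_smul, opK_cls, map_smul, opK_cls,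
    smul_comm]

end Descent

/-! ### The operators E⁻_α on the quotient and the relations -/

section Hat

variable {I H : Type*} {k : Type u} [Field k] [Fintype k] [DecidableEq k]
variable [Fintype I] [DecidableEq I] [Fintype H] [DecidableEq H]
variable {Q : Qv I H} {ε : I → Bool} {ψ : AddChar k ℂ} {r : I → H ⊕ I → Bool} {w : I → ℕ}

theorem Eop_mem_NC (hψ : ψ ≠ 1) {j : I} {F : CF k w (Q.hat ε)} (hF : F ∈ NC ψ (r j) j)
    (α : IsoClass Q k) : Eop w ε α F ∈ NC ψ (r j) j := by
  rw [Eop_eq]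
  exact Submodule.smul_mem _ _
    (hmul_mem_NC hψ (fun N c hN => ind_of_not_unframed hN) (Kop_mem_NC _ hF))

/-- The operator `E⁻_α` on the quotient space. -/
def opF (hψ : ψ ≠ 1) (α : IsoClass Q k) : Module.End ℂ (FSpace ψ (Q.hat ε) r) :=
  descend (fun ν => cls ψ (Q.hat ε) r (ν.1 + α.dim, ν.2) ∘ₗ restr (ν.1 + α.dim) ∘ₗ
      Eop ν.2 ε α ∘ₗ ev ν.1)
    fun _ _ _ hf => cls_eq_zero (restr_mem_NI _ (Eop_mem_NC hψ (ev_mem_NC hf) α))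

theorem opF_cls (hψ : ψ ≠ 1) (α : IsoClass Q k) (n : I → ℕ) (f : Inv (Q.hat ε) k (n, w)) :
    (opF hψ α : Module.End ℂ (FSpace ψ (Q.hat ε) r)) (cls ψ (Q.hat ε) r (n, w) f) =
      cls ψ (Q.hat ε) r (n + α.dim, w) (eminus Q ε α n w f) := by
  conv_rhs => rw [← restr_ev f, eminus_restr]
  exact descend_cls _ _ _ _

theorem opF_cl (hψ : ψ ≠ 1) (α : IsoClass Q k) (d : I → ℤ) (F : CF k w (Q.hat ε)) :
    (opF hψ α : Module.End ℂ (FSpace ψ (Q.hat ε) r)) (cl ψ r d F) =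
      cl ψ r (d + α.dimZ) (Eop w ε α F) := by
  by_cases h : ∀ l, 0 ≤ d l
  · obtain ⟨n, hn⟩ := exists_natCast h
    have h' : ∀ l, (d + α.dimZ) l = ((n + α.dim : I → ℕ) l : ℕ) := by
      intro l
      rw [Pi.add_apply, hn, Pi.add_apply, Nat.cast_add]
      rfl
    rw [cl_natCast hn, opF_cls, eminus_restr, cl_natCast h']
  · rw [cl_of_neg h, map_zero]
    by_cases h' : ∀ l, 0 ≤ (d + α.dimZ) l
    · obtain ⟨m, hm⟩ := exists_natCast h'
      -- If d has a negative entry, no subspace of the standard space has dimension d, so the Hall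
      -- product has no nonzero term.
      have h2 : restr m (Eop w ε α F) = 0 := by
        refine Subtype.ext (funext fun X => ?_)
        rw [restr_apply, Eop_apply, Finset.sum_eq_zero, mul_zero]
        · rfl
        · intro W _
          by_contra hW
          refine h fun l => ?_
          have h3 := congrFun (of_hterm_ind_ne_zero hW).2 (Sum.inl l)
          rw [std_dim, Pi.add_apply, sp_dim] at h3
          have h4 : (m l : ℤ) = Module.finrank k (W (Sum.inl l)) + α.dim l := h3
          have h5 := hm l
          rw [Pi.add_apply] at h5
          change d l + (α.dim l : ℤ) = m l at h5
          omega
      rw [cl_natCast hm, h2, map_zero]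
    · rw [cl_of_neg h']

theorem opK_mul_opE (hψ : ψ ≠ 1) (hΓ : ∀ a, (Q.hat ε).src a ≠ (Q.hat ε).tgt a)
    (hr : ∀ i, ((Q.hat ε).reorient (r i)).IsSource (Sum.inl i)) (i j : I) :
    opK ψ (Q.hat ε) r j * opE hψ hΓ hr i =
      vv k ^ Q.symEuler (Pi.single j 1) (Pi.single i 1) •
        (opE hψ hΓ hr i * opK ψ (Q.hat ε) r j) := by
  refine end_ext_cl fun w d F => ?_
  have h : (Sum.elim (d - Pi.single i 1) fun i => (w i : ℤ) : I ⊕ I → ℤ) =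
      Sum.elim d (fun i => (w i : ℤ)) - inc (Pi.single i 1) := by
    funext l
    rcases l with l | l
    · rfl
    · simp [inc]
  rw [LinearMap.smul_apply, Module.End.mul_apply, Module.End.mul_apply, opE_cl, opK_cl, opK_cl,
    cl_Kop, cl_Kop, map_smul, opE_cl, smul_smul, ← zpow_add₀ vv_ne_zero, h, map_sub, kW_inc,
    sub_neg_eq_add, Qv.symEuler, Qv.symEuler, add_comm (kW _ _ _), add_comm (Q.euler _ _)]

theorem opK_mul_opF (hψ : ψ ≠ 1) (j : I) (α : IsoClass Q k) :
    opK ψ (Q.hat ε) r j * opF hψ α =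
      vv k ^ (-Q.symEuler α.dimZ (Pi.single j 1)) • (opF hψ α * opK ψ (Q.hat ε) r j) := by
  refine end_ext_cl fun w d F => ?_
  have h : (Sum.elim (d + α.dimZ) fun i => (w i : ℤ) : I ⊕ I → ℤ) =
      Sum.elim d (fun i => (w i : ℤ)) + inc α.dimZ := by
    funext l
    rcases l with l | l <;> simp [inc]
  rw [LinearMap.smul_apply, Module.End.mul_apply, Module.End.mul_apply, opF_cl, opK_cl, opK_cl,
    cl_Kop, cl_Kop, map_smul, opF_cl, smul_smul, ← zpow_add₀ vv_ne_zero, h, map_add, kW_inc,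
    add_comm (kW _ _ _)]

theorem opE_serre (hψ : ψ ≠ 1) (hΓ : ∀ a, (Q.hat ε).src a ≠ (Q.hat ε).tgt a)
    (hr : ∀ i, ((Q.hat ε).reorient (r i)).IsSource (Sum.inl i)) {i j : I} (hij : i ≠ j) :
    0 ≤ 1 - Q.symEuler (Pi.single i 1) (Pi.single j 1) ∧
      ∑ m ∈ Finset.range ((1 - Q.symEuler (Pi.single i 1) (Pi.single j 1)).toNat + 1),
        (-1 : ℂ) ^ m • (divPow (vv k) (opE hψ hΓ hr i) m * opE hψ hΓ hr j *
          divPow (vv k) (opE hψ hΓ hr i)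
            ((1 - Q.symEuler (Pi.single i 1) (Pi.single j 1)).toNat - m)) = 0 := by
  have h0 : ∀ i j, 0 ≤ inW (Q.hat ε) i (dl j) := by
    intro i j
    rw [inW_apply]
    refine Finset.sum_nonneg fun a _ => ?_
    split_ifs
    · rw [dl, Pi.single_apply]
      split_ifs <;> norm_num
    · rfl
  -- The number n of edges between i and j equals -(i, j), so the Serre exponent is n + 1.
  obtain ⟨n, hn⟩ := Int.eq_ofNat_of_zero_le (add_nonneg (h0 j i) (h0 i j))
  have h1 : 1 - Q.symEuler (Pi.single i 1) (Pi.single j 1) = ((n + 1 : ℕ) : ℤ) := by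
    have h2 : dl i (Sum.inl j) = 0 := by simp [dl, hij.symm]
    have h3 : dl j (Sum.inl i) = 0 := by simp [dl, hij]
    rw [Qv.symEuler, ← euler_hat_inc Q ε, ← euler_hat_inc Q ε, inc_single, inc_single,
      euler_dl_right, euler_dl_right, h2, h3, Nat.cast_succ, ← hn]
    ring
  rw [h1, Int.toNat_natCast]
  refine ⟨Int.natCast_nonneg _, ?_⟩
  have h4 : qad (vv k) n (opE hψ hΓ hr i) (opE hψ hΓ hr j) (n + 1) = 0 := by
    refine end_ext_cl fun w d F => ?_
    rw [qad_opE_cl, Dop_serre hψ hΓ hij (r i) (hr i) hn, LinearMap.zero_apply, map_zero,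
      LinearMap.zero_apply]
  rw [serre_eq_qad vv_ne_zero qFact_ne_zero] at h4
  exact (smul_eq_zero.1 h4).resolve_left (qFact_ne_zero _)

theorem finite_hallNumber_ne_zero (α β : IsoClass Q k) :
    {γ : IsoClass Q k | hallNumber α β γ ≠ 0}.Finite :=
  (finite_dim_eq (α.dim + β.dim)).subset fun _ h => (hallNumber_dim h).symm

theorem finite_hallNumber_simple_ne_zero (α : IsoClass Q k) (i : I) :
    {β : IsoClass Q k | hallNumber (IsoClass.simple Q k i) β α ≠ 0 ∨
      hallNumber β (IsoClass.simple Q k i) α ≠ 0}.Finite := by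
  refine (finite_dim_eq (α.dim - (IsoClass.simple Q k i).dim)).subset ?_
  rintro β (h | h)
  · exact (tsub_eq_of_eq_add_rev (hallNumber_dim h).symm).symm
  · exact (tsub_eq_of_eq_add (hallNumber_dim h).symm).symm

/-- The finite set of classes with nonzero Hall number turns the infinite sum into the finite one of
`Eop_Eop`; each such class has dimension dim α + dim β, so all terms lie in one summand. -/
theorem opF_mul_opF (hψ : ψ ≠ 1) (α β : IsoClass Q k) :
    (opF hψ α * opF hψ β : Module.End ℂ (FSpace ψ (Q.hat ε) r)) = vv k ^ Q.euler α.dimZ β.dimZ •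
      ∑ᶠ γ : IsoClass Q k, (hallNumber α β γ : ℂ) • opF hψ γ := by
  have hT := finite_hallNumber_ne_zero α β
  rw [finsum_eq_sum_of_support_subset (s := hT.toFinset)]
  · refine end_ext_cl fun w d F => ?_
    rw [Module.End.mul_apply, opF_cl, opF_cl, Eop_Eop α β hT.toFinset fun γ h => hT.mem_toFinset.2 h,
      map_smul, map_sum, LinearMap.smul_apply, LinearMap.sum_apply]
    congr 1
    refine Finset.sum_congr rfl fun γ hγ => ?_
    have h1 : d + β.dimZ + α.dimZ = d + γ.dimZ := by
      have h2 := hallNumber_dim (hT.mem_toFinset.1 hγ)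
      funext l
      have h3 := congrFun h2 l
      simp only [Pi.add_apply, IsoClass.dimZ, ← h3]
      push_cast
      ring
    rw [map_smul, LinearMap.smul_apply, opF_cl, h1]
  · intro γ hγ
    rw [Set.Finite.coe_toFinset]
    intro h
    refine hγ ?_
    beta_reduce
    rw [h, Nat.cast_zero, zero_smul]

theorem opF_commutator (hQ : ∀ h, Q.src h ≠ Q.tgt h) (hψ : ψ ≠ 1)
    (hΓ : ∀ a, (Q.hat ε).src a ≠ (Q.hat ε).tgt a)
    (hr : ∀ i, ((Q.hat ε).reorient (r i)).IsSource (Sum.inl i)) (α : IsoClass Q k) (i : I) :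
    opF hψ α * opE hψ hΓ hr i - opE hψ hΓ hr i * opF hψ α =
      ((Fintype.card k : ℂ) / (α.autCard : ℂ)) •
        ∑ᶠ β : IsoClass Q k, (β.autCard : ℂ) • (opF hψ β *
          ((vv k ^ (-Q.euler β.dimZ (Pi.single i 1)) *
              (hallNumber (IsoClass.simple Q k i) β α : ℂ)) • opK ψ (Q.hat ε) r i -
            (vv k ^ Q.euler β.dimZ (Pi.single i 1) *
              (hallNumber β (IsoClass.simple Q k i) α : ℂ)) • opKinv ψ (Q.hat ε) r i)) := by
  have hT := finite_hallNumber_simple_ne_zero α i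
  rw [finsum_eq_sum_of_support_subset (s := hT.toFinset)]
  · refine end_ext_cl fun w d F => ?_
    have h0 : d + α.dimZ - Pi.single i 1 = d - Pi.single i 1 + α.dimZ := by abel
    rw [LinearMap.sub_apply, Module.End.mul_apply, Module.End.mul_apply, opE_cl, opF_cl, opF_cl,
      opE_cl, h0, ← map_sub, Eop_commutator hQ α i hT.toFinset
        (fun β h => hT.mem_toFinset.2 (Or.inl h)) (fun β h => hT.mem_toFinset.2 (Or.inr h)),
      map_smul, map_sum, LinearMap.smul_apply, LinearMap.sum_apply]
    congr 1
    refine Finset.sum_congr rfl fun β hβ => ?_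
    have h1 : d - Pi.single i 1 + α.dimZ = d + β.dimZ := by
      have h2 : α.dim = (IsoClass.simple Q k i).dim + β.dim := by
        rcases hT.mem_toFinset.1 hβ with h | h
        · exact (hallNumber_dim h).symm
        · rw [add_comm]
          exact (hallNumber_dim h).symm
      funext l
      have h3 : (IsoClass.simple Q k i).dim l = (Pi.single i 1 : I → ℕ) l := rfl
      have h4 : (((Pi.single i 1 : I → ℕ) l : ℕ) : ℤ) = (Pi.single i 1 : I → ℤ) l := by
        by_cases hl : l = i
        · subst hl; simp
        · simp [hl]
      simp only [Pi.add_apply, Pi.sub_apply, IsoClass.dimZ, h2, h3, Nat.cast_add, h4]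
      ring
    rw [LinearMap.smul_apply, Module.End.mul_apply, LinearMap.sub_apply, LinearMap.smul_apply,
      LinearMap.smul_apply, opK_cl, opKinv_cl]
    simp only [map_sub, map_smul, opF_cl, h1]
  · intro β hβ
    rw [Set.Finite.coe_toFinset]
    by_contra h
    change ¬(_ ∨ _) at h
    rw [not_or, not_not, not_not] at h
    refine hβ ?_
    beta_reduce
    rw [h.1, h.2, Nat.cast_zero, mul_zero, mul_zero, zero_smul, zero_smul, sub_zero, mul_zero,
      smul_zero]

end Hat

end FramedHall

end

/-! ### Existence of the induced operators and their relations -/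

open FramedHall in
theorem theorem3p1 {I H k : Type*} [Fintype I] [DecidableEq I] [Fintype H] [DecidableEq H]
    [Field k] [Fintype k] [DecidableEq k]
    (Q : Qv I H) (hQ : ∀ h, Q.src h ≠ Q.tgt h) (ε : I → Bool)
    (ψ : AddChar k ℂ) (hψ : ψ ≠ 1)
    (r : I → H ⊕ I → Bool)
    (hr : ∀ i, ((Q.hat ε).reorient (r i)).IsSource (Sum.inl i)) :
    ∃ (Ep : I → Module.End ℂ (FSpace ψ (Q.hat ε) r))
      (Em : IsoClass Q k → Module.End ℂ (FSpace ψ (Q.hat ε) r)),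
      (∀ i, InducedPlus ψ (Q.hat ε) r i (Ep i)) ∧
      (∀ α, InducedMinus ψ Q ε r α (Em α)) ∧
      -- `K_i` and `K_i⁻¹` are inverse to each other, and the `K_i` commute
      (∀ i, opK ψ (Q.hat ε) r i * opKinv ψ (Q.hat ε) r i = 1 ∧
        opKinv ψ (Q.hat ε) r i * opK ψ (Q.hat ε) r i = 1) ∧
      (∀ i j, opK ψ (Q.hat ε) r i * opK ψ (Q.hat ε) r j =
        opK ψ (Q.hat ε) r j * opK ψ (Q.hat ε) r i) ∧
      -- weight relations
      (∀ i j, opK ψ (Q.hat ε) r j * Ep i =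
        vv k ^ Q.symEuler (Pi.single j 1) (Pi.single i 1) • (Ep i * opK ψ (Q.hat ε) r j)) ∧
      (∀ j α, opK ψ (Q.hat ε) r j * Em α =
        vv k ^ (-Q.symEuler α.dimZ (Pi.single j 1)) • (Em α * opK ψ (Q.hat ε) r j)) ∧
      -- quantum Serre relations
      (∀ i j, i ≠ j → 0 ≤ 1 - Q.symEuler (Pi.single i 1) (Pi.single j 1) ∧
        ∑ m ∈ Finset.range ((1 - Q.symEuler (Pi.single i 1) (Pi.single j 1)).toNat + 1),
          (-1 : ℂ) ^ m • (divPow (vv k) (Ep i) m * Ep j *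
            divPow (vv k) (Ep i)
              ((1 - Q.symEuler (Pi.single i 1) (Pi.single j 1)).toNat - m)) = 0) ∧
      -- Hall multiplication
      (∀ α β : IsoClass Q k, {γ : IsoClass Q k | hallNumber α β γ ≠ 0}.Finite ∧
        Em α * Em β = vv k ^ Q.euler α.dimZ β.dimZ •
          ∑ᶠ γ : IsoClass Q k, (hallNumber α β γ : ℂ) • Em γ) ∧
      -- the mixed commutator formula
      (∀ (α : IsoClass Q k) (i : I),
        {β : IsoClass Q k | hallNumber (IsoClass.simple Q k i) β α ≠ 0 ∨
          hallNumber β (IsoClass.simple Q k i) α ≠ 0}.Finite ∧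
        Em α * Ep i - Ep i * Em α =
          ((Fintype.card k : ℂ) / (α.autCard : ℂ)) •
            ∑ᶠ β : IsoClass Q k, (β.autCard : ℂ) • (Em β *
              ((vv k ^ (-Q.euler β.dimZ (Pi.single i 1)) *
                  (hallNumber (IsoClass.simple Q k i) β α : ℂ)) • opK ψ (Q.hat ε) r i -
                (vv k ^ Q.euler β.dimZ (Pi.single i 1) *
                  (hallNumber β (IsoClass.simple Q k i) α : ℂ)) • opKinv ψ (Q.hat ε) r i))) := by
  have hΓ := hat_src_ne_tgt (ε := ε) hQ
  exact ⟨opE hψ hΓ hr, opF hψ, inducedPlus_opE hψ hΓ hr, fun α n w f => opF_cls hψ α n f,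
    fun i => ⟨opK_mul_opKinv i, opKinv_mul_opK i⟩, opK_mul_opK, opK_mul_opE hψ hΓ hr,
    opK_mul_opF hψ, fun i j hij => opE_serre hψ hΓ hr hij,
    fun α β => ⟨finite_hallNumber_ne_zero α β, opF_mul_opF hψ α β⟩,
    fun α i => ⟨finite_hallNumber_simple_ne_zero α i, opF_commutator hQ hψ hΓ hr α i⟩⟩
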